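/- Let $B_r\subset\mathbb R^4$ be the open ball of radius $r$ centred at $0$. For a measurable $g$ on $\Omega\subset\mathbb R^4$ let $g^*$ be the non-increasing rearrangement of $|g|$, $g^{**}(s)=\frac1s\int_0^s g^*$, $\|g\|_{L^{p,\infty}(\Omega)}=\sup_{s>0}s^{1/p}g^{**}(s)$ and $\|g\|_{L\log L(\Omega)}=\int_0^\infty g^*(s)\log(2+\tfrac1s)\,ds$; $g\in L\log L(\Omega)$ means $\int_\Omega|g|\log(2+|g|)<\infty$. All lengths $|Du|,|D^2u|,|D\Delta u|$ are Euclidean. For $f\in L\log L(B_1,\mathbb R^{n+1})$, a map $u\in W^{2,2}(B_1,\mathbb S^n)$ (that is, $u\in W^{2,2}(B_1,\mathbb R^{n+1})$ and $|u|=1$ a.e.) is an $f$-approximate biharmonic map if, in the sense of distributions on $B_1$, $$\Delta^2u-\Delta\big(A(u)(Du,Du)\big)-2\,d^*\langle\Delta u,DP(u)\rangle+\langle\Delta(P(u)),\Delta u\rangle=f ,$$ where $A(y)(X,Y)=-\langle X,Y\rangle y$ is the second fundamental form of $\mathbb S^n\subset\mathbb R^{n+1}$, $P(y)=\mathrm{Id}-y\otimes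 y$ is the orthogonal projection onto $T_y\mathbb S^n$, $A(u)(Du,Du)=\sum_iA(u)(\partial_iu,\partial_iu)$, and $d^*=\sum_i\partial_i$ is the divergence. **Lemma 2.3.** For every $n$ and every $\Lambda$ there is a constant $C=C(n,\Lambda)>0$ with the following property. Let $u\in W^{2,2}(B_1,\mathbb S^n)$ be an $f$-approximate biharmonic map with $f\in L\log L(B_1,\mathbb R^{n+1})$ and $$\|D^2u\|_{L^2(B_1)}+\|Du\|_{L^4(B_1)}+\|f\|_{L\log L(B_1)}\le\Lambda .$$ Let $\varepsilon>0$ and $0<t<\delta\le\frac12$, and suppose that the weak derivative $D\Delta u$ exists as a locally integrable function on $B_{2\delta}\setminus\overline{B_{t/2}}$ and that, for all $\rho>0$ with $B_{2\rho}\setminus B_\rho\subset B_{2\delta}\setminus B_{t/2}$, $$\int_{B_{2\rho}\setminus B_\rho}|Du|^4+|D^2u|^2+|D\Delta u|^{4/3}<\varepsilon .$$ Then $$\|Du\|_{L^{4,\infty}(B_\delta\setminus B_t)}+\|D^2u\|_{L^{2,\infty}(B_\delta\setminus B_t)}+\|D\Delta u\|_{L^{4/3,\infty}(B_\delta\setminus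 B_t)}\le C\Big(\varepsilon^{1/8}+\big(\log(1/\delta)\big)^{-1}\Big).$$ -/

import Mathlib

open MeasureTheory Set
open scoped ENNReal

noncomputable section

namespace BiharmonicSphere

/-- The domain `ℝ⁴` with its Euclidean norm. -/
abbrev R4 : Type := EuclideanSpace ℝ (Fin 4)

/-- The ambient space `ℝⁿ⁺¹` of the sphere `𝕊ⁿ`, with its Euclidean norm. -/
abbrev Amb (n : ℕ) : Type := EuclideanSpace ℝ (Fin (n + 1))

/-- The open ball `B_r ⊆ ℝ⁴` centred at the origin. -/
abbrev B (r : ℝ) : Set R4 := Metric.ball 0 r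

/-- The `i`-th standard basis vector of `ℝ⁴`. -/
abbrev e (i : Fin 4) : R4 := EuclideanSpace.single i 1

section WeakDerivatives

variable {n : ℕ}

/-- `w` is the weak `i`-th partial derivative of `v` on the open set `Ω ⊆ ℝ⁴`. -/
structure HasWeakPartial (Ω : Set R4) (i : Fin 4) (v w : R4 → Amb n) : Prop where
  locallyIntegrable : LocallyIntegrableOn v Ω
  locallyIntegrable_partial : LocallyIntegrableOn w Ω
  integral_eq : ∀ φ : R4 → ℝ, ContDiff ℝ (⊤ : ℕ∞) φ → HasCompactSupport φ → tsupport φ ⊆ Ω →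
    ∫ x in Ω, (fderiv ℝ φ x (e i)) • v x = -∫ x in Ω, φ x • w x

/-- `u ∈ W^{2,2}(Ω, ℝⁿ⁺¹)`, where `Du i = ∂ᵢu` and `D2u i j = ∂ᵢ∂ⱼu` are its weak derivatives. -/
structure IsW22 (Ω : Set R4) (u : R4 → Amb n) (Du : Fin 4 → R4 → Amb n)
    (D2u : Fin 4 → Fin 4 → R4 → Amb n) : Prop where
  memLp : MemLp u 2 (volume.restrict Ω)
  memLp_D : ∀ i, MemLp (Du i) 2 (volume.restrict Ω)
  memLp_D2 : ∀ i j, MemLp (D2u i j) 2 (volume.restrict Ω)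
  weak_D : ∀ i, HasWeakPartial Ω i u (Du i)
  weak_D2 : ∀ i j, HasWeakPartial Ω i (Du j) (D2u i j)

/-- The Laplacian `Δu = ∑ᵢ ∂ᵢ∂ᵢu` in terms of the second derivatives. -/
def lap (D2u : Fin 4 → Fin 4 → R4 → Amb n) (x : R4) : Amb n := ∑ i, D2u i i x

/-- The Euclidean (Hilbert–Schmidt) length `|Du|(x)` of a first derivative
(also used for `DΔu`). -/
def gradNorm (g : Fin 4 → R4 → Amb n) (x : R4) : ℝ := Real.sqrt (∑ i, ‖g i x‖ ^ 2)

/-- The Euclidean (Hilbert–Schmidt) length `|D²u|(x)` of the second derivative. -/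
def hessNorm (h : Fin 4 → Fin 4 → R4 → Amb n) (x : R4) : ℝ :=
  Real.sqrt (∑ i, ∑ j, ‖h i j x‖ ^ 2)

end WeakDerivatives

section Rearrangement

variable {α F : Type*} [MeasurableSpace α] [NormedAddCommGroup F]

/-- The non-increasing rearrangement `g^*(t)` of `|g|` with respect to `μ`, for `t > 0`. -/
def rearr (μ : Measure α) (g : α → F) (t : ℝ) : ℝ≥0∞ :=
  sInf {s : ℝ≥0∞ | μ {x | s < ‖g x‖ₑ} ≤ ENNReal.ofReal t}

/-- `g^{**}(t) = t⁻¹ ∫₀ᵗ g^*(s) ds`. -/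
def rearrAvg (μ : Measure α) (g : α → F) (t : ℝ) : ℝ≥0∞ :=
  (ENNReal.ofReal t)⁻¹ * ∫⁻ s in Ioc 0 t, rearr μ g s

/-- The Lorentz norm `‖g‖_{L^{p,∞}} = sup_{t>0} t^{1/p} g^{**}(t)`, as an extended real. -/
def weakLorentzNorm (p : ℝ) (μ : Measure α) (g : α → F) : ℝ≥0∞ :=
  ⨆ (t : ℝ) (_ : 0 < t), ENNReal.ofReal (t ^ (1 / p)) * rearrAvg μ g t

/-- The norm `‖g‖_{L log L} = ∫₀^∞ g^*(t) log (2 + 1/t) dt`, as an extended real. -/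
def LLogLNorm (μ : Measure α) (g : α → F) : ℝ≥0∞ :=
  ∫⁻ t in Ioi (0 : ℝ), rearr μ g t * ENNReal.ofReal (Real.log (2 + 1 / t))

/-- `g ∈ L log L`: `g` is measurable and `∫ |g| log (2 + |g|) < ∞`. -/
structure MemLLogL (μ : Measure α) (g : α → F) : Prop where
  aestronglyMeasurable : AEStronglyMeasurable g μ
  lintegral_lt_top : ∫⁻ x, ENNReal.ofReal (‖g x‖ * Real.log (2 + ‖g x‖)) ∂μ < ⊤

end Rearrangement

section Sphere

variable {n : ℕ}

/-- The second fundamental form `A(y)(X, Y) = -⟨X, Y⟩ y` of `𝕊ⁿ ⊆ ℝⁿ⁺¹` at `y ∈ 𝕊ⁿ`. -/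
def secondFF (y X Y : Amb n) : Amb n := -(inner ℝ X Y • y)

/-- The orthogonal projection `P(y) v = v - ⟨y, v⟩ y` of `ℝⁿ⁺¹` onto `T_y 𝕊ⁿ`, for `y ∈ 𝕊ⁿ`. -/
def tanProj (y v : Amb n) : Amb n := v - inner ℝ y v • y

/-- The derivative of `y ↦ P(y) v` in the direction `w` (see `hasLineDerivAt_tanProj`). It is
symmetric and bilinear in `(y, w)`, so that `dTanProj w w'` is also the second derivative of `P` in
the directions `w, w'` (see `hasLineDerivAt_dTanProj`). -/
def dTanProj (y w v : Amb n) : Amb n := -(inner ℝ y v • w + inner ℝ w v • y)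

theorem hasLineDerivAt_tanProj (y w v : Amb n) :
    HasLineDerivAt ℝ (fun z => tanProj z v) (dTanProj y w v) y w := by
  have h1 : HasDerivAt (fun s : ℝ => y + s • w) w 0 := by
    simpa using ((hasDerivAt_id (0 : ℝ)).smul_const w).const_add y
  have h2 : HasDerivAt (fun s : ℝ => (inner ℝ (y + s • w) v : ℝ)) (inner ℝ w v) 0 := by
    simpa using h1.inner ℝ (hasDerivAt_const (0 : ℝ) v)
  have h3 := (hasDerivAt_const (0 : ℝ) v).sub (h2.smul h1)
  refine HasDerivAt.congr_deriv (f := fun s : ℝ => tanProj (y + s • w) v) h3 ?_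
  simp [dTanProj, add_comm]

theorem hasLineDerivAt_dTanProj (y w w' v : Amb n) :
    HasLineDerivAt ℝ (fun z => dTanProj z w v) (dTanProj w' w v) y w' := by
  have h1 : HasDerivAt (fun s : ℝ => y + s • w') w' 0 := by
    simpa using ((hasDerivAt_id (0 : ℝ)).smul_const w').const_add y
  have h2 : HasDerivAt (fun s : ℝ => (inner ℝ (y + s • w') v : ℝ)) (inner ℝ w' v) 0 := by
    simpa using h1.inner ℝ (hasDerivAt_const (0 : ℝ) v)
  have h3 := ((h2.smul_const w).add (h1.const_smul (inner ℝ w v : ℝ))).neg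
  refine HasDerivAt.congr_deriv (f := fun s : ℝ => dTanProj (y + s • w') w v) h3 ?_
  simp [dTanProj, add_comm]

/-- `A(u)(Du, Du) = ∑ᵢ A(u)(∂ᵢu, ∂ᵢu)`. -/
def secondFFTrace (u : R4 → Amb n) (Du : Fin 4 → R4 → Amb n) (x : R4) : Amb n :=
  ∑ i, secondFF (u x) (Du i x) (Du i x)

/-- `∂ᵢ(P(u))` applied to `v`, by the chain rule. -/
def partialProj (u : R4 → Amb n) (Du : Fin 4 → R4 → Amb n) (i : Fin 4) (x : R4) (v : Amb n) :
    Amb n :=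
  dTanProj (u x) (Du i x) v

/-- `Δ(P(u))` applied to `v`, by the chain rule: `dP_u(Δu) v + ∑ᵢ d²P_u(∂ᵢu, ∂ᵢu) v`. -/
def lapProj (u : R4 → Amb n) (Du : Fin 4 → R4 → Amb n) (D2u : Fin 4 → Fin 4 → R4 → Amb n)
    (x : R4) (v : Amb n) : Amb n :=
  dTanProj (u x) (lap D2u x) v + ∑ i, dTanProj (Du i x) (Du i x) v

/-- The equation of an `f`-approximate (extrinsic) biharmonic map into `𝕊ⁿ`,
`Δ²u - Δ(A(u)(Du, Du)) - 2 d^*⟨Δu, DP(u)⟩ + ⟨Δ(P(u)), Δu⟩ = f`,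
where `d^* = ∑ᵢ ∂ᵢ` is the divergence, in the sense of distributions on the open set `Ω`. -/
def ApproxBiharmonicEq (Ω : Set R4) (u : R4 → Amb n) (Du : Fin 4 → R4 → Amb n)
    (D2u : Fin 4 → Fin 4 → R4 → Amb n) (f : R4 → Amb n) : Prop :=
  ∀ η : R4 → Amb n, ContDiff ℝ (⊤ : ℕ∞) η → HasCompactSupport η → tsupport η ⊆ Ω →
    ∫ x in Ω,
      (inner ℝ (lap D2u x) (Laplacian.laplacian η x)
        - inner ℝ (secondFFTrace u Du x) (Laplacian.laplacian η x)
        + 2 * ∑ i, inner ℝ (partialProj u Du i x (lap D2u x)) (fderiv ℝ η x (e i))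
        + inner ℝ (lapProj u Du D2u x (lap D2u x)) (η x))
      = ∫ x in Ω, inner ℝ (f x) (η x)

/-- `u ∈ W^{2,2}(Ω, 𝕊ⁿ)`, with weak derivatives `Du` and `D2u`, is an `f`-approximate biharmonic
map, with `f ∈ L log L(Ω, ℝⁿ⁺¹)`. -/
structure IsApproxBiharmonic (Ω : Set R4) (u : R4 → Amb n) (Du : Fin 4 → R4 → Amb n)
    (D2u : Fin 4 → Fin 4 → R4 → Amb n) (f : R4 → Amb n) : Prop where
  isW22 : IsW22 Ω u Du D2u
  norm_eq_one : ∀ᵐ x ∂(volume.restrict Ω), ‖u x‖ = 1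
  memLLogL : MemLLogL (volume.restrict Ω) f
  equation : ApproxBiharmonicEq Ω u Du D2u f

end Sphere

end BiharmonicSphere

end

open BiharmonicSphere

/-!
*Wedge form.* Testing the equation with `φ (u^b e_a - u^a e_b)` cancels every term of critical growth
except a divergence: with `ω = u^b Δu^a - u^a Δu^b` (`wedgeLap`),
`∫ ω Δφ + 2 ∂ᵢφ (∂ᵢu^b Δu^a - ∂ᵢu^a Δu^b) = ∫ φ (f^a u^b - f^b u^a)` (`SphereMap.integral_wedgeLap`).
Differentiating `|u|² = 1` gives `⟨u, ∂ᵢu⟩ = 0` and `⟨u, Δu⟩ = -|Du|²`, so that `Δu` and `DΔu` are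
recovered from `ω` and its derivative up to quadratic terms (`enorm_sphere_le`).

*Weak norms by duality.* A weak `Lᵖ` bound is stated as `SetBound θ₁ θ₂ K₁ K₂ Z`: the integral of
`Z` over a set `E` is at most `K₁ |E| ^ θ₁ + K₂ |E| ^ θ₂`. Layer cake arguments show how such bounds
behave under products with `Lᵖ` functions and under Riesz potentials (`SetBoundCalculus`), and
`weakLorentzNorm_le` turns them into bounds of the Lorentz norm.

*Linear theory.* If `W` is compactly supported and `ΔW = div G + g` weakly, then `|W|` is bounded by
potentials of `|G|` and `|g|` (`IsWeakPoisson.ae_enorm_le_pot`). The first derivatives of `W` involve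
singular integrals of `G` (`IsWeakPoisson.exists_setBound_deriv`). For the kernels regularized by
`1 / (|z|² + h²)` these are bounded in `L²` by an integration by parts (`sum_integral_regCZ_sq_le`),
have weak type `(1,1)` by a Calderón–Zygmund decomposition (`volume_lt_cv_le`), and by interpolation
act on set bounds, uniformly in `h`.

*One annulus.* On an annulus of unit size, let `κ` bound `‖Du‖_{L⁴}` and `‖D²u‖_{L²}`. For small `κ`
the equations for `ω` and `Du` bound `Δu` and `Du` by a small multiple of themselves plus a
remainder, which iteration absorbs (`SetBound.of_iterate`, `exists_local_setBound`). The remainder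
has two parts. The source `f` enters with the scale invariant set exponents `3/4`, `1/2`, `1/4` of
`L^{4,∞}`, `L^{2,∞}`, `L^{4/3,∞}`; the energy enters with an exponent that is better by `1/6`. The
third derivatives also have a bound without smallness, quadratic in `κ`.

*Summation.* Cover the neck by annuli of ratio `3/2`. After scaling, the gain of `1/6`
makes the energy terms of the annuli decay geometrically away from the scale `|E| ^ (1/4)`, so they
add up without a logarithm (`exists_sum_scales_le`, `exists_neck_setBound`). The masses of `f` add up
to the `L¹` norm of `f` on a ball of radius `2δ`, which is at most a constant times
`‖f‖_{L log L} / log (1/δ)` (`exists_setLIntegral_le_LLogLNorm`). The smallness needed on each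
annulus holds for `ε` below a threshold; above it the global norms of `Du` and `D²u` and the
unconditional third order bound are constants, hence at most `C ε ^ (1/8)`
(`exists_neck_setBound_of_energy_le`).
-/
noncomputable section

open Filter Topology
open scoped NNReal ContDiff
open ENNReal (add_ne_top coe_le_coe coe_mul coe_ne_top coe_rpow_of_nonneg coe_toNNReal div_le_iff
  div_ne_top measurable_ofReal mul_lt_top mul_ne_top mul_rpow_of_nonneg mul_top ofReal ofReal_add
  ofReal_coe_nnreal ofReal_inv_of_pos ofReal_le_ofReal ofReal_le_one ofReal_lt_top ofReal_mul
  ofReal_ne_top ofReal_pow ofReal_rpow_of_pos ofReal_toReal pow_lt_top pow_ne_top rpow_add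
  rpow_add_of_nonneg rpow_eq_zero_iff rpow_le_rpow rpow_mul rpow_natCast rpow_ne_top_of_nonneg
  rpow_one toReal_ofReal toReal_pos tsum_le_tsum zero_rpow_of_pos)
open Finset (card_univ measurable_sum mul_sum single_le_sum sum_add_distrib sum_comm sum_congr
  sum_const sum_eq_zero sum_le_sum sum_mul sum_neg_distrib)
open Real (HolderConjugate enorm_of_nonneg norm_eq_abs norm_of_nonneg sqrt_nonneg toNNReal)
open Metric (ball_subset_ball closedBall cthickening)
open Fintype (card_fin)

namespace BiharmonicSphere

/-! ### Layer cake estimates -/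

theorem lintegral_ofReal_lt (w : ℝ≥0∞) :
    ∫⁻ s in Ioi (0 : ℝ), ({s : ℝ | ofReal s < w}.indicator 1 s : ℝ≥0∞) = w := by
  have hm : MeasurableSet {s : ℝ | ofReal s < w} :=
    measurableSet_lt measurable_ofReal measurable_const
  rw [lintegral_indicator_one hm, Measure.restrict_apply hm]
  rcases eq_or_ne w ⊤ with rfl | hw
  · simp
  · have : {s : ℝ | ofReal s < w} ∩ Ioi 0 = Ioo 0 w.toReal := by
      ext s
      simp only [mem_inter_iff, mem_ofPred_eq, mem_Ioi, mem_Ioo]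
      constructor
      · rintro ⟨h1, h2⟩
        exact ⟨h2, (ENNReal.ofReal_lt_iff_lt_toReal h2.le hw).1 h1⟩
      · rintro ⟨h1, h2⟩
        exact ⟨(ENNReal.ofReal_lt_iff_lt_toReal h1.le hw).2 h2, h1⟩
    simp [*]

theorem lintegral_mul_eq_layer {α : Type*} [MeasurableSpace α] (μ : Measure α) [SFinite μ]
    {Z w : α → ℝ≥0∞} (hZ : Measurable Z) (hw : Measurable w) :
    ∫⁻ x, Z x * w x ∂μ
      = ∫⁻ s in Ioi (0 : ℝ), ∫⁻ x in {x | ofReal s < w x}, Z x ∂μ := by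
  have hms : MeasurableSet {q : α × ℝ | ofReal q.2 < w q.1} :=
    measurableSet_lt (measurable_ofReal.comp measurable_snd) (hw.comp measurable_fst)
  have h1 : ∀ x, Z x * w x = ∫⁻ s in Ioi (0 : ℝ),
      {q : α × ℝ | ofReal q.2 < w q.1}.indicator (fun q => Z q.1) (x, s) := by
    intro x
    conv_lhs => rw [← lintegral_ofReal_lt (w x)]
    rw [← lintegral_const_mul]
    · refine lintegral_congr fun s => ?_
      by_cases h : ofReal s < w x <;> simp [h]
    · measurability
  simp_rw [h1]
  rw [lintegral_lintegral_swap]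
  · refine lintegral_congr fun s => ?_
    rw [← lintegral_indicator]
    · rfl
    · measurability
  · fun_prop

/-- One-dimensional integral behind the layer cake estimate for integrands supported on a set of
finite measure `m`. -/
theorem lintegral_min_rpow_le {p θ : ℝ} (hp : 0 < p) (hpθ : 1 < p * θ) {m A : ℝ≥0∞} (hm : m ≠ ⊤)
    (D : ℝ → ℝ≥0∞) (h1 : ∀ s, 0 < s → D s ≤ m)
    (h2 : ∀ s, 0 < s → D s ≤ (A / ofReal s) ^ p) :
    ∫⁻ s in Ioi (0 : ℝ), D s ^ θ
      ≤ ofReal (1 + 1 / (p * θ - 1)) * A * m ^ (θ - 1 / p) := by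
  have hθ : 0 < θ := by nlinarith
  have hθp : 0 < θ - 1 / p := by
    rw [sub_pos, div_lt_iff₀ hp]; linarith
  have hC : ofReal (1 + 1 / (p * θ - 1)) ≠ 0 := by positivity
  rcases eq_or_ne m 0 with rfl | hm0
  · have : ∀ s ∈ Ioi (0 : ℝ), D s ^ θ = 0 := fun s hs => by aesop
    rw [setLIntegral_congr_fun measurableSet_Ioi this]; simp
  rcases eq_or_ne A 0 with rfl | hA0
  · have : ∀ s ∈ Ioi (0 : ℝ), D s ^ θ = 0 := fun s hs => by aesop
    rw [setLIntegral_congr_fun measurableSet_Ioi this]; simp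
  rcases eq_or_ne A ⊤ with rfl | hAt
  · rw [mul_top hC, ENNReal.top_mul]
    · exact le_top
    · positivity
  lift m to ℝ≥0 using hm
  lift A to ℝ≥0 using hAt
  have hm' : (0 : ℝ) < m := by
    have : m ≠ 0 := by simpa using hm0
    positivity
  have hA' : (0 : ℝ) < A := by
    have : A ≠ 0 := by simpa using hA0
    exact_mod_cast pos_iff_ne_zero.2 this
  set S : ℝ := A * (m : ℝ) ^ (-(1 / p)) with hS
  have hSpos : 0 < S := by positivity
  have hsplit : Ioi (0 : ℝ) = Ioc 0 S ∪ Ioi S := (Ioc_union_Ioi_eq_Ioi hSpos.le).symm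
  rw [hsplit]
  refine (lintegral_union_le _ _ _).trans ?_
  have hmE : (m : ℝ≥0∞) = ofReal m := (ofReal_coe_nnreal).symm
  have hAE : (A : ℝ≥0∞) = ofReal A := (ofReal_coe_nnreal).symm
  have e1 : ∫⁻ s in Ioc 0 S, D s ^ θ ≤ ofReal ((m : ℝ) ^ θ * S) := by
    calc ∫⁻ s in Ioc 0 S, D s ^ θ ≤ ∫⁻ s in Ioc 0 S, (m : ℝ≥0∞) ^ θ :=
          setLIntegral_mono measurable_const fun s hs =>
            rpow_le_rpow (h1 s hs.1) hθ.le
      _ = _ := by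
          rw [setLIntegral_const, Real.volume_Ioc, sub_zero, hmE,
            ofReal_rpow_of_pos hm', ← ofReal_mul (by positivity)]
  have e2 : ∫⁻ s in Ioi S, D s ^ θ
      ≤ ofReal ((A : ℝ) ^ (p * θ) * (-S ^ (-(p * θ) + 1) / (-(p * θ) + 1))) := by
    have hint : IntegrableOn (fun s : ℝ => (A : ℝ) ^ (p * θ) * s ^ (-(p * θ))) (Ioi S) :=
      (integrableOn_Ioi_rpow_of_lt (by linarith) hSpos).const_mul _
    calc ∫⁻ s in Ioi S, D s ^ θ
        ≤ ∫⁻ s in Ioi S, ofReal ((A : ℝ) ^ (p * θ) * s ^ (-(p * θ))) := by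
          refine setLIntegral_mono (by fun_prop) fun s hs => ?_
          have hs0 : 0 < s := hSpos.trans hs
          refine (rpow_le_rpow (h2 s hs0) hθ.le).trans_eq ?_
          rw [← rpow_mul, hAE, ← ENNReal.ofReal_div_of_pos hs0,
            ofReal_rpow_of_pos (by positivity), Real.div_rpow hA'.le hs0.le,
            Real.rpow_neg hs0.le, div_eq_mul_inv]
      _ = _ := by
          rw [← ofReal_integral_eq_lintegral_ofReal hint, integral_const_mul,
            integral_Ioi_rpow_of_lt (by linarith) hSpos]
          filter_upwards [ae_restrict_mem measurableSet_Ioi] with s hs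
          have hs0 : 0 < s := hSpos.trans hs
          positivity
  refine (add_le_add e1 e2).trans_eq ?_
  have hd : p * θ - 1 ≠ 0 := by linarith
  have r1 : (m : ℝ) ^ θ * S = A * (m : ℝ) ^ (θ - 1 / p) := by
    rw [hS, sub_eq_add_neg, Real.rpow_add hm']; ring
  have r2 : (A : ℝ) ^ (p * θ) * S ^ (-(p * θ) + 1) = A * (m : ℝ) ^ (θ - 1 / p) := by
    rw [hS, Real.mul_rpow hA'.le (by positivity), ← Real.rpow_mul hm'.le, ← mul_assoc,
      ← Real.rpow_add hA']
    congr 1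
    · simp
    · grind
  have hneg : -(p * θ) + 1 ≠ 0 := by bound
  have r3 : (A : ℝ) ^ (p * θ) * (-S ^ (-(p * θ) + 1) / (-(p * θ) + 1))
      = 1 / (p * θ - 1) * (A * (m : ℝ) ^ (θ - 1 / p)) := by grind
  have hpos : 0 < 1 / (p * θ - 1) := by positivity
  rw [r1, r3, ← ofReal_add (by positivity) (by positivity), hmE,
    ofReal_rpow_of_pos hm', hAE, ← ofReal_mul (by linarith),
    ← ofReal_mul (by positivity)]
  ring_nf

/-- One-dimensional integral behind the layer cake estimate for bounded integrands. -/
theorem lintegral_Ioc_div_rpow_le {q : ℝ} (hq0 : 0 < q) (hq : q < 1) (A S : ℝ≥0∞) :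
    ∫⁻ s in {s : ℝ | 0 < s ∧ ofReal s < S}, (A / ofReal s) ^ q
      ≤ ofReal (1 / (1 - q)) * A ^ q * S ^ (1 - q) := by
  have hq1 : 0 < 1 / (1 - q) := one_div_pos.2 (by linarith)
  have hC : ofReal (1 / (1 - q)) ≠ 0 := by simpa using hq
  rcases eq_or_ne S 0 with rfl | hS0
  · simp
  rcases eq_or_ne A 0 with rfl | hA0
  · simp [*]
  rcases eq_or_ne A ⊤ with rfl | hAt
  · rw [ENNReal.top_rpow_of_pos hq0, mul_top hC, ENNReal.top_mul]
    · exact le_top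
    · positivity
  rcases eq_or_ne S ⊤ with rfl | hSt
  · rw [ENNReal.top_rpow_of_pos (by linarith), mul_top]
    · exact le_top
    · positivity
  lift S to ℝ≥0 using hSt
  lift A to ℝ≥0 using hAt
  have hS' : (0 : ℝ) < S := by
    have : S ≠ 0 := by simpa using hS0
    positivity
  have hA' : (0 : ℝ) < A := by
    have : A ≠ 0 := by simpa using hA0
    exact_mod_cast pos_iff_ne_zero.2 this
  have hSE : (S : ℝ≥0∞) = ofReal S := (ofReal_coe_nnreal).symm
  have hAE : (A : ℝ≥0∞) = ofReal A := (ofReal_coe_nnreal).symm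
  have hset : {s : ℝ | 0 < s ∧ ofReal s < S} ⊆ Ioc 0 (S : ℝ) := by
    rintro s ⟨h1, h2⟩
    rw [hSE, ENNReal.ofReal_lt_ofReal_iff hS'] at h2
    grind
  refine (lintegral_mono_set hset).trans ?_
  have hii := intervalIntegral.intervalIntegrable_rpow' (a := 0) (b := S) (r := -q) (by linarith)
  have hint : IntegrableOn (fun s : ℝ => (A : ℝ) ^ q * s ^ (-q)) (Ioc 0 (S : ℝ)) :=
    ((intervalIntegrable_iff_integrableOn_Ioc_of_le hS'.le).1 hii).const_mul _
  have e : ∫⁻ s in Ioc 0 (S : ℝ), (A / ofReal s) ^ q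
      = ∫⁻ s in Ioc 0 (S : ℝ), ofReal ((A : ℝ) ^ q * s ^ (-q)) := by
    refine setLIntegral_congr_fun measurableSet_Ioc fun s hs => ?_
    have hs0 : 0 < s := hs.1
    rw [hAE, ← ENNReal.ofReal_div_of_pos hs0,
      ofReal_rpow_of_pos (by positivity), Real.div_rpow hA'.le hs0.le,
      Real.rpow_neg hs0.le, div_eq_mul_inv]
  rw [e, ← ofReal_integral_eq_lintegral_ofReal hint, integral_const_mul,
    ← intervalIntegral.integral_of_le hS'.le, integral_rpow (Or.inl (by linarith))]
  · rw [hSE, hAE, ofReal_rpow_of_pos hS', ofReal_rpow_of_pos hA',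
      ← ofReal_mul hq1.le, ← ofReal_mul (by positivity)]
    refine ofReal_le_ofReal (le_of_eq ?_)
    rw [Real.zero_rpow (by linarith), show -q + 1 = 1 - q by ring]; ring
  · filter_upwards [ae_restrict_mem measurableSet_Ioc] with s hs
    have hs0 : 0 < s := hs.1
    positivity

/-! ### Bounds on set integrals -/

/-- `Z` obeys the two-term bound `∫_E Z ≤ K₁ |E|^θ₁ + K₂ |E|^θ₂` on all sets `E ⊆ ℝ⁴` of finite
measure. With `θ = 1 - 1/p`, each term is a bound on the norm of `Z` in weak `L^p`; a single
predicate with two terms makes it unnecessary to split `Z` into two summands. -/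
def SetBound (θ₁ θ₂ : ℝ) (K₁ K₂ : ℝ≥0∞) (Z : R4 → ℝ≥0∞) : Prop :=
  ∀ E, MeasurableSet E → volume E ≠ ⊤ →
    ∫⁻ x in E, Z x ≤ K₁ * volume E ^ θ₁ + K₂ * volume E ^ θ₂

namespace SetBound

variable {θ₁ θ₂ : ℝ} {K₁ K₂ L₁ L₂ : ℝ≥0∞} {Z Y : R4 → ℝ≥0∞}

theorem mono (h : SetBound θ₁ θ₂ K₁ K₂ Z) (h1 : K₁ ≤ L₁) (h2 : K₂ ≤ L₂) :
    SetBound θ₁ θ₂ L₁ L₂ Z := fun E hE hf =>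
  (h E hE hf).trans (by gcongr)

theorem mono_fun (h : SetBound θ₁ θ₂ K₁ K₂ Z) (hYZ : ∀ᵐ x, Y x ≤ Z x) :
    SetBound θ₁ θ₂ K₁ K₂ Y := fun E hE hf =>
  (lintegral_mono_ae (ae_restrict_of_ae hYZ)).trans (h E hE hf)

theorem add (hZ : SetBound θ₁ θ₂ K₁ K₂ Z) (hY : SetBound θ₁ θ₂ L₁ L₂ Y) (hm : Measurable Z) :
    SetBound θ₁ θ₂ (K₁ + L₁) (K₂ + L₂) (fun x => Z x + Y x) := fun E hE hf => by
  rw [lintegral_add_left hm]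
  refine (add_le_add (hZ E hE hf) (hY E hE hf)).trans_eq ?_
  ring

theorem const_mul (hZ : SetBound θ₁ θ₂ K₁ K₂ Z) (hm : Measurable Z) (c : ℝ≥0∞) :
    SetBound θ₁ θ₂ (c * K₁) (c * K₂) (fun x => c * Z x) := fun E hE hf => by
  rw [lintegral_const_mul _ hm]
  refine (mul_le_mul_right (hZ E hE hf) c).trans_eq ?_
  ring

theorem sum {ι : Type*} (s : Finset ι) {K₁ K₂ : ι → ℝ≥0∞} {Z : ι → R4 → ℝ≥0∞}
    (h : ∀ i ∈ s, SetBound θ₁ θ₂ (K₁ i) (K₂ i) (Z i)) (hm : ∀ i, Measurable (Z i)) :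
    SetBound θ₁ θ₂ (∑ i ∈ s, K₁ i) (∑ i ∈ s, K₂ i) (fun x => ∑ i ∈ s, Z i x) := fun E hE hf => by
  rw [lintegral_finsetSum _ fun i _ => hm i]
  refine (sum_le_sum fun i hi => h i hi E hE hf).trans_eq ?_
  rw [sum_add_distrib, sum_mul, sum_mul]

end SetBound

/-- Layer cake estimate for a weight supported on a set of finite measure. -/
theorem SetBound.lintegral_mul_le {θ₁ θ₂ : ℝ} {K₁ K₂ : ℝ≥0∞} {Z : R4 → ℝ≥0∞}
    (hZ : SetBound θ₁ θ₂ K₁ K₂ Z) (hZm : Measurable Z) {p : ℝ} (hp : 0 < p) (h1 : 1 < p * θ₁)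
    (h2 : 1 < p * θ₂) {w : R4 → ℝ≥0∞} (hw : Measurable w) {m A : ℝ≥0∞} (hm : m ≠ ⊤)
    (hwm : ∀ s : ℝ, 0 < s → volume {x | ofReal s < w x} ≤ m)
    (hwA : ∀ s : ℝ, 0 < s →
      volume {x | ofReal s < w x} ≤ (A / ofReal s) ^ p) :
    ∫⁻ x, Z x * w x ≤ ofReal (1 + 1 / (p * θ₁ - 1)) * A * K₁ * m ^ (θ₁ - 1 / p)
      + ofReal (1 + 1 / (p * θ₂ - 1)) * A * K₂ * m ^ (θ₂ - 1 / p) := by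
  have hD : Measurable fun s : ℝ => volume {x | ofReal s < w x} := by
    have : Antitone fun s : ℝ => volume {x | ofReal s < w x} := fun s t hst =>
      measure_mono fun x hx => lt_of_le_of_lt (ofReal_le_ofReal hst) hx
    exact this.measurable
  rw [lintegral_mul_eq_layer _ hZm hw]
  calc _ ≤ ∫⁻ s in Ioi (0 : ℝ), (K₁ * volume {x | ofReal s < w x} ^ θ₁
          + K₂ * volume {x | ofReal s < w x} ^ θ₂) :=
        setLIntegral_mono (by fun_prop) fun s hs => hZ _ (measurableSet_lt measurable_const hw)
          (ne_top_of_le_ne_top hm (hwm s hs))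
    _ = K₁ * (∫⁻ s in Ioi (0 : ℝ), volume {x | ofReal s < w x} ^ θ₁)
        + K₂ * ∫⁻ s in Ioi (0 : ℝ), volume {x | ofReal s < w x} ^ θ₂ := by
        rw [lintegral_add_left (by fun_prop), lintegral_const_mul _ (by fun_prop),
          lintegral_const_mul _ (by fun_prop)]
    _ ≤ K₁ * (ofReal (1 + 1 / (p * θ₁ - 1)) * A * m ^ (θ₁ - 1 / p))
        + K₂ * (ofReal (1 + 1 / (p * θ₂ - 1)) * A * m ^ (θ₂ - 1 / p)) := by
        gcongr
        · exact lintegral_min_rpow_le hp h1 hm _ hwm hwA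
        · exact lintegral_min_rpow_le hp h2 hm _ hwm hwA
    _ = _ := by ring

/-- Layer cake estimate for a bounded weight. -/
theorem SetBound.lintegral_mul_le_of_le {θ₁ θ₂ : ℝ} {K₁ K₂ : ℝ≥0∞} {Z : R4 → ℝ≥0∞}
    (hZ : SetBound θ₁ θ₂ K₁ K₂ Z) (hZm : Measurable Z) {p : ℝ} (hp : 0 < p)
    (hθ₁ : 0 < θ₁) (hθ₂ : 0 < θ₂) (h1 : p * θ₁ < 1)
    (h2 : p * θ₂ < 1) {w : R4 → ℝ≥0∞} (hw : Measurable w) {S A : ℝ≥0∞} (hA : A ≠ ⊤)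
    (hwS : ∀ x, w x ≤ S)
    (hwA : ∀ s : ℝ, 0 < s →
      volume {x | ofReal s < w x} ≤ (A / ofReal s) ^ p) :
    ∫⁻ x, Z x * w x
      ≤ ofReal (1 / (1 - p * θ₁)) * A ^ (p * θ₁) * S ^ (1 - p * θ₁) * K₁
      + ofReal (1 / (1 - p * θ₂)) * A ^ (p * θ₂) * S ^ (1 - p * θ₂) * K₂ := by
  have hms : MeasurableSet {s : ℝ | 0 < s ∧ ofReal s < S} :=
    measurableSet_Ioi.inter (measurableSet_lt measurable_ofReal measurable_const)
  have hmq : ∀ θ : ℝ, Measurable fun s : ℝ => (A / ofReal s) ^ (p * θ) := by fun_prop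
  rw [lintegral_mul_eq_layer _ hZm hw]
  calc _ ≤ ∫⁻ s in Ioi (0 : ℝ), {s : ℝ | 0 < s ∧ ofReal s < S}.indicator (fun s =>
            K₁ * (A / ofReal s) ^ (p * θ₁) + K₂ * (A / ofReal s) ^ (p * θ₂)) s := by
        refine setLIntegral_mono (Measurable.indicator
          (((hmq θ₁).const_mul _).add ((hmq θ₂).const_mul _)) hms) fun s hs => ?_
        by_cases hsS : ofReal s < S
        · rw [indicator_of_mem (show s ∈ {s : ℝ | 0 < s ∧ ofReal s < S} from ⟨hs, hsS⟩)]
          have hs' : ofReal s ≠ 0 := by simpa using hs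
          have hfin : volume {x | ofReal s < w x} ≠ ⊤ :=
            ne_top_of_le_ne_top (rpow_ne_top_of_nonneg hp.le
              (div_ne_top hA hs')) (hwA s hs)
          refine (hZ _ (measurableSet_lt measurable_const hw) hfin).trans ?_
          rw [rpow_mul, rpow_mul]; gcongr
          · exact hwA s hs
          · exact hwA s hs
        · have : {x | ofReal s < w x} = ∅ := by grind
          simp [this]
    _ = ∫⁻ s in {s : ℝ | 0 < s ∧ ofReal s < S},
          (K₁ * (A / ofReal s) ^ (p * θ₁) + K₂ * (A / ofReal s) ^ (p * θ₂)) := by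
        rw [lintegral_indicator hms, Measure.restrict_restrict hms]
        congr 2; grind
    _ = K₁ * (∫⁻ s in {s : ℝ | 0 < s ∧ ofReal s < S}, (A / ofReal s) ^ (p * θ₁))
        + K₂ * ∫⁻ s in {s : ℝ | 0 < s ∧ ofReal s < S},
          (A / ofReal s) ^ (p * θ₂) := by
        rw [lintegral_add_left ((hmq θ₁).const_mul _), lintegral_const_mul _ (hmq θ₁),
          lintegral_const_mul _ (hmq θ₂)]
    _ ≤ K₁ * (ofReal (1 / (1 - p * θ₁)) * A ^ (p * θ₁) * S ^ (1 - p * θ₁))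
        + K₂ * (ofReal (1 / (1 - p * θ₂)) * A ^ (p * θ₂) * S ^ (1 - p * θ₂)) := by
        gcongr
        · exact lintegral_Ioc_div_rpow_le (by positivity) h1 A S
        · exact lintegral_Ioc_div_rpow_le (by positivity) h2 A S
    _ = _ := by ring

/-! ### Riesz potentials -/

/-- The potential `∫ |x - y|^{-k} g(y) dy` on `ℝ⁴`; for `k = 3` and `k = 2` these are, up to
constants, the Riesz potentials of order `1` and `2`. -/
def pot (k : ℕ) (g : R4 → ℝ≥0∞) (x : R4) : ℝ≥0∞ := ∫⁻ y, (‖x - y‖ₑ⁻¹) ^ k * g y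

theorem measurable_pot (k : ℕ) {g : R4 → ℝ≥0∞} (hg : Measurable g) : Measurable (pot k g) := by
  unfold pot
  fun_prop

theorem pot_mono (k : ℕ) {g h : R4 → ℝ≥0∞} (hgh : ∀ᵐ y, g y ≤ h y) (x : R4) :
    pot k g x ≤ pot k h x :=
  lintegral_mono_ae (hgh.mono fun y hy => by gcongr)

theorem pot_add (k : ℕ) {g : R4 → ℝ≥0∞} (hg : Measurable g) (h : R4 → ℝ≥0∞) (x : R4) :
    pot k (fun y => g y + h y) x = pot k g x + pot k h x := by
  unfold pot
  rw [← lintegral_add_left (by fun_prop)]; ring_nf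

theorem pot_const_mul (k : ℕ) {g : R4 → ℝ≥0∞} (hg : Measurable g) (c : ℝ≥0∞) (x : R4) :
    pot k (fun y => c * g y) x = c * pot k g x := by
  unfold pot
  rw [← lintegral_const_mul _ (by fun_prop)]
  grind

theorem enorm_sub_comm' (x y : R4) : ‖x - y‖ₑ = ‖y - x‖ₑ := by
  rw [← edist_eq_enorm_sub, edist_comm, edist_eq_enorm_sub]

/-- The potentials are symmetric. -/
theorem lintegral_mul_pot (k : ℕ) {g h : R4 → ℝ≥0∞} (hg : Measurable g) (hh : Measurable h) :
    ∫⁻ x, h x * pot k g x = ∫⁻ x, g x * pot k h x := by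
  unfold pot
  have e1 : ∀ x, h x * ∫⁻ y, (‖x - y‖ₑ⁻¹) ^ k * g y = ∫⁻ y, h x * ((‖x - y‖ₑ⁻¹) ^ k * g y) :=
    fun x => (lintegral_const_mul _ (by fun_prop)).symm
  have e2 : ∀ x, g x * ∫⁻ y, (‖x - y‖ₑ⁻¹) ^ k * h y = ∫⁻ y, g x * ((‖x - y‖ₑ⁻¹) ^ k * h y) :=
    fun x => (lintegral_const_mul _ (by fun_prop)).symm
  simp_rw [e1, e2]
  rw [lintegral_lintegral_swap (by fun_prop)]
  refine lintegral_congr fun y => lintegral_congr fun x => ?_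
  rw [enorm_sub_comm']; ring

/-- The volume of the unit ball, as a constant. -/
def ballVol : ℝ≥0 := (volume (Metric.ball (0 : R4) 1)).toNNReal

theorem coe_ballVol : (ballVol : ℝ≥0∞) = volume (Metric.ball (0 : R4) 1) :=
  coe_toNNReal measure_ball_lt_top.ne

theorem ballVol_pos : 0 < ballVol :=
  ENNReal.toNNReal_pos (Metric.measure_ball_pos _ _ one_pos).ne' measure_ball_lt_top.ne

theorem volume_ball_R4 (x : R4) {r : ℝ} (hr : 0 ≤ r) :
    volume (Metric.ball x r) = ofReal r ^ 4 * ballVol := by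
  rw [Measure.addHaar_ball _ _ hr, coe_ballVol, finrank_euclideanSpace_fin,
    ofReal_pow hr]

theorem volume_lt_inv_enorm_pow_le {k : ℕ} (hk : 0 < k) (x : R4) {s : ℝ} (hs : 0 < s) :
    volume {y : R4 | ofReal s < (‖x - y‖ₑ⁻¹) ^ k}
      ≤ ((ballVol : ℝ≥0∞) ^ ((k : ℝ) / 4) / ofReal s) ^ (4 / (k : ℝ)) := by
  have hk' : (0 : ℝ) < k := by exact_mod_cast hk
  set r : ℝ := s ^ (-(1 / (k : ℝ))) with hr
  have hr0 : 0 < r := by positivity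
  have hsub : {y : R4 | ofReal s < (‖x - y‖ₑ⁻¹) ^ k} ⊆ Metric.ball x r := by
    intro y hy
    by_contra h
    rw [Metric.mem_ball, not_lt, dist_comm, dist_eq_norm] at h
    have h1 : ofReal r ≤ ‖x - y‖ₑ := by
      rw [← ofReal_norm]; exact ofReal_le_ofReal h
    have h2 : (‖x - y‖ₑ⁻¹) ^ k ≤ ofReal s := by
      calc (‖x - y‖ₑ⁻¹) ^ k ≤ ((ofReal r)⁻¹) ^ k := by gcongr
        _ = ofReal s := by
          rw [← ofReal_inv_of_pos hr0, ← ofReal_pow (by positivity), hr,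
            ← Real.rpow_neg hs.le, neg_neg, ← Real.rpow_natCast, ← Real.rpow_mul hs.le,
            one_div_mul_cancel hk'.ne', Real.rpow_one]
    exact absurd hy (not_lt.2 h2)
  refine (measure_mono hsub).trans_eq ?_
  rw [volume_ball_R4 x hr0.le, ENNReal.div_rpow_of_nonneg _ _ (by positivity), ← rpow_mul,
    show (k : ℝ) / 4 * (4 / k) = 1 by field_simp, rpow_one, mul_comm, div_eq_mul_inv]
  congr 1
  rw [hr, ← ofReal_rpow_of_pos hs, ← rpow_natCast, ← rpow_mul,
    ← ENNReal.rpow_neg]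
  ring_nf

theorem setBound_one : SetBound 1 1 1 0 (fun _ => 1) := fun E _ _ => by simp

/-- Constant in the bound for the potential of an indicator function. -/
def potConst (k : ℕ) : ℝ≥0 :=
  toNNReal (1 + 1 / (4 / (k : ℝ) * 1 - 1)) * ballVol ^ ((k : ℝ) / 4)

theorem setLIntegral_inv_enorm_pow_le {k : ℕ} (hk : 0 < k) (hk4 : k < 4) {E : Set R4}
    (hE : MeasurableSet E) (hf : volume E ≠ ⊤) (x : R4) :
    ∫⁻ y in E, (‖x - y‖ₑ⁻¹) ^ k ≤ potConst k * volume E ^ (1 - (k : ℝ) / 4) := by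
  have hk' : (0 : ℝ) < k := by exact_mod_cast hk
  have hk4' : (k : ℝ) < 4 := by exact_mod_cast hk4
  have hp1 : 1 < 4 / (k : ℝ) * 1 := by bound
  have := setBound_one.lintegral_mul_le measurable_const (p := 4 / (k : ℝ)) (by positivity)
    hp1 hp1 (w := E.indicator fun y => (‖x - y‖ₑ⁻¹) ^ k) (Measurable.indicator (by fun_prop) hE)
    (m := volume E) (A := (ballVol : ℝ≥0∞) ^ ((k : ℝ) / 4)) hf ?_ ?_
  · simp only [one_mul, mul_zero, zero_mul, add_zero, mul_one] at this
    rw [lintegral_indicator hE] at this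
    refine this.trans_eq ?_
    unfold potConst
    rw [coe_mul, ofReal, one_div_div, mul_one,
      coe_rpow_of_nonneg _ (by positivity)]
  · intro s hs
    refine measure_mono fun y hy => ?_
    by_contra h
    simp_all
  · intro s hs
    refine (measure_mono fun y hy => ?_).trans (volume_lt_inv_enorm_pow_le hk x hs)
    by_cases h : y ∈ E
    · aesop
    · aesop

theorem pot_indicator_le {k : ℕ} (hk : 0 < k) (hk4 : k < 4) {E : Set R4}
    (hE : MeasurableSet E) (hf : volume E ≠ ⊤) (x : R4) :
    pot k (E.indicator 1) x ≤ potConst k * volume E ^ (1 - (k : ℝ) / 4) := by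
  refine le_trans (le_of_eq ?_) (setLIntegral_inv_enorm_pow_le hk hk4 hE hf x)
  unfold pot
  rw [← lintegral_indicator hE]
  refine lintegral_congr fun y => ?_
  by_cases h : y ∈ E <;> simp [h]

theorem setLIntegral_pot (k : ℕ) {g : R4 → ℝ≥0∞} (hg : Measurable g) {E : Set R4}
    (hE : MeasurableSet E) : ∫⁻ x in E, pot k g x = ∫⁻ x, g x * pot k (E.indicator 1) x := by
  rw [← lintegral_mul_pot k hg (measurable_one.indicator hE), ← lintegral_indicator hE]
  refine lintegral_congr fun y => ?_
  by_cases h : y ∈ E <;> simp [h]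

/-- Weak-type bound for the potential of an indicator function. -/
theorem volume_lt_pot_indicator_le {k : ℕ} (hk : 0 < k) (hk4 : k < 4) {E : Set R4}
    (hE : MeasurableSet E) {s : ℝ} (hs : 0 < s) :
    volume {x | ofReal s < pot k (E.indicator 1) x}
      ≤ (potConst k * volume E / ofReal s) ^ (4 / (k : ℝ)) := by
  have hk' : (0 : ℝ) < k := by exact_mod_cast hk
  have hmE : Measurable (E.indicator (1 : R4 → ℝ≥0∞)) := measurable_one.indicator hE
  by_contra hlt
  rw [not_le] at hlt
  obtain ⟨G, hG, hGs, hG1, hG2⟩ := Measure.exists_subset_measure_lt_top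
    (measurableSet_lt measurable_const (measurable_pot k hmE)) hlt
  have h1 : ofReal s * volume G ≤ volume E * (potConst k * volume G ^ (1 - (k : ℝ) / 4)) :=
    calc ofReal s * volume G = ∫⁻ x in G, ofReal s := by simp
      _ ≤ ∫⁻ x in G, pot k (E.indicator 1) x :=
          setLIntegral_mono (measurable_pot k hmE) fun x hx => (hGs hx).le
      _ = ∫⁻ x, E.indicator 1 x * pot k (G.indicator 1) x := setLIntegral_pot k hmE hG
      _ ≤ ∫⁻ x, E.indicator 1 x * (potConst k * volume G ^ (1 - (k : ℝ) / 4)) := by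
          gcongr with x
          exact pot_indicator_le hk hk4 hG hG2.ne x
      _ = _ := by
          rw [lintegral_mul_const _ hmE, lintegral_indicator_one hE]
  have hG0 : volume G ≠ 0 := (bot_le.trans_lt hG1).ne'
  have h2 : volume G ^ ((k : ℝ) / 4) ≤ potConst k * volume E / ofReal s := by
    rw [ENNReal.le_div_iff_mul_le (Or.inl (by simpa using hs)) (Or.inl ofReal_ne_top)]
    have h3 : volume G ^ (1 - (k : ℝ) / 4) ≠ 0 := by positivity
    have h4 : volume G ^ (1 - (k : ℝ) / 4) ≠ ⊤ := by aesop
    have h5 : volume G = volume G ^ ((k : ℝ) / 4) * volume G ^ (1 - (k : ℝ) / 4) := by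
      rw [← rpow_add _ _ hG0 hG2.ne, add_sub_cancel, rpow_one]
    rw [← ENNReal.mul_le_mul_iff_left h3 h4]
    calc _ = ofReal s * volume G := by
          conv_rhs => rw [h5]
          ring
      _ ≤ _ := h1
      _ = _ := by ring
  have h6 := rpow_le_rpow h2 (show 0 ≤ 4 / (k : ℝ) by positivity)
  rw [← rpow_mul, show (k : ℝ) / 4 * (4 / k) = 1 by field_simp, rpow_one] at h6
  grind

/-- The potential of order `4 - k` improves the exponents of a set bound by `1 - k/4`. -/
theorem SetBound.pot {k : ℕ} (hk : 0 < k) (hk4 : k < 4) {θ₁ θ₂ : ℝ} (hθ₁ : 0 < θ₁) (hθ₂ : 0 < θ₂)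
    (h1 : 4 / (k : ℝ) * θ₁ < 1) (h2 : 4 / (k : ℝ) * θ₂ < 1) :
    ∃ C : ℝ≥0, ∀ {K₁ K₂ : ℝ≥0∞} {Z : R4 → ℝ≥0∞}, Measurable Z → SetBound θ₁ θ₂ K₁ K₂ Z →
      SetBound (θ₁ + (1 - (k : ℝ) / 4)) (θ₂ + (1 - (k : ℝ) / 4)) (C * K₁) (C * K₂) (pot k Z) := by
  have hk' : (0 : ℝ) < k := by exact_mod_cast hk
  have hk4' : (k : ℝ) < 4 := by exact_mod_cast hk4
  set P : ℝ≥0∞ := ((potConst k : ℝ≥0) : ℝ≥0∞) with hP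
  have hPt : P ≠ ⊤ := coe_ne_top
  have key : ∀ θ : ℝ, 0 < θ → 4 / (k : ℝ) * θ < 1 → ∀ v : ℝ≥0∞, v ≠ ⊤ →
      (P * v) ^ (4 / (k : ℝ) * θ) * (P * v ^ (1 - (k : ℝ) / 4)) ^ (1 - 4 / (k : ℝ) * θ)
      = P * v ^ (θ + (1 - (k : ℝ) / 4)) := by
    intro θ hθ hkθ v hv
    have hq : 0 < 1 - 4 / (k : ℝ) * θ := by linarith
    have ha : 0 < 4 / (k : ℝ) * θ := by positivity
    have hb : 0 < 1 - (k : ℝ) / 4 := by linarith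
    rw [mul_rpow_of_nonneg _ _ ha.le, mul_rpow_of_nonneg _ _ hq.le,
      ← rpow_mul, mul_mul_mul_comm, ← rpow_add_of_nonneg _ _ ha.le hq.le,
      ← rpow_add_of_nonneg _ _ ha.le (by positivity), add_sub_cancel, rpow_one]
    grind
  refine ⟨max (toNNReal (1 / (1 - 4 / (k : ℝ) * θ₁)))
    (toNNReal (1 / (1 - 4 / (k : ℝ) * θ₂))) * potConst k, ?_⟩
  intro K₁ K₂ Z hZm hZ E hE hf
  have hmE : Measurable (E.indicator (1 : R4 → ℝ≥0∞)) := measurable_one.indicator hE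
  rw [setLIntegral_pot k hZm hE]
  refine (hZ.lintegral_mul_le_of_le hZm (p := 4 / (k : ℝ)) (by positivity) hθ₁ hθ₂ h1 h2
    (measurable_pot k hmE) (S := P * volume E ^ (1 - (k : ℝ) / 4)) (A := P * volume E)
    (mul_ne_top hPt hf) (fun x => pot_indicator_le hk hk4 hE hf x)
    (fun s hs => volume_lt_pot_indicator_le hk hk4 hE hs)).trans ?_
  rw [mul_assoc (ofReal (1 / (1 - 4 / (k : ℝ) * θ₁))) (_ ^ _) (_ ^ _),
    mul_assoc (ofReal (1 / (1 - 4 / (k : ℝ) * θ₂))) (_ ^ _) (_ ^ _), key θ₁ hθ₁ h1 _ hf,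
    key θ₂ hθ₂ h2 _ hf, coe_mul, ← hP]
  have c1 : ofReal (1 / (1 - 4 / (k : ℝ) * θ₁))
      ≤ ((max (toNNReal (1 / (1 - 4 / (k : ℝ) * θ₁)))
    (toNNReal (1 / (1 - 4 / (k : ℝ) * θ₂))) : ℝ≥0) : ℝ≥0∞) :=
    coe_le_coe.2 (le_max_left _ _)
  have c2 : ofReal (1 / (1 - 4 / (k : ℝ) * θ₂))
      ≤ ((max (toNNReal (1 / (1 - 4 / (k : ℝ) * θ₁)))
    (toNNReal (1 / (1 - 4 / (k : ℝ) * θ₂))) : ℝ≥0) : ℝ≥0∞) :=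
    coe_le_coe.2 (le_max_right _ _)
  refine (add_le_add (mul_le_mul_left (mul_le_mul_left c1 _) _)
    (mul_le_mul_left (mul_le_mul_left c2 _) _)).trans_eq ?_
  ring

/-- Chebyshev's inequality for the fourth power. -/
theorem volume_lt_le_of_lintegral_pow_four_le {a : R4 → ℝ≥0∞} (ha : Measurable a) {A : ℝ≥0∞}
    (hA : ∫⁻ x, a x ^ 4 ≤ A ^ 4) {s : ℝ} (hs : 0 < s) :
    volume {x | ofReal s < a x} ≤ (A / ofReal s) ^ (4 : ℝ) := by
  have hs0 : ofReal s ≠ 0 := by simpa using hs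
  rw [ENNReal.div_rpow_of_nonneg _ _ (by norm_num), show (4 : ℝ) = (4 : ℕ) by norm_num,
    rpow_natCast, rpow_natCast,
    ENNReal.le_div_iff_mul_le (Or.inl (pow_ne_zero _ hs0))
      (Or.inl (pow_ne_top ofReal_ne_top)), mul_comm]
  refine le_trans ?_ hA
  refine le_trans ?_ (mul_meas_ge_le_lintegral (ha.pow_const 4) (ofReal s ^ 4))
  gcongr with x
  bound

/-- Multiplication by a function in `L⁴` lowers the exponents of a set bound by `1/4`. -/
theorem SetBound.mul_of_pow_four {θ₁ θ₂ : ℝ} (h1 : 1 < 4 * θ₁) (h2 : 1 < 4 * θ₂) :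
    ∃ C : ℝ≥0, ∀ {K₁ K₂ A : ℝ≥0∞} {Z a : R4 → ℝ≥0∞}, Measurable Z → Measurable a →
      ∫⁻ x, a x ^ 4 ≤ A ^ 4 → SetBound θ₁ θ₂ K₁ K₂ Z →
      SetBound (θ₁ - 1 / 4) (θ₂ - 1 / 4) (C * A * K₁) (C * A * K₂) (fun x => a x * Z x) := by
  refine ⟨max (toNNReal (1 + 1 / (4 * θ₁ - 1))) (toNNReal (1 + 1 / (4 * θ₂ - 1))), ?_⟩
  intro K₁ K₂ A Z a hZm ham hA hZ E hE hf
  have hlev : ∀ s : ℝ, 0 < s → {x | ofReal s < E.indicator a x}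
      = {x | ofReal s < a x} ∩ E := by
    intro s hs
    ext x
    by_cases h : x ∈ E <;> simp [h]
  have e : ∫⁻ x in E, a x * Z x = ∫⁻ x, Z x * E.indicator a x := by
    rw [← lintegral_indicator hE]
    refine lintegral_congr fun y => ?_
    by_cases h : y ∈ E <;> simp [h, mul_comm]
  rw [e]
  refine (hZ.lintegral_mul_le hZm (p := 4) (by norm_num) h1 h2 (ham.indicator hE)
    (m := volume E) (A := A) hf (fun s hs => ?_) (fun s hs => ?_)).trans ?_
  · rw [hlev s hs]; exact measure_mono inter_subset_right
  · rw [hlev s hs]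
    exact (measure_mono inter_subset_left).trans (volume_lt_le_of_lintegral_pow_four_le ham hA hs)
  · have c1 := coe_le_coe.2 (le_max_left (toNNReal (1 + 1 / (4 * θ₁ - 1)))
      (toNNReal (1 + 1 / (4 * θ₂ - 1))))
    have c2 := coe_le_coe.2 (le_max_right (toNNReal (1 + 1 / (4 * θ₁ - 1)))
      (toNNReal (1 + 1 / (4 * θ₂ - 1))))
    bound

/-- Set bounds improve by iteration: a function dominated by its image under a contraction of
half size plus a remainder obeys, up to a factor `2`, the bound of the remainder. -/
theorem SetBound.of_iterate {θ₁ θ₂ : ℝ} {T : (R4 → ℝ≥0∞) → R4 → ℝ≥0∞} {b Z : R4 → ℝ≥0∞}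
    {K₁ K₂ M : ℝ≥0∞} (hM : M ≠ ⊤) (hZm : Measurable Z) (hZ : SetBound θ₁ θ₂ K₁ K₂ Z)
    (hb : SetBound θ₁ θ₂ 0 M b) (hbT : ∀ᵐ x, b x ≤ Z x + T b x)
    (hT : ∀ L₁ L₂, SetBound θ₁ θ₂ L₁ L₂ b → SetBound θ₁ θ₂ (2⁻¹ * L₁) (2⁻¹ * L₂) (T b)) (hθ₂ : 0 ≤ θ₂) :
    SetBound θ₁ θ₂ (2 * K₁) (2 * K₂) b := by
  have step : ∀ n : ℕ, SetBound θ₁ θ₂ (2 * K₁) (2 * K₂ + 2⁻¹ ^ n * M) b := by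
    intro n
    induction n with
    | zero => exact hb.mono bot_le (by simp)
    | succ n ih =>
      have h2 : (2⁻¹ : ℝ≥0∞) * 2 = 1 := ENNReal.inv_mul_cancel (by norm_num) (by norm_num)
      refine ((hZ.add (hT _ _ ih) hZm).mono_fun hbT).mono (le_of_eq ?_) (le_of_eq ?_)
      · rw [← mul_assoc, h2]; ring
      · rw [mul_add, ← mul_assoc, h2, pow_succ]; ring
  intro E hE hf
  have hlim : Tendsto (fun n : ℕ => 2 * K₁ * volume E ^ θ₁
      + (2 * K₂ + 2⁻¹ ^ n * M) * volume E ^ θ₂) atTop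
      (𝓝 (2 * K₁ * volume E ^ θ₁ + (2 * K₂ + 0 * M) * volume E ^ θ₂)) := by
    refine tendsto_const_nhds.add ?_
    refine ENNReal.Tendsto.mul_const (tendsto_const_nhds.add ?_)
      (Or.inr (rpow_ne_top_of_nonneg hθ₂ hf))
    exact ENNReal.Tendsto.mul_const (ENNReal.tendsto_pow_atTop_nhds_zero_of_lt_one (by norm_num))
      (Or.inr hM)
  have := ge_of_tendsto' hlim fun n => step n E hE hf
  simp_all

/-! ### Regularized fundamental solutions -/

/-- The partial derivative `∂ᵢf`. -/
def pd (i : Fin 4) (f : R4 → ℝ) (x : R4) : ℝ := fderiv ℝ f x (e i)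

/-- The Laplacian as the sum of the pure second partial derivatives. -/
def lapl (f : R4 → ℝ) (x : R4) : ℝ := ∑ i, pd i (pd i f) x

/-- The regularized multiple `(|z|² + h²)⁻¹` of the fundamental solution of `Δ` on `ℝ⁴`. -/
def regKer (h : ℝ) (z : R4) : ℝ := (‖z‖ ^ 2 + h ^ 2)⁻¹

/-- The first derivatives `∂ᵢ` of `regKer`. -/
def regKer₁ (h : ℝ) (i : Fin 4) (z : R4) : ℝ := -2 * z i * regKer h z ^ 2

/-- The second derivatives `∂ⱼ∂ᵢ` of `regKer`. -/
def regKer₂ (h : ℝ) (i j : Fin 4) (z : R4) : ℝ :=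
  -2 * (if i = j then 1 else 0) * regKer h z ^ 2 + 8 * z i * z j * regKer h z ^ 3

/-- The third derivatives `∂ₖ∂ⱼ∂ᵢ` of `regKer`. -/
def regKer₃ (h : ℝ) (i j k : Fin 4) (z : R4) : ℝ :=
  8 * ((if i = j then 1 else 0) * z k + (if i = k then 1 else 0) * z j
    + (if j = k then 1 else 0) * z i) * regKer h z ^ 3 - 48 * z i * z j * z k * regKer h z ^ 4

/-- The Laplacian of `regKer`, an approximate identity up to a constant. -/
def regDelta (h : ℝ) (z : R4) : ℝ := -8 * h ^ 2 * regKer h z ^ 3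

section Calculus

variable {h : ℝ}

theorem regKer_den_pos (hh : 0 < h) (z : R4) : 0 < ‖z‖ ^ 2 + h ^ 2 := by positivity

theorem regKer_pos (hh : 0 < h) (z : R4) : 0 < regKer h z := inv_pos.2 (regKer_den_pos hh z)

theorem hasFDerivAt_regKer (hh : 0 < h) (z : R4) :
    HasFDerivAt (regKer h) (-(2 * regKer h z ^ 2) • innerSL ℝ z) z := by
  have h1 : HasFDerivAt (fun z : R4 => ‖z‖ ^ 2 + h ^ 2) (2 • innerSL ℝ z) z :=
    (hasStrictFDerivAt_norm_sq z).hasFDerivAt.add_const _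
  have h2 := (hasDerivAt_inv (regKer_den_pos hh z).ne').comp_hasFDerivAt z h1
  refine h2.congr_fderiv ?_
  ext v
  simp [regKer]
  ring

theorem contDiff_regKer (hh : 0 < h) {n : WithTop ℕ∞} : ContDiff ℝ n (regKer h) :=
  ((contDiff_norm_sq ℝ).add contDiff_const).inv fun z => (regKer_den_pos hh z).ne'

theorem contDiff_coord {n : WithTop ℕ∞} (i : Fin 4) : ContDiff ℝ n (fun z : R4 => z i) :=
  (EuclideanSpace.proj (𝕜 := ℝ) i).contDiff

theorem contDiff_regKer₁ (hh : 0 < h) {n : WithTop ℕ∞} (i : Fin 4) :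
    ContDiff ℝ n (regKer₁ h i) :=
  ((contDiff_const.mul (contDiff_coord i)).mul ((contDiff_regKer hh).pow 2))

theorem contDiff_regKer₂ (hh : 0 < h) {n : WithTop ℕ∞} (i j : Fin 4) :
    ContDiff ℝ n (regKer₂ h i j) :=
  ((contDiff_const.mul ((contDiff_regKer hh).pow 2))).add
    (((contDiff_const.mul (contDiff_coord i)).mul (contDiff_coord j)).mul
      ((contDiff_regKer hh).pow 3))

theorem contDiff_regKer₃ (hh : 0 < h) {n : WithTop ℕ∞} (i j k : Fin 4) :
    ContDiff ℝ n (regKer₃ h i j k) := by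
  have := contDiff_coord (n := n) i
  have := contDiff_coord (n := n) j
  have := contDiff_coord (n := n) k
  have := contDiff_regKer hh (n := n)
  unfold regKer₃
  fun_prop

theorem contDiff_regDelta (hh : 0 < h) {n : WithTop ℕ∞} : ContDiff ℝ n (regDelta h) :=
  contDiff_const.mul ((contDiff_regKer hh).pow 3)

theorem hasFDerivAt_coord (i : Fin 4) (z : R4) :
    HasFDerivAt (fun z : R4 => z i) (EuclideanSpace.proj (𝕜 := ℝ) i) z :=
  (EuclideanSpace.proj (𝕜 := ℝ) i).hasFDerivAt

theorem e_apply (i j : Fin 4) : (e j : R4) i = if i = j then 1 else 0 := by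
  simp [e]

theorem inner_e (z : R4) (i : Fin 4) : inner ℝ z (e i) = z i := by
  simp [e, EuclideanSpace.inner_single_right]

theorem pd_regKer (hh : 0 < h) (i : Fin 4) : pd i (regKer h) = regKer₁ h i := by
  ext z
  rw [pd, (hasFDerivAt_regKer hh z).fderiv]
  simp only [smul_apply, innerSL_apply_apply, inner_e, smul_eq_mul, regKer₁]; ring

theorem pd_regKer₁ (hh : 0 < h) (i j : Fin 4) : pd j (regKer₁ h i) = regKer₂ h i j := by
  ext z
  have h1 := (((hasFDerivAt_coord i z).const_mul (-2)).mul ((hasFDerivAt_regKer hh z).pow 2))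
  have h2 : HasFDerivAt (regKer₁ h i) _ z := h1
  rw [pd, h2.fderiv]
  simp only [add_apply, smul_apply, innerSL_apply_apply,
    inner_e, smul_eq_mul, regKer₂, PiLp.proj_apply, e_apply]
  ring

theorem pd_regKer₂ (hh : 0 < h) (i j k : Fin 4) : pd k (regKer₂ h i j) = regKer₃ h i j k := by
  ext z
  have h1 := ((hasFDerivAt_regKer hh z).pow 2).const_mul (-2 * (if i = j then 1 else 0))
  have h2 := (((hasFDerivAt_coord i z).const_mul 8).mul (hasFDerivAt_coord j z)).mul
    ((hasFDerivAt_regKer hh z).pow 3)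
  have h3 : HasFDerivAt (regKer₂ h i j) _ z := h1.add h2
  rw [pd, h3.fderiv]
  simp only [add_apply, smul_apply, innerSL_apply_apply,
    inner_e, smul_eq_mul, regKer₃, PiLp.proj_apply, e_apply]
  norm_num
  split_ifs <;> ring

theorem norm_sq_eq_sum (z : R4) : ‖z‖ ^ 2 = ∑ i, z i ^ 2 := by
  rw [EuclideanSpace.norm_sq_eq]; simp

theorem sum_regKer₂ (hh : 0 < h) (z : R4) : ∑ i, regKer₂ h i i z = regDelta h z := by
  have h0 : regKer h z * (‖z‖ ^ 2 + h ^ 2) = 1 := inv_mul_cancel₀ (regKer_den_pos hh z).ne'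
  have h1 := norm_sq_eq_sum z
  rw [Fin.sum_univ_four] at h1 ⊢
  simp only [regKer₂, regDelta, if_true]
  grind

theorem regKer₂_symm (i j : Fin 4) (z : R4) : regKer₂ h i j z = regKer₂ h j i z := by
  simp only [regKer₂, eq_comm (a := i)]; ring

theorem regKer₃_symm (i j k : Fin 4) (z : R4) : regKer₃ h i j k z = regKer₃ h j k i z := by
  simp only [regKer₃, eq_comm (a := i)]; ring

theorem regKer₂_neg (i j : Fin 4) (z : R4) : regKer₂ h i j (-z) = regKer₂ h i j z := by
  simp [regKer₂, regKer]

theorem sum_regKer₃ (hh : 0 < h) (j : Fin 4) (z : R4) :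
    ∑ i, regKer₃ h j i i z = pd j (regDelta h) z := by
  have h1 : regDelta h = fun z => ∑ i, regKer₂ h i i z := funext fun z => (sum_regKer₂ hh z).symm
  have h2 : pd j (regDelta h) z = ∑ i, pd j (regKer₂ h i i) z := by
    rw [h1, pd, fderiv_fun_sum fun i _ => (contDiff_regKer₂ hh i i).differentiable one_ne_zero z]
    simp [pd]
  rw [h2]
  refine sum_congr rfl fun i _ => ?_
  rw [pd_regKer₂ hh, regKer₃_symm]

theorem abs_coord_le (z : R4) (i : Fin 4) : |z i| ≤ ‖z‖ := by
  simpa using PiLp.norm_apply_le z i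

theorem regKer_le {z : R4} (hz : z ≠ 0) : regKer h z ≤ (‖z‖⁻¹) ^ 2 := by
  have : 0 < ‖z‖ := norm_pos_iff.2 hz
  rw [regKer, inv_pow]; bound

theorem norm_sq_mul_regKer_le (hh : 0 < h) (z : R4) : ‖z‖ ^ 2 * regKer h z ≤ 1 := by
  rw [regKer, ← div_eq_mul_inv, div_le_one (regKer_den_pos hh z)]
  nlinarith

theorem abs_regKer₁_le (z : R4) (i : Fin 4) :
    |regKer₁ h i z| ≤ 2 * ‖z‖ * regKer h z ^ 2 := by
  rw [regKer₁, abs_mul, abs_mul, abs_of_nonneg (sq_nonneg (regKer h z))]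
  have := abs_coord_le z i
  bound

theorem abs_regKer₂_le (hh : 0 < h) (z : R4) (i j : Fin 4) :
    |regKer₂ h i j z| ≤ 10 * regKer h z ^ 2 := by
  have hq := (regKer_pos hh z).le
  have hi := abs_coord_le z i
  have hj := abs_coord_le z j
  have h1 : |z i * z j| ≤ ‖z‖ ^ 2 := by
    rw [abs_mul, sq]; gcongr
  have h2 := norm_sq_mul_regKer_le hh z
  have h3 : |(-2 * (if i = j then 1 else 0) * regKer h z ^ 2 : ℝ)| ≤ 2 * regKer h z ^ 2 := by aesop
  have h4 : |8 * z i * z j * regKer h z ^ 3| ≤ 8 * regKer h z ^ 2 := by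
    rw [show 8 * z i * z j * regKer h z ^ 3 = (8 * regKer h z ^ 3) * (z i * z j) by ring, abs_mul,
      abs_of_nonneg (by positivity)]
    calc 8 * regKer h z ^ 3 * |z i * z j| ≤ 8 * regKer h z ^ 3 * ‖z‖ ^ 2 := by gcongr
      _ = 8 * regKer h z ^ 2 * (‖z‖ ^ 2 * regKer h z) := by ring
      _ ≤ 8 * regKer h z ^ 2 * 1 := by gcongr
      _ = _ := by ring
  rw [regKer₂]
  exact (abs_add_le _ _).trans (by linarith)

theorem abs_regKer₃_le (hh : 0 < h) (z : R4) (i j k : Fin 4) :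
    |regKer₃ h i j k z| ≤ 72 * ‖z‖ * regKer h z ^ 3 := by
  have hq := (regKer_pos hh z).le
  have hi := abs_coord_le z i
  have hj := abs_coord_le z j
  have hk := abs_coord_le z k
  have hn := norm_nonneg z
  have h2 := norm_sq_mul_regKer_le hh z
  have d : ∀ (p : Prop) [Decidable p] (t : ℝ), |t| ≤ ‖z‖ → |(if p then 1 else 0) * t| ≤ ‖z‖ := by
    aesop
  have h3 : |(if i = j then 1 else 0) * z k + (if i = k then 1 else 0) * z j
    + (if j = k then 1 else 0) * z i| ≤ 3 * ‖z‖ := by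
    refine (abs_add_three _ _ _).trans ?_
    grind
  have h4 : |z i * z j * z k| ≤ ‖z‖ ^ 3 := by
    rw [abs_mul, abs_mul, show ‖z‖ ^ 3 = ‖z‖ * ‖z‖ * ‖z‖ by ring]; gcongr
  have h5 : |48 * z i * z j * z k * regKer h z ^ 4| ≤ 48 * ‖z‖ * regKer h z ^ 3 := by
    rw [show 48 * z i * z j * z k * regKer h z ^ 4 = (48 * regKer h z ^ 4) * (z i * z j * z k) by
      ring, abs_mul, abs_of_nonneg (by positivity)]
    calc 48 * regKer h z ^ 4 * |z i * z j * z k| ≤ 48 * regKer h z ^ 4 * ‖z‖ ^ 3 := by gcongr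
      _ = 48 * ‖z‖ * regKer h z ^ 3 * (‖z‖ ^ 2 * regKer h z) := by ring
      _ ≤ 48 * ‖z‖ * regKer h z ^ 3 * 1 := by gcongr
      _ = _ := by ring
  rw [regKer₃]
  refine (abs_sub _ _).trans ?_
  rw [abs_mul, abs_mul, abs_of_nonneg (show (0 : ℝ) ≤ regKer h z ^ 3 by positivity),
    abs_of_nonneg (show (0 : ℝ) ≤ 8 by norm_num)]
  have : 8 * |(if i = j then 1 else 0) * z k + (if i = k then 1 else 0) * z j
    + (if j = k then 1 else 0) * z i| * regKer h z ^ 3 ≤ 8 * (3 * ‖z‖) * regKer h z ^ 3 := by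
    gcongr
  linarith

end Calculus

/-! ### Convolution of a kernel with an integrable function -/

/-- The convolution `∫ k(x - y) F(y) dy`. -/
def cv (k F : R4 → ℝ) (x : R4) : ℝ := ∫ y, k (x - y) * F y

theorem norm_fderiv_le_sum (L : R4 →L[ℝ] ℝ) : ‖L‖ ≤ ∑ i, |L (e i)| := by
  refine L.opNorm_le_bound (Finset.sum_nonneg fun i _ => abs_nonneg _) fun v => ?_
  have hv : v = ∑ i, v i • (e i : R4) := by
    have := (EuclideanSpace.basisFun (Fin 4) ℝ).sum_repr v
    simp_all
  conv_lhs => rw [hv]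
  rw [map_sum, sum_mul]
  refine (norm_sum_le _ _).trans (sum_le_sum fun i _ => ?_)
  rw [map_smul, smul_eq_mul, norm_mul, norm_eq_abs, norm_eq_abs, mul_comm]
  have := abs_coord_le v i
  gcongr

theorem integrable_cv {k F : R4 → ℝ} (hk : Continuous k) {M : ℝ} (hM : ∀ z, |k z| ≤ M)
    (hF : Integrable F) (x : R4) : Integrable (fun y => k (x - y) * F y) :=
  hF.bdd_mul (by fun_prop) (.of_forall fun y => hM (x - y))

theorem hasFDerivAt_cv {k F : R4 → ℝ} (hk : ContDiff ℝ 1 k) {M : ℝ} (hM : ∀ z, |k z| ≤ M)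
    (hM' : ∀ i z, |pd i k z| ≤ M) (hF : Integrable F) (x : R4) :
    HasFDerivAt (cv k F) (∫ y, F y • fderiv ℝ k (x - y)) x := by
  have hc : Continuous (fderiv ℝ k) := hk.continuous_fderiv one_ne_zero
  have hb : ∀ z, ‖fderiv ℝ k z‖ ≤ 4 * M := fun z =>
    (norm_fderiv_le_sum _).trans ((sum_le_sum fun i _ => hM' i z).trans_eq (by simp))
  refine hasFDerivAt_integral_of_dominated_of_fderiv_le (s := univ)
    (bound := fun y => 4 * M * |F y|) (F' := fun x y => F y • fderiv ℝ k (x - y)) univ_mem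
    (.of_forall fun z => (integrable_cv hk.continuous hM hF z).aestronglyMeasurable)
    (integrable_cv hk.continuous hM hF x) ?_ ?_ (hF.abs.const_mul _) ?_
  · fun_prop
  · refine Eventually.of_forall fun y z _ => ?_
    rw [norm_smul, norm_eq_abs, mul_comm]; gcongr
    exact hb _
  · refine Eventually.of_forall fun y z _ => ?_
    have h1 : HasFDerivAt k (fderiv ℝ k (z - y)) (z - y) :=
      (hk.differentiable one_ne_zero (z - y)).hasFDerivAt
    have h2 : HasFDerivAt (fun z => k (z - y)) (fderiv ℝ k (z - y)) z := by
      simpa [Function.comp_def] using h1.comp z ((hasFDerivAt_id z).sub_const y)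
    simpa [mul_comm] using h2.mul_const (F y)

theorem differentiable_cv {k F : R4 → ℝ} (hk : ContDiff ℝ 1 k) {M : ℝ} (hM : ∀ z, |k z| ≤ M)
    (hM' : ∀ i z, |pd i k z| ≤ M) (hF : Integrable F) : Differentiable ℝ (cv k F) := fun x =>
  (hasFDerivAt_cv hk hM hM' hF x).differentiableAt

theorem pd_cv {k F : R4 → ℝ} (hk : ContDiff ℝ 1 k) {M : ℝ} (hM : ∀ z, |k z| ≤ M)
    (hM' : ∀ i z, |pd i k z| ≤ M) (hF : Integrable F) (i : Fin 4) :
    pd i (cv k F) = cv (pd i k) F := by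
  ext x
  have hc : Continuous (fderiv ℝ k) := hk.continuous_fderiv one_ne_zero
  have hb : ∀ z, ‖fderiv ℝ k z‖ ≤ 4 * M := fun z =>
    (norm_fderiv_le_sum _).trans ((sum_le_sum fun i _ => hM' i z).trans_eq (by simp))
  have hint : Integrable fun y => F y • fderiv ℝ k (x - y) := by
    refine (hF.abs.const_mul (4 * M)).mono' (hF.aestronglyMeasurable.smul
      (hc.comp (continuous_const.sub continuous_id)).aestronglyMeasurable)
      (.of_forall fun y => ?_)
    rw [norm_smul, norm_eq_abs, mul_comm]; gcongr
    exact hb _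
  rw [pd, (hasFDerivAt_cv hk hM hM' hF x).fderiv, ContinuousLinearMap.integral_apply hint]
  simp [cv, pd, mul_comm]

/-! ### Mollification and duality -/

theorem cv_eq_convolution (k F : R4 → ℝ) :
    cv k F = (convolution k F (ContinuousLinearMap.lsmul ℝ ℝ) volume) := by
  ext x
  rw [convolution_lsmul_swap]
  simp [cv]

theorem cv_comm (k F : R4 → ℝ) (x : R4) : cv k F x = cv F k x := by
  unfold cv
  rw [← integral_sub_left_eq_self _ volume x]
  simp [mul_comm]

theorem contDiff_cv_right {k ψ : R4 → ℝ} (hk : LocallyIntegrable k) (hψ : ContDiff ℝ ∞ ψ)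
    (hc : HasCompactSupport ψ) : ContDiff ℝ ∞ (cv k ψ) := by
  rw [cv_eq_convolution]
  exact hc.contDiff_convolution_right _ hk hψ

/-- The bump functions generating the mollifiers. -/
def mollBump (n : ℕ) : ContDiffBump (0 : R4) where
  rIn := 1 / (2 * (n + 1))
  rOut := 1 / (n + 1)
  rIn_pos := by positivity
  rIn_lt_rOut := by bound

/-- A smooth, nonnegative approximate identity. -/
def mollKer (n : ℕ) : R4 → ℝ := (mollBump n).normed volume

theorem mollKer_nonneg (n : ℕ) (x : R4) : 0 ≤ mollKer n x := (mollBump n).nonneg_normed x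

theorem contDiff_mollKer (n : ℕ) {m : ℕ∞} : ContDiff ℝ m (mollKer n) :=
  (mollBump n).contDiff_normed

theorem hasCompactSupport_mollKer (n : ℕ) : HasCompactSupport (mollKer n) :=
  (mollBump n).hasCompactSupport_normed

theorem integral_mollKer (n : ℕ) : ∫ x, mollKer n x = 1 := (mollBump n).integral_normed

theorem integrable_mollKer (n : ℕ) : Integrable (mollKer n) :=
  (contDiff_mollKer n (m := 0)).continuous.integrable_of_hasCompactSupport
    (hasCompactSupport_mollKer n)

theorem mollKer_eq_zero {n : ℕ} {x : R4} (hx : 1 / ((n : ℝ) + 1) ≤ ‖x‖) : mollKer n x = 0 := by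
  by_contra h
  have : x ∈ Function.support ((mollBump n).normed volume) := h
  rw [(mollBump n).support_normed_eq, mem_ball_zero_iff] at this
  exact absurd this (not_lt.2 hx)

theorem contDiff_cv_mollKer (n : ℕ) {v : R4 → ℝ} (hv : LocallyIntegrable v) :
    ContDiff ℝ ∞ (cv (mollKer n) v) := by
  rw [cv_eq_convolution]
  exact (hasCompactSupport_mollKer n).contDiff_convolution_left _ (contDiff_mollKer n) hv

theorem ae_tendsto_cv_mollKer {v : R4 → ℝ} (hv : LocallyIntegrable v) :
    ∀ᵐ x, Tendsto (fun n => cv (mollKer n) v x) atTop (𝓝 (v x)) := by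
  have h1 : Tendsto (fun n : ℕ => (mollBump n).rOut) atTop (𝓝 0) :=
    tendsto_one_div_add_atTop_nhds_zero_nat
  have h2 : ∀ᶠ n in atTop, (mollBump n).rOut ≤ 2 * (mollBump n).rIn := by
    refine Eventually.of_forall fun n => le_of_eq ?_
    simp only [mollBump]
    field_simp
  have h3 := ContDiffBump.ae_convolution_tendsto_right_of_locallyIntegrable (μ := volume) h1 h2 hv
  filter_upwards [h3] with x hx
  simpa only [cv_eq_convolution, mollKer] using hx

theorem cv_mollKer_eq_zero {n : ℕ} {v : R4 → ℝ} {x : R4}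
    (hx : ∀ y, v y ≠ 0 → 1 / ((n : ℝ) + 1) ≤ dist x y) : cv (mollKer n) v x = 0 := by
  unfold cv
  refine integral_eq_zero_of_ae (.of_forall fun y => ?_)
  by_cases hy : v y = 0
  · simp [hy]
  · simp [mollKer_eq_zero (n := n) (x := x - y) (by rw [← dist_eq_norm]; exact hx y hy)]

theorem abs_cv_mollKer_le {n : ℕ} {v : R4 → ℝ} {M : ℝ} (hv : ∀ᵐ y, |v y| ≤ M) (x : R4) :
    |cv (mollKer n) v x| ≤ M := by
  have h1 : Integrable fun y => mollKer n (x - y) := (integrable_mollKer n).comp_sub_left x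
  calc |cv (mollKer n) v x| ≤ ∫ y : R4, mollKer n (x - y) * M := by
        rw [← norm_eq_abs, cv]
        refine norm_integral_le_of_norm_le (h1.mul_const M) ?_
        filter_upwards [hv] with y hy
        rw [norm_mul, norm_eq_abs, abs_of_nonneg (mollKer_nonneg n _), norm_eq_abs]
        exact mul_le_mul_of_nonneg_left hy (mollKer_nonneg n _)
    _ = M := by
        rw [integral_mul_const, integral_sub_left_eq_self _ volume x, integral_mollKer, one_mul]

/-- Bounding the pairings of an integrable function with test functions of absolute value at most
`1` bounds the integrals of its absolute value. -/
theorem setLIntegral_enorm_le_of_forall_test {Y : R4 → ℝ} (hYm : Measurable Y) (hY : Integrable Y)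
    {Ψ : Set R4 → ℝ≥0∞} (hΨm : ∀ s t, s ⊆ t → Ψ s ≤ Ψ t)
    (hΨ : ∀ K, IsCompact K → Tendsto (fun r => Ψ (cthickening r K)) (𝓝[>] 0) (𝓝 (Ψ K)))
    (H : ∀ ψ : R4 → ℝ, ContDiff ℝ ∞ ψ → HasCompactSupport ψ → (∀ x, |ψ x| ≤ 1) →
      ∀ U, IsCompact U → (∀ x, x ∉ U → ψ x = 0) → ‖∫ x, Y x * ψ x‖ₑ ≤ Ψ U)
    {E : Set R4} (hE : MeasurableSet E) : ∫⁻ x in E, ‖Y x‖ₑ ≤ Ψ E := by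
  have hcomp : ∀ K, IsCompact K → ∫⁻ x in K, ‖Y x‖ₑ ≤ Ψ K := by
    intro K hK
    set s : R4 → ℝ := K.indicator fun x => if 0 ≤ Y x then 1 else -1 with hs
    have hsm : Measurable s :=
      (Measurable.ite (measurableSet_le measurable_const hYm) measurable_const
        measurable_const).indicator hK.measurableSet
    have hs1 : ∀ x, |s x| ≤ 1 := by
      intro x
      by_cases hx : x ∈ K
      · simp only [hs, indicator_of_mem hx]; split_ifs <;> simp
      · simp [hs, hx]
    have hsl : LocallyIntegrable s := by
      have : IntegrableOn (fun x => if 0 ≤ Y x then (1 : ℝ) else -1) K := by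
        refine Measure.integrableOn_of_bounded (M := 1) hK.measure_lt_top.ne
          (Measurable.ite (measurableSet_le measurable_const hYm) measurable_const
            measurable_const).aestronglyMeasurable ?_
        filter_upwards with x
        bound
      exact (this.integrable_indicator hK.measurableSet).locallyIntegrable
    set ψ : ℕ → R4 → ℝ := fun n => cv (mollKer n) s
    have hψ1 : ∀ (n : ℕ) x, |ψ n x| ≤ 1 := fun n x => abs_cv_mollKer_le (.of_forall hs1) x
    have hψ0 : ∀ (n : ℕ) x, x ∉ cthickening (1 / ((n : ℝ) + 1)) K → ψ n x = 0 := by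
      intro n x hx
      refine cv_mollKer_eq_zero fun y hy => ?_
      by_contra hlt
      refine hx (Metric.mem_cthickening_of_dist_le x y _ K ?_ (not_le.1 hlt).le)
      simp_all
    have hψc : ∀ n, ContDiff ℝ ∞ (ψ n) := fun n => contDiff_cv_mollKer n hsl
    have hKc : ∀ n : ℕ, IsCompact (cthickening (1 / ((n : ℝ) + 1)) K) := fun n =>
      hK.cthickening
    have hlim : Tendsto (fun n => ∫ x, Y x * ψ n x) atTop (𝓝 (∫ x, Y x * s x)) := by
      refine tendsto_integral_of_dominated_convergence (fun x => |Y x|)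
        (fun n => hY.aestronglyMeasurable.mul (hψc n).continuous.aestronglyMeasurable) hY.abs
        (fun n => Eventually.of_forall fun x => ?_) ?_
      · rw [norm_mul, norm_eq_abs]; bound
      · filter_upwards [ae_tendsto_cv_mollKer hsl] with x hx
        exact hx.const_mul _
    have hval : ‖∫ x, Y x * s x‖ₑ = ∫⁻ x in K, ‖Y x‖ₑ := by
      have e1 : ∀ x, Y x * s x = K.indicator (fun x => ‖Y x‖) x := by
        intro x
        by_cases hx : x ∈ K
        · simp only [hs, indicator_of_mem hx, norm_eq_abs]
          grind
        · simp [hs, hx]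
      simp_rw [e1]
      rw [integral_indicator hK.measurableSet, enorm_of_nonneg
        (integral_nonneg fun x => norm_nonneg _),
        ofReal_integral_norm_eq_lintegral_enorm hY.integrableOn]
    have hr : Tendsto (fun n : ℕ => 1 / ((n : ℝ) + 1)) atTop (𝓝[>] 0) :=
      tendsto_nhdsWithin_iff.2 ⟨tendsto_one_div_add_atTop_nhds_zero_nat,
        Eventually.of_forall fun n => by simp only [mem_Ioi]; positivity⟩
    rw [← hval]
    refine le_of_tendsto_of_tendsto' hlim.enorm ((hΨ K hK).comp hr) fun n => ?_
    exact H (ψ n) (hψc n) (HasCompactSupport.intro (hKc n) (hψ0 n)) (hψ1 n) _ (hKc n) (hψ0 n)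
  have hfin : IsFiniteMeasure (volume.withDensity fun x => ‖Y x‖ₑ) :=
    isFiniteMeasure_withDensity hY.2.ne
  have := hE.measure_eq_iSup_isCompact (μ := volume.withDensity fun x => ‖Y x‖ₑ)
  rw [withDensity_apply _ hE] at this
  rw [this]
  refine iSup₂_le fun K hK => iSup_le fun hKc => ?_
  rw [withDensity_apply _ hKc.measurableSet]
  exact (hcomp K hKc).trans (hΨm _ _ hK)

/-! ### Representation of solutions of Poisson's equation -/

section Bounds

variable {h : ℝ}

theorem regKer_le_inv_sq (hh : 0 < h) (z : R4) : regKer h z ≤ (h ^ 2)⁻¹ := by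
  rw [regKer]; bound

theorem norm_mul_regKer_le (hh : 0 < h) (z : R4) : ‖z‖ * regKer h z ≤ h⁻¹ := by
  have hq := (regKer_pos hh z).le
  have h1 := norm_sq_mul_regKer_le (h := h) hh z
  have h2 := regKer_le_inv_sq hh z
  have : (‖z‖ * regKer h z) ^ 2 ≤ (h⁻¹) ^ 2 := by
    calc (‖z‖ * regKer h z) ^ 2 = (‖z‖ ^ 2 * regKer h z) * regKer h z := by ring
      _ ≤ 1 * (h ^ 2)⁻¹ := by gcongr
      _ = (h⁻¹) ^ 2 := by simp
  exact (abs_le_of_sq_le_sq' this (by positivity)).2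

/-- For fixed `h > 0`, the regularized kernels are bounded. -/
theorem exists_bound_regKer (hh : 0 < h) : ∃ M : ℝ, (∀ z, |regKer h z| ≤ M)
    ∧ (∀ i z, |regKer₁ h i z| ≤ M) ∧ (∀ i j z, |regKer₂ h i j z| ≤ M)
    ∧ (∀ i j k z, |regKer₃ h i j k z| ≤ M) ∧ (∀ z, |regDelta h z| ≤ M)
    ∧ (∀ i z, |pd i (regDelta h) z| ≤ M) := by
  set a := (h ^ 2)⁻¹ with ha
  have ha0 : 0 < a := by positivity
  set b := h⁻¹ with hb
  have hb0 : 0 < b := by positivity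
  have B0 : ∀ z, |regKer h z| ≤ a := fun z => by
    rw [abs_of_pos (regKer_pos hh z)]; exact regKer_le_inv_sq hh z
  have B1 : ∀ i z, |regKer₁ h i z| ≤ 2 * b * a := fun i z => by
    have hq := (regKer_pos hh z).le
    refine (abs_regKer₁_le z i).trans ?_
    calc 2 * ‖z‖ * regKer h z ^ 2 = 2 * (‖z‖ * regKer h z) * regKer h z := by ring
      _ ≤ 2 * b * a := by
        have := norm_mul_regKer_le hh z
        have := regKer_le_inv_sq hh z
        gcongr
  have B2 : ∀ i j z, |regKer₂ h i j z| ≤ 10 * a ^ 2 := fun i j z => by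
    have hq := (regKer_pos hh z).le
    refine (abs_regKer₂_le hh z i j).trans ?_
    have := regKer_le_inv_sq hh z
    gcongr
  have B3 : ∀ i j k z, |regKer₃ h i j k z| ≤ 72 * b * a ^ 2 := fun i j k z => by
    have hq := (regKer_pos hh z).le
    refine (abs_regKer₃_le hh z i j k).trans ?_
    calc 72 * ‖z‖ * regKer h z ^ 3 = 72 * (‖z‖ * regKer h z) * regKer h z ^ 2 := by ring
      _ ≤ 72 * b * a ^ 2 := by
        have := norm_mul_regKer_le hh z
        have := regKer_le_inv_sq hh z
        gcongr
  have B4 : ∀ z, |regDelta h z| ≤ 40 * a ^ 2 := fun z => by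
    rw [← sum_regKer₂ hh]
    refine (Finset.abs_sum_le_sum_abs _ _).trans ((sum_le_sum fun i _ => B2 i i z).trans ?_)
    simp; linarith
  have B5 : ∀ i z, |pd i (regDelta h) z| ≤ 288 * b * a ^ 2 := fun j z => by
    rw [← sum_regKer₃ hh]
    refine (Finset.abs_sum_le_sum_abs _ _).trans
      ((sum_le_sum fun i _ => B3 j i i z).trans ?_)
    simp; linarith
  have p1 : 0 ≤ 2 * b * a := by positivity
  have p2 : 0 ≤ 40 * a ^ 2 := by positivity
  have p3 : 0 ≤ 288 * b * a ^ 2 := by positivity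
  refine ⟨a + 2 * b * a + 40 * a ^ 2 + 288 * b * a ^ 2, fun z => (B0 z).trans ?_,
    fun i z => (B1 i z).trans ?_, fun i j z => (B2 i j z).trans ?_,
    fun i j k z => (B3 i j k z).trans ?_, fun z => (B4 z).trans ?_, fun i z => (B5 i z).trans ?_⟩
  all_goals linarith

theorem enorm_regKer_le (hh : 0 < h) (z : R4) : ‖regKer h z‖ₑ ≤ (‖z‖ₑ⁻¹) ^ 2 := by
  rcases eq_or_ne z 0 with rfl | hz
  · simp
  have hz' : 0 < ‖z‖ := norm_pos_iff.2 hz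
  rw [enorm_of_nonneg (regKer_pos hh z).le, ← ofReal_norm, ← ofReal_inv_of_pos hz',
    ← ofReal_pow (by positivity)]
  exact ofReal_le_ofReal (regKer_le hz)

theorem enorm_regKer₁_le (hh : 0 < h) (i : Fin 4) (z : R4) :
    ‖regKer₁ h i z‖ₑ ≤ 2 * (‖z‖ₑ⁻¹) ^ 3 := by
  rcases eq_or_ne z 0 with rfl | hz
  · simp
  have hz' : 0 < ‖z‖ := norm_pos_iff.2 hz
  have hq := (regKer_pos hh z).le
  rw [← ofReal_norm, ← ofReal_norm, ← ofReal_inv_of_pos hz',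
    ← ofReal_pow (by positivity)]
  have e2 : ∀ a : ℝ, (2 : ℝ≥0∞) * ofReal a = ofReal (2 * a) := fun a => by simp
  rw [e2]
  refine ofReal_le_ofReal ((abs_regKer₁_le z i).trans ?_)
  calc 2 * ‖z‖ * regKer h z ^ 2 ≤ 2 * ‖z‖ * ((‖z‖⁻¹) ^ 2) ^ 2 := by
        have := regKer_le (h := h) hz
        gcongr
    _ = 2 * ‖z‖⁻¹ ^ 3 := by field_simp

end Bounds

/-- The constant `∫ 8 (1 + |z|²)⁻³`, with `-Δ |z|⁻² = kerMass • δ₀` on `ℝ⁴`. -/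
def kerMass : ℝ := ∫ z : R4, 8 * regKer 1 z ^ 3

theorem integrable_regKer_one_pow : Integrable fun z : R4 => 8 * regKer 1 z ^ 3 := by
  have h1 := integrable_rpow_neg_one_add_norm_sq (E := R4) (μ := volume) (r := 6)
    (by rw [finrank_euclideanSpace_fin]; norm_num)
  refine (h1.const_mul 8).congr (.of_forall fun z => ?_)
  have : (0 : ℝ) < 1 + ‖z‖ ^ 2 := by positivity
  simp only [regKer]
  rw [show (-6 : ℝ) / 2 = -((3 : ℕ) : ℝ) by norm_num, Real.rpow_neg this.le, Real.rpow_natCast,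
    one_pow, add_comm, inv_pow]

theorem kerMass_pos : 0 < kerMass := by
  unfold kerMass
  refine (integral_pos_iff_support_of_nonneg (fun z => ?_) integrable_regKer_one_pow).2 ?_
  · have := regKer_pos (h := 1) one_pos z
    positivity
  · have : Function.support (fun z : R4 => 8 * regKer 1 z ^ 3) = univ := by
      refine eq_univ_of_forall fun z => ?_
      have := regKer_pos (h := 1) one_pos z
      simp only [Function.mem_support]; positivity
    simp [*]

theorem regDelta_scale {h : ℝ} (hh : 0 < h) (z : R4) :
    h ^ 4 * regDelta h (h • z) = -(8 * regKer 1 z ^ 3) := by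
  have h1 : regKer h (h • z) = (h ^ 2)⁻¹ * regKer 1 z := by
    simp only [regKer]
    rw [norm_smul, norm_of_nonneg hh.le, ← mul_inv]; ring
  rw [regDelta, h1]
  field_simp

theorem cv_regDelta_eq {h : ℝ} (hh : 0 < h) (ψ : R4 → ℝ) (x : R4) :
    cv (regDelta h) ψ x = -∫ z, 8 * regKer 1 z ^ 3 * ψ (x - h • z) := by
  rw [cv_comm, cv]
  have h1 := Measure.integral_comp_smul_of_nonneg (μ := (volume : Measure R4))
    (fun z => ψ (x - z) * regDelta h z) h (hR := hh.le)
  rw [finrank_euclideanSpace_fin, smul_eq_mul] at h1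
  have h2 : ∫ z : R4, ψ (x - z) * regDelta h z
      = h ^ 4 * ∫ z : R4, ψ (x - h • z) * regDelta h (h • z) := by
    rw [h1, ← mul_assoc, mul_inv_cancel₀ (by positivity), one_mul]
  rw [h2, ← integral_const_mul, ← integral_neg]
  refine integral_congr_ae (.of_forall fun z => ?_)
  simp only
  linear_combination ψ (x - h • z) * regDelta_scale hh z

theorem abs_cv_regDelta_le {h : ℝ} (hh : 0 < h) {ψ : R4 → ℝ} {M : ℝ} (hM : ∀ x, |ψ x| ≤ M)
    (x : R4) : |cv (regDelta h) ψ x| ≤ kerMass * M := by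
  rw [cv_regDelta_eq hh, abs_neg, ← norm_eq_abs, kerMass, ← integral_mul_const]
  refine norm_integral_le_of_norm_le (integrable_regKer_one_pow.mul_const M)
    (.of_forall fun z => ?_)
  have := regKer_pos (h := 1) one_pos z
  rw [norm_mul, norm_of_nonneg (by positivity), norm_eq_abs]; bound

/-- The regularization parameters. -/
def regPar (n : ℕ) : ℝ := 1 / ((n : ℝ) + 1)

theorem regPar_pos (n : ℕ) : 0 < regPar n := by unfold regPar; positivity

theorem regPar_le_one (n : ℕ) : regPar n ≤ 1 := by
  unfold regPar
  bound

theorem tendsto_integral_mul_cv_regDelta {W ψ : R4 → ℝ} (hW : Integrable W) (hψ : Continuous ψ)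
    {M : ℝ} (hM : ∀ x, |ψ x| ≤ M) :
    Tendsto (fun n => ∫ x, W x * cv (regDelta (regPar n)) ψ x) atTop
      (𝓝 (-kerMass * ∫ x, W x * ψ x)) := by
  have hlim : ∀ x, Tendsto (fun n => cv (regDelta (regPar n)) ψ x) atTop (𝓝 (-kerMass * ψ x)) := by
    intro x
    have e : ∀ n, cv (regDelta (regPar n)) ψ x
        = -∫ z, 8 * regKer 1 z ^ 3 * ψ (x - regPar n • z) := fun n =>
      cv_regDelta_eq (regPar_pos n) ψ x
    simp_rw [e]
    have : -kerMass * ψ x = -∫ z : R4, 8 * regKer 1 z ^ 3 * ψ x := by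
      rw [integral_mul_const, kerMass, neg_mul]
    rw [this]
    refine (tendsto_integral_of_dominated_convergence (fun z : R4 => 8 * regKer 1 z ^ 3 * M)
      (fun n => ?_) (integrable_regKer_one_pow.mul_const M)
      (fun n => Eventually.of_forall fun z => ?_) (.of_forall fun z => ?_)).neg
    · exact integrable_regKer_one_pow.aestronglyMeasurable.mul
        (by fun_prop : Continuous fun z : R4 => ψ (x - regPar n • z)).aestronglyMeasurable
    · have := regKer_pos (h := 1) one_pos z
      rw [norm_mul, norm_of_nonneg (by positivity), norm_eq_abs]; gcongr
      exact hM _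
    · refine Tendsto.const_mul _ ?_
      have h1 : Tendsto (fun n => x - regPar n • z) atTop (𝓝 (x - (0 : ℝ) • z)) :=
        tendsto_const_nhds.sub (tendsto_one_div_add_atTop_nhds_zero_nat.smul_const z)
      have h2 := (hψ.tendsto _).comp h1
      aesop
  have hc : ∀ n, Continuous (cv (regDelta (regPar n)) ψ) := by
    intro n
    have e : cv (regDelta (regPar n)) ψ
        = fun x => -∫ z, 8 * regKer 1 z ^ 3 * ψ (x - regPar n • z) := by
      ext x; exact cv_regDelta_eq (regPar_pos n) ψ x
    rw [e]
    refine (continuous_of_dominated (bound := fun z : R4 => 8 * regKer 1 z ^ 3 * M)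
      (fun x => ?_) (fun x => Eventually.of_forall fun z => ?_)
      (integrable_regKer_one_pow.mul_const M) (.of_forall fun z => ?_)).neg
    · exact integrable_regKer_one_pow.aestronglyMeasurable.mul
        (by fun_prop : Continuous fun z : R4 => ψ (x - regPar n • z)).aestronglyMeasurable
    · have := regKer_pos (h := 1) one_pos z
      rw [norm_mul, norm_of_nonneg (by positivity), norm_eq_abs]; gcongr
      exact hM _
    · fun_prop
  rw [← integral_const_mul]
  refine tendsto_integral_of_dominated_convergence (fun x => |W x| * (kerMass * M))
    (fun n => hW.aestronglyMeasurable.mul (hc n).aestronglyMeasurable)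
    (hW.abs.mul_const _) (fun n => Eventually.of_forall fun x => ?_)
    (.of_forall fun x => ?_)
  · rw [norm_mul, norm_eq_abs, norm_eq_abs]; gcongr
    exact abs_cv_regDelta_le (regPar_pos n) hM x
  · have := (hlim x).const_mul (W x)
    grind

/-- `W` solves `ΔW = -∑ᵢ ∂ᵢGᵢ + g` on `ℝ⁴` in the sense of distributions, tested with all smooth
functions (so that, in practice, `W`, `G` and `g` have compact support). -/
structure IsWeakPoisson (W : R4 → ℝ) (G : Fin 4 → R4 → ℝ) (g : R4 → ℝ) : Prop where
  measurable : Measurable W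
  measurable_flux : ∀ i, Measurable (G i)
  measurable_source : Measurable g
  integrable : Integrable W
  integrable_flux : ∀ i, Integrable (G i)
  integrable_source : Integrable g
  eq : ∀ φ : R4 → ℝ, ContDiff ℝ ∞ φ →
    ∫ x, W x * lapl φ x = (∑ i, ∫ x, G i x * pd i φ x) + ∫ x, g x * φ x

theorem enorm_integral_mul_cv_le {G k ψ : R4 → ℝ} (hG : Measurable G) (hψ : Measurable ψ)
    {c : ℝ≥0∞} {m : ℕ} (hk : ∀ z, ‖k z‖ₑ ≤ c * (‖z‖ₑ⁻¹) ^ m) :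
    ‖∫ x, G x * cv k ψ x‖ₑ ≤ c * ∫⁻ x, ‖ψ x‖ₑ * pot m (fun y => ‖G y‖ₑ) x := by
  have hm := measurable_pot m hψ.enorm
  calc ‖∫ x, G x * cv k ψ x‖ₑ ≤ ∫⁻ x, ‖G x * cv k ψ x‖ₑ := enorm_integral_le_lintegral_enorm _
    _ ≤ ∫⁻ x, c * (‖G x‖ₑ * pot m (fun y => ‖ψ y‖ₑ) x) := by
        refine lintegral_mono fun x => ?_
        rw [enorm_mul, mul_left_comm]; gcongr
        refine (enorm_integral_le_lintegral_enorm _).trans ?_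
        rw [pot, ← lintegral_const_mul _ (by fun_prop)]
        refine lintegral_mono fun y => ?_
        rw [enorm_mul, ← mul_assoc]; bound
    _ = _ := by
        rw [lintegral_const_mul _ (by fun_prop), lintegral_mul_pot m hψ.enorm hG.enorm]

theorem exists_abs_le_of_hasCompactSupport {ψ : R4 → ℝ} (hψ : Continuous ψ)
    (hc : HasCompactSupport ψ) : ∃ M, ∀ x, |ψ x| ≤ M := by
  simpa using hc.exists_bound_of_continuous hψ

/-- Set bounds pass from shrinking neighbourhoods of a compact set to the set itself. -/
theorem tendsto_of_compact_setFun {C₁ C₂ : ℝ≥0∞} (hC₁ : C₁ ≠ ⊤) (hC₂ : C₂ ≠ ⊤) {θ₁ θ₂ : ℝ}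
    (hθ₁ : 0 < θ₁) (hθ₂ : 0 < θ₂) {w : R4 → ℝ≥0∞} (hw : ∀ K, IsCompact K → ∫⁻ x in K, w x ≠ ⊤)
    {K : Set R4} (hK : IsCompact K) :
    Tendsto (fun r => C₁ * volume (cthickening r K) ^ θ₁
      + C₂ * volume (cthickening r K) ^ θ₂ + ∫⁻ x in cthickening r K, w x) (𝓝[>] 0)
      (𝓝 (C₁ * volume K ^ θ₁ + C₂ * volume K ^ θ₂ + ∫⁻ x in K, w x)) := by
  have h1 : Tendsto (fun r => volume (cthickening r K)) (𝓝[>] 0) (𝓝 (volume K)) :=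
    (tendsto_measure_cthickening_of_isCompact hK).mono_left nhdsWithin_le_nhds
  have h2 : Tendsto (fun r => ∫⁻ x in cthickening r K, w x) (𝓝[>] 0)
      (𝓝 (∫⁻ x in K, w x)) := by
    have := tendsto_measure_cthickening_of_isClosed (μ := volume.withDensity w) (s := K)
      ⟨1, one_pos, by
        rw [withDensity_apply _ Metric.isClosed_cthickening.measurableSet]
        exact hw _ hK.cthickening⟩ hK.isClosed
    rw [withDensity_apply _ hK.measurableSet] at this
    refine (this.mono_left nhdsWithin_le_nhds).congr fun r => ?_
    rw [withDensity_apply _ Metric.isClosed_cthickening.measurableSet]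
  have h3 : ∀ (C : ℝ≥0∞), C ≠ ⊤ → ∀ θ : ℝ, 0 < θ →
      Tendsto (fun r => C * volume (cthickening r K) ^ θ) (𝓝[>] 0)
      (𝓝 (C * volume K ^ θ)) := fun C hC θ hθ =>
    ENNReal.Tendsto.const_mul ((ENNReal.continuous_rpow_const.tendsto _).comp h1) (Or.inr hC)
  exact ((h3 C₁ hC₁ θ₁ hθ₁).add (h3 C₂ hC₂ θ₂ hθ₂)).add h2

theorem enorm_integral_le_of_tendsto {a : ℕ → ℝ} {b : ℝ} {B : ℝ≥0∞}
    (h : Tendsto a atTop (𝓝 (-kerMass * b))) (ha : ∀ n, ‖a n‖ₑ ≤ B) :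
    ‖b‖ₑ ≤ ofReal kerMass⁻¹ * B := by
  have h1 : ‖-kerMass * b‖ₑ ≤ B := le_of_tendsto' h.enorm ha
  have h2 : b = -kerMass⁻¹ * (-kerMass * b) := by
    have := kerMass_pos.ne'
    field_simp
  rw [h2, enorm_mul, enorm_neg, enorm_of_nonneg (inv_pos.2 kerMass_pos).le]; gcongr

namespace IsWeakPoisson

variable {W g : R4 → ℝ} {G : Fin 4 → R4 → ℝ}

/-- Pointwise bound for the solution of Poisson's equation. -/
theorem ae_enorm_le (hW : IsWeakPoisson W G g)
    (hfin : ∀ K, IsCompact K → ∫⁻ x in K, (2 * ∑ i, pot 3 (fun y => ‖G i y‖ₑ) x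
      + pot 2 (fun y => ‖g y‖ₑ) x) ≠ ⊤) :
    ∀ᵐ x, ‖W x‖ₑ ≤ ofReal kerMass⁻¹ *
      (2 * ∑ i, pot 3 (fun y => ‖G i y‖ₑ) x + pot 2 (fun y => ‖g y‖ₑ) x) := by
  set w : R4 → ℝ≥0∞ := fun x => 2 * ∑ i, pot 3 (fun y => ‖G i y‖ₑ) x + pot 2 (fun y => ‖g y‖ₑ) x
    with hw
  have hp3 : ∀ i, Measurable (pot 3 fun y => ‖G i y‖ₑ) := fun i =>
    measurable_pot 3 (hW.measurable_flux i).enorm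
  have hp2 : Measurable (pot 2 fun y => ‖g y‖ₑ) := measurable_pot 2 hW.measurable_source.enorm
  have hwm : Measurable w := by fun_prop
  refine ae_le_of_forall_setLIntegral_le_of_sigmaFinite₀ hW.measurable.enorm.aemeasurable
    fun E hE _ => ?_
  have key := setLIntegral_enorm_le_of_forall_test (Ψ := fun U => 0 * volume U ^ (1 : ℝ)
      + 0 * volume U ^ (1 : ℝ) + ∫⁻ x in U, ofReal kerMass⁻¹ * w x)
    hW.measurable hW.integrable
    (fun s t hst => by gcongr)
    (fun K hK => tendsto_of_compact_setFun ENNReal.zero_ne_top ENNReal.zero_ne_top one_pos one_pos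
      (fun K hK => by
        rw [lintegral_const_mul _ hwm]
        exact mul_ne_top ofReal_ne_top (hfin K hK)) hK) ?_ hE
  · aesop
  intro ψ hψ hc hψ1 U hU hψU
  simp only [zero_mul, zero_add]
  have hlim := tendsto_integral_mul_cv_regDelta hW.integrable hψ.continuous hψ1
  rw [lintegral_const_mul _ hwm]
  refine enorm_integral_le_of_tendsto hlim fun n => ?_
  have hh := regPar_pos n
  obtain ⟨M, M0, M1, M2, M3, -, -⟩ := exists_bound_regKer hh
  have hψi : Integrable ψ := hψ.continuous.integrable_of_hasCompactSupport hc
  have hφ : ContDiff ℝ ∞ (cv (regKer (regPar n)) ψ) :=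
    contDiff_cv_right (contDiff_regKer hh (n := 0)).continuous.locallyIntegrable hψ hc
  have d1 : ∀ i, pd i (cv (regKer (regPar n)) ψ) = cv (regKer₁ (regPar n) i) ψ := fun i => by
    rw [pd_cv (contDiff_regKer hh) M0 (fun i z => by rw [pd_regKer hh]; exact M1 i z) hψi,
      pd_regKer hh]
  have d2 : lapl (cv (regKer (regPar n)) ψ) = cv (regDelta (regPar n)) ψ := by
    ext x
    have : ∀ i, pd i (pd i (cv (regKer (regPar n)) ψ)) x = cv (regKer₂ (regPar n) i i) ψ x := by
      intro i
      rw [d1, pd_cv (contDiff_regKer₁ hh i) (M1 i)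
        (fun j z => by rw [pd_regKer₁ hh]; exact M2 i j z) hψi, pd_regKer₁ hh]
    simp only [lapl, this]
    unfold cv
    rw [← integral_finsetSum _ fun i _ =>
      integrable_cv (contDiff_regKer₂ hh i i (n := 0)).continuous (M2 i i) hψi x]
    refine integral_congr_ae (.of_forall fun y => ?_)
    simp only
    rw [← sum_mul, sum_regKer₂ hh]
  have heq := hW.eq _ hφ
  rw [d2] at heq
  rw [heq]
  simp only [d1]
  have b1 : ∀ i, ‖∫ x, G i x * cv (regKer₁ (regPar n) i) ψ x‖ₑ
      ≤ 2 * ∫⁻ x, ‖ψ x‖ₑ * pot 3 (fun y => ‖G i y‖ₑ) x := fun i =>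
    enorm_integral_mul_cv_le (hW.measurable_flux i) hψ.continuous.measurable
      (enorm_regKer₁_le hh i)
  have b2 : ‖∫ x, g x * cv (regKer (regPar n)) ψ x‖ₑ
      ≤ 1 * ∫⁻ x, ‖ψ x‖ₑ * pot 2 (fun y => ‖g y‖ₑ) x :=
    enorm_integral_mul_cv_le hW.measurable_source hψ.continuous.measurable
      (fun z => by rw [one_mul]; exact enorm_regKer_le hh z)
  have hψm : Measurable fun x => ‖ψ x‖ₑ := hψ.continuous.measurable.enorm
  calc _ ≤ (∑ i, 2 * ∫⁻ x, ‖ψ x‖ₑ * pot 3 (fun y => ‖G i y‖ₑ) x)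
        + 1 * ∫⁻ x, ‖ψ x‖ₑ * pot 2 (fun y => ‖g y‖ₑ) x := by
        refine (enorm_add_le _ _).trans (add_le_add ?_ b2)
        exact (enorm_sum_le _ _).trans (sum_le_sum fun i _ => b1 i)
    _ = ∫⁻ x, ‖ψ x‖ₑ * w x := by
        rw [one_mul, ← mul_sum, ← lintegral_finsetSum _ fun i _ => by
          have := hp3 i; fun_prop, ← lintegral_const_mul _ (by fun_prop), ← lintegral_add_left (by fun_prop)]
        refine lintegral_congr fun x => ?_
        rw [hw, ← mul_sum]; ring
    _ ≤ ∫⁻ x in U, w x := by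
        rw [← lintegral_indicator hU.measurableSet]
        refine lintegral_mono fun x => ?_
        by_cases hx : x ∈ U
        · rw [indicator_of_mem hx]
          refine mul_le_of_le_one_left bot_le ?_
          rw [← ofReal_norm, norm_eq_abs]
          simp [*]
        · simp [hx, hψU x hx]

end IsWeakPoisson

/-- The `j`-th component of the gradient of the divergence of `regKer h * G`, a regularized
Calderón–Zygmund operator. -/
def regCZ (h : ℝ) (j : Fin 4) (G : Fin 4 → R4 → ℝ) (x : R4) : ℝ :=
  ∑ i, cv (regKer₂ h i j) (G i) x

theorem integral_mul_cv_comm {k G ψ : R4 → ℝ} (hk : Continuous k) (heven : ∀ z, k (-z) = k z)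
    {M : ℝ} (hM : ∀ z, |k z| ≤ M) (hG : Integrable G) (hψ : Integrable ψ) :
    ∫ x, G x * cv k ψ x = ∫ x, cv k G x * ψ x := by
  have hint : Integrable (fun q : R4 × R4 => k (q.1 - q.2) * (G q.1 * ψ q.2))
      (volume.prod volume) :=
    (hG.mul_prod hψ).bdd_mul (c := M) (by fun_prop) (.of_forall fun q => hM _)
  calc ∫ x, G x * cv k ψ x = ∫ x, ∫ y, k (x - y) * (G x * ψ y) := by
        refine integral_congr_ae (.of_forall fun x => ?_)
        simp only [cv]
        rw [← integral_const_mul]; ring_nf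
    _ = ∫ y, ∫ x, k (x - y) * (G x * ψ y) := integral_integral_swap hint
    _ = ∫ y, cv k G y * ψ y := by
        refine integral_congr_ae (.of_forall fun y => ?_)
        simp only [cv]
        rw [← integral_mul_const]
        refine integral_congr_ae (.of_forall fun x => ?_)
        simp only
        rw [← heven, neg_sub]; ring

theorem continuous_cv {k F : R4 → ℝ} (hk : Continuous k) {M : ℝ} (hM : ∀ z, |k z| ≤ M)
    (hF : Integrable F) : Continuous (cv k F) := by
  refine continuous_of_dominated (bound := fun y => M * |F y|)
    (fun x => (integrable_cv hk hM hF x).aestronglyMeasurable)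
    (fun x => Eventually.of_forall fun y => ?_) (hF.abs.const_mul _)
    (.of_forall fun y => by fun_prop)
  rw [norm_mul, norm_eq_abs, norm_eq_abs]; bound

/-- Bound for a weak derivative of the solution of Poisson's equation: the flux enters through a
bound for the regularized Calderón–Zygmund operators, the source through its potential. -/
theorem IsWeakPoisson.setLIntegral_deriv_le {W g : R4 → ℝ} {G : Fin 4 → R4 → ℝ}
    (hW : IsWeakPoisson W G g) {j : Fin 4} {Y : R4 → ℝ} (hYm : Measurable Y) (hY : Integrable Y)
    (hWY : ∀ ψ : R4 → ℝ, ContDiff ℝ ∞ ψ → HasCompactSupport ψ →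
      ∫ x, W x * pd j ψ x = -∫ x, Y x * ψ x)
    {θ₁ θ₂ : ℝ} (hθ₁ : 0 < θ₁) (hθ₂ : 0 < θ₂) {C₁ C₂ : ℝ≥0∞} (hC₁ : C₁ ≠ ⊤) (hC₂ : C₂ ≠ ⊤)
    (hCZ : ∀ h : ℝ, 0 < h → h ≤ 1 → SetBound θ₁ θ₂ C₁ C₂ fun x => ‖regCZ h j G x‖ₑ)
    (hfin : ∀ K, IsCompact K → ∫⁻ x in K, pot 3 (fun y => ‖g y‖ₑ) x ≠ ⊤)
    {E : Set R4} (hE : MeasurableSet E) :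
    ∫⁻ x in E, ‖Y x‖ₑ ≤ ofReal kerMass⁻¹ * (C₁ * volume E ^ θ₁ + C₂ * volume E ^ θ₂
      + 2 * ∫⁻ x in E, pot 3 (fun y => ‖g y‖ₑ) x) := by
  set κ : ℝ≥0∞ := ofReal kerMass⁻¹
  have hκ : κ ≠ ⊤ := ofReal_ne_top
  have hp3 : Measurable (pot 3 fun y => ‖g y‖ₑ) := measurable_pot 3 hW.measurable_source.enorm
  set w : R4 → ℝ≥0∞ := fun x => (κ * 2) * pot 3 (fun y => ‖g y‖ₑ) x
  have key := setLIntegral_enorm_le_of_forall_test (Ψ := fun U => (κ * C₁) * volume U ^ θ₁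
      + (κ * C₂) * volume U ^ θ₂ + ∫⁻ x in U, w x) hYm hY
    (fun s t hst => by gcongr)
    (fun K hK => tendsto_of_compact_setFun (mul_ne_top hκ hC₁) (mul_ne_top hκ hC₂)
      hθ₁ hθ₂ (fun K hK => by
        rw [lintegral_const_mul _ hp3]
        exact mul_ne_top (mul_ne_top hκ (by simp)) (hfin K hK)) hK) ?_ hE
  · refine key.trans_eq ?_
    rw [lintegral_const_mul _ hp3]; ring
  intro ψ hψ hc hψ1 U hU hψU
  have hψi : Integrable ψ := hψ.continuous.integrable_of_hasCompactSupport hc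
  have hdψ : ContDiff ℝ ∞ (pd j ψ) :=
    (hψ.fderiv_right (m := ∞) (by simp)).clm_apply contDiff_const
  have hdc : HasCompactSupport (pd j ψ) := hc.fderiv_apply ℝ (e j)
  obtain ⟨M', hM'⟩ := exists_abs_le_of_hasCompactSupport hdψ.continuous hdc
  have hlim := tendsto_integral_mul_cv_regDelta hW.integrable hdψ.continuous hM'
  have hkey : ‖∫ x, W x * pd j ψ x‖ₑ ≤ κ * (C₁ * volume U ^ θ₁ + C₂ * volume U ^ θ₂
      + 2 * ∫⁻ x in U, pot 3 (fun y => ‖g y‖ₑ) x) := by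
    refine enorm_integral_le_of_tendsto hlim fun n => ?_
    have hh := regPar_pos n
    obtain ⟨M, M0, M1, M2, M3, M4, M5⟩ := exists_bound_regKer hh
    have hφ : ContDiff ℝ ∞ (cv (regKer₁ (regPar n) j) ψ) :=
      contDiff_cv_right (contDiff_regKer₁ hh j (n := 0)).continuous.locallyIntegrable hψ hc
    have d1 : ∀ i, pd i (cv (regKer₁ (regPar n) j) ψ) = cv (regKer₂ (regPar n) j i) ψ := fun i => by
      rw [pd_cv (contDiff_regKer₁ hh j) (M1 j) (fun i z => by rw [pd_regKer₁ hh]; exact M2 j i z)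
        hψi, pd_regKer₁ hh]
    have d2 : lapl (cv (regKer₁ (regPar n) j) ψ) = cv (regDelta (regPar n)) (pd j ψ) := by
      ext x
      have h1 : ∀ i, pd i (pd i (cv (regKer₁ (regPar n) j) ψ)) x
          = cv (regKer₃ (regPar n) j i i) ψ x := by
        intro i
        rw [d1, pd_cv (contDiff_regKer₂ hh j i) (M2 j i)
          (fun k z => by rw [pd_regKer₂ hh]; exact M3 j i k z) hψi, pd_regKer₂ hh]
      have h2 : cv (regDelta (regPar n)) (pd j ψ) x = cv (pd j (regDelta (regPar n))) ψ x := by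
        rw [← pd_cv (contDiff_regDelta hh) M4 M5 hψi, cv_eq_convolution, cv_eq_convolution, pd]
        have h3 := hc.hasFDerivAt_convolution_right (ContinuousLinearMap.lsmul ℝ ℝ)
          (contDiff_regDelta hh (n := 0)).continuous.locallyIntegrable (μ := volume)
          (hψ.of_le (by simp)) x
        rw [h3.fderiv, convolution_precompR_apply]
        · rfl
        · exact (contDiff_regDelta hh (n := 0)).continuous.locallyIntegrable
        · exact hc.fderiv ℝ
        · exact hψ.continuous_fderiv (by simp)
      rw [h2]
      simp only [lapl, h1]
      unfold cv
      rw [← integral_finsetSum _ fun i _ =>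
        integrable_cv (contDiff_regKer₃ hh j i i (n := 0)).continuous (M3 j i i) hψi x]
      refine integral_congr_ae (.of_forall fun y => ?_)
      simp only
      rw [← sum_mul, sum_regKer₃ hh]
    have heq := hW.eq _ hφ
    rw [d2] at heq
    rw [heq]
    simp only [d1]
    have e1 : (∑ i, ∫ x, G i x * cv (regKer₂ (regPar n) j i) ψ x)
        = ∫ x, regCZ (regPar n) j G x * ψ x := by
      have e2 : ∀ i, ∫ x, G i x * cv (regKer₂ (regPar n) j i) ψ x
          = ∫ x, cv (regKer₂ (regPar n) i j) (G i) x * ψ x := fun i => by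
        rw [integral_mul_cv_comm (contDiff_regKer₂ hh j i (n := 0)).continuous
          (regKer₂_neg j i) (M2 j i) (hW.integrable_flux i) hψi]
        have : regKer₂ (regPar n) j i = regKer₂ (regPar n) i j := funext (regKer₂_symm j i)
        rw [this]
      simp_rw [e2]
      rw [← integral_finsetSum]
      · refine integral_congr_ae (.of_forall fun x => ?_)
        simp only [regCZ]
        rw [sum_mul]
      · intro i _
        have hc2 := continuous_cv (contDiff_regKer₂ hh i j (n := 0)).continuous (M2 i j)
          (hW.integrable_flux i)
        exact (hc2.mul hψ.continuous).integrable_of_hasCompactSupport hc.mul_left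
    rw [e1]
    have bU : ∀ (Z : R4 → ℝ≥0∞), ∫⁻ x, ‖ψ x‖ₑ * Z x ≤ ∫⁻ x in U, Z x := fun Z => by
      rw [← lintegral_indicator hU.measurableSet]
      refine lintegral_mono fun x => ?_
      by_cases hx : x ∈ U
      · rw [indicator_of_mem hx]
        refine mul_le_of_le_one_left bot_le ?_
        rw [← ofReal_norm, norm_eq_abs]
        simp [*]
      · simp [hx, hψU x hx]
    refine (enorm_add_le _ _).trans (add_le_add ?_ ?_)
    · refine le_trans ?_ (hCZ _ hh (regPar_le_one n) U hU.measurableSet hU.measure_lt_top.ne)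
      refine (enorm_integral_le_lintegral_enorm _).trans ?_
      refine le_trans (le_of_eq ?_) (bU _)
      refine lintegral_congr fun x => ?_
      rw [enorm_mul, mul_comm]
    · refine (enorm_integral_mul_cv_le hW.measurable_source hψ.continuous.measurable
        (enorm_regKer₁_le hh j)).trans ?_
      bound
  rw [hWY ψ hψ hc, enorm_neg] at hkey
  refine hkey.trans_eq ?_
  rw [lintegral_const_mul _ hp3]; ring

/-! ### The energy estimate for the regularized Calderón–Zygmund operators -/

/-- Young's inequality for the convolution with an integrable kernel. -/
theorem lintegral_cv_rpow_le {p q : ℝ} (hpq : p.HolderConjugate q) {k F : R4 → ℝ}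
    (hk : Measurable k) (hF : Measurable F) :
    ∫⁻ x, ‖cv k F x‖ₑ ^ p ≤ (∫⁻ z, ‖k z‖ₑ) ^ p * ∫⁻ x, ‖F x‖ₑ ^ p := by
  have hp := hpq.pos
  have hq := hpq.symm.pos
  set A : ℝ≥0∞ := ∫⁻ z, ‖k z‖ₑ with hA
  have hAx : ∀ x : R4, ∫⁻ y, ‖k (x - y)‖ₑ = A := fun x =>
    lintegral_sub_left_eq_self (fun z => ‖k z‖ₑ) x
  have hAy : ∀ y : R4, ∫⁻ x, ‖k (x - y)‖ₑ = A := fun y =>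
    lintegral_sub_right_eq_self (fun z => ‖k z‖ₑ) y
  have pt : ∀ x, ‖cv k F x‖ₑ ^ p ≤ A ^ (p / q) * ∫⁻ y, ‖k (x - y)‖ₑ * ‖F y‖ₑ ^ p := by
    intro x
    have h1 : ‖cv k F x‖ₑ ≤ ∫⁻ y, ‖k (x - y)‖ₑ * ‖F y‖ₑ := by
      refine (enorm_integral_le_lintegral_enorm _).trans_eq ?_
      simp
    have h2 : ∫⁻ y, ‖k (x - y)‖ₑ * ‖F y‖ₑ
        ≤ A ^ (1 / q) * (∫⁻ y, ‖k (x - y)‖ₑ * ‖F y‖ₑ ^ p) ^ (1 / p) := by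
      have h3 := ENNReal.lintegral_mul_le_Lp_mul_Lq (volume : Measure R4) hpq.symm
        (f := fun y => ‖k (x - y)‖ₑ ^ (1 / q)) (g := fun y => ‖k (x - y)‖ₑ ^ (1 / p) * ‖F y‖ₑ)
        (by fun_prop) (by fun_prop)
      have e1 : ∀ y, ((fun y => ‖k (x - y)‖ₑ ^ (1 / q))
          * fun y => ‖k (x - y)‖ₑ ^ (1 / p) * ‖F y‖ₑ) y = ‖k (x - y)‖ₑ * ‖F y‖ₑ := by
        intro y
        simp only [Pi.mul_apply]
        rw [← mul_assoc, ← rpow_add_of_nonneg _ _ (by positivity) (by positivity),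
          add_comm, one_div, one_div, hpq.inv_add_inv_eq_one, rpow_one]
      have e2 : ∀ y, (‖k (x - y)‖ₑ ^ (1 / q)) ^ q = ‖k (x - y)‖ₑ := fun y => by aesop
      have e3 : ∀ y, (‖k (x - y)‖ₑ ^ (1 / p) * ‖F y‖ₑ) ^ p = ‖k (x - y)‖ₑ * ‖F y‖ₑ ^ p := fun y => by
        rw [mul_rpow_of_nonneg _ _ hp.le, ← rpow_mul, one_div_mul_cancel hp.ne',
          rpow_one]
      simp_rw [e1, e2, e3, hAx] at h3
      exact h3
    refine (rpow_le_rpow (h1.trans h2) hp.le).trans_eq ?_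
    rw [mul_rpow_of_nonneg _ _ hp.le, ← rpow_mul, ← rpow_mul,
      one_div_mul_cancel hp.ne', rpow_one, one_div_mul_eq_div]
  calc ∫⁻ x, ‖cv k F x‖ₑ ^ p
      ≤ ∫⁻ x, A ^ (p / q) * ∫⁻ y, ‖k (x - y)‖ₑ * ‖F y‖ₑ ^ p := lintegral_mono pt
    _ = A ^ (p / q) * ∫⁻ x, ∫⁻ y, ‖k (x - y)‖ₑ * ‖F y‖ₑ ^ p := by
        rw [lintegral_const_mul]
        fun_prop
    _ = A ^ (p / q) * ∫⁻ y, ∫⁻ x, ‖k (x - y)‖ₑ * ‖F y‖ₑ ^ p := by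
        rw [lintegral_lintegral_swap (by fun_prop)]
    _ = A ^ (p / q) * ∫⁻ y, A * ‖F y‖ₑ ^ p := by
        congr 2
        ext y
        rw [lintegral_mul_const _ (by fun_prop), hAy]
    _ = A ^ (p / q) * A * ∫⁻ y, ‖F y‖ₑ ^ p := by
        rw [lintegral_const_mul _ (by fun_prop), mul_assoc]
    _ = _ := by
        congr 1
        have : p = p / q + 1 := by
          have := hpq.inv_add_inv_eq_one
          grind
        conv_rhs => rw [this, rpow_add_of_nonneg _ _ (by positivity) zero_le_one,
          rpow_one]

theorem memLp_two_cv {k F : R4 → ℝ} (hkm : Continuous k) {M : ℝ} (hM : ∀ z, |k z| ≤ M)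
    (hk : MemLp k 2) (hFm : Measurable F) (hF : Integrable F) : MemLp (cv k F) 2 := by
  refine ⟨(continuous_cv hkm hM hF).aestronglyMeasurable, ?_⟩
  have h1 := lintegral_cv_rpow_le HolderConjugate.two_two hFm hkm.measurable
  rw [eLpNorm_lt_top_iff_lintegral_rpow_enorm_lt_top (by norm_num) (by norm_num)] at *
  have e : cv k F = cv F k := funext fun x => cv_comm k F x
  have h3 := hk.2
  rw [eLpNorm_lt_top_iff_lintegral_rpow_enorm_lt_top (by norm_num) (by norm_num)] at h3
  rw [e]
  norm_num at h1 h3 ⊢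
  refine h1.trans_lt (mul_lt_top (pow_lt_top ?_) h3)
  exact hF.2

theorem memLp_two_of_sq_le {k : R4 → ℝ} (hk : Continuous k) {M : ℝ}
    (hM : ∀ z, k z ^ 2 ≤ M * (8 * regKer 1 z ^ 3)) : MemLp k 2 := by
  rw [memLp_two_iff_integrable_sq hk.aestronglyMeasurable]
  refine (integrable_regKer_one_pow.const_mul M).mono' (hk.pow 2).aestronglyMeasurable
    (.of_forall fun z => ?_)
  simp [*]

theorem regKer_le_regKer_one {h : ℝ} (hh : 0 < h) (h1 : h ≤ 1) (z : R4) :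
    regKer h z ≤ (h ^ 2)⁻¹ * regKer 1 z := by
  rw [regKer, regKer, ← mul_inv]; gcongr
  have : h ^ 2 ≤ 1 := by nlinarith
  nlinarith [sq_nonneg ‖z‖]

theorem regKer_pow_le {h : ℝ} (hh : 0 < h) (h1 : h ≤ 1) (m : ℕ) (z : R4) :
    regKer h z ^ (3 + m) ≤ ((h ^ 2)⁻¹ ^ (3 + m) / 8) * (8 * regKer 1 z ^ 3) := by
  have hq := (regKer_pos hh z).le
  calc regKer h z ^ (3 + m) = regKer h z ^ 3 * regKer h z ^ m := pow_add _ _ _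
    _ ≤ ((h ^ 2)⁻¹ * regKer 1 z) ^ 3 * (h ^ 2)⁻¹ ^ m := by
        have := regKer_le_regKer_one hh h1 z
        have := regKer_le_inv_sq hh z
        have := (regKer_pos (h := 1) one_pos z).le
        gcongr
    _ = _ := by ring

theorem memLp_regKer {h : ℝ} (hh : 0 < h) (h1 : h ≤ 1) :
    (∀ i, MemLp (regKer₁ h i) 2) ∧ (∀ i j, MemLp (regKer₂ h i j) 2)
      ∧ (∀ i j k, MemLp (regKer₃ h i j k) 2) := by
  refine ⟨fun i => ?_, fun i j => ?_, fun i j k => ?_⟩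
  · refine memLp_two_of_sq_le (contDiff_regKer₁ hh i (n := 0)).continuous
      (M := 4 * ((h ^ 2)⁻¹ ^ (3 + 0) / 8)) fun z => ?_
    have hq := (regKer_pos hh z).le
    have h2 := norm_sq_mul_regKer_le hh z
    calc regKer₁ h i z ^ 2 = |regKer₁ h i z| ^ 2 := (sq_abs _).symm
      _ ≤ (2 * ‖z‖ * regKer h z ^ 2) ^ 2 := by gcongr; exact abs_regKer₁_le z i
      _ = 4 * regKer h z ^ (3 + 0) * (‖z‖ ^ 2 * regKer h z) := by ring
      _ ≤ 4 * regKer h z ^ (3 + 0) * 1 := by gcongr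
      _ ≤ _ := by
        rw [mul_one, mul_assoc]; gcongr
        exact regKer_pow_le hh h1 0 z
  · refine memLp_two_of_sq_le (contDiff_regKer₂ hh i j (n := 0)).continuous
      (M := 100 * ((h ^ 2)⁻¹ ^ (3 + 1) / 8)) fun z => ?_
    calc regKer₂ h i j z ^ 2 = |regKer₂ h i j z| ^ 2 := (sq_abs _).symm
      _ ≤ (10 * regKer h z ^ 2) ^ 2 := by gcongr; exact abs_regKer₂_le hh z i j
      _ = 100 * regKer h z ^ (3 + 1) := by ring
      _ ≤ _ := by
        rw [mul_assoc]; gcongr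
        exact regKer_pow_le hh h1 1 z
  · refine memLp_two_of_sq_le (contDiff_regKer₃ hh i j k (n := 0)).continuous
      (M := 5184 * ((h ^ 2)⁻¹ ^ (3 + 2) / 8)) fun z => ?_
    have hq := (regKer_pos hh z).le
    have h2 := norm_sq_mul_regKer_le hh z
    calc regKer₃ h i j k z ^ 2 = |regKer₃ h i j k z| ^ 2 := (sq_abs _).symm
      _ ≤ (72 * ‖z‖ * regKer h z ^ 3) ^ 2 := by gcongr; exact abs_regKer₃_le hh z i j k
      _ = 5184 * regKer h z ^ (3 + 2) * (‖z‖ ^ 2 * regKer h z) := by ring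
      _ ≤ 5184 * regKer h z ^ (3 + 2) * 1 := by gcongr
      _ ≤ _ := by
        rw [mul_one, mul_assoc]; gcongr
        exact regKer_pow_le hh h1 2 z

theorem regDelta_nonpos {h : ℝ} (hh : 0 < h) (z : R4) : regDelta h z ≤ 0 := by
  have := regKer_pos hh z
  have : 0 ≤ h ^ 2 * regKer h z ^ 3 := by positivity
  rw [regDelta]; nlinarith

theorem integrable_regDelta {h : ℝ} (hh : 0 < h) (h1 : h ≤ 1) : Integrable (regDelta h) := by
  refine (integrable_regKer_one_pow.const_mul (8 * h ^ 2 * ((h ^ 2)⁻¹ ^ (3 + 0) / 8))).mono'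
    (contDiff_regDelta hh (n := 0)).continuous.aestronglyMeasurable
    (.of_forall fun z => ?_)
  have hq := (regKer_pos hh z).le
  have := regKer_pow_le hh h1 0 z
  rw [Real.norm_of_nonpos (regDelta_nonpos hh z), regDelta]
  calc -(-8 * h ^ 2 * regKer h z ^ 3) = 8 * h ^ 2 * regKer h z ^ (3 + 0) := by ring
    _ ≤ _ := by nlinarith

theorem lintegral_regDelta {h : ℝ} (hh : 0 < h) (h1 : h ≤ 1) :
    ∫⁻ z, ‖regDelta h z‖ₑ = ofReal kerMass := by
  rw [← ofReal_integral_norm_eq_lintegral_enorm (integrable_regDelta hh h1)]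
  congr 1
  have e1 := cv_regDelta_eq hh (fun _ => 1) 0
  have e2 : cv (regDelta h) (fun _ => 1) 0 = ∫ z, regDelta h z := by
    rw [cv]
    simp only [mul_one]
    exact integral_sub_left_eq_self _ volume 0
  rw [e2] at e1
  have e3 : ∀ z, ‖regDelta h z‖ = -regDelta h z := fun z =>
    Real.norm_of_nonpos (regDelta_nonpos hh z)
  simp_rw [e3]
  rw [integral_neg, e1, neg_neg, kerMass]; simp

/-- The regularized Calderón–Zygmund operators are bounded on `L²`, uniformly in the
regularization, by integration by parts. -/
theorem sum_integral_regCZ_sq_le {h : ℝ} (hh : 0 < h) (h1 : h ≤ 1) {F : Fin 4 → R4 → ℝ}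
    (hFm : ∀ i, Measurable (F i)) (hF : ∀ i, Integrable (F i)) (hF2 : ∀ i, MemLp (F i) 2) :
    ∑ j, ∫ x, regCZ h j F x ^ 2 ≤ ∑ i, ∫ x, cv (regDelta h) (F i) x ^ 2 := by
  obtain ⟨M, M0, M1, M2, M3, M4, M5⟩ := exists_bound_regKer hh
  obtain ⟨L1, L2, L3⟩ := memLp_regKer hh h1
  set v : R4 → ℝ := fun x => ∑ i, cv (regKer₁ h i) (F i) x with hv
  have dd1 : ∀ i, Differentiable ℝ (cv (regKer₁ h i) (F i)) := fun i =>
    differentiable_cv (contDiff_regKer₁ hh i) (M1 i)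
      (fun j z => by rw [pd_regKer₁ hh]; exact M2 i j z) (hF i)
  have dd2 : ∀ i j, Differentiable ℝ (cv (regKer₂ h i j) (F i)) := fun i j =>
    differentiable_cv (contDiff_regKer₂ hh i j) (M2 i j)
      (fun k z => by rw [pd_regKer₂ hh]; exact M3 i j k z) (hF i)
  have dv : Differentiable ℝ v := Differentiable.fun_sum fun i _ => dd1 i
  have dcz : ∀ j, Differentiable ℝ (regCZ h j F) := fun j =>
    Differentiable.fun_sum fun i _ => dd2 i j
  have ev1 : ∀ j, pd j v = regCZ h j F := by
    intro j; ext x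
    rw [pd, hv, fderiv_fun_sum fun i _ => dd1 i x]
    simp only [sum_apply, regCZ]
    refine sum_congr rfl fun i _ => ?_
    have := congrFun (pd_cv (contDiff_regKer₁ hh i) (M1 i)
      (fun j z => by rw [pd_regKer₁ hh]; exact M2 i j z) (hF i) j) x
    rw [pd_regKer₁ hh] at this
    exact this
  have ev2 : ∀ j, pd j (regCZ h j F) = fun x => ∑ i, cv (regKer₃ h i j j) (F i) x := by
    intro j; ext x
    have : regCZ h j F = fun x => ∑ i, cv (regKer₂ h i j) (F i) x := rfl
    rw [pd, this, fderiv_fun_sum fun i _ => dd2 i j x]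
    simp only [sum_apply]
    refine sum_congr rfl fun i _ => ?_
    have := congrFun (pd_cv (contDiff_regKer₂ hh i j) (M2 i j)
      (fun k z => by rw [pd_regKer₂ hh]; exact M3 i j k z) (hF i) j) x
    rw [pd_regKer₂ hh] at this
    exact this
  have ed : ∀ i, pd i (cv (regDelta h) (F i)) = cv (pd i (regDelta h)) (F i) := fun i =>
    pd_cv (contDiff_regDelta hh) M4 M5 (hF i) i
  have dδ : ∀ i, Differentiable ℝ (cv (regDelta h) (F i)) := fun i =>
    differentiable_cv (contDiff_regDelta hh) M4 M5 (hF i)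
  have ed2 : ∀ i, pd i (cv (regDelta h) (F i)) = fun x => ∑ j, cv (regKer₃ h i j j) (F i) x := by
    intro i; ext x
    rw [ed]
    unfold cv
    rw [← integral_finsetSum _ fun j _ =>
      integrable_cv (contDiff_regKer₃ hh i j j (n := 0)).continuous (M3 i j j) (hF i) x]
    refine integral_congr_ae (.of_forall fun y => ?_)
    simp only
    rw [← sum_mul, sum_regKer₃ hh]
  have m1 : MemLp v 2 := memLp_finsetSum _ fun i _ =>
    memLp_two_cv (contDiff_regKer₁ hh i (n := 0)).continuous (M1 i) (L1 i) (hFm i) (hF i)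
  have m2 : ∀ j, MemLp (regCZ h j F) 2 := fun j => memLp_finsetSum _ fun i _ =>
    memLp_two_cv (contDiff_regKer₂ hh i j (n := 0)).continuous (M2 i j) (L2 i j) (hFm i) (hF i)
  have m3 : ∀ i j, MemLp (cv (regKer₃ h i j j) (F i)) 2 := fun i j =>
    memLp_two_cv (contDiff_regKer₃ hh i j j (n := 0)).continuous (M3 i j j) (L3 i j j) (hFm i)
      (hF i)
  have m4 : ∀ i, MemLp (cv (regDelta h) (F i)) 2 := by
    intro i
    refine ⟨(dδ i).continuous.aestronglyMeasurable, ?_⟩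
    have h1' := lintegral_cv_rpow_le HolderConjugate.two_two
      (contDiff_regDelta hh (n := 0)).continuous.measurable (hFm i)
    rw [lintegral_regDelta hh h1] at h1'
    have h3 := (hF2 i).2
    rw [eLpNorm_lt_top_iff_lintegral_rpow_enorm_lt_top (by norm_num) (by norm_num)] at h3 ⊢
    norm_num at h1' h3 ⊢
    exact h1'.trans_lt (mul_lt_top (pow_lt_top ofReal_lt_top) h3)
  have m5 : ∀ j, MemLp (pd j (regCZ h j F)) 2 := fun j => by
    rw [ev2]; exact memLp_finsetSum _ fun i _ => m3 i j
  have m6 : ∀ i, MemLp (pd i (cv (regDelta h) (F i))) 2 := fun i => by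
    rw [ed2]; exact memLp_finsetSum _ fun j _ => m3 i j
  have ibp1 : ∀ j, ∫ x, v x * pd j (regCZ h j F) x = -∫ x, regCZ h j F x * regCZ h j F x := by
    intro j
    have := integral_mul_fderiv_eq_neg_fderiv_mul_of_integrable (μ := (volume : Measure R4))
      (f := v) (g := regCZ h j F) (v := e j)
      (by
        have : Integrable (fun x => pd j v x * regCZ h j F x) := by
          rw [ev1]; exact (m2 j).integrable_mul (m2 j)
        exact this)
      (m1.integrable_mul (m5 j)) (m1.integrable_mul (m2 j)) (fun x _ => dv x) (fun x _ => dcz j x)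
    rw [← ev1 j] at this ⊢
    exact this
  have ibp2 : ∀ i, ∫ x, v x * pd i (cv (regDelta h) (F i)) x
      = -∫ x, regCZ h i F x * cv (regDelta h) (F i) x := by
    intro i
    have := integral_mul_fderiv_eq_neg_fderiv_mul_of_integrable (μ := (volume : Measure R4))
      (f := v) (g := cv (regDelta h) (F i)) (v := e i)
      (by
        have : Integrable (fun x => pd i v x * cv (regDelta h) (F i) x) := by
          rw [ev1]; exact (m2 i).integrable_mul (m4 i)
        exact this)
      (m1.integrable_mul (m6 i)) (m1.integrable_mul (m4 i)) (fun x _ => dv x) (fun x _ => dδ i x)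
    rw [← ev1 i]
    exact this
  have hsum : ∑ j, ∫ x, v x * pd j (regCZ h j F) x
      = ∑ i, ∫ x, v x * pd i (cv (regDelta h) (F i)) x := by
    have i1 : ∀ j, Integrable fun x => v x * pd j (regCZ h j F) x := fun j =>
      m1.integrable_mul (m5 j)
    have i2 : ∀ i, Integrable fun x => v x * pd i (cv (regDelta h) (F i)) x := fun i =>
      m1.integrable_mul (m6 i)
    rw [← integral_finsetSum _ fun j _ => i1 j, ← integral_finsetSum _ fun j _ => i2 j]
    refine integral_congr_ae (.of_forall fun x => ?_)
    simp only [ev2, ed2]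
    rw [← mul_sum, ← mul_sum, sum_comm]
  simp_rw [ibp1, ibp2] at hsum
  rw [sum_neg_distrib, sum_neg_distrib, neg_inj] at hsum
  have hle : ∀ i, ∫ x, regCZ h i F x * cv (regDelta h) (F i) x
      ≤ 1 / 2 * (∫ x, regCZ h i F x ^ 2) + 1 / 2 * ∫ x, cv (regDelta h) (F i) x ^ 2 := by
    intro i
    rw [← integral_const_mul, ← integral_const_mul, ← integral_add
      ((m2 i).integrable_sq.const_mul _) ((m4 i).integrable_sq.const_mul _)]
    refine integral_mono ((m2 i).integrable_mul (m4 i))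
      (((m2 i).integrable_sq.const_mul _).add ((m4 i).integrable_sq.const_mul _)) fun x => ?_
    simp only
    nlinarith [sq_nonneg (regCZ h i F x - cv (regDelta h) (F i) x)]
  have hfin := sum_le_sum fun i (_ : i ∈ Finset.univ) => hle i
  rw [← hsum, sum_add_distrib, ← mul_sum, ← mul_sum] at hfin
  have e4 : ∀ j, ∫ x, regCZ h j F x * regCZ h j F x = ∫ x, regCZ h j F x ^ 2 := fun j => by ring_nf
  simp_rw [e4] at hfin
  linarith

theorem lintegral_regCZ_sq_le {h : ℝ} (hh : 0 < h) (h1 : h ≤ 1) {F : Fin 4 → R4 → ℝ}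
    (hFm : ∀ i, Measurable (F i)) (hF : ∀ i, Integrable (F i)) (hF2 : ∀ i, MemLp (F i) 2)
    (j : Fin 4) :
    ∫⁻ x, ‖regCZ h j F x‖ₑ ^ 2 ≤ ofReal kerMass ^ 2 * ∑ i, ∫⁻ x, ‖F i x‖ₑ ^ 2 := by
  obtain ⟨M, M0, M1, M2, M3, M4, M5⟩ := exists_bound_regKer hh
  obtain ⟨L1, L2, L3⟩ := memLp_regKer hh h1
  have key := sum_integral_regCZ_sq_le hh h1 hFm hF hF2
  have m2 : ∀ j, MemLp (regCZ h j F) 2 := fun j => memLp_finsetSum _ fun i _ =>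
    memLp_two_cv (contDiff_regKer₂ hh i j (n := 0)).continuous (M2 i j) (L2 i j) (hFm i) (hF i)
  have hb : ∀ i, ∫⁻ x, ‖cv (regDelta h) (F i) x‖ₑ ^ 2
      ≤ ofReal kerMass ^ 2 * ∫⁻ x, ‖F i x‖ₑ ^ 2 := fun i => by
    have h1' := lintegral_cv_rpow_le HolderConjugate.two_two
      (contDiff_regDelta hh (n := 0)).continuous.measurable (hFm i)
    rw [lintegral_regDelta hh h1] at h1'
    simp_all
  have conv : ∀ {f : R4 → ℝ}, Integrable (fun x => f x ^ 2) →
      ∫⁻ x, ‖f x‖ₑ ^ 2 = ofReal (∫ x, f x ^ 2) := by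
    intro f hf
    rw [ofReal_integral_eq_lintegral_ofReal hf (.of_forall fun x => sq_nonneg _)]
    refine lintegral_congr fun x => ?_
    rw [← ofReal_norm, ← ofReal_pow (norm_nonneg _), norm_eq_abs, sq_abs]
  have m4 : ∀ i, Integrable fun x => cv (regDelta h) (F i) x ^ 2 := by
    intro i
    have hc : Continuous (cv (regDelta h) (F i)) :=
      continuous_cv (contDiff_regDelta hh (n := 0)).continuous M4 (hF i)
    have : MemLp (cv (regDelta h) (F i)) 2 := by
      refine ⟨hc.aestronglyMeasurable, ?_⟩
      have h3 := (hF2 i).2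
      rw [eLpNorm_lt_top_iff_lintegral_rpow_enorm_lt_top (by norm_num) (by norm_num)] at h3 ⊢
      norm_num at h3 ⊢
      exact (hb i).trans_lt (mul_lt_top (pow_lt_top ofReal_lt_top) h3)
    exact this.integrable_sq
  calc ∫⁻ x, ‖regCZ h j F x‖ₑ ^ 2 = ofReal (∫ x, regCZ h j F x ^ 2) :=
        conv (m2 j).integrable_sq
    _ ≤ ofReal (∑ i, ∫ x, cv (regDelta h) (F i) x ^ 2) := by
        refine ofReal_le_ofReal (le_trans ?_ key)
        exact single_le_sum (f := fun j => ∫ x, regCZ h j F x ^ 2)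
          (fun i _ => integral_nonneg fun x => sq_nonneg _) (Finset.mem_univ j)
    _ = ∑ i, ∫⁻ x, ‖cv (regDelta h) (F i) x‖ₑ ^ 2 := by
        rw [ENNReal.ofReal_sum_of_nonneg fun i _ => integral_nonneg fun x => sq_nonneg _]
        simp [*]
    _ ≤ _ := by
        rw [mul_sum]; bound

/-! ### The Calderón–Zygmund decomposition -/

/-- The index of the half-open dyadic cube of generation `n` (side `s / 2 ^ n`) containing `x`. -/
def cellIdx (s : ℝ) (n : ℕ) (x : R4) : Fin 4 → ℤ := fun i => ⌊2 ^ n * x i / s⌋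

/-- The half-open dyadic cube of generation `n` with index `a`. -/
def cell (s : ℝ) (n : ℕ) (a : Fin 4 → ℤ) : Set R4 := {x | cellIdx s n x = a}

theorem measurable_coord (i : Fin 4) : Measurable fun x : R4 => x i :=
  (EuclideanSpace.proj (𝕜 := ℝ) i).continuous.measurable

theorem measurableSet_cell (s : ℝ) (n : ℕ) (a : Fin 4 → ℤ) : MeasurableSet (cell s n a) := by
  have : cell s n a = ⋂ i, (fun x : R4 => ⌊2 ^ n * x i / s⌋) ⁻¹' {a i} := by
    ext x
    simp [cell, cellIdx, funext_iff]
  rw [this]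
  refine MeasurableSet.iInter fun i => ?_
  exact (Int.measurable_floor.comp (((measurable_coord i).const_mul _).div_const _))
    (measurableSet_singleton _)

theorem mem_cell_iff {s : ℝ} (hs : 0 < s) {n : ℕ} {a : Fin 4 → ℤ} {x : R4} :
    x ∈ cell s n a ↔ ∀ i, x i ∈ Ico (s / 2 ^ n * a i) (s / 2 ^ n * (a i + 1)) := by
  simp only [cell, cellIdx, mem_ofPred_eq, funext_iff, Int.floor_eq_iff, mem_Ico]
  refine forall_congr' fun i => and_congr ?_ ?_
  · field_simp
  · field_simp

theorem volume_cell {s : ℝ} (hs : 0 < s) (n : ℕ) (a : Fin 4 → ℤ) :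
    volume (cell s n a) = ofReal (s / 2 ^ n) ^ 4 := by
  have h : cell s n a = (@WithLp.ofLp 2 (Fin 4 → ℝ)) ⁻¹'
      (Set.pi univ fun i => Ico (s / 2 ^ n * a i) (s / 2 ^ n * (a i + 1))) := by
    ext x
    rw [mem_cell_iff hs]; simp
  rw [h, (PiLp.volume_preserving_ofLp (Fin 4)).measure_preimage
    (MeasurableSet.univ_pi fun i => measurableSet_Ico).nullMeasurableSet, Real.volume_pi_Ico]
  have : ∀ i, s / 2 ^ n * ((a i : ℝ) + 1) - s / 2 ^ n * a i = s / 2 ^ n := fun i => by ring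
  simp [*]

theorem cellIdx_eq_of_succ {s : ℝ} {n : ℕ} {x y : R4}
    (h : cellIdx s (n + 1) x = cellIdx s (n + 1) y) : cellIdx s n x = cellIdx s n y := by
  have key : ∀ x : R4, cellIdx s n x = fun i => cellIdx s (n + 1) x i / 2 := by
    intro x; ext i
    have := Int.floor_div_natCast (2 ^ (n + 1) * x i / s) 2
    simp only [cellIdx]
    rw [show (2 : ℤ) = ((2 : ℕ) : ℤ) by norm_num, ← this]; ring_nf
  simp [*]

theorem cellIdx_eq_of_le {s : ℝ} {m n : ℕ} (hmn : m ≤ n) {x y : R4}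
    (h : cellIdx s n x = cellIdx s n y) : cellIdx s m x = cellIdx s m y := by
  induction n, hmn using Nat.le_induction with
  | base => exact h
  | succ n _ ih => exact ih (cellIdx_eq_of_succ h)

theorem norm_sub_le_of_mem_cell {s : ℝ} (hs : 0 < s) {n : ℕ} {a : Fin 4 → ℤ} {x y : R4}
    (hx : x ∈ cell s n a) (hy : y ∈ cell s n a) : ‖x - y‖ ≤ 2 * (s / 2 ^ n) := by
  rw [mem_cell_iff hs] at hx hy
  have hd : 0 < s / 2 ^ n := by positivity
  refine abs_le_of_sq_le_sq' ?_ (by positivity) |>.2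
  rw [norm_sq_eq_sum]
  have : ∀ i, (x - y) i ^ 2 ≤ (s / 2 ^ n) ^ 2 := by
    intro i
    obtain ⟨h1, h2⟩ := hx i
    obtain ⟨h3, h4⟩ := hy i
    have : (x - y) i = x i - y i := rfl
    rw [this]
    apply sq_le_sq'
    · nlinarith
    · nlinarith
  calc ∑ i, (x - y) i ^ 2 ≤ ∑ _i : Fin 4, (s / 2 ^ n) ^ 2 := sum_le_sum fun i _ => this i
    _ = (2 * (s / 2 ^ n)) ^ 2 := by simp; ring

/-- Calderón–Zygmund decomposition at height `s`: the maximal dyadic cubes on which the mean of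
`|f|` exceeds `s`. -/
theorem exists_calderonZygmund_cubes {f : R4 → ℝ} (hf : Integrable f) {s : ℝ} (hs : 0 < s) :
    ∃ (S : Set (ℕ × (Fin 4 → ℤ))) (Q : S → Set R4) (c : S → R4) (r : S → ℝ),
      (∀ q, 0 < r q) ∧ (∀ q, MeasurableSet (Q q)) ∧ Pairwise (Function.onFun Disjoint Q) ∧
      (∀ q, Q q ⊆ closedBall (c q) (r q)) ∧
      (∀ q, ofReal (r q) ^ 4 = 16 * volume (Q q)) ∧
      (∀ q, ofReal s * volume (Q q) ≤ ∫⁻ x in Q q, ‖f x‖ₑ) ∧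
      (∀ q, ∫⁻ x in Q q, ‖f x‖ₑ ≤ 16 * ofReal s * volume (Q q)) ∧
      ∀ᵐ x, x ∉ ⋃ q, Q q → ‖f x‖ₑ ≤ ofReal s := by
  have hft : ∫⁻ x, ‖f x‖ₑ ≠ ⊤ := hf.2.ne
  -- the initial side length is so large that no cube of generation `0` is bad
  obtain ⟨σ, hσ, hσf⟩ : ∃ σ : ℝ, 0 < σ ∧ ∫⁻ x, ‖f x‖ₑ ≤ ofReal s * ofReal σ ^ 4 := by
    set I := (∫⁻ x, ‖f x‖ₑ).toReal with hI
    have hI0 : 0 ≤ I := ENNReal.toReal_nonneg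
    refine ⟨1 + I / s, by positivity, ?_⟩
    have h1 : I ≤ s * (1 + I / s) ^ 4 := by
      have h2 : (0 : ℝ) ≤ I / s := by positivity
      have h3 : (1 + I / s) ^ 1 ≤ (1 + I / s) ^ 4 := pow_le_pow_right₀ (by linarith) (by norm_num)
      have h4 : s * (I / s) = I := by field_simp
      nlinarith
    rw [← ofReal_pow (by positivity), ← ofReal_mul hs.le,
      ← ofReal_toReal hft]
    bound
  set bad : ℕ → (Fin 4 → ℤ) → Prop := fun n a =>
    ofReal s * volume (cell σ n a) < ∫⁻ x in cell σ n a, ‖f x‖ₑ with hbad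
  have hbad0 : ∀ a, ¬ bad 0 a := fun a h => by
    refine absurd h (not_lt.2 ?_)
    refine (setLIntegral_le_lintegral _ _).trans ?_
    rw [volume_cell hσ]
    simp [*]
  set S : Set (ℕ × (Fin 4 → ℤ)) :=
    {q | bad q.1 q.2 ∧ ∃ x ∈ cell σ q.1 q.2, ∀ m < q.1, ¬ bad m (cellIdx σ m x)} with hS
  have hc : ∀ q : S, ∃ x ∈ cell σ q.1.1 q.1.2, ∀ m < q.1.1, ¬ bad m (cellIdx σ m x) :=
    fun q => q.2.2
  choose c hcm hcb using hc
  have hbad' : ∀ q : S, ∀ x ∈ cell σ q.1.1 q.1.2, ∀ m < q.1.1, ¬ bad m (cellIdx σ m x) := by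
    intro q x hx m hm
    have h1 : cellIdx σ q.1.1 x = cellIdx σ q.1.1 (c q) := by
      have h2 : cellIdx σ q.1.1 x = q.1.2 := hx
      have h3 : cellIdx σ q.1.1 (c q) = q.1.2 := hcm q
      rw [h2, h3]
    rw [cellIdx_eq_of_le hm.le h1]
    grind
  refine ⟨S, fun q => cell σ q.1.1 q.1.2, c, fun q => 2 * (σ / 2 ^ q.1.1), fun q => by positivity,
    fun q => measurableSet_cell _ _ _, ?_, ?_, ?_, fun q => q.2.1.le, ?_, ?_⟩
  · intro q q' hne
    rw [Function.onFun, Set.disjoint_left]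
    intro x hx hx'
    have e1 : cellIdx σ q.1.1 x = q.1.2 := hx
    have e2 : cellIdx σ q'.1.1 x = q'.1.2 := hx'
    grind
  · intro q x hx
    rw [mem_closedBall_iff_norm]
    exact norm_sub_le_of_mem_cell hσ hx (hcm q)
  · intro q
    rw [volume_cell hσ, ofReal_mul zero_le_two, mul_pow]; norm_num
  · intro q
    obtain ⟨n, hn⟩ : ∃ n, q.1.1 = n + 1 := by
      refine Nat.exists_eq_succ_of_ne_zero fun h => ?_
      grind
    have h1 := hbad' q (c q) (hcm q) n (by omega)
    rw [hbad, not_lt, volume_cell hσ] at h1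
    have h2 : cell σ q.1.1 q.1.2 ⊆ cell σ n (cellIdx σ n (c q)) := by
      intro x hx
      have e1 : cellIdx σ q.1.1 x = cellIdx σ q.1.1 (c q) := by
        have h2 : cellIdx σ q.1.1 x = q.1.2 := hx
        have h3 : cellIdx σ q.1.1 (c q) = q.1.2 := hcm q
        grind
      exact cellIdx_eq_of_le (by omega) e1
    refine (lintegral_mono_set h2).trans (h1.trans_eq ?_)
    rw [volume_cell hσ, hn]
    have : σ / 2 ^ n = 2 * (σ / 2 ^ (n + 1)) := by field_simp; ring
    rw [this, ofReal_mul zero_le_two, mul_pow]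
    norm_num; ring
  · have hleb := (Besicovitch.vitaliFamily (volume : Measure R4)).ae_tendsto_lintegral_enorm_sub_div
      hf.locallyIntegrable
    filter_upwards [hleb] with x hx hxU
    have hgood : ∀ n, ¬ bad n (cellIdx σ n x) := by
      classical
      by_contra! hex
      refine hxU ?_
      have hm := Nat.find_spec hex
      refine mem_iUnion.2 ⟨⟨(Nat.find hex, cellIdx σ (Nat.find hex) x), hm, x, rfl,
        fun m hm => Nat.find_min hex hm⟩, rfl⟩
    have hr : Tendsto (fun n : ℕ => 2 * (σ / 2 ^ n)) atTop (𝓝[>] 0) := by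
      rw [tendsto_nhdsWithin_iff]
      refine ⟨?_, Eventually.of_forall fun n => by simp only [mem_Ioi]; positivity⟩
      have : Tendsto (fun n : ℕ => 2 * (σ * (1 / 2 : ℝ) ^ n)) atTop (𝓝 (2 * (σ * 0))) :=
        ((tendsto_pow_atTop_nhds_zero_of_lt_one (by norm_num) (by norm_num)).const_mul _).const_mul _
      simp only [mul_zero] at this
      refine this.congr fun n => ?_
      rw [one_div, inv_pow]; ring
    have h1 := (hx.comp (Besicovitch.tendsto_filterAt volume x)).comp hr
    have h2 : Tendsto (fun n : ℕ => 16 * ballVol * ((∫⁻ y in closedBall x (2 * (σ / 2 ^ n)),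
        ‖f y - f x‖ₑ) / volume (closedBall x (2 * (σ / 2 ^ n)))) + ofReal s) atTop
        (𝓝 (16 * ballVol * 0 + ofReal s)) := by
      refine Tendsto.add_const _ (ENNReal.Tendsto.const_mul h1 (Or.inr ?_))
      finiteness
    rw [mul_zero, zero_add] at h2
    refine ge_of_tendsto' h2 fun n => ?_
    set a := cellIdx σ n x with ha
    have hd : 0 < σ / 2 ^ n := by positivity
    have hQ0 : volume (cell σ n a) ≠ 0 := by rw [volume_cell hσ]; positivity
    have hQt : volume (cell σ n a) ≠ ⊤ := by
      rw [volume_cell hσ]; exact pow_ne_top ofReal_ne_top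
    have hsub : cell σ n a ⊆ closedBall x (2 * (σ / 2 ^ n)) := fun y hy => by
      rw [mem_closedBall_iff_norm]
      exact norm_sub_le_of_mem_cell hσ hy rfl
    have hvB : volume (closedBall x (2 * (σ / 2 ^ n)))
        = 16 * ballVol * volume (cell σ n a) := by
      rw [Measure.addHaar_closedBall_eq_addHaar_ball, volume_ball_R4 _ (by positivity),
        volume_cell hσ, ofReal_mul zero_le_two, mul_pow]
      norm_num; ring
    have h3 : ‖f x‖ₑ * volume (cell σ n a)
        ≤ (∫⁻ y in cell σ n a, ‖f y - f x‖ₑ) + ∫⁻ y in cell σ n a, ‖f y‖ₑ := by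
      rw [← lintegral_add_right' _ hf.1.restrict.enorm, ← setLIntegral_const]
      refine lintegral_mono fun y => ?_
      calc ‖f x‖ₑ = ‖(f x - f y) + f y‖ₑ := by rw [sub_add_cancel]
        _ ≤ ‖f x - f y‖ₑ + ‖f y‖ₑ := enorm_add_le _ _
        _ = _ := by rw [← edist_eq_enorm_sub, edist_comm, edist_eq_enorm_sub]
    have h4 := not_lt.1 (hgood n)
    have hB0 : (16 * ballVol : ℝ≥0∞) ≠ 0 := by
      have := ballVol_pos.ne'
      positivity
    have hBt : (16 * ballVol : ℝ≥0∞) ≠ ⊤ := mul_ne_top (by norm_num) coe_ne_top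
    rw [hvB, ← mul_div_assoc, ENNReal.mul_div_mul_left _ _ hB0 hBt, ← ENNReal.mul_le_mul_iff_left hQ0 hQt, add_mul, ENNReal.div_mul_cancel hQ0 hQt]
    exact h3.trans (add_le_add (lintegral_mono_set hsub) h4)

/-! ### The weak `(1,1)` estimate -/

theorem lintegral_tail_le (c : R4) {r : ℝ} (hr : 0 < r) :
    ∫⁻ x in {x | r < ‖c - x‖}, (‖c - x‖ₑ⁻¹) ^ 5 ≤ 5 * ballVol * (ofReal r)⁻¹ := by
  have hm : MeasurableSet {x : R4 | r < ‖c - x‖} := measurableSet_lt (by fun_prop) (by fun_prop)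
  have hr0 : ofReal r ≠ 0 := by simpa using hr
  have h := setBound_one.lintegral_mul_le_of_le measurable_const (p := 4 / 5) (by norm_num)
    one_pos one_pos (by norm_num) (by norm_num)
    (w := {x : R4 | r < ‖c - x‖}.indicator fun x => (‖c - x‖ₑ⁻¹) ^ 5)
    (S := ((ofReal r)⁻¹) ^ 5) (A := (ballVol : ℝ≥0∞) ^ ((5 : ℕ) / 4 : ℝ))
    (Measurable.indicator (by fun_prop) hm)
    (rpow_ne_top_of_nonneg (by positivity) coe_ne_top) ?_ ?_
  · simp_rw [one_mul] at h
    rw [lintegral_indicator hm] at h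
    refine h.trans_eq ?_
    rw [mul_zero, add_zero, ← rpow_mul, ← rpow_natCast, ← rpow_mul]; norm_num
  · intro x
    by_cases hx : r < ‖c - x‖
    · rw [indicator_of_mem (by exact hx)]; gcongr
      rw [← ofReal_norm]; bound
    · simp [*]
  · intro s hs
    refine le_trans (measure_mono fun x hx => ?_)
      (volume_lt_inv_enorm_pow_le (k := 5) (by norm_num) c hs)
    rw [mem_ofPred_eq] at hx ⊢
    exact hx.trans_le (indicator_le_self _ _ _)

/-- A splitting of `f` splits the distribution function of `cv k f`; Chebyshev's inequality is
applied to the first part. -/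
theorem volume_lt_cv_le_add {k : R4 → ℝ} (hk : Continuous k) {M : ℝ} (hM : ∀ z, |k z| ≤ M)
    {f g b : R4 → ℝ} (hg : Integrable g) (hb : Integrable b) (h : ∀ y, f y = g y + b y) {s : ℝ}
    (hs : 0 < s) : volume {x | ofReal s < ‖cv k f x‖ₑ}
      ≤ 4 / ofReal s ^ 2 * (∫⁻ x, ‖cv k g x‖ₑ ^ 2) + volume {x | ofReal (s / 2) < ‖cv k b x‖ₑ} := by
  have hcg := (continuous_cv hk hM hg).measurable
  set σ := ofReal (s / 2) with hσ
  have hσ2 : ofReal s = 2 * σ := by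
    rw [hσ, show (2 : ℝ≥0∞) = ofReal 2 by simp, ← ofReal_mul zero_le_two]; ring_nf
  have hσ0 : σ ≠ 0 := by simpa [hσ] using hs
  have hσt : σ ≠ ⊤ := ofReal_ne_top
  have hsplit : {x | ofReal s < ‖cv k f x‖ₑ}
      ⊆ {x | σ ^ 2 ≤ ‖cv k g x‖ₑ ^ 2} ∪ {x | σ < ‖cv k b x‖ₑ} := by
    intro x hx
    have hcv : cv k f x = cv k g x + cv k b x := by
      rw [cv, cv, cv, ← integral_add (integrable_cv hk hM hg x) (integrable_cv hk hM hb x)]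
      simp only [h, mul_add]
    rw [mem_ofPred_eq, hcv] at hx
    by_contra! h
    simp only [mem_union, mem_ofPred_eq, not_or, not_lt] at h
    refine absurd hx (not_lt.2 ((enorm_add_le _ _).trans ?_))
    rw [hσ2, two_mul]
    exact add_le_add (le_of_not_ge fun h1 => h.1 (pow_le_pow_left' h1 2)) h.2
  refine (measure_mono hsplit).trans ((measure_union_le _ _).trans (add_le_add ?_ le_rfl))
  refine (meas_ge_le_lintegral_div (by fun_prop) (pow_ne_zero 2 hσ0) (pow_ne_top hσt)).trans_eq ?_
  have : (4 : ℝ≥0∞) * 4⁻¹ = 1 := ENNReal.mul_inv_cancel (by simp) (by simp)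
  rw [hσ2, mul_pow, div_eq_mul_inv, div_eq_mul_inv, ENNReal.mul_inv (by simp) (by simp),
    ← mul_assoc 4, show (2 : ℝ≥0∞) ^ 2 = 4 by norm_num, this, one_mul, mul_comm]

/-- Operators with a Calderón–Zygmund kernel are of weak type `(1,1)`. -/
theorem volume_lt_cv_le {k : R4 → ℝ} (hk : Continuous k) {M : ℝ} (hM : ∀ z, |k z| ≤ M)
    {A A₀ : ℝ≥0} (hL2 : ∀ f : R4 → ℝ, Measurable f → Integrable f → MemLp f 2 →
      ∫⁻ x, ‖cv k f x‖ₑ ^ 2 ≤ A * ∫⁻ x, ‖f x‖ₑ ^ 2)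
    (hH : ∀ z w : R4, 2 * ‖w‖ ≤ ‖z‖ → ‖k (z - w) - k z‖ₑ ≤ A₀ * ‖w‖ₑ * (‖z‖ₑ⁻¹) ^ 5)
    {f : R4 → ℝ} (hfm : Measurable f) (hf : Integrable f) {s : ℝ} (hs : 0 < s) :
    volume {x | ofReal s < ‖cv k f x‖ₑ}
      ≤ (64 * A + 256 * ballVol + 20 * A₀ * ballVol) / ofReal s * ∫⁻ x, ‖f x‖ₑ := by
  obtain ⟨S, Q, c, r, hr, hQm, hQd, hQb, hQr, hQ1, hQ2, hoff⟩ := exists_calderonZygmund_cubes hf hs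
  have hs0 : ofReal s ≠ 0 := by simpa using hs
  have hst : ofReal s ≠ ⊤ := ofReal_ne_top
  have hQt : ∀ q, volume (Q q) ≠ ⊤ := fun q => ((measure_mono (hQb q)).trans_lt
    measure_closedBall_lt_top).ne
  have hQ0 : ∀ q, volume (Q q) ≠ 0 := fun q h => by
    have h1 := hQr q
    rw [h, mul_zero] at h1
    have : ofReal (r q) ≠ 0 := by simpa using hr q
    exact pow_ne_zero 4 this h1
  set Ω : Set R4 := ⋃ q, Q q with hΩ
  have hΩm : MeasurableSet Ω := MeasurableSet.iUnion hQm
  set avg : S → ℝ := fun q => ⨍ x in Q q, f x with havg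
  have havgle : ∀ q, ‖avg q‖ₑ * volume (Q q) ≤ ∫⁻ x in Q q, ‖f x‖ₑ := by
    intro q
    have h1 : avg q * (volume.real (Q q)) = ∫ x in Q q, f x := by
      rw [havg]
      simp only [setAverage_eq, smul_eq_mul]
      have : volume.real (Q q) ≠ 0 := (toReal_pos (hQ0 q) (hQt q)).ne'
      field_simp
    have h2 : ‖avg q‖ₑ * volume (Q q) = ‖avg q * (volume.real (Q q))‖ₑ := by
      rw [enorm_mul, Measure.real, enorm_of_nonneg ENNReal.toReal_nonneg,
        ofReal_toReal (hQt q)]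
    rw [h2, h1]
    exact enorm_integral_le_lintegral_enorm _
  have havg16 : ∀ q, ‖avg q‖ₑ ≤ 16 * ofReal s := by
    intro q
    have := (havgle q).trans (hQ2 q)
    rwa [ENNReal.mul_le_mul_iff_left (hQ0 q) (hQt q)] at this
  -- the good part
  obtain ⟨g, hgm, hg⟩ := exists_measurable_piecewise (ι := Option S)
    (fun o => o.elim Ωᶜ Q) (fun o => by cases o <;> simp [hΩm.compl, hQm])
    (fun o => o.elim f fun q _ => avg q)
    (fun o => by cases o <;> simp [hfm]) (by
      rintro (_ | q) (_ | q') hne x ⟨hx, hx'⟩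
      · exact absurd rfl hne
      · exact absurd (mem_iUnion.2 ⟨q', hx'⟩) hx
      · exact absurd (mem_iUnion.2 ⟨q, hx⟩) hx'
      · exact absurd hx' (Set.disjoint_left.1 (hQd fun h => hne (by rw [h])) hx))
  have hgoff : ∀ x, x ∉ Ω → g x = f x := fun x hx => hg none hx
  have hgQ : ∀ q, ∀ x ∈ Q q, g x = avg q := fun q x hx => hg (some q) hx
  have hg16 : ∀ᵐ x, ‖g x‖ₑ ≤ 16 * ofReal s := by
    filter_upwards [hoff] with x hx
    by_cases hxΩ : x ∈ Ω
    · obtain ⟨q, hq⟩ := mem_iUnion.1 hxΩ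
      grind
    · rw [hgoff x hxΩ]
      exact (hx hxΩ).trans (le_mul_of_one_le_left bot_le (by norm_num))
  have hgint : ∀ q, ∫⁻ x in Q q, ‖g x‖ₑ ≤ ∫⁻ x in Q q, ‖f x‖ₑ := by
    intro q
    refine le_trans (le_of_eq ?_) (havgle q)
    rw [setLIntegral_congr_fun (g := fun _ => ‖avg q‖ₑ) (hQm q) fun x hx => by
      simp only [hgQ q x hx], setLIntegral_const]
  have hg1 : ∫⁻ x, ‖g x‖ₑ ≤ ∫⁻ x, ‖f x‖ₑ := by
    rw [← lintegral_add_compl _ hΩm, ← lintegral_add_compl (fun x => ‖f x‖ₑ) hΩm]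
    refine add_le_add ?_ (le_of_eq (setLIntegral_congr_fun hΩm.compl fun x hx => by
      simp only [hgoff x hx]))
    rw [hΩ, lintegral_iUnion hQm hQd, lintegral_iUnion hQm hQd]
    exact tsum_le_tsum hgint
  have hgI : Integrable g := ⟨hgm.aestronglyMeasurable, hg1.trans_lt hf.2⟩
  have hg2 : ∫⁻ x, ‖g x‖ₑ ^ 2 ≤ 16 * ofReal s * ∫⁻ x, ‖f x‖ₑ := by
    calc ∫⁻ x, ‖g x‖ₑ ^ 2 ≤ ∫⁻ x, 16 * ofReal s * ‖g x‖ₑ :=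
          lintegral_mono_ae (hg16.mono fun x hx => by rw [sq]; gcongr)
      _ = 16 * ofReal s * ∫⁻ x, ‖g x‖ₑ := lintegral_const_mul _ (by fun_prop)
      _ ≤ _ := by gcongr
  have hgL2 : MemLp g 2 := by
    refine ⟨hgm.aestronglyMeasurable, ?_⟩
    rw [eLpNorm_lt_top_iff_lintegral_rpow_enorm_lt_top (by norm_num) (by norm_num)]
    norm_num
    exact hg2.trans_lt (mul_lt_top (mul_lt_top (by norm_num) hst.lt_top) hf.2)
  -- the bad part
  set b : R4 → ℝ := fun x => f x - g x with hb
  have hbI : Integrable b := hf.sub hgI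
  have hbm : Measurable b := hfm.sub hgm
  have hboff : ∀ x, x ∉ Ω → b x = 0 := fun x hx => by rw [hb]; simp only [hgoff x hx, sub_self]
  have hbQ : ∀ q, ∫ x in Q q, b x = 0 := by
    intro q
    rw [hb, integral_sub hf.integrableOn hgI.integrableOn,
      setIntegral_congr_fun (g := fun _ => avg q) (hQm q) fun x hx => hgQ q x hx,
      setIntegral_const, havg]
    simp only [setAverage_eq, smul_eq_mul]
    have : volume.real (Q q) ≠ 0 := (toReal_pos (hQ0 q) (hQt q)).ne'
    simp [*]
  have hb1 : ∀ q, ∫⁻ x in Q q, ‖b x‖ₑ ≤ 2 * ∫⁻ x in Q q, ‖f x‖ₑ := by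
    intro q
    calc ∫⁻ x in Q q, ‖b x‖ₑ ≤ ∫⁻ x in Q q, (‖f x‖ₑ + ‖g x‖ₑ) :=
          lintegral_mono fun x => enorm_sub_le
      _ = (∫⁻ x in Q q, ‖f x‖ₑ) + ∫⁻ x in Q q, ‖g x‖ₑ := lintegral_add_left (by fun_prop) _
      _ ≤ (∫⁻ x in Q q, ‖f x‖ₑ) + ∫⁻ x in Q q, ‖f x‖ₑ :=
          add_le_add le_rfl (hgint q)
      _ = _ := (two_mul _).symm
  have hsumf : ∑' q, ∫⁻ x in Q q, ‖f x‖ₑ ≤ ∫⁻ x, ‖f x‖ₑ := by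
    rw [← lintegral_iUnion hQm hQd]
    exact setLIntegral_le_lintegral _ _
  have hcvb : ∀ x, ‖cv k b x‖ₑ
      ≤ ∑' q, ∫⁻ y in Q q, ‖k (x - y) - k (x - c q)‖ₑ * ‖b y‖ₑ := by
    intro x
    have e1 : cv k b x = ∫ y in Ω, k (x - y) * b y := by
      rw [cv, setIntegral_eq_integral_of_forall_compl_eq_zero]
      intro y hy
      grind
    rw [e1, hΩ, integral_iUnion hQm hQd (integrable_cv hk hM hbI x).integrableOn]
    refine enorm_tsum_le_tsum_enorm.trans (tsum_le_tsum fun q => ?_)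
    have e2 : ∫ y in Q q, k (x - y) * b y = ∫ y in Q q, (k (x - y) - k (x - c q)) * b y := by
      simp_rw [sub_mul]
      rw [integral_sub (integrable_cv hk hM hbI x).integrableOn
        (hbI.integrableOn.const_mul _), integral_const_mul, hbQ, mul_zero, sub_zero]
    rw [e2]
    refine (enorm_integral_le_lintegral_enorm _).trans_eq ?_
    simp
  set Ω' : Set R4 := ⋃ q, closedBall (c q) (2 * r q) with hΩ'
  have hΩ'm : MeasurableSet Ω' := MeasurableSet.iUnion fun q => measurableSet_closedBall
  have hkm : Measurable k := hk.measurable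
  have hbad : ∫⁻ x in Ω'ᶜ, ‖cv k b x‖ₑ ≤ 10 * A₀ * ballVol * ∫⁻ x, ‖f x‖ₑ := by
    calc ∫⁻ x in Ω'ᶜ, ‖cv k b x‖ₑ
        ≤ ∫⁻ x in Ω'ᶜ, ∑' q, ∫⁻ y in Q q, ‖k (x - y) - k (x - c q)‖ₑ * ‖b y‖ₑ :=
          lintegral_mono hcvb
      _ = ∑' q, ∫⁻ x in Ω'ᶜ, ∫⁻ y in Q q, ‖k (x - y) - k (x - c q)‖ₑ * ‖b y‖ₑ := by
          exact lintegral_tsum fun q => Measurable.aemeasurable (by fun_prop)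
      _ ≤ ∑' q, 5 * A₀ * ballVol * ∫⁻ y in Q q, ‖b y‖ₑ := by
          refine tsum_le_tsum fun q => ?_
          rw [lintegral_lintegral_swap (by fun_prop), ← lintegral_const_mul _ (by fun_prop)]
          refine setLIntegral_mono (by fun_prop) fun y hy => ?_
          rw [lintegral_mul_const _ (by fun_prop)]; gcongr
          have hyc : ‖y - c q‖ ≤ r q := mem_closedBall_iff_norm.1 (hQb q hy)
          have hsub : Ω'ᶜ ⊆ {x | 2 * r q < ‖c q - x‖} := by
            intro x hx
            by_contra h
            refine hx (mem_iUnion.2 ⟨q, ?_⟩)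
            rw [mem_closedBall_iff_norm, norm_sub_rev]
            simpa using h
          have hm : MeasurableSet {x : R4 | 2 * r q < ‖c q - x‖} :=
            measurableSet_lt (by fun_prop) (by fun_prop)
          calc ∫⁻ x in Ω'ᶜ, ‖k (x - y) - k (x - c q)‖ₑ
              ≤ ∫⁻ x in {x | 2 * r q < ‖c q - x‖}, ‖k (x - y) - k (x - c q)‖ₑ :=
                lintegral_mono_set hsub
            _ ≤ ∫⁻ x in {x | 2 * r q < ‖c q - x‖},
                  A₀ * ofReal (r q) * (‖c q - x‖ₑ⁻¹) ^ 5 := by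
                refine setLIntegral_mono (by fun_prop) fun x hx => ?_
                rw [← sub_sub_sub_cancel_right x y (c q)]
                have hx' : 2 * r q < ‖c q - x‖ := hx
                refine (hH (x - c q) (y - c q) ?_).trans ?_
                · rw [norm_sub_rev x]; linarith
                · rw [enorm_sub_comm' x]; gcongr
                  rw [← ofReal_norm]; bound
            _ = A₀ * ofReal (r q) * ∫⁻ x in {x | 2 * r q < ‖c q - x‖},
                  (‖c q - x‖ₑ⁻¹) ^ 5 := lintegral_const_mul _ (by fun_prop)
            _ ≤ A₀ * ofReal (r q) * (5 * ballVol * (ofReal (2 * r q))⁻¹) := by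
                gcongr
                exact lintegral_tail_le (c q) (by linarith [hr q])
            _ ≤ A₀ * ofReal (r q) * (5 * ballVol * (ofReal (r q))⁻¹) := by
                gcongr
                simp [*]
            _ = 5 * A₀ * ballVol * (ofReal (r q) * (ofReal (r q))⁻¹) := by ring
            _ = _ := by
                rw [ENNReal.mul_inv_cancel (by simpa using hr q) ofReal_ne_top, mul_one]
      _ ≤ ∑' q, 5 * A₀ * ballVol * (2 * ∫⁻ y in Q q, ‖f y‖ₑ) := by
          refine tsum_le_tsum fun q => ?_
          bound
      _ = 10 * A₀ * ballVol * ∑' q, ∫⁻ y in Q q, ‖f y‖ₑ := by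
          rw [ENNReal.tsum_mul_left, ENNReal.tsum_mul_left]; ring
      _ ≤ _ := by gcongr
  have hcb := (continuous_cv hk hM hbI).measurable
  set I := ∫⁻ x, ‖f x‖ₑ with hI
  have v1 : 4 / ofReal s ^ 2 * ∫⁻ x, ‖cv k g x‖ₑ ^ 2 ≤ 64 * A / ofReal s * I := by
    calc _ ≤ 4 / ofReal s ^ 2 * (A * (16 * ofReal s * I)) := by
          gcongr; exact (hL2 g hgm hgI hgL2).trans (by gcongr)
      _ = 64 * A / ofReal s * I * ((ofReal s)⁻¹ * ofReal s) := by
          rw [div_eq_mul_inv, div_eq_mul_inv, ENNReal.inv_pow]; ring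
      _ = _ := by rw [ENNReal.inv_mul_cancel hs0 hst, mul_one]
  have v2 : volume Ω' ≤ 256 * ballVol / ofReal s * I := by
    calc volume Ω' ≤ ∑' q, volume (closedBall (c q) (2 * r q)) := measure_iUnion_le _
      _ ≤ ∑' q, 256 * ballVol / ofReal s * ∫⁻ x in Q q, ‖f x‖ₑ := by
          refine tsum_le_tsum fun q => ?_
          rw [Measure.addHaar_closedBall_eq_addHaar_ball,
            volume_ball_R4 _ (by linarith [hr q]), ofReal_mul zero_le_two, mul_pow, hQr]
          have h1 : volume (Q q) ≤ (ofReal s)⁻¹ * ∫⁻ x in Q q, ‖f x‖ₑ := by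
            rw [mul_comm, ← div_eq_mul_inv, ENNReal.le_div_iff_mul_le (Or.inl hs0) (Or.inl hst),
              mul_comm]
            bound
          calc _ = 256 * ballVol * volume (Q q) := by norm_num; ring
            _ ≤ 256 * ballVol * ((ofReal s)⁻¹ * ∫⁻ x in Q q, ‖f x‖ₑ) := by gcongr
            _ = _ := by rw [div_eq_mul_inv]; ring
      _ ≤ _ := by
          rw [ENNReal.tsum_mul_left]; gcongr
  have v3 : volume.restrict Ω'ᶜ {x | ofReal (s / 2) < ‖cv k b x‖ₑ}
      ≤ 20 * A₀ * ballVol / ofReal s * I := by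
    refine (measure_mono (t := {x | ofReal (s / 2) ≤ ‖cv k b x‖ₑ}) fun x hx => by
      rw [mem_ofPred_eq] at hx ⊢; exact hx.le).trans ((meas_ge_le_lintegral_div (by fun_prop)
        (by simpa using hs) ofReal_ne_top).trans ((ENNReal.div_le_div_right hbad _).trans_eq ?_))
    rw [ENNReal.ofReal_div_of_pos two_pos, div_eq_mul_inv, ENNReal.inv_div (by simp) (by simp)]
    simp only [div_eq_mul_inv, ENNReal.ofReal_ofNat]; ring
  rw [Measure.restrict_apply' hΩ'm.compl] at v3
  refine (volume_lt_cv_le_add hk hM hgI hbI (fun y => (add_sub_cancel _ _).symm) hs).trans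
    ((add_le_add v1 ((measure_le_inter_add_sdiff _ _ Ω').trans
      (add_le_add ((measure_mono inter_subset_right).trans v2) v3))).trans_eq ?_)
  simp only [div_eq_mul_inv]; ring

/-! ### Interpolation -/

/-- The self-improvement that turns a distributional estimate at level `σ` into a bound of the
measure `D` of the level set. -/
theorem le_div_rpow_of_mul_le {θ : ℝ} (hθ : θ < 1) {D K σ : ℝ≥0∞} (hD : D ≠ ⊤)
    (hσ : σ ≠ 0) (hσt : σ ≠ ⊤) (h : σ * D ≤ K * D ^ θ) (hθ0 : 0 < θ) :
    D ≤ (K / σ) ^ (1 / (1 - θ)) := by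
  rcases eq_or_ne D 0 with rfl | hD0
  · simp
  have h1 : D ^ (1 - θ) ≤ K / σ := by
    rw [ENNReal.le_div_iff_mul_le (Or.inl hσ) (Or.inl hσt)]
    have h2 : D ^ θ ≠ 0 := by positivity
    have h3 : D ^ θ ≠ ⊤ := rpow_ne_top_of_nonneg hθ0.le hD
    rw [← ENNReal.mul_le_mul_iff_left h2 h3]
    refine le_trans (le_of_eq ?_) h
    have : D = D ^ (1 - θ) * D ^ θ := by
      rw [← rpow_add _ _ hD0 hD]; simp
    conv_rhs => rw [this]
    ring
  calc D = (D ^ (1 - θ)) ^ (1 / (1 - θ)) := by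
        rw [← rpow_mul, mul_one_div_cancel (by linarith), rpow_one]
    _ ≤ _ := rpow_le_rpow h1 (by rw [one_div_nonneg]; linarith)

/-- Weak-type bound for the distribution function of a function with a `SetBound`. -/
theorem SetBound.volume_lt_le {θ₁ θ₂ : ℝ} {K₁ K₂ : ℝ≥0∞} {Z : R4 → ℝ≥0∞} (hZm : Measurable Z)
    (hZ : SetBound θ₁ θ₂ K₁ K₂ Z) (h10 : 0 < θ₁) (h11 : θ₁ < 1) (h20 : 0 < θ₂) (h21 : θ₂ < 1)
    {s : ℝ} (hs : 0 < s) (hfin : volume {x | ofReal s < Z x} ≠ ⊤) :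
    volume {x | ofReal s < Z x} ≤ (2 * K₁ / ofReal s) ^ (1 / (1 - θ₁))
      + (2 * K₂ / ofReal s) ^ (1 / (1 - θ₂)) := by
  have hs0 : ofReal s ≠ 0 := by simpa using hs
  have hE : MeasurableSet {x | ofReal s < Z x} := measurableSet_lt measurable_const hZm
  set D := volume {x | ofReal s < Z x} with hD
  have h1 : ofReal s * D ≤ K₁ * D ^ θ₁ + K₂ * D ^ θ₂ := by
    refine le_trans ?_ (hZ _ hE hfin)
    rw [← setLIntegral_const]
    exact setLIntegral_mono hZm fun x hx => le_of_lt hx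
  rcases le_total (K₁ * D ^ θ₁) (K₂ * D ^ θ₂) with h | h
  · refine le_add_left (le_div_rpow_of_mul_le h21 hfin hs0 ofReal_ne_top ?_ h20)
    refine h1.trans ((add_le_add h le_rfl).trans_eq ?_)
    ring
  · refine le_add_right (le_div_rpow_of_mul_le h11 hfin hs0 ofReal_ne_top ?_ h10)
    refine h1.trans ((add_le_add le_rfl h).trans_eq ?_)
    ring

theorem volume_lt_ne_top {f : R4 → ℝ} (hf : Integrable f) {s : ℝ} (hs : 0 < s) :
    volume {x | ofReal s < ‖f x‖ₑ} ≠ ⊤ := by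
  simpa [← ofReal_norm, ENNReal.ofReal_lt_ofReal_iff_of_nonneg hs.le] using
    (hf.measure_norm_gt_lt_top hs).ne

/-- Marcinkiewicz interpolation between the weak type `(1,1)` and the type `(2,2)`. -/
theorem SetBound.convolution {θ₁ θ₂ : ℝ} (h10 : 0 < θ₁) (h11 : θ₁ < 1 / 2) (h20 : 0 < θ₂)
    (h21 : θ₂ < 1 / 2) (A W : ℝ≥0) :
    ∃ C : ℝ≥0, ∀ {K₁ K₂ : ℝ≥0∞} {k f : R4 → ℝ} {M : ℝ}, Continuous k → (∀ z, |k z| ≤ M) →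
      (∀ f : R4 → ℝ, Measurable f → Integrable f → MemLp f 2 →
        ∫⁻ x, ‖cv k f x‖ₑ ^ 2 ≤ A * ∫⁻ x, ‖f x‖ₑ ^ 2) →
      (∀ f : R4 → ℝ, Measurable f → Integrable f → ∀ s : ℝ, 0 < s →
        volume {x | ofReal s < ‖cv k f x‖ₑ} ≤ W / ofReal s * ∫⁻ x, ‖f x‖ₑ) →
      Measurable f → Integrable f → K₁ ≠ ⊤ → K₂ ≠ ⊤ →
      SetBound θ₁ θ₂ K₁ K₂ (fun x => ‖f x‖ₑ) →
      SetBound θ₁ θ₂ (C * K₁) (C * K₂) (fun x => ‖cv k f x‖ₑ) := by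
  set p₁ := 1 / (1 - θ₁) with hp₁
  set p₂ := 1 / (1 - θ₂) with hp₂
  have hp : ∀ θ : ℝ, 0 < θ → θ < 1 / 2 → 1 < 1 / (1 - θ) ∧ 1 / (1 - θ) < 2 := fun θ h0 h1 =>
    ⟨by rw [lt_div_iff₀ (by linarith)]; linarith, by rw [div_lt_iff₀ (by linarith)]; linarith⟩
  obtain ⟨hp1, hp1'⟩ := hp θ₁ h10 h11
  obtain ⟨hp2, hp2'⟩ := hp θ₂ h20 h21
  rw [← hp₁] at hp1 hp1'
  rw [← hp₂] at hp2 hp2'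
  -- the constant in the bound of the distribution function
  set L : ℝ≥0 := 2 * W + 4 * A * (toNNReal (1 / (2 - p₁)) + toNNReal (1 / (2 - p₂)))
    with hL
  set C : ℝ → ℝ≥0 := fun p => toNNReal (1 + 1 / (p * 1 - 1)) * (L ^ (1 / p) * 2) with hC
  refine ⟨max (C p₁) (C p₂), ?_⟩
  intro K₁ K₂ k f M hk hM hL2 hW hfm hf hK₁ hK₂ hZ
  set N : ℝ → ℝ≥0∞ := fun s =>
    (2 * K₁ / ofReal s) ^ p₁ + (2 * K₂ / ofReal s) ^ p₂ with hN
  have hZm : Measurable fun x => ‖f x‖ₑ := hfm.enorm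
  have hvol : ∀ s : ℝ, 0 < s → volume {x | ofReal s < ‖f x‖ₑ} ≤ N s := fun s hs =>
    hZ.volume_lt_le hZm h10 (by linarith) h20 (by linarith) hs (volume_lt_ne_top hf hs)
  have hNt : ∀ s : ℝ, 0 < s → N s ≠ ⊤ := fun s hs => by finiteness
  -- the part of `f` above height `s`
  have hint : ∀ s : ℝ, 0 < s →
      ∫⁻ x in {x | ofReal s < ‖f x‖ₑ}, ‖f x‖ₑ ≤ ofReal s * N s := by
    intro s hs
    have hs0 : ofReal s ≠ 0 := by simpa using hs
    refine (hZ _ (measurableSet_lt measurable_const hZm) (volume_lt_ne_top hf hs)).trans ?_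
    have key : ∀ (θ : ℝ) (K : ℝ≥0∞), 0 < θ → θ < 1 →
        (2 * K / ofReal s) ^ (1 / (1 - θ)) ≤ N s →
        K * volume {x | ofReal s < ‖f x‖ₑ} ^ θ ≤ 2⁻¹ * (ofReal s * N s) := by
      intro θ K hθ0 hθ1 hK
      rcases eq_or_ne (N s) 0 with h0 | h0
      · have : volume {x | ofReal s < ‖f x‖ₑ} = 0 := le_antisymm (h0 ▸ hvol s hs) bot_le
        simp [*]
      have h1 : 2 * K ≤ ofReal s * N s ^ (1 - θ) := by
        have h2 := rpow_le_rpow hK (z := 1 - θ) (by linarith)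
        rw [← rpow_mul, one_div_mul_cancel (by linarith), rpow_one,
          div_le_iff hs0 ofReal_ne_top, mul_comm (N s ^ _)] at h2
        exact h2
      calc K * volume {x | ofReal s < ‖f x‖ₑ} ^ θ ≤ K * N s ^ θ := by
            gcongr; exact hvol s hs
        _ = 2⁻¹ * (2 * K) * N s ^ θ := by
            rw [← mul_assoc, ENNReal.inv_mul_cancel (by norm_num) (by norm_num), one_mul]
        _ ≤ 2⁻¹ * (ofReal s * N s ^ (1 - θ)) * N s ^ θ := by gcongr
        _ = 2⁻¹ * (ofReal s * (N s ^ (1 - θ) * N s ^ θ)) := by ring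
        _ = _ := by
            rw [← rpow_add _ _ h0 (hNt s hs)]; simp
    have := add_le_add (key θ₁ K₁ h10 (by linarith) (le_add_right le_rfl))
      (key θ₂ K₂ h20 (by linarith) (le_add_left le_rfl))
    refine this.trans_eq ?_
    rw [← two_mul, ← mul_assoc, ENNReal.mul_inv_cancel (by norm_num) (by norm_num), one_mul]
  have hpow : ∀ (X : ℝ≥0∞) {p : ℝ}, 1 < p → X ^ p = X * X ^ (p - 1) := fun X p hp => by
    conv_lhs => rw [← add_sub_cancel 1 p, rpow_add_of_nonneg _ _ zero_le_one (by linarith), rpow_one]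
  -- the part of `f` below height `s`
  have hlow : ∀ s : ℝ, 0 < s → ∫⁻ x in {x | ‖f x‖ₑ ≤ ofReal s}, ‖f x‖ₑ ^ 2
      ≤ (ofReal (1 / (2 - p₁)) + ofReal (1 / (2 - p₂)))
        * (ofReal s ^ 2 * N s) := by
    intro s hs
    have hs0 : ofReal s ≠ 0 := by simpa using hs
    have hms : MeasurableSet {x | ‖f x‖ₑ ≤ ofReal s} := measurableSet_le hZm measurable_const
    set w : R4 → ℝ≥0∞ := {x | ‖f x‖ₑ ≤ ofReal s}.indicator fun x => ‖f x‖ₑ with hw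
    have hwm : Measurable w := hZm.indicator hms
    have hwle : ∀ x, w x ≤ ofReal s := indicator_le fun x hx => hx
    have e1 : ∫⁻ x in {x | ‖f x‖ₑ ≤ ofReal s}, ‖f x‖ₑ ^ 2 = ∫⁻ x, ‖f x‖ₑ * w x := by
      rw [← lintegral_indicator hms]
      congr with x; by_cases hx : ‖f x‖ₑ ≤ ofReal s <;> simp [hw, hx, sq]
    rw [e1, lintegral_mul_eq_layer _ hZm hwm]
    have hms' : MeasurableSet {τ : ℝ | 0 < τ ∧ ofReal τ < ofReal s} :=
      measurableSet_Ioi.inter (measurableSet_lt measurable_ofReal measurable_const)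
    have hpt : ∀ τ ∈ Ioi (0 : ℝ), ∫⁻ x in {x | ofReal τ < w x}, ‖f x‖ₑ
        ≤ {τ : ℝ | 0 < τ ∧ ofReal τ < ofReal s}.indicator (fun τ =>
          2 * K₁ * (2 * K₁ / ofReal τ) ^ (p₁ - 1)
            + 2 * K₂ * (2 * K₂ / ofReal τ) ^ (p₂ - 1)) τ := by
      intro τ hτ
      have hτ0 : ofReal τ ≠ 0 := by simpa using hτ
      by_cases h : ofReal τ < ofReal s
      · rw [indicator_of_mem (by exact ⟨hτ, h⟩)]
        refine (lintegral_mono_set (t := {x | ofReal τ < ‖f x‖ₑ}) fun x hx => by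
          rw [mem_ofPred_eq] at hx ⊢; exact hx.trans_le (indicator_le_self _ _ _)).trans ((hint τ hτ).trans_eq ?_)
        have e2 : ∀ K : ℝ≥0∞, ofReal τ * (2 * K / ofReal τ) = 2 * K := fun K =>
          ENNReal.mul_div_cancel hτ0 ofReal_ne_top
        rw [hN, mul_add, hpow _ hp1, hpow _ hp2, ← mul_assoc, e2, ← mul_assoc, e2]
      · have : {x | ofReal τ < w x} = ∅ := by
          ext x; simpa using (hwle x).trans (not_lt.1 h)
        simp [this]
    refine (setLIntegral_mono (Measurable.indicator (by fun_prop) hms') hpt).trans ?_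
    rw [lintegral_indicator hms', Measure.restrict_restrict hms',
      show {τ : ℝ | 0 < τ ∧ ofReal τ < ofReal s} ∩ Ioi 0
        = {τ : ℝ | 0 < τ ∧ ofReal τ < ofReal s} from
        inter_eq_left.2 fun τ hτ => hτ.1,
      lintegral_add_left (by fun_prop), lintegral_const_mul _ (by fun_prop),
      lintegral_const_mul _ (by fun_prop)]
    have e3 : ∀ (K : ℝ≥0∞) (p : ℝ), 1 < p → p < 2 → K ≠ ⊤ →
        2 * K * ∫⁻ τ in {τ : ℝ | 0 < τ ∧ ofReal τ < ofReal s},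
          (2 * K / ofReal τ) ^ (p - 1)
        ≤ ofReal (1 / (2 - p))
          * (ofReal s ^ 2 * (2 * K / ofReal s) ^ p) := by
      intro K p h1 h2 hK
      have h3 := lintegral_Ioc_div_rpow_le (q := p - 1) (by linarith) (by linarith) (2 * K)
        (ofReal s)
      refine (mul_le_mul_right h3 _).trans_eq ?_
      rw [show 1 - (p - 1) = 2 - p by ring, ENNReal.div_rpow_of_nonneg _ _ (by linarith : 0 ≤ p),
        ENNReal.rpow_sub _ _ hs0 ofReal_ne_top, hpow (2 * K) h1, ENNReal.rpow_two]
      simp only [div_eq_mul_inv]; ring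
    refine (add_le_add (e3 K₁ p₁ hp1 hp1' hK₁) (e3 K₂ p₂ hp2 hp2' hK₂)).trans ?_
    rw [add_mul]; bound
  -- the distribution function of `cv k f`
  have hdist : ∀ s : ℝ, 0 < s → volume {x | ofReal s < ‖cv k f x‖ₑ} ≤ L * N s := by
    intro s hs
    have hs0 : ofReal s ≠ 0 := by simpa using hs
    have hms : MeasurableSet {x | ‖f x‖ₑ ≤ ofReal s} := measurableSet_le hZm measurable_const
    set U := {x | ‖f x‖ₑ ≤ ofReal s} with hU
    have hUc : Uᶜ = {x | ofReal s < ‖f x‖ₑ} := by ext x; simp [hU]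
    set g := U.indicator f with hg
    set b := Uᶜ.indicator f with hb
    have hgm : Measurable g := hfm.indicator hms
    have hbm : Measurable b := hfm.indicator hms.compl
    have hgI : Integrable g := hf.indicator hms
    have hbI : Integrable b := hf.indicator hms.compl
    have hg2 : ∫⁻ x, ‖g x‖ₑ ^ 2 = ∫⁻ x in U, ‖f x‖ₑ ^ 2 := by
      rw [← lintegral_indicator hms]
      congr with x; by_cases hx : x ∈ U <;> simp [hg, hx]
    have hb1 : ∫⁻ x, ‖b x‖ₑ = ∫⁻ x in Uᶜ, ‖f x‖ₑ := by
      simp_rw [hb, enorm_indicator_eq_indicator_enorm, lintegral_indicator hms.compl]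
    have hg2' := hlow s hs
    rw [← hU, ← hg2] at hg2'
    have hb1' := hint s hs
    rw [← hUc, ← hb1] at hb1'
    have hgL : MemLp g 2 := by
      refine ⟨hgm.aestronglyMeasurable, ?_⟩
      rw [eLpNorm_lt_top_iff_lintegral_rpow_enorm_lt_top (by norm_num) (by norm_num)]
      norm_num
      have := hNt s hs
      exact hg2'.trans_lt (by finiteness)
    have e1 : (ofReal s)⁻¹ * ofReal s = 1 := ENNReal.inv_mul_cancel hs0 ofReal_ne_top
    have v1 : 4 / ofReal s ^ 2 * ∫⁻ x, ‖cv k g x‖ₑ ^ 2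
        ≤ 4 * A * (ofReal (1 / (2 - p₁)) + ofReal (1 / (2 - p₂))) * N s := by
      refine (mul_le_mul_right ((hL2 g hgm hgI hgL).trans (mul_le_mul_right hg2' _)) _).trans_eq ?_
      rw [div_eq_mul_inv, ENNReal.inv_pow]
      calc _ = 4 * A * (ofReal (1 / (2 - p₁)) + ofReal (1 / (2 - p₂))) * N s
            * ((ofReal s)⁻¹ * ofReal s) ^ 2 := by ring
        _ = _ := by rw [e1, one_pow, mul_one]
    have v2 : volume {x | ofReal (s / 2) < ‖cv k b x‖ₑ} ≤ 2 * W * N s := by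
      refine (hW b hbm hbI (s / 2) (by linarith)).trans ((mul_le_mul_right hb1' _).trans_eq ?_)
      rw [ENNReal.ofReal_div_of_pos two_pos, div_eq_mul_inv, ENNReal.inv_div (by simp) (by simp),
        ENNReal.ofReal_ofNat, div_eq_mul_inv]
      calc _ = 2 * W * N s * ((ofReal s)⁻¹ * ofReal s) := by ring
        _ = _ := by rw [e1, mul_one]
    refine (volume_lt_cv_le_add hk hM hgI hbI
      (fun y => (congrFun (indicator_self_add_compl U f) y).symm) hs).trans
      ((add_le_add v1 v2).trans_eq ?_)
    rw [hL]
    push_cast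
    rw [ofReal, ofReal]; ring
  intro E hE hfE
  have hcm : Measurable fun x => ‖cv k f x‖ₑ :=
    (continuous_cv hk hM hf).measurable.enorm
  have e1 : ∫⁻ x in E, ‖cv k f x‖ₑ
      = ∫⁻ x, E.indicator 1 x * ‖cv k f x‖ₑ := by
    rw [← lintegral_indicator hE]
    congr with x; by_cases hx : x ∈ E <;> simp [hx]
  rw [e1, lintegral_mul_eq_layer _ (measurable_one.indicator hE) hcm]
  set D : ℝ → ℝ≥0∞ → ℝ → ℝ≥0∞ := fun p K s =>
    min (volume E) (((L ^ (1 / p) : ℝ≥0) * (2 * K) / ofReal s) ^ p) with hD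
  have hDm : ∀ p K, Measurable (D p K) := fun p K => by fun_prop
  have hDeq : ∀ (p : ℝ) (K : ℝ≥0∞) (s : ℝ), 1 < p → ((L ^ (1 / p) : ℝ≥0) * (2 * K) / ofReal s : ℝ≥0∞) ^ p
      = L * (2 * K / ofReal s) ^ p := by
    intro p K s hp
    rw [mul_div_assoc, mul_rpow_of_nonneg _ _ (by linarith), ← coe_rpow_of_nonneg _
      (by linarith), ← NNReal.rpow_mul, one_div_mul_cancel (by linarith), NNReal.rpow_one]
  have hpt : ∀ s ∈ Ioi (0 : ℝ), ∫⁻ x in {x | ofReal s < ‖cv k f x‖ₑ},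
      E.indicator 1 x ≤ D p₁ K₁ s + D p₂ K₂ s := by
    intro s hs
    rw [lintegral_indicator_one hE]
    have h1 : (volume.restrict {x | ofReal s < ‖cv k f x‖ₑ}) E
        ≤ volume E := Measure.restrict_apply_le _ _
    have h2 : (volume.restrict {x | ofReal s < ‖cv k f x‖ₑ}) E
        ≤ L * N s := by
      rw [Measure.restrict_apply hE]
      exact (measure_mono inter_subset_right).trans (hdist s hs)
    have h3 : L * N s = L * (2 * K₁ / ofReal s) ^ p₁
        + L * (2 * K₂ / ofReal s) ^ p₂ := mul_add _ _ _
    rw [h3] at h2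
    rw [hD]
    simp only [hDeq _ _ _ hp1, hDeq _ _ _ hp2]
    rcases le_total (volume E) (L * (2 * K₁ / ofReal s) ^ p₁) with h4 | h4
    · rw [min_eq_left h4]; exact le_add_right h1
    rcases le_total (volume E) (L * (2 * K₂ / ofReal s) ^ p₂) with h5 | h5
    · rw [min_eq_left h5]; exact le_add_left h1
    · rw [min_eq_right h4, min_eq_right h5]; exact h2
  refine (setLIntegral_mono ((hDm _ _).add (hDm _ _)) hpt).trans ?_
  simp only [Pi.add_apply]
  rw [lintegral_add_left (hDm _ _)]
  have hfin : ∀ θ K, 0 < θ → θ < 1 / 2 → C (1 / (1 - θ)) ≤ max (C p₁) (C p₂) →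
      ∫⁻ s in Ioi (0 : ℝ), D (1 / (1 - θ)) K s
        ≤ (max (C p₁) (C p₂) : ℝ≥0) * K * volume E ^ θ := by
    intro θ K h0 h1 hCle
    obtain ⟨q1, q2⟩ := hp θ h0 h1
    have := lintegral_min_rpow_le (p := 1 / (1 - θ)) (θ := 1) (by linarith) (by linarith) hfE
      (D (1 / (1 - θ)) K) (fun s _ => min_le_left _ _) (fun s _ => min_le_right _ _)
    simp only [rpow_one] at this
    refine this.trans ?_
    have e2 : 1 - 1 / (1 / (1 - θ)) = θ := by rw [one_div_one_div]; ring
    have e3 : ofReal (1 + 1 / (1 / (1 - θ) * 1 - 1))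
        * ((L ^ (1 / (1 / (1 - θ))) : ℝ≥0) * (2 * K)) = (C (1 / (1 - θ)) : ℝ≥0) * K := by
      rw [hC]; push_cast; rw [ofReal]; ring
    rw [e2, e3]; gcongr
  bound

/-- The kernels `regKer₂` satisfy Hörmander's condition, uniformly in the regularization. -/
theorem enorm_regKer₂_sub_le {h : ℝ} (hh : 0 < h) (i j : Fin 4) {z w : R4}
    (hw : 2 * ‖w‖ ≤ ‖z‖) :
    ‖regKer₂ h i j (z - w) - regKer₂ h i j z‖ₑ ≤ (9216 : ℝ≥0) * ‖w‖ₑ * (‖z‖ₑ⁻¹) ^ 5 := by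
  rcases eq_or_ne z 0 with rfl | hz
  · have : w = 0 := by
      rw [norm_zero] at hw
      exact norm_le_zero_iff.1 (by linarith)
    bound
  have hz' : 0 < ‖z‖ := norm_pos_iff.2 hz
  have hD : ∀ y ∈ closedBall z (‖z‖ / 2),
      ‖fderiv ℝ (regKer₂ h i j) y‖ ≤ 9216 * (‖z‖⁻¹) ^ 5 := by
    intro y hy
    have hy1 : ‖z‖ / 2 ≤ ‖y‖ := by
      have h1 : ‖z‖ ≤ ‖y‖ + ‖z - y‖ := by
        calc ‖z‖ = ‖y + (z - y)‖ := by rw [add_sub_cancel]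
          _ ≤ _ := norm_add_le _ _
      have h2 := mem_closedBall_iff_norm'.1 hy
      linarith
    have hy0 : 0 < ‖y‖ := by linarith
    refine (norm_fderiv_le_sum _).trans ?_
    have hk : ∀ k, |fderiv ℝ (regKer₂ h i j) y (e k)| ≤ 2304 * (‖z‖⁻¹) ^ 5 := by
      intro k
      have e1 : fderiv ℝ (regKer₂ h i j) y (e k) = regKer₃ h i j k y :=
        congrFun (pd_regKer₂ hh i j k) y
      rw [e1]
      have hq : regKer h y ≤ (‖y‖⁻¹) ^ 2 := by
        rw [regKer, inv_pow]; bound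
      have hq0 := (regKer_pos hh y).le
      calc |regKer₃ h i j k y| ≤ 72 * ‖y‖ * regKer h y ^ 3 := abs_regKer₃_le hh y i j k
        _ ≤ 72 * ‖y‖ * ((‖y‖⁻¹) ^ 2) ^ 3 := by gcongr
        _ = 72 * (‖y‖⁻¹) ^ 5 := by field_simp
        _ ≤ 72 * ((‖z‖ / 2)⁻¹) ^ 5 := by gcongr
        _ = _ := by ring
    calc ∑ k, |fderiv ℝ (regKer₂ h i j) y (e k)| ≤ ∑ _k : Fin 4, 2304 * (‖z‖⁻¹) ^ 5 :=
          sum_le_sum fun k _ => hk k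
      _ = _ := by simp; ring
  have key := (convex_closedBall z (‖z‖ / 2)).norm_image_sub_le_of_norm_fderiv_le
    (f := regKer₂ h i j) (𝕜 := ℝ)
    (fun y _ => (contDiff_regKer₂ hh i j (n := 1)).differentiable (by norm_num) y) hD
    (Metric.mem_closedBall_self (by linarith)) (y := z - w) (by
      rw [mem_closedBall_iff_norm, sub_sub_cancel_left, norm_neg]; linarith)
  rw [sub_sub_cancel_left, norm_neg] at key
  rw [← ofReal_norm, ← ofReal_norm w, ← ofReal_norm z, ← ofReal_inv_of_pos hz',
    ← ofReal_pow (by positivity),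
    show ((9216 : ℝ≥0) : ℝ≥0∞) = ofReal 9216 by simp,
    ← ofReal_mul (by norm_num), ← ofReal_mul (by positivity)]
  bound

/-- The regularized Calderón–Zygmund operators preserve the bounds `SetBound` with exponents in
`(0, 1/2)`, uniformly in the regularization. -/
theorem SetBound.regCZ {θ₁ θ₂ : ℝ} (h10 : 0 < θ₁) (h11 : θ₁ < 1 / 2) (h20 : 0 < θ₂)
    (h21 : θ₂ < 1 / 2) :
    ∃ C : ℝ≥0, ∀ {K₁ K₂ : ℝ≥0∞} {h : ℝ} {G : Fin 4 → R4 → ℝ} (j : Fin 4), 0 < h → h ≤ 1 →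
      (∀ i, Measurable (G i)) → (∀ i, Integrable (G i)) → K₁ ≠ ⊤ → K₂ ≠ ⊤ →
      (∀ i, SetBound θ₁ θ₂ K₁ K₂ (fun x => ‖G i x‖ₑ)) →
      SetBound θ₁ θ₂ (C * K₁) (C * K₂) (fun x => ‖regCZ h j G x‖ₑ) := by
  set A : ℝ≥0 := toNNReal kerMass ^ 2 with hA
  set W : ℝ≥0 := 64 * A + 256 * ballVol + 20 * 9216 * ballVol with hW
  obtain ⟨C, hC⟩ := SetBound.convolution h10 h11 h20 h21 A W
  refine ⟨4 * C, ?_⟩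
  intro K₁ K₂ h G j hh h1 hGm hG hK₁ hK₂ hZ
  obtain ⟨M, M0, M1, M2, M3, M4, M5⟩ := exists_bound_regKer hh
  have hk : ∀ i, Continuous (regKer₂ h i j) := fun i =>
    (contDiff_regKer₂ hh i j (n := 0)).continuous
  have hL2 : ∀ i, ∀ f : R4 → ℝ, Measurable f → Integrable f → MemLp f 2 →
      ∫⁻ x, ‖cv (regKer₂ h i j) f x‖ₑ ^ 2 ≤ A * ∫⁻ x, ‖f x‖ₑ ^ 2 := by
    intro i f hfm hf hf2
    have h2 := lintegral_regCZ_sq_le hh h1 (F := fun l => if l = i then f else 0)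
      (fun l => by by_cases hl : l = i <;> simp [hl, hfm, measurable_zero])
      (fun l => by by_cases hl : l = i <;> simp [hl, hf])
      (fun l => by by_cases hl : l = i <;> simp [hl, hf2]) j
    have e1 : ∀ x, BiharmonicSphere.regCZ h j (fun l => if l = i then f else 0) x
        = cv (regKer₂ h i j) f x := by
      intro x
      rw [BiharmonicSphere.regCZ, Finset.sum_eq_single i]
      · simp
      · intro l _ hl
        simp [hl, cv]
      · simp
    simp_rw [e1] at h2
    refine h2.trans_eq ?_
    rw [Finset.sum_eq_single i, if_pos rfl, hA, ENNReal.coe_pow, ofReal]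
    · intro l _ hl
      simp [hl]
    · simp
  have hi : ∀ i, SetBound θ₁ θ₂ (C * K₁) (C * K₂) (fun x => ‖cv (regKer₂ h i j) (G i) x‖ₑ) := by
    intro i
    refine hC (hk i) (M2 i j) (hL2 i) ?_ (hGm i) (hG i) hK₁ hK₂ (hZ i)
    intro f hfm hf s hs
    have := volume_lt_cv_le (hk i) (M2 i j) (A := A) (A₀ := 9216) (hL2 i)
      (fun z w hw => enorm_regKer₂_sub_le hh i j hw) hfm hf hs
    bound
  have hs := SetBound.sum Finset.univ (fun i _ => hi i) fun i =>
    (continuous_cv (hk i) (M2 i j) (hG i)).measurable.enorm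
  refine (hs.mono_fun (.of_forall fun x => ?_)).mono ?_ ?_
  · exact enorm_sum_le _ _
  · simp [mul_assoc]
  · simp [mul_assoc]

/-! ### Mollification in `Lᵖ` -/

theorem eLpNorm_cv_mollKer_le {p q : ℝ} (hpq : p.HolderConjugate q) (n : ℕ) {f : R4 → ℝ}
    (hf : Measurable f) :
    eLpNorm (cv (mollKer n) f) (ofReal p) volume ≤ eLpNorm f (ofReal p) volume := by
  have hp := hpq.pos
  rw [eLpNorm_eq_lintegral_rpow_enorm_toReal (by simpa using hp) (by simp),
    eLpNorm_eq_lintegral_rpow_enorm_toReal (by simpa using hp) (by simp), toReal_ofReal hp.le]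
  gcongr ?_ ^ _
  have h1 := lintegral_cv_rpow_le hpq (contDiff_mollKer n (m := 0)).continuous.measurable hf
  have h2 : ∫⁻ z, ‖mollKer n z‖ₑ = 1 := by
    rw [← ofReal_integral_norm_eq_lintegral_enorm (integrable_mollKer n)]
    simp_rw [norm_eq_abs, abs_of_nonneg (mollKer_nonneg n _)]
    rw [integral_mollKer, ENNReal.ofReal_one]
  simp_all

theorem exists_bound_mollKer (n : ℕ) : ∃ M, ∀ z, |mollKer n z| ≤ M :=
  exists_abs_le_of_hasCompactSupport (contDiff_mollKer n (m := 0)).continuous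
    (hasCompactSupport_mollKer n)

theorem continuous_mollKer (n : ℕ) : Continuous (mollKer n) :=
  (contDiff_mollKer n (m := 0)).continuous

theorem cv_add {k : R4 → ℝ} (hk : Continuous k) {M : ℝ} (hM : ∀ z, |k z| ≤ M) {f g : R4 → ℝ}
    (hf : Integrable f) (hg : Integrable g) (x : R4) :
    cv k (f + g) x = cv k f x + cv k g x := by
  rw [cv, cv, cv, ← integral_add (integrable_cv hk hM hf x) (integrable_cv hk hM hg x)]
  simp only [Pi.add_apply, mul_add]

theorem tendsto_eLpNorm_cv_mollKer_of_continuous {p : ℝ} (hp : 0 < p) {g : R4 → ℝ}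
    (hg : Continuous g) (hc : HasCompactSupport g) :
    Tendsto (fun n => eLpNorm (cv (mollKer n) g - g) (ofReal p) volume) atTop (𝓝 0) := by
  obtain ⟨M, hM⟩ := exists_abs_le_of_hasCompactSupport hg hc
  have hM0 : 0 ≤ M := (abs_nonneg _).trans (hM 0)
  have hgi : Integrable g := hg.integrable_of_hasCompactSupport hc
  set K : Set R4 := cthickening 1 (tsupport g) with hK
  have hKc : IsCompact K := hc.isCompact.cthickening
  have hlim : Tendsto (fun n => ∫⁻ x, ‖(cv (mollKer n) g - g) x‖ₑ ^ p) atTop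
      (𝓝 (∫⁻ _x : R4, 0)) := by
    refine tendsto_lintegral_of_dominated_convergence
      (K.indicator fun _ => ofReal (2 * M) ^ p) (fun n => ?_) (fun n => ?_) ?_ ?_
    · have := continuous_cv (continuous_mollKer n) (exists_bound_mollKer n).choose_spec hgi
      fun_prop
    · refine Eventually.of_forall fun x => ?_
      by_cases hx : x ∈ K
      · rw [indicator_of_mem hx]
        refine rpow_le_rpow ?_ hp.le
        rw [← ofReal_norm]
        refine ofReal_le_ofReal ?_
        have h1 := abs_cv_mollKer_le (n := n) (.of_forall hM) x
        have h2 := hM x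
        calc ‖cv (mollKer n) g x - g x‖ ≤ |cv (mollKer n) g x| + |g x| := norm_sub_le _ _
          _ ≤ 2 * M := by linarith
      · have hgx : g x = 0 := by
          by_contra h
          exact hx (Metric.self_subset_cthickening _ (subset_tsupport _ h))
        have h1 : cv (mollKer n) g x = 0 := by
          refine cv_mollKer_eq_zero fun y hy => ?_
          by_contra h
          push Not at h
          refine hx (Metric.mem_cthickening_of_dist_le x y 1 _ (subset_tsupport _ hy) ?_)
          refine h.le.trans ?_
          bound
        simp [h1, hgx, hp]
    · rw [lintegral_indicator hKc.measurableSet, setLIntegral_const]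
      exact mul_ne_top (rpow_ne_top_of_nonneg hp.le ofReal_ne_top)
        hKc.measure_lt_top.ne
    · filter_upwards [ae_tendsto_cv_mollKer hgi.locallyIntegrable] with x hx
      have h1 : Tendsto (fun n => ‖cv (mollKer n) g x - g x‖ₑ ^ p) atTop (𝓝 (‖g x - g x‖ₑ ^ p)) :=
        ((hx.sub_const _).enorm).ennrpow_const p
      simp_all
  have h2 := hlim.ennrpow_const (1 / p)
  simp only [lintegral_zero, zero_rpow_of_pos (one_div_pos.2 hp)] at h2
  refine h2.congr fun n => ?_
  rw [eLpNorm_eq_lintegral_rpow_enorm_toReal (by simpa using hp) (by simp),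
    toReal_ofReal hp.le]

theorem tendsto_eLpNorm_cv_mollKer {p q : ℝ} (hpq : p.HolderConjugate q) {f : R4 → ℝ}
    (hfm : Measurable f) (hf : Integrable f) (hfp : MemLp f (ofReal p)) :
    Tendsto (fun n => eLpNorm (cv (mollKer n) f - f) (ofReal p) volume) atTop (𝓝 0) := by
  have hp1 : 1 ≤ ofReal p := by
    rw [ENNReal.one_le_ofReal]; exact hpq.lt.le
  rw [ENNReal.tendsto_atTop_zero]
  intro ε hε
  have hε3 : ε / 3 ≠ 0 := by simpa using hε.ne'
  obtain ⟨g, hgc, hfg, hgcont, hgp⟩ :=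
    hfp.exists_hasCompactSupport_eLpNorm_sub_le ofReal_ne_top hε3
  have hgi : Integrable g := hgcont.integrable_of_hasCompactSupport hgc
  obtain ⟨N, hN⟩ := (ENNReal.tendsto_atTop_zero.1
    (tendsto_eLpNorm_cv_mollKer_of_continuous hpq.pos hgcont hgc)) (ε / 3) (pos_iff_ne_zero.2 hε3)
  refine ⟨N, fun n hn => ?_⟩
  obtain ⟨M, hM⟩ := exists_bound_mollKer n
  have hcm : ∀ {F : R4 → ℝ}, Integrable F → AEStronglyMeasurable (cv (mollKer n) F) volume :=
    fun hF => (continuous_cv (continuous_mollKer n) hM hF).aestronglyMeasurable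
  have e1 : cv (mollKer n) f - f = cv (mollKer n) (f - g) + ((cv (mollKer n) g - g) + (g - f)) := by
    ext x
    have : cv (mollKer n) f x = cv (mollKer n) (f - g) x + cv (mollKer n) g x := by
      rw [← cv_add (continuous_mollKer n) hM (hf.sub hgi) hgi, sub_add_cancel]
    simp only [Pi.sub_apply, Pi.add_apply, this]; ring
  rw [e1]
  have h3 : ε / 3 + (ε / 3 + ε / 3) = ε := by rw [← add_assoc, ENNReal.add_thirds]
  refine (eLpNorm_add_le (hcm (hf.sub hgi)) (((hcm hgi).sub hgcont.aestronglyMeasurable).add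
    (hgcont.aestronglyMeasurable.sub hf.1)) hp1).trans ((add_le_add ?_ ((eLpNorm_add_le
      ((hcm hgi).sub hgcont.aestronglyMeasurable)
      (hgcont.aestronglyMeasurable.sub hf.1) hp1).trans (add_le_add (hN n hn) ?_))).trans_eq h3)
  · exact (eLpNorm_cv_mollKer_le hpq n (hfm.sub hgcont.measurable)).trans hfg
  · rwa [eLpNorm_sub_comm]

theorem lintegral_enorm_mul_le {p q : ℝ} (hpq : p.HolderConjugate q) {f h : R4 → ℝ}
    (hf : AEStronglyMeasurable f volume) (hh : AEStronglyMeasurable h volume) :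
    ∫⁻ x, ‖h x * f x‖ₑ
      ≤ eLpNorm h (ofReal q) volume * eLpNorm f (ofReal p) volume := by
  have hp := hpq.pos
  have hq := hpq.symm.pos
  rw [eLpNorm_eq_lintegral_rpow_enorm_toReal (by simpa using hq) (by simp),
    eLpNorm_eq_lintegral_rpow_enorm_toReal (by simpa using hp) (by simp), toReal_ofReal hp.le,
    toReal_ofReal hq.le]
  simp_rw [enorm_mul]
  exact ENNReal.lintegral_mul_le_Lp_mul_Lq volume hpq.symm hh.enorm hf.enorm

theorem integrable_mul_of_memLp {p q : ℝ} (hpq : p.HolderConjugate q) {f h : R4 → ℝ}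
    (hf : MemLp f (ofReal p)) (hh : MemLp h (ofReal q)) :
    Integrable fun x => h x * f x :=
  ⟨hh.1.mul hf.1, (lintegral_enorm_mul_le hpq hf.1 hh.1).trans_lt (mul_lt_top hh.2 hf.2)⟩

theorem memLp_cv_mollKer {p q : ℝ} (hpq : p.HolderConjugate q) (n : ℕ) {f : R4 → ℝ}
    (hfm : Measurable f) (hf : Integrable f) (hfp : MemLp f (ofReal p)) :
    MemLp (cv (mollKer n) f) (ofReal p) :=
  ⟨(continuous_cv (continuous_mollKer n) (exists_bound_mollKer n).choose_spec
    hf).aestronglyMeasurable, (eLpNorm_cv_mollKer_le hpq n hfm).trans_lt hfp.2⟩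

/-- Integrable functions `F n` whose integrals converge to the integral of the integrable function
`G`. -/
structure TendstoIntegral (F : ℕ → R4 → ℝ) (G : R4 → ℝ) : Prop where
  integrable : ∀ n, Integrable (F n)
  integrable_lim : Integrable G
  tendsto : Tendsto (fun n => ∫ x, F n x) atTop (𝓝 (∫ x, G x))

namespace TendstoIntegral

variable {F F' : ℕ → R4 → ℝ} {G G' : R4 → ℝ}

theorem add (h : TendstoIntegral F G) (h' : TendstoIntegral F' G') :
    TendstoIntegral (fun n x => F n x + F' n x) fun x => G x + G' x :=
  ⟨fun n => (h.integrable n).add (h'.integrable n), h.integrable_lim.add h'.integrable_lim, by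
    simp_rw [integral_add (h.integrable _) (h'.integrable _),
      integral_add h.integrable_lim h'.integrable_lim]
    exact h.tendsto.add h'.tendsto⟩

theorem sum {F : Fin 4 → ℕ → R4 → ℝ} {G : Fin 4 → R4 → ℝ}
    (h : ∀ i, TendstoIntegral (F i) (G i)) :
    TendstoIntegral (fun n x => ∑ i, F i n x) fun x => ∑ i, G i x := by
  simp only [Fin.sum_univ_four]
  exact (((h 0).add (h 1)).add (h 2)).add (h 3)

theorem congr (h : TendstoIntegral F G) (hF : ∀ n x, F n x = F' n x) (hG : ∀ x, G x = G' x) :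
    TendstoIntegral F' G' := by
  obtain rfl : F = F' := funext fun n => funext (hF n)
  obtain rfl : G = G' := funext hG
  exact h

end TendstoIntegral

theorem tendstoIntegral_mul_cv_mollKer {p q : ℝ} (hpq : p.HolderConjugate q) {f h : R4 → ℝ}
    (hfm : Measurable f) (hf : Integrable f) (hfp : MemLp f (ofReal p))
    (hh : MemLp h (ofReal q)) :
    TendstoIntegral (fun n x => h x * cv (mollKer n) f x) fun x => h x * f x := by
  have hm := fun n => memLp_cv_mollKer hpq n hfm hf hfp
  have hi := fun n => integrable_mul_of_memLp hpq (hm n) hh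
  have hi' := integrable_mul_of_memLp hpq hfp hh
  refine ⟨hi, hi', ?_⟩
  rw [tendsto_iff_edist_tendsto_0]
  have h1 : Tendsto (fun n => eLpNorm h (ofReal q) volume
      * eLpNorm (cv (mollKer n) f - f) (ofReal p) volume) atTop
      (𝓝 (eLpNorm h (ofReal q) volume * 0)) :=
    ENNReal.Tendsto.const_mul (tendsto_eLpNorm_cv_mollKer hpq hfm hf hfp) (Or.inr hh.2.ne)
  rw [mul_zero] at h1
  refine tendsto_of_tendsto_of_tendsto_of_le_of_le tendsto_const_nhds h1 (fun _ => bot_le)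
    fun n => ?_
  simp only
  rw [edist_eq_enorm_sub, ← integral_sub (hi n) hi']
  refine (enorm_integral_le_lintegral_enorm _).trans (le_trans (le_of_eq ?_)
    (lintegral_enorm_mul_le hpq ((hm n).1.sub hfp.1) hh.1))
  simp [mul_sub]

theorem tendstoIntegral_mul_cv_mollKer_of_le {f h : R4 → ℝ} (hf : Integrable f) {M : ℝ}
    (hM : ∀ x, |f x| ≤ M) (hh : Integrable h) :
    TendstoIntegral (fun n x => h x * cv (mollKer n) f x) fun x => h x * f x := by
  have hm := fun n => (continuous_cv (continuous_mollKer n) (exists_bound_mollKer n).choose_spec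
    hf).aestronglyMeasurable (μ := volume)
  have hb := fun n x => abs_cv_mollKer_le (n := n) (.of_forall hM) x
  refine ⟨fun n => hh.mul_bdd (hm n) (.of_forall (hb n)), hh.mul_bdd hf.1 (.of_forall hM),
    tendsto_integral_of_dominated_convergence (fun x => |h x| * M) (fun n => hh.1.mul (hm n))
      (hh.abs.mul_const M) (fun n => .of_forall fun x => ?_) ?_⟩
  · rw [norm_mul, norm_eq_abs, norm_eq_abs]; bound
  · filter_upwards [ae_tendsto_cv_mollKer hf.locallyIntegrable] with x hx
    exact hx.const_mul _

/-! ### Weak partial derivatives of scalar functions -/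

/-- Smooth functions with compact support in `Ω`. -/
structure IsTest (Ω : Set R4) (φ : R4 → ℝ) : Prop where
  contDiff : ContDiff ℝ ∞ φ
  hasCompactSupport : HasCompactSupport φ
  tsupport_subset : tsupport φ ⊆ Ω

theorem contDiff_pd {φ : R4 → ℝ} (hφ : ContDiff ℝ ∞ φ) (i : Fin 4) :
    ContDiff ℝ ∞ (pd i φ) :=
  (hφ.fderiv_right (m := ∞) (by simp)).clm_apply contDiff_const

theorem tsupport_pd_subset (φ : R4 → ℝ) (i : Fin 4) : tsupport (pd i φ) ⊆ tsupport φ :=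
  tsupport_fderiv_apply_subset ℝ (e i)

namespace IsTest

variable {Ω : Set R4} {φ ψ : R4 → ℝ}

theorem continuous (h : IsTest Ω φ) : Continuous φ := h.contDiff.continuous

theorem pd (h : IsTest Ω φ) (i : Fin 4) : IsTest Ω (pd i φ) :=
  ⟨contDiff_pd h.contDiff i, h.hasCompactSupport.mono' (subset_tsupport _ |>.trans
    (tsupport_pd_subset φ i)), (tsupport_pd_subset φ i).trans h.tsupport_subset⟩

theorem mul_right (h : IsTest Ω φ) (hψ : ContDiff ℝ ∞ ψ) : IsTest Ω fun x => φ x * ψ x :=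
  ⟨h.contDiff.mul hψ, h.hasCompactSupport.mul_right,
    (tsupport_mul_subset_left (f := φ) (g := ψ)).trans h.tsupport_subset⟩

theorem exists_bound (h : IsTest Ω φ) : ∃ M, ∀ x, |φ x| ≤ M :=
  exists_abs_le_of_hasCompactSupport h.continuous h.hasCompactSupport

theorem eq_zero (h : IsTest Ω φ) {x : R4} (hx : x ∉ Ω) : φ x = 0 :=
  image_eq_zero_of_notMem_tsupport fun h' => hx (h.tsupport_subset h')

theorem add (h : IsTest Ω φ) (h' : IsTest Ω ψ) : IsTest Ω fun x => φ x + ψ x :=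
  ⟨h.contDiff.add h'.contDiff, h.hasCompactSupport.add h'.hasCompactSupport,
    (tsupport_add φ ψ).trans (union_subset h.tsupport_subset h'.tsupport_subset)⟩

theorem mono {Ω' : Set R4} (h : IsTest Ω φ) (hΩ : Ω ⊆ Ω') : IsTest Ω' φ :=
  ⟨h.contDiff, h.hasCompactSupport, h.tsupport_subset.trans hΩ⟩

theorem integrable (h : IsTest Ω φ) : Integrable φ :=
  h.continuous.integrable_of_hasCompactSupport h.hasCompactSupport

end IsTest

theorem pd_mul {φ ψ : R4 → ℝ} (hφ : ContDiff ℝ ∞ φ) (hψ : ContDiff ℝ ∞ ψ)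
    (i : Fin 4) (x : R4) :
    pd i (fun x => φ x * ψ x) x = pd i φ x * ψ x + φ x * pd i ψ x := by
  have h1 := (hφ.differentiable (by simp)) x
  have h2 := (hψ.differentiable (by simp)) x
  rw [pd, fderiv_fun_mul h1 h2]
  simp [pd]
  ring

/-- A smooth cutoff function of a compact subset of an open set. -/
theorem exists_cutoff {K Ω : Set R4} (hK : IsCompact K) (hΩ : IsOpen Ω) (h : K ⊆ Ω) :
    ∃ χ, IsTest Ω χ ∧ (∀ x, 0 ≤ χ x) ∧ (∀ x, χ x ≤ 1) ∧ ∃ U, IsOpen U ∧ K ⊆ U ∧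
      ∀ x ∈ U, χ x = 1 := by
  obtain ⟨L, hL, hKL, hLΩ⟩ := exists_compact_between hK hΩ h
  obtain ⟨L', hL', hLL', hLΩ'⟩ := exists_compact_between hL hΩ hLΩ
  obtain ⟨χ, h1, h2, h3, h4⟩ := exists_contMDiff_support_eq_eq_one_iff (modelWithCornersSelf ℝ R4)
    (n := (⊤ : ℕ∞)) isOpen_interior hL.isClosed hLL'
  have hsub : tsupport χ ⊆ L' := by
    rw [tsupport, h3]
    exact closure_minimal interior_subset hL'.isClosed
  refine ⟨χ, ⟨h1.contDiff, hL'.of_isClosed_subset (isClosed_tsupport _) hsub, hsub.trans hLΩ'⟩,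
    fun x => (h2 ⟨x, rfl⟩).1, fun x => (h2 ⟨x, rfl⟩).2, interior L, isOpen_interior, hKL,
    fun x hx => (h4 x).1 (interior_subset hx)⟩

theorem pd_eq_zero_of_eq_one {χ : R4 → ℝ} {U : Set R4} (hU : IsOpen U) {c : ℝ}
    (h : ∀ x ∈ U, χ x = c) (i : Fin 4) : ∀ x ∈ U, pd i χ x = 0 := by
  intro x hx
  have : χ =ᶠ[𝓝 x] fun _ => c := by
    filter_upwards [hU.mem_nhds hx] with y hy using h y hy
  rw [pd, this.fderiv_eq]; simp

theorem integrable_mul_test {Ω : Set R4} {φ v : R4 → ℝ} (hv : Integrable v) (hφ : IsTest Ω φ) :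
    Integrable fun x => v x * φ x := by
  obtain ⟨M, hM⟩ := hφ.exists_bound
  exact hv.mul_bdd (c := M) hφ.continuous.aestronglyMeasurable
    (.of_forall fun x => by simpa using hM x)

theorem memLp_test_mul {Ω : Set R4} {p : ℝ≥0∞} {ψ F : R4 → ℝ} (hψ : IsTest Ω ψ)
    (hF : MemLp F p) : MemLp (fun x => ψ x * F x) p := by
  obtain ⟨M, hM⟩ := hψ.exists_bound
  refine hF.of_le_mul (c := M) (hψ.continuous.aestronglyMeasurable.mul hF.1) (.of_forall fun x => ?_)
  rw [norm_mul]; bound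

theorem memLp_mul_test {Ω : Set R4} {p : ℝ≥0∞} {ψ F : R4 → ℝ} (hψ : IsTest Ω ψ)
    (hF : MemLp F p) : MemLp (fun x => F x * ψ x) p := by
  simpa only [mul_comm] using memLp_test_mul hψ hF

theorem integrable_test_mul {Ω : Set R4} {φ v : R4 → ℝ} (hv : Integrable v) (hφ : IsTest Ω φ) :
    Integrable fun x => φ x * v x := by
  simpa only [mul_comm] using integrable_mul_test hv hφ

/-- `w` is the weak partial derivative `∂ᵢv` on `Ω`, for functions that are integrable on `ℝ⁴`. -/
structure WeakPd (Ω : Set R4) (i : Fin 4) (v w : R4 → ℝ) : Prop where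
  measurable : Measurable v
  measurable_deriv : Measurable w
  integrable : Integrable v
  integrable_deriv : Integrable w
  eq : ∀ φ, IsTest Ω φ → ∫ x, v x * pd i φ x = -∫ x, w x * φ x

namespace WeakPd

variable {Ω : Set R4} {i : Fin 4} {v w v' w' : R4 → ℝ}

theorem integral_add_eq_zero (h : WeakPd Ω i v w) {φ : R4 → ℝ} (hφ : IsTest Ω φ) :
    ∫ x, (v x * pd i φ x + w x * φ x) = 0 := by
  rw [integral_add (integrable_mul_test h.integrable (hφ.pd i))
    (integrable_mul_test h.integrable_deriv hφ), h.eq φ hφ, neg_add_cancel]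

theorem of_integral (hm : Measurable v) (hm' : Measurable w) (hv : Integrable v) (hw : Integrable w)
    (h : ∀ φ, IsTest Ω φ → ∫ x, (v x * pd i φ x + w x * φ x) = 0) : WeakPd Ω i v w :=
  ⟨hm, hm', hv, hw, fun φ hφ => by
    rw [← add_eq_zero_iff_eq_neg, ← h φ hφ,
      integral_add (integrable_mul_test hv (hφ.pd i)) (integrable_mul_test hw hφ)]⟩

theorem mul_test (h : WeakPd Ω i v w) {χ : R4 → ℝ} (hχ : IsTest Ω χ) :
    WeakPd univ i (fun x => χ x * v x) (fun x => χ x * w x + pd i χ x * v x) := by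
  have mχ := hχ.continuous.measurable
  have mχ' := (hχ.pd i).continuous.measurable
  refine of_integral (mχ.mul h.measurable) ((mχ.mul h.measurable_deriv).add (mχ'.mul h.measurable))
    (integrable_test_mul h.integrable hχ) ((integrable_test_mul h.integrable_deriv hχ).add
      (integrable_test_mul h.integrable (hχ.pd i))) fun φ hφ => ?_
  rw [← h.integral_add_eq_zero (hχ.mul_right hφ.contDiff)]
  congr 1 with x
  rw [pd_mul hχ.contDiff hφ.contDiff]; ring

/-- Mollification commutes with weak derivatives. -/
theorem pd_cv (h : WeakPd univ i v w) (n : ℕ) :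
    pd i (cv (mollKer n) v) = cv (mollKer n) w := by
  have hsm : ContDiff ℝ ∞ (mollKer n) := contDiff_mollKer n
  have hcs := hasCompactSupport_mollKer n
  obtain ⟨M, hM⟩ := exists_bound_mollKer n
  have hT : IsTest univ (mollKer n) := ⟨hsm, hcs, subset_univ _⟩
  have hb : ∃ M, ∀ i z, |pd i (mollKer n) z| ≤ M := by
    choose M hM using fun i => (hT.pd i).exists_bound
    exact ⟨∑ i, |M i|, fun i z => (hM i z).trans ((le_abs_self _).trans
      (single_le_sum (f := fun i => |M i|) (fun _ _ => abs_nonneg _) (Finset.mem_univ i)))⟩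
  obtain ⟨M', hM'⟩ := hb
  rw [BiharmonicSphere.pd_cv (contDiff_mollKer n (m := 1)) (M := max M M')
    (fun z => (hM z).trans (le_max_left _ _))
    (fun i z => (hM' i z).trans (le_max_right _ _)) h.integrable i]
  ext x
  have hTx : IsTest univ (fun y => mollKer n (x - y)) := by
    refine ⟨hsm.comp (contDiff_const.sub contDiff_id), ?_, subset_univ _⟩
    exact hcs.comp_homeomorph (Homeomorph.subLeft x)
  have h1 := h.eq _ hTx
  have h2 : ∀ y, pd i (fun y => mollKer n (x - y)) y
      = -pd i (mollKer n) (x - y) := by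
    intro y
    have hd := ((hsm.differentiable (by simp)) (x - y)).hasFDerivAt
    have hs : HasFDerivAt (fun y : R4 => x - y) (-ContinuousLinearMap.id ℝ R4) y :=
      (hasFDerivAt_id y).const_sub x
    have := hd.comp y hs
    have h3 : HasFDerivAt (fun y => mollKer n (x - y)) _ y := this
    rw [pd, h3.fderiv]
    simp [pd]
  simp only [h2, mul_neg, integral_neg, neg_inj] at h1
  rw [cv, cv]
  simp only [mul_comm (pd i (mollKer n) _), mul_comm (mollKer n _)]
  exact h1

theorem sum {ι : Type*} (s : Finset ι) {v w : ι → R4 → ℝ}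
    (h : ∀ a ∈ s, WeakPd Ω i (v a) (w a)) :
    WeakPd Ω i (fun x => ∑ a ∈ s, v a x) (fun x => ∑ a ∈ s, w a x) := by
  refine ⟨Finset.measurable_fun_sum s fun a ha => (h a ha).measurable,
    Finset.measurable_fun_sum s fun a ha => (h a ha).measurable_deriv,
    integrable_finsetSum s fun a ha => (h a ha).integrable,
    integrable_finsetSum s fun a ha => (h a ha).integrable_deriv, fun φ hφ => ?_⟩
  simp_rw [sum_mul]
  rw [integral_finsetSum s fun a ha => integrable_mul_test (h a ha).integrable (hφ.pd i),
    integral_finsetSum s fun a ha => integrable_mul_test (h a ha).integrable_deriv hφ,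
    ← sum_neg_distrib]
  exact sum_congr rfl fun a ha => (h a ha).eq φ hφ

theorem add (h : WeakPd Ω i v w) (h' : WeakPd Ω i v' w') :
    WeakPd Ω i (fun x => v x + v' x) (fun x => w x + w' x) := by
  simpa using sum (v := ![v, v']) (w := ![w, w']) Finset.univ
    (Fin.forall_fin_two.2 ⟨fun _ => h, fun _ => h'⟩)

theorem neg (h : WeakPd Ω i v w) : WeakPd Ω i (fun x => -v x) (fun x => -w x) := by
  refine ⟨h.measurable.neg, h.measurable_deriv.neg, h.integrable.neg, h.integrable_deriv.neg,
    fun φ hφ => ?_⟩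
  simp_rw [neg_mul, integral_neg]
  rw [h.eq φ hφ]

theorem congr (h : WeakPd Ω i v w) (hm : Measurable v') (hm' : Measurable w')
    (hv : v =ᵐ[volume] v') (hw : w =ᵐ[volume] w') : WeakPd Ω i v' w' := by
  refine ⟨hm, hm', h.integrable.congr hv, h.integrable_deriv.congr hw, fun φ hφ => ?_⟩
  have e1 : ∫ x, v x * pd i φ x = ∫ x, v' x * pd i φ x :=
    integral_congr_ae (hv.mono fun x hx => by simp only [hx])
  have e2 : ∫ x, w x * φ x = ∫ x, w' x * φ x :=
    integral_congr_ae (hw.mono fun x hx => by simp only [hx])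
  rw [← e1, ← e2]
  exact h.eq φ hφ

/-- The product rule, when the second derivative is either square integrable or paired with a
bounded function. -/
theorem mul (h : WeakPd Ω i v w) (h' : WeakPd Ω i v' w') (hΩ : IsOpen Ω)
    (hv2 : MemLp v 2) (hw2 : MemLp w 2) (hv'2 : MemLp v' 2)
    (hor : (∃ M, ∀ x, |v x| ≤ M) ∨ MemLp w' 2) :
    WeakPd Ω i (fun x => v x * v' x) (fun x => w x * v' x + v x * w' x) := by
  have h22 : ∀ {F : R4 → ℝ}, MemLp F 2 → MemLp F (ofReal 2) := fun hF => by simpa using hF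
  have hol := HolderConjugate.two_two
  have i1 : Integrable fun x => v x * v' x := hv2.integrable_mul hv'2
  have i2 : Integrable fun x => w x * v' x := hw2.integrable_mul hv'2
  have i3 : Integrable fun x => v x * w' x := by
    rcases hor with ⟨M, hM⟩ | hw'2
    · exact h'.integrable_deriv.bdd_mul (c := M) h.measurable.aestronglyMeasurable
        (.of_forall fun x => by simpa using hM x)
    · exact hv2.integrable_mul hw'2
  refine of_integral (h.measurable.mul h'.measurable)
    ((h.measurable_deriv.mul h'.measurable).add (h.measurable.mul h'.measurable_deriv)) i1
    (i2.add i3) fun φ hφ => ?_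
  obtain ⟨χ, hχ, hχ0, hχ1, U, hU, hKU, hχU⟩ :=
    exists_cutoff hφ.hasCompactSupport.isCompact hΩ hφ.tsupport_subset
  have hV := h.mul_test hχ
  set V : R4 → ℝ := fun x => χ x * v x with hVdef
  set W : R4 → ℝ := fun x => χ x * w x + pd i χ x * v x with hWdef
  have hV2 := memLp_test_mul hχ hv2
  have hW2 := (memLp_test_mul hχ hw2).add (memLp_test_mul (hχ.pd i) hv2)
  have hVn : ∀ n, ContDiff ℝ ∞ (cv (mollKer n) V) := fun n =>
    contDiff_cv_mollKer n hV.integrable.locallyIntegrable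
  have l1 := tendstoIntegral_mul_cv_mollKer hol hV.measurable hV.integrable (h22 hV2)
    (h22 (memLp_mul_test (hφ.pd i) hv'2))
  have l2 := tendstoIntegral_mul_cv_mollKer hol hV.measurable_deriv hV.integrable_deriv
    (h22 hW2) (h22 (memLp_mul_test hφ hv'2))
  have l3 : TendstoIntegral (fun n x => (w' x * φ x) * cv (mollKer n) V x)
      fun x => (w' x * φ x) * V x := by
    rcases hor with ⟨M, hM⟩ | hw'2
    · refine tendstoIntegral_mul_cv_mollKer_of_le hV.integrable (M := M) (fun x => ?_)
        (integrable_mul_test h'.integrable_deriv hφ)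
      rw [hVdef, abs_mul, abs_of_nonneg (hχ0 x)]
      exact (mul_le_of_le_one_left (abs_nonneg _) (hχ1 x)).trans (hM x)
    · exact tendstoIntegral_mul_cv_mollKer hol hV.measurable hV.integrable (h22 hV2)
        (h22 (memLp_mul_test hφ hw'2))
  have hlim := tendsto_nhds_unique ((l1.add l2).add l3).tendsto (tendsto_const_nhds (x := (0 : ℝ)) |>.congr fun n => by
    refine (h'.integral_add_eq_zero (hφ.mul_right (hVn n))).symm.trans ?_
    congr 1 with x
    rw [pd_mul hφ.contDiff (hVn n), hV.pd_cv n]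
    ring)
  rw [← hlim]
  congr 1 with x
  -- on the support of the test function the cutoff is trivial
  by_cases hx : x ∈ U
  · simp only [hVdef, hWdef, hχU x hx, pd_eq_zero_of_eq_one hU hχU i x hx]; ring
  · have hφ0 : φ x = 0 := image_eq_zero_of_notMem_tsupport fun h => hx (hKU h)
    have hφ0' : pd i φ x = 0 :=
      image_eq_zero_of_notMem_tsupport fun h => hx (hKU (tsupport_pd_subset φ i h))
    simp [*]

end WeakPd

theorem integral_pd_eq_zero {Ω : Set R4} {φ : R4 → ℝ} (hφ : IsTest Ω φ) (i : Fin 4) :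
    ∫ x, pd i φ x = 0 := by
  have h := integral_mul_fderiv_eq_neg_fderiv_mul_of_integrable (μ := (volume : Measure R4))
    (f := fun _ => (1 : ℝ)) (g := φ) (v := e i) (by simp)
    (by simp only [one_mul]; exact (hφ.pd i).integrable) (by simpa only [one_mul] using hφ.integrable)
    (fun x _ => differentiableAt_const _)
    (fun x _ => (hφ.contDiff.differentiable (by simp)) x)
  aesop

/-- The weak derivative of a function that is constant on `Ω` vanishes there. -/
theorem WeakPd.ae_eq_zero {Ω : Set R4} {i : Fin 4} {v w : R4 → ℝ} (h : WeakPd Ω i v w)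
    (hΩ : IsOpen Ω) {c : ℝ} (hv : ∀ᵐ x, x ∈ Ω → v x = c) : ∀ᵐ x, x ∈ Ω → w x = 0 := by
  refine hΩ.ae_eq_zero_of_integral_contDiff_smul_eq_zero
    (h.integrable_deriv.locallyIntegrable.locallyIntegrableOn _) fun φ h1 h2 h3 => ?_
  have hφ : IsTest Ω φ := ⟨h1, h2, h3⟩
  have e1 := h.eq φ hφ
  have e2 : ∫ x, v x * pd i φ x = c * ∫ x, pd i φ x := by
    rw [← integral_const_mul]
    refine integral_congr_ae ?_
    filter_upwards [hv] with x hx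
    by_cases hxΩ : x ∈ Ω
    · rw [hx hxΩ]
    · rw [(hφ.pd i).eq_zero hxΩ, mul_zero, mul_zero]
  rw [e2, integral_pd_eq_zero hφ, mul_zero] at e1
  simp only [smul_eq_mul, mul_comm (φ _)]; linarith

/-! ### Mollified test functions -/

theorem lapl_mul {φ ψ : R4 → ℝ} (hφ : ContDiff ℝ ∞ φ) (hψ : ContDiff ℝ ∞ ψ)
    (x : R4) :
    lapl (fun x => φ x * ψ x) x
      = φ x * lapl ψ x + 2 * (∑ i, pd i φ x * pd i ψ x) + ψ x * lapl φ x := by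
  have h1 : ∀ i, pd i (fun x => φ x * ψ x) = fun x => pd i φ x * ψ x + φ x * pd i ψ x := fun i =>
    funext fun x => pd_mul hφ hψ i x
  have h2 : ∀ i, pd i (pd i (fun x => φ x * ψ x)) x = pd i (pd i φ) x * ψ x
      + 2 * (pd i φ x * pd i ψ x) + φ x * pd i (pd i ψ) x := by
    intro i
    have d1 := ((contDiff_pd hφ i).mul hψ).differentiable (by simp) x
    have d2 := (hφ.mul (contDiff_pd hψ i)).differentiable (by simp) x
    rw [h1, pd, fderiv_fun_add d1 d2, add_apply]
    have e1 := pd_mul (contDiff_pd hφ i) hψ i x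
    have e2 := pd_mul hφ (contDiff_pd hψ i) i x
    rw [pd] at e1 e2
    linarith
  simp only [lapl, h2, sum_add_distrib, mul_sum]
  grind

theorem holderConjugate_four : (4 : ℝ).HolderConjugate (4 / 3) := by
  rw [Real.holderConjugate_iff]; norm_num

theorem isTest_lapl {Ω : Set R4} {φ : R4 → ℝ} (h : IsTest Ω φ) : IsTest Ω (lapl φ) := by
  have h1 : lapl φ = fun x => ((pd 0 (pd 0 φ) x + pd 1 (pd 1 φ) x) + pd 2 (pd 2 φ) x)
      + pd 3 (pd 3 φ) x := by
    ext x
    rw [lapl, Fin.sum_univ_four]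
  rw [h1]
  exact ((((h.pd 0).pd 0).add ((h.pd 1).pd 1)).add ((h.pd 2).pd 2)).add ((h.pd 3).pd 3)

/-- The test functions `φ vₙ`, where `vₙ` are the mollifications of a bounded function `v` of class
`W^{2,2}`, may be replaced by `φ v` in the limit. -/
theorem tendstoIntegral_test_mollified {Ω : Set R4} (hΩ : IsOpen Ω) {φ : R4 → ℝ}
    (hφ : IsTest Ω φ) :
    ∃ (χ : R4 → ℝ), IsTest Ω χ ∧ ∀ {H R v : R4 → ℝ} {Q v₁ v₂ : Fin 4 → R4 → ℝ},
      MemLp H 2 → (∀ i, MemLp (Q i) (ofReal (4 / 3))) → Integrable R →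
      (∀ i, WeakPd Ω i v (v₁ i)) → (∀ i, WeakPd Ω i (v₁ i) (v₂ i)) → (∀ x, |v x| ≤ 1) →
      MemLp v 4 → MemLp v 2 → (∀ i, MemLp (v₁ i) 4) → (∀ i, MemLp (v₁ i) 2) →
      (∀ i, MemLp (v₂ i) 2) →
      TendstoIntegral (fun n x => H x * lapl (fun x => φ x * cv (mollKer n) (fun x => χ x * v x) x) x
        + (∑ i, Q i x * pd i (fun x => φ x * cv (mollKer n) (fun x => χ x * v x) x) x)
        + R x * (φ x * cv (mollKer n) (fun x => χ x * v x) x))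
        fun x => H x * (φ x * (∑ i, v₂ i x) + 2 * (∑ i, pd i φ x * v₁ i x) + v x * lapl φ x)
          + (∑ i, Q i x * (φ x * v₁ i x + pd i φ x * v x)) + R x * (φ x * v x) := by
  obtain ⟨χ, hχ, hχ0, hχ1, U, hU, hKU, hχU⟩ :=
    exists_cutoff hφ.hasCompactSupport.isCompact hΩ hφ.tsupport_subset
  refine ⟨χ, hχ, ?_⟩
  intro H R v Q v₁ v₂ hH hQ hR hv hv₁ hvb hv4 hv2 hv₁4 hv₁2 hv₂2
  have h22 : ∀ {F : R4 → ℝ}, MemLp F 2 → MemLp F (ofReal 2) := fun hF => by simpa using hF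
  have h44 : ∀ {F : R4 → ℝ}, MemLp F 4 → MemLp F (ofReal 4) := fun hF => by simpa using hF
  set V : R4 → ℝ := fun x => χ x * v x with hV
  set V₁ : Fin 4 → R4 → ℝ := fun i x => χ x * v₁ i x + pd i χ x * v x with hV₁
  set V₂ : Fin 4 → R4 → ℝ := fun i x => (χ x * v₂ i x + pd i χ x * v₁ i x)
    + (pd i χ x * v₁ i x + pd i (pd i χ) x * v x) with hV₂
  have w1 : ∀ i, WeakPd univ i V (V₁ i) := fun i => (hv i).mul_test hχ
  have w2 : ∀ i, WeakPd univ i (V₁ i) (V₂ i) := fun i =>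
    ((hv₁ i).mul_test hχ).add ((hv i).mul_test (hχ.pd i))
  have sm : ∀ n, ContDiff ℝ ∞ (cv (mollKer n) V) := fun n =>
    contDiff_cv_mollKer n (w1 0).integrable.locallyIntegrable
  have hV₁2 : ∀ i, MemLp (V₁ i) 2 := fun i =>
    (memLp_test_mul hχ (hv₁2 i)).add (memLp_test_mul (hχ.pd i) hv2)
  have hV₁4 : ∀ i, MemLp (V₁ i) 4 := fun i =>
    (memLp_test_mul hχ (hv₁4 i)).add (memLp_test_mul (hχ.pd i) hv4)
  have hV₂2 : ∀ i, MemLp (V₂ i) 2 := fun i =>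
    ((memLp_test_mul hχ (hv₂2 i)).add (memLp_test_mul (hχ.pd i) (hv₁2 i))).add
      ((memLp_test_mul (hχ.pd i) (hv₁2 i)).add (memLp_test_mul ((hχ.pd i).pd i) hv2))
  have hVb : ∀ x, |V x| ≤ 1 := fun x => by
    rw [hV, abs_mul, abs_of_nonneg (hχ0 x)]; bound
  have l1 := fun i => tendstoIntegral_mul_cv_mollKer HolderConjugate.two_two
    (w2 i).measurable_deriv (w2 i).integrable_deriv (h22 (hV₂2 i)) (h22 (memLp_mul_test hφ hH))
  have l2 := fun i => tendstoIntegral_mul_cv_mollKer HolderConjugate.two_two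
    (w1 i).measurable_deriv (w1 i).integrable_deriv (h22 (hV₁2 i))
    (h22 (memLp_mul_test (hφ.pd i) hH))
  have l3 := tendstoIntegral_mul_cv_mollKer HolderConjugate.two_two (w1 0).measurable
    (w1 0).integrable (h22 (memLp_test_mul hχ hv2)) (h22 (memLp_mul_test (isTest_lapl hφ) hH))
  have l4 := fun i => tendstoIntegral_mul_cv_mollKer holderConjugate_four (w1 i).measurable_deriv
    (w1 i).integrable_deriv (h44 (hV₁4 i)) (memLp_mul_test hφ (hQ i))
  have l5 := fun i => tendstoIntegral_mul_cv_mollKer holderConjugate_four (w1 0).measurable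
    (w1 0).integrable (h44 (memLp_test_mul hχ hv4)) (memLp_mul_test (hφ.pd i) (hQ i))
  have l6 := tendstoIntegral_mul_cv_mollKer_of_le (w1 0).integrable hVb (integrable_mul_test hR hφ)
  refine ((((((TendstoIntegral.sum l1).add (TendstoIntegral.sum l2)).add
    (TendstoIntegral.sum l2)).add l3).add
    (TendstoIntegral.sum fun i => (l4 i).add (l5 i))).add l6).congr (fun n x => ?_) fun x => ?_
  · have eQ : ∀ i, pd i (fun x => φ x * cv (mollKer n) V x) x
        = pd i φ x * cv (mollKer n) V x + φ x * cv (mollKer n) (V₁ i) x := fun i => by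
      rw [pd_mul hφ.contDiff (sm n), (w1 i).pd_cv n]
    simp only [lapl_mul hφ.contDiff (sm n), eQ]
    simp only [lapl, fun i => (w1 i).pd_cv n, fun i => (w2 i).pd_cv n, Fin.sum_univ_four]
    ring
  -- on the support of the test function the cutoff is trivial
  · have hz : ∀ {ψ : R4 → ℝ}, tsupport ψ ⊆ tsupport φ → x ∉ U → ψ x = 0 := fun hψ hx =>
      image_eq_zero_of_notMem_tsupport fun h => hx (hKU (hψ h))
    by_cases hx : x ∈ U
    · have c1 := fun i => pd_eq_zero_of_eq_one hU hχU i x hx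
      have c2 := fun i => pd_eq_zero_of_eq_one hU (pd_eq_zero_of_eq_one hU hχU i) i x hx
      simp only [hV, hV₁, hV₂, hχU x hx, c1, c2, one_mul, zero_mul, add_zero, Fin.sum_univ_four]
      ring
    · have c1 : ∀ i, pd i φ x = 0 := fun i => hz (tsupport_pd_subset φ i) hx
      have c2 : ∀ i, pd i (pd i φ) x = 0 := fun i =>
        hz ((tsupport_pd_subset _ i).trans (tsupport_pd_subset φ i)) hx
      simp [lapl, hz subset_rfl hx, c1, c2]

/-! ### The equation in components and its wedge form -/

section SphereMap

variable {ι : Type*} [Fintype ι] {Ω : Set R4} (u : ι → R4 → ℝ) (D1 : Fin 4 → ι → R4 → ℝ)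
  (D2 : Fin 4 → Fin 4 → ι → R4 → ℝ) {D3 : Fin 4 → ι → R4 → ℝ} {f : ι → R4 → ℝ}

/-- The Laplacian in components. -/
def lapC (a : ι) (x : R4) : ℝ := ∑ i, D2 i i a x

/-- `|Du|²` in components. -/
def gradSq (x : R4) : ℝ := ∑ i, ∑ a, D1 i a x ^ 2

/-- The coefficients `⟨∂ᵢu, Δu⟩`. -/
def gradLap (i : Fin 4) (x : R4) : ℝ :=
  ∑ a, D1 i a x * lapC D2 a x

/-- The coefficient `⟨u, Δu⟩`. -/
def dotLap (x : R4) : ℝ :=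
  ∑ a, u a x * lapC D2 a x

/-- The second order coefficient of the equation of approximate biharmonic maps. -/
def coeffLap (a : ι) (x : R4) : ℝ :=
  lapC D2 a x + gradSq D1 x * u a x

/-- The first order coefficients of the equation of approximate biharmonic maps. -/
def coeffGrad (i : Fin 4) (a : ι) (x : R4) : ℝ :=
  -2 * (dotLap u D2 x * D1 i a x + gradLap D1 D2 i x * u a x)

/-- The zeroth order coefficient of the equation of approximate biharmonic maps. -/
def coeffZero (a : ι) (x : R4) : ℝ :=
  -(dotLap u D2 x * lapC D2 a x + (∑ c, lapC D2 c x ^ 2) * u a x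
    + 2 * ∑ i, gradLap D1 D2 i x * D1 i a x)

/-- An `f`-approximate biharmonic map into the sphere on the open set `Ω`, in components: its first
and second derivatives are `D1` and `D2`, and `D3` is the gradient of its Laplacian. All functions
are defined and integrable on `ℝ⁴`. -/
structure SphereMap (Ω : Set R4) (u : ι → R4 → ℝ) (D1 : Fin 4 → ι → R4 → ℝ)
    (D2 : Fin 4 → Fin 4 → ι → R4 → ℝ) (D3 : Fin 4 → ι → R4 → ℝ) (f : ι → R4 → ℝ) : Prop where
  isOpen : IsOpen Ω
  weak₁ : ∀ i a, WeakPd Ω i (u a) (D1 i a)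
  weak₂ : ∀ i j a, WeakPd Ω i (D1 j a) (D2 i j a)
  weak₃ : ∀ i a, WeakPd Ω i (lapC D2 a) (D3 i a)
  abs_le : ∀ a x, |u a x| ≤ 1
  sphere : ∀ᵐ x, x ∈ Ω → ∑ a, u a x ^ 2 = 1
  memLp_two : ∀ a, MemLp (u a) 2
  memLp_four : ∀ a, MemLp (u a) 4
  memLp_D1_two : ∀ i a, MemLp (D1 i a) 2
  memLp_D1_four : ∀ i a, MemLp (D1 i a) 4
  memLp_D2_two : ∀ i j a, MemLp (D2 i j a) 2
  measurable_f : ∀ a, Measurable (f a)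
  integrable_f : ∀ a, Integrable (f a)
  eq : ∀ a φ, IsTest Ω φ → ∫ x, (coeffLap u D1 D2 a x * lapl φ x
    + (∑ i, coeffGrad u D1 D2 i a x * pd i φ x) + coeffZero u D1 D2 a x * φ x) = ∫ x, f a x * φ x

namespace SphereMap

variable {u D1 D2}

theorem memLp_lapC (h : SphereMap Ω u D1 D2 D3 f) (a : ι) : MemLp (lapC D2 a) 2 :=
  memLp_finsetSum _ fun i _ => h.memLp_D2_two i i a

theorem ae_dot_grad (h : SphereMap Ω u D1 D2 D3 f) (i : Fin 4) :
    ∀ᵐ x, x ∈ Ω → ∑ a, u a x * D1 i a x = 0 := by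
  have h1 := WeakPd.sum Finset.univ fun a (_ : a ∈ Finset.univ) =>
    (h.weak₁ i a).mul (h.weak₁ i a) h.isOpen (h.memLp_two a) (h.memLp_D1_two i a) (h.memLp_two a)
      (Or.inl ⟨1, h.abs_le a⟩)
  have h2 := h1.ae_eq_zero h.isOpen (c := 1) (by
    filter_upwards [h.sphere] with x hx hxΩ
    rw [← hx hxΩ]
    exact sum_congr rfl fun a _ => by ring)
  filter_upwards [h2] with x hx hxΩ
  have := hx hxΩ
  have e : ∑ a, (D1 i a x * u a x + u a x * D1 i a x) = 2 * ∑ a, u a x * D1 i a x := by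
    rw [mul_sum]
    grind
  linarith

/-- Taking the divergence of `⟨u, Du⟩ = 0`. -/
theorem ae_dotLap (h : SphereMap Ω u D1 D2 D3 f) :
    ∀ᵐ x, x ∈ Ω → dotLap u D2 x = -gradSq D1 x := by
  have h1 : ∀ i, ∀ᵐ x, x ∈ Ω → ∑ a, (D1 i a x * D1 i a x + u a x * D2 i i a x) = 0 := fun i =>
    (WeakPd.sum Finset.univ fun a (_ : a ∈ Finset.univ) =>
      (h.weak₁ i a).mul (h.weak₂ i i a) h.isOpen (h.memLp_two a) (h.memLp_D1_two i a)
      (h.memLp_D1_two i a) (Or.inl ⟨1, h.abs_le a⟩)).ae_eq_zero h.isOpen (h.ae_dot_grad i)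
  filter_upwards [ae_all_iff.2 h1] with x hx hxΩ
  have h2 : ∑ i, ∑ a, (D1 i a x * D1 i a x + u a x * D2 i i a x) = 0 :=
    sum_eq_zero fun i _ => hx i hxΩ
  simp only [sum_add_distrib] at h2
  have e1 : ∑ i, ∑ a, u a x * D2 i i a x = dotLap u D2 x := by
    rw [sum_comm, dotLap]
    exact sum_congr rfl fun a _ => by rw [lapC, mul_sum]
  have e2 : ∑ i, ∑ a, D1 i a x * D1 i a x = gradSq D1 x := by simp only [gradSq, sq]
  linarith

theorem ae_dot_gradLap (h : SphereMap Ω u D1 D2 D3 f) (j : Fin 4) :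
    ∀ᵐ x, x ∈ Ω → ∑ a, u a x * D3 j a x
      = -(gradLap D1 D2 j x) - 2 * ∑ i, ∑ a, D2 j i a x * D1 i a x := by
  have h1 := WeakPd.sum Finset.univ fun a (_ : a ∈ Finset.univ) =>
    (h.weak₁ j a).mul (h.weak₃ j a) h.isOpen (h.memLp_two a) (h.memLp_D1_two j a)
      (h.memLp_lapC a) (Or.inl ⟨1, h.abs_le a⟩)
  have h2 := WeakPd.sum Finset.univ fun i (_ : i ∈ Finset.univ) =>
    WeakPd.sum Finset.univ fun a (_ : a ∈ Finset.univ) =>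
    (h.weak₂ j i a).mul (h.weak₂ j i a) h.isOpen (h.memLp_D1_two i a) (h.memLp_D2_two j i a)
      (h.memLp_D1_two i a) (Or.inr (h.memLp_D2_two j i a))
  have h3 := (h1.add h2).ae_eq_zero h.isOpen (c := 0) (by
    filter_upwards [h.ae_dotLap] with x hx hxΩ
    have := hx hxΩ
    simp only [dotLap, gradSq] at this
    simp only [this, ← sq]
    ring)
  filter_upwards [h3] with x hx hxΩ
  have := hx hxΩ
  simp only [sum_add_distrib] at this
  simp only [gradLap]
  have e1 : ∑ i, ∑ a, D1 i a x * D2 j i a x = ∑ i, ∑ a, D2 j i a x * D1 i a x :=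
    sum_congr rfl fun i _ => sum_congr rfl fun a _ => mul_comm _ _
  linarith

instance holderTriple_two_four : ENNReal.HolderTriple 2 4 (ofReal (4 / 3)) where
  inv_add_inv_eq_inv := by
    rw [← ofReal_inv_of_pos (by norm_num)]
    rw [show (2 : ℝ≥0∞) = ofReal 2 by simp, show (4 : ℝ≥0∞) = ofReal 4 by simp,
      ← ofReal_inv_of_pos (by norm_num), ← ofReal_inv_of_pos (by norm_num),
      ← ofReal_add (by norm_num) (by norm_num)]
    norm_num

theorem memLp_gradLap (h : SphereMap Ω u D1 D2 D3 f) (i : Fin 4) :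
    MemLp (gradLap D1 D2 i) (ofReal (4 / 3)) :=
  memLp_finsetSum _ fun a _ => by
    have := (h.memLp_D1_four i a).mul' (h.memLp_lapC a) (r := ofReal (4 / 3))
    simpa only [mul_comm] using this

theorem memLp_mul_of_abs_le {F v : R4 → ℝ} {p : ℝ≥0∞} (hF : MemLp F p)
    (hv : AEStronglyMeasurable v volume) (hb : ∀ x, |v x| ≤ 1) : MemLp (fun x => F x * v x) p :=
  hF.of_le (hF.1.mul hv) (.of_forall fun x => by
    rw [norm_mul]
    exact mul_le_of_le_one_right (norm_nonneg _) (hb x))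

theorem memLp_dotLap (h : SphereMap Ω u D1 D2 D3 f) : MemLp (dotLap u D2) 2 :=
  memLp_finsetSum _ fun a _ => by
    simpa only [mul_comm] using
      memLp_mul_of_abs_le (h.memLp_lapC a) (h.memLp_two a).1 (h.abs_le a)

theorem memLp_coeffGrad (h : SphereMap Ω u D1 D2 D3 f) (i : Fin 4) (a : ι) :
    MemLp (coeffGrad u D1 D2 i a) (ofReal (4 / 3)) := by
  have h1 : MemLp (fun x => dotLap u D2 x * D1 i a x) (ofReal (4 / 3)) :=
    (h.memLp_D1_four i a).mul' h.memLp_dotLap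
  exact (h1.add (memLp_mul_of_abs_le (h.memLp_gradLap i) (h.memLp_two a).1 (h.abs_le a))).const_mul
    (-2)

theorem memLp_gradSq (h : SphereMap Ω u D1 D2 D3 f) : MemLp (gradSq D1) 2 := by
  refine memLp_finsetSum _ fun i _ => memLp_finsetSum _ fun a _ => ?_
  have : ENNReal.HolderTriple 4 4 2 := ⟨by
    rw [show (2 : ℝ≥0∞) = ofReal 2 by simp, show (4 : ℝ≥0∞) = ofReal 4 by simp,
      ← ofReal_inv_of_pos (by norm_num), ← ofReal_inv_of_pos (by norm_num),
      ← ofReal_add (by norm_num) (by norm_num)]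
    norm_num⟩
  simpa only [sq] using (h.memLp_D1_four i a).mul' (h.memLp_D1_four i a) (r := 2)

theorem memLp_coeffLap (h : SphereMap Ω u D1 D2 D3 f) (a : ι) :
    MemLp (coeffLap u D1 D2 a) 2 :=
  (h.memLp_lapC a).add (memLp_mul_of_abs_le h.memLp_gradSq (h.memLp_two a).1 (h.abs_le a))

theorem integrable_coeffZero (h : SphereMap Ω u D1 D2 D3 f) (a : ι) :
    Integrable (coeffZero u D1 D2 a) := by
  have h1 : Integrable fun x => dotLap u D2 x * lapC D2 a x :=
    h.memLp_dotLap.integrable_mul (h.memLp_lapC a)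
  have h2 : Integrable fun x => ∑ c, lapC D2 c x ^ 2 :=
    integrable_finsetSum _ fun c _ => (h.memLp_lapC c).integrable_sq
  have h3 : Integrable fun x => (∑ c, lapC D2 c x ^ 2) * u a x :=
    h2.mul_bdd (c := 1) (h.memLp_two a).1 (.of_forall fun x => h.abs_le a x)
  have h4 : Integrable fun x => ∑ i, gradLap D1 D2 i x * D1 i a x :=
    integrable_finsetSum _ fun i _ => integrable_mul_of_memLp holderConjugate_four
      (by simpa using h.memLp_D1_four i a) (h.memLp_gradLap i)
  exact ((h1.add h3).add (h4.const_mul 2)).neg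

theorem integrable_coeffLap (h : SphereMap Ω u D1 D2 D3 f) (a : ι) :
    Integrable (coeffLap u D1 D2 a) := by
  have h1 : Integrable (gradSq D1) := integrable_finsetSum _ fun i _ =>
    integrable_finsetSum _ fun a _ => (h.memLp_D1_two i a).integrable_sq
  exact (h.weak₃ 0 a).integrable.add (h1.mul_bdd (c := 1) (h.memLp_two a).1
    (.of_forall fun x => h.abs_le a x))

theorem integrable_coeffGrad (h : SphereMap Ω u D1 D2 D3 f) (i : Fin 4) (a : ι) :
    Integrable (coeffGrad u D1 D2 i a) := by
  have h1 : Integrable (gradLap D1 D2 i) := integrable_finsetSum _ fun a _ =>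
    (h.memLp_D1_two i a).integrable_mul (h.memLp_lapC a)
  have h2 : Integrable fun x => dotLap u D2 x * D1 i a x :=
    h.memLp_dotLap.integrable_mul (h.memLp_D1_two i a)
  exact (h2.add (h1.mul_bdd (c := 1) (h.memLp_two a).1
    (.of_forall fun x => h.abs_le a x))).const_mul (-2)

theorem integral_eq_zero (h : SphereMap Ω u D1 D2 D3 f) (a : ι) {φ : R4 → ℝ} (hφ : IsTest Ω φ) :
    ∫ x, (coeffLap u D1 D2 a x * lapl φ x + (∑ i, coeffGrad u D1 D2 i a x * pd i φ x)
      + (coeffZero u D1 D2 a x - f a x) * φ x) = 0 := by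
  have I1 := ((integrable_mul_test (h.integrable_coeffLap a) (isTest_lapl hφ)).add
    (integrable_finsetSum Finset.univ fun i _ =>
      integrable_mul_test (h.integrable_coeffGrad i a) (hφ.pd i))).add
    (integrable_mul_test (h.integrable_coeffZero a) hφ)
  rw [← sub_eq_zero.2 (h.eq a φ hφ)]
  refine Eq.trans ?_ (integral_sub I1 (integrable_mul_test (h.integrable_f a) hφ))
  grind

/-- The flux of the conservation law for `u^b Δu^a - u^a Δu^b`. -/
def wedgeFlux (D1 : Fin 4 → ι → R4 → ℝ) (D2 : Fin 4 → Fin 4 → ι → R4 → ℝ) (a b : ι) (i : Fin 4)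
    (x : R4) : ℝ :=
  D1 i b x * lapC D2 a x - D1 i a x * lapC D2 b x

/-- The components `u^b Δu^a - u^a Δu^b` of `Δu ∧ u`. -/
def wedgeLap (u : ι → R4 → ℝ) (D2 : Fin 4 → Fin 4 → ι → R4 → ℝ) (a b : ι) (x : R4) : ℝ :=
  u b x * lapC D2 a x - u a x * lapC D2 b x

/-- The equation tested with `φ (u^b e_a - u^a e_b)`: all terms of critical growth cancel, except
for one in divergence form. -/
theorem integral_wedgeLap (h : SphereMap Ω u D1 D2 D3 f) (a b : ι) {φ : R4 → ℝ}
    (hφ : IsTest Ω φ) :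
    ∫ x, (wedgeLap u D2 a b x * lapl φ x + 2 * (∑ i, wedgeFlux D1 D2 a b i x * pd i φ x)
      - (f a x * u b x - f b x * u a x) * φ x) = 0 := by
  obtain ⟨χ, hχ, key⟩ := tendstoIntegral_test_mollified h.isOpen hφ
  have hk : ∀ a b, _ := fun a b => key (h.memLp_coeffLap a) (fun i => h.memLp_coeffGrad i a)
    ((h.integrable_coeffZero a).sub (h.integrable_f a)) (fun i => h.weak₁ i b)
    (fun i => h.weak₂ i i b) (h.abs_le b) (h.memLp_four b) (h.memLp_two b) (fun i => h.memLp_D1_four i b) (fun i => h.memLp_D1_two i b)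
    (fun i => h.memLp_D2_two i i b)
  set J : ι → ι → R4 → ℝ := fun a b x => coeffLap u D1 D2 a x * (φ x * (∑ i, D2 i i b x)
      + 2 * (∑ i, pd i φ x * D1 i b x) + u b x * lapl φ x)
      + (∑ i, coeffGrad u D1 D2 i a x * (φ x * D1 i b x + pd i φ x * u b x))
      + (coeffZero u D1 D2 a x - f a x) * (φ x * u b x) with hJ
  have hJI : ∀ a b, Integrable (J a b) := fun a b => (hk a b).integrable_lim
  have hz : ∀ a b, ∫ x, J a b x = 0 := fun a b =>
    tendsto_nhds_unique (hk a b).tendsto (tendsto_const_nhds.congr fun n =>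
      (h.integral_eq_zero a (hφ.mul_right (contDiff_cv_mollKer n
        (integrable_test_mul (h.weak₁ 0 b).integrable hχ).locallyIntegrable))).symm)
  have hsub : ∫ x, (J a b x - J b a x) = 0 := by
    rw [integral_sub (hJI a b) (hJI b a), hz, hz, sub_zero]
  rw [← hsub]
  refine integral_congr_ae ?_
  filter_upwards [h.ae_dotLap] with x hx
  by_cases hxΩ : x ∈ Ω
  · have hx' := hx hxΩ
    simp only [hJ, coeffLap, coeffGrad, coeffZero, wedgeLap, wedgeFlux, hx']
    have e1 : ∀ a, ∑ i, D2 i i a x = lapC D2 a x := fun a => rfl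
    simp only [e1]
    generalize gradSq D1 x = e
    generalize (∑ c, lapC D2 c x ^ 2) = q
    simp only [Fin.sum_univ_four]; ring
  · have c0 : φ x = 0 := hφ.eq_zero hxΩ
    have c1 : ∀ i, pd i φ x = 0 := fun i => (hφ.pd i).eq_zero hxΩ
    have c2 : lapl φ x = 0 := (isTest_lapl hφ).eq_zero hxΩ
    simp [*]

end SphereMap

end SphereMap

/-! ### Cutoffs of weak solutions -/

theorem setLIntegral_pot_le {k : ℕ} (hk : 0 < k) (hk4 : k < 4) {g : R4 → ℝ≥0∞} (hg : Measurable g)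
    {E : Set R4} (hE : MeasurableSet E) (hf : volume E ≠ ⊤) :
    ∫⁻ x in E, pot k g x ≤ potConst k * (∫⁻ x, g x) * volume E ^ (1 - (k : ℝ) / 4) := by
  rw [setLIntegral_pot k hg hE]
  calc ∫⁻ x, g x * pot k (E.indicator 1) x
      ≤ ∫⁻ x, g x * (potConst k * volume E ^ (1 - (k : ℝ) / 4)) :=
        lintegral_mono fun x => by gcongr; exact pot_indicator_le hk hk4 hE hf x
    _ = _ := by rw [lintegral_mul_const _ hg]; ring

theorem setLIntegral_pot_ne_top {k : ℕ} (hk : 0 < k) (hk4 : k < 4) {g : R4 → ℝ≥0∞}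
    (hg : Measurable g) (hi : ∫⁻ x, g x ≠ ⊤) {K : Set R4} (hK : IsCompact K) :
    ∫⁻ x in K, pot k g x ≠ ⊤ := by
  refine ((setLIntegral_pot_le hk hk4 hg hK.measurableSet hK.measure_lt_top.ne).trans_lt ?_).ne
  have h4 : (k : ℝ) < 4 := by exact_mod_cast hk4
  exact mul_lt_top (mul_lt_top ENNReal.coe_lt_top hi.lt_top)
    (ENNReal.rpow_lt_top_of_nonneg (by linarith) hK.measure_lt_top.ne)

theorem IsWeakPoisson.ae_enorm_le_pot {W g : R4 → ℝ} {G : Fin 4 → R4 → ℝ}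
    (hW : IsWeakPoisson W G g) :
    ∀ᵐ x, ‖W x‖ₑ ≤ ofReal kerMass⁻¹ *
      (2 * ∑ i, pot 3 (fun y => ‖G i y‖ₑ) x + pot 2 (fun y => ‖g y‖ₑ) x) := by
  refine hW.ae_enorm_le fun K hK => ?_
  have m3 : ∀ i, Measurable (pot 3 fun y => ‖G i y‖ₑ) := fun i =>
    measurable_pot 3 (hW.measurable_flux i).enorm
  rw [lintegral_add_left (by fun_prop), lintegral_const_mul _ (by fun_prop),
    lintegral_finsetSum _ fun i _ => m3 i]
  refine add_ne_top.2 ⟨mul_ne_top (by simp) (ENNReal.sum_ne_top.2 fun i _ => ?_), ?_⟩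
  · exact setLIntegral_pot_ne_top (by norm_num) (by norm_num) (hW.measurable_flux i).enorm
      (hW.integrable_flux i).2.ne hK
  · exact setLIntegral_pot_ne_top (by norm_num) (by norm_num) hW.measurable_source.enorm
      hW.integrable_source.2.ne hK

section Cutoff

variable {Ω : Set R4} {W g ζ : R4 → ℝ} {G : Fin 4 → R4 → ℝ}

theorem contDiff_lapl {φ : R4 → ℝ} (hφ : ContDiff ℝ ∞ φ) : ContDiff ℝ ∞ (lapl φ) :=
  ContDiff.sum fun i _ => contDiff_pd (contDiff_pd hφ i) i

/-- An integrable function that vanishes off the support of `ζ` may be multiplied by any smooth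
function. -/
theorem IsTest.integrable_mul (hζ : IsTest Ω ζ) {v ψ : R4 → ℝ} (hv : Integrable v)
    (hψ : ContDiff ℝ ∞ ψ)
    (h : ∀ x, ζ x = 0 → (∀ i, BiharmonicSphere.pd i ζ x = 0) → lapl ζ x = 0 → v x = 0) :
    Integrable fun x => v x * ψ x := by
  obtain ⟨χ, hχ, -, -, U, -, hKU, hχU⟩ := exists_cutoff hζ.hasCompactSupport.isCompact isOpen_univ
    (subset_univ _)
  refine (integrable_mul_test hv (hχ.mul_right hψ)).congr (.of_forall fun x => ?_)
  by_cases hx : x ∈ tsupport ζ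
  · simp [hχU x (hKU hx)]
  · have h0 : ∀ {g : R4 → ℝ}, tsupport g ⊆ tsupport ζ → g x = 0 := fun hg =>
      image_eq_zero_of_notMem_tsupport fun hx' => hx (hg hx')
    simp [h x (h0 subset_rfl) (fun i => h0 (tsupport_pd_subset ζ i)) (sum_eq_zero fun i _ =>
      h0 ((tsupport_pd_subset _ i).trans (tsupport_pd_subset ζ i)))]

theorem integral_sub_sum_sub {A C : R4 → ℝ} {F : Fin 4 → R4 → ℝ} (hA : Integrable A)
    (hF : ∀ i, Integrable (F i)) (hC : Integrable C) :
    ∫ x, (A x - (∑ i, F i x) - C x) = (∫ x, A x) - (∑ i, ∫ x, F i x) - ∫ x, C x := by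
  have hs := integrable_finsetSum Finset.univ fun i _ => hF i
  rw [← integral_finsetSum _ fun i _ => hF i, ← integral_sub hA hs]
  exact integral_sub (hA.sub hs) hC

/-- A weak solution of `ΔW = -div G + g` on `Ω`, cut off inside of `Ω`. -/
theorem isWeakPoisson_cutoff (hWm : Measurable W) (hW : Integrable W) (hGm : ∀ i, Measurable (G i))
    (hG : ∀ i, Integrable (G i)) (hgm : Measurable g) (hg : Integrable g)
    (heq : ∀ φ, IsTest Ω φ →
      ∫ x, W x * lapl φ x = (∑ i, ∫ x, G i x * pd i φ x) + ∫ x, g x * φ x) (hζ : IsTest Ω ζ) :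
    IsWeakPoisson (fun x => ζ x * W x) (fun i x => ζ x * G i x - 2 * (pd i ζ x * W x))
      (fun x => ζ x * g x + (∑ i, pd i ζ x * G i x) - lapl ζ x * W x) := by
  have mζ := hζ.continuous.measurable
  have mζ' := fun i => (hζ.pd i).continuous.measurable
  have mζ'' := (isTest_lapl hζ).continuous.measurable
  have I1 := integrable_test_mul hW hζ
  have I2 := fun i => (integrable_test_mul (hG i) hζ).sub
    ((integrable_test_mul hW (hζ.pd i)).const_mul 2)
  have I3 := ((integrable_test_mul hg hζ).add (integrable_finsetSum Finset.univ fun i _ =>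
    integrable_test_mul (hG i) (hζ.pd i))).sub (integrable_test_mul hW (isTest_lapl hζ))
  refine ⟨by fun_prop, fun i => by fun_prop, by fun_prop, I1, I2, I3, fun φ hφ => ?_⟩
  have hT := hζ.mul_right hφ
  have key := heq _ hT
  rw [← sub_eq_zero, ← sub_sub] at key ⊢
  rw [← integral_sub_sum_sub (integrable_mul_test hW (isTest_lapl hT))
    (fun i => integrable_mul_test (hG i) (hT.pd i)) (integrable_mul_test hg hT)] at key
  refine (integral_sub_sum_sub (hζ.integrable_mul I1 (contDiff_lapl hφ) fun x h _ _ => by simp [h])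
    (fun i => hζ.integrable_mul (I2 i) (contDiff_pd hφ i) fun x h h' _ => by simp [h, h'])
    (hζ.integrable_mul I3 hφ fun x h h' h'' => by simp [h, h', h''])).symm.trans
    (Eq.trans ?_ key)
  congr 1 with x
  simp only [lapl_mul hζ.contDiff hφ, pd_mul hζ.contDiff hφ, Fin.sum_univ_four, Pi.sub_apply,
    Pi.add_apply]
  ring

/-- A weak solution of `ΔW = g` on `Ω`, cut off inside of `Ω`; the first derivatives of `W` allow for
a right-hand side without flux. -/
theorem isWeakPoisson_cutoff_of_weakPd {W' : Fin 4 → R4 → ℝ} (hW : ∀ i, WeakPd Ω i W (W' i))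
    (hgm : Measurable g) (hg : Integrable g)
    (heq : ∀ φ, IsTest Ω φ → ∫ x, W x * lapl φ x = ∫ x, g x * φ x) (hζ : IsTest Ω ζ) :
    IsWeakPoisson (fun x => ζ x * W x) (fun _ _ => 0)
      (fun x => ζ x * g x + 2 * (∑ i, pd i ζ x * W' i x) + lapl ζ x * W x) := by
  have mζ := hζ.continuous.measurable
  have mζ' := fun i => (hζ.pd i).continuous.measurable
  have mζ'' := (isTest_lapl hζ).continuous.measurable
  have mW := (hW 0).measurable
  have mW' := fun i => (hW i).measurable_deriv
  have hWi := (hW 0).integrable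
  have I1 := integrable_test_mul hWi hζ
  have I3 := ((integrable_test_mul hg hζ).add ((integrable_finsetSum Finset.univ fun i _ =>
    integrable_test_mul (hW i).integrable_deriv (hζ.pd i)).const_mul 2)).add
    (integrable_test_mul hWi (isTest_lapl hζ))
  refine ⟨by fun_prop, fun _ => measurable_const, by fun_prop, I1, fun _ => integrable_zero _ _ _,
    I3, fun φ hφ => ?_⟩
  have hT := hζ.mul_right hφ
  have hT' := fun i => (hζ.pd i).mul_right hφ
  have hB : ∀ i, Integrable fun x =>
      2 * (W x * pd i (fun x => pd i ζ x * φ x) x + W' i x * (pd i ζ x * φ x)) := fun i =>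
    ((integrable_mul_test hWi ((hT' i).pd i)).add
      (integrable_mul_test (hW i).integrable_deriv (hT' i))).const_mul 2
  have key := integral_sub_sum_sub (integrable_mul_test hWi (isTest_lapl hT)) hB
    (integrable_mul_test hg hT)
  simp only [integral_const_mul, (hW _).integral_add_eq_zero (hT' _), heq _ hT, mul_zero,
    Finset.sum_const_zero, sub_zero, sub_self] at key
  rw [← sub_eq_zero]
  simp only [zero_mul, integral_zero, Finset.sum_const_zero, zero_add]
  refine (integral_sub (hζ.integrable_mul I1 (contDiff_lapl hφ) fun x h _ _ => by simp [h])
    (hζ.integrable_mul I3 hφ fun x h h' h'' => by simp [h, h', h''])).symm.trans (Eq.trans ?_ key)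
  congr 1 with x
  simp only [lapl_mul hζ.contDiff hφ, pd_mul (hζ.pd _).contDiff hφ, Fin.sum_univ_four, Pi.add_apply]
  simp only [lapl, Fin.sum_univ_four]; ring

end Cutoff

/-! ### Equations for the cut off derivatives -/

theorem pd_comm {φ : R4 → ℝ} (hφ : ContDiff ℝ ∞ φ) (i j : Fin 4) :
    pd i (pd j φ) = pd j (pd i φ) := by
  have h2 : ∀ i j x, pd i (pd j φ) x = fderiv ℝ (fderiv ℝ φ) x (e i) (e j) := by
    intro i j x
    have hd : DifferentiableAt ℝ (fderiv ℝ φ) x :=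
      (hφ.fderiv_right (m := ∞) (by simp)).contDiffAt.differentiableAt (by simp)
    have : HasFDerivAt (fun y => fderiv ℝ φ y (e j))
        ((ContinuousLinearMap.apply ℝ ℝ (e j)).comp (fderiv ℝ (fderiv ℝ φ) x)) x :=
      (ContinuousLinearMap.apply ℝ ℝ (e j)).hasFDerivAt.comp x hd.hasFDerivAt
    show fderiv ℝ (fun y => fderiv ℝ φ y (e j)) x (e i) = _
    rw [this.fderiv]; rfl
  funext x
  rw [h2, h2]
  have := (hφ.contDiffAt (x := x)).isSymmSndFDerivAt (n := ∞) (by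
    rw [minSmoothness_of_isRCLikeNormedField]; exact WithTop.coe_le_coe.2 (le_top : (2 : ℕ∞) ≤ ⊤))
  bound

/-- A test function and its derivatives of order at most two are bounded. -/
theorem IsTest.exists_enorm_le {Ω : Set R4} {ζ : R4 → ℝ} (hζ : IsTest Ω ζ) :
    ∃ M : ℝ≥0, (∀ x, ‖ζ x‖ₑ ≤ M) ∧ (∀ i x, ‖BiharmonicSphere.pd i ζ x‖ₑ ≤ M)
      ∧ ∀ x, ‖lapl ζ x‖ₑ ≤ M := by
  have hb : ∀ {ψ : R4 → ℝ}, IsTest Ω ψ → ∃ M : ℝ≥0, ∀ x, ‖ψ x‖ₑ ≤ M := by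
    intro ψ hψ
    obtain ⟨M, hM⟩ := hψ.exists_bound
    refine ⟨M.toNNReal, fun x => ?_⟩
    rw [Real.enorm_eq_ofReal_abs]
    simp [*]
  obtain ⟨M0, h0⟩ := hb hζ
  choose M1 h1 using fun i => hb (hζ.pd i)
  obtain ⟨M2, h2⟩ := hb (isTest_lapl hζ)
  refine ⟨M0 + ∑ i, M1 i + M2, fun x => (h0 x).trans ?_, fun i x => (h1 i x).trans ?_,
    fun x => (h2 x).trans ?_⟩ <;> norm_cast
  · rw [add_assoc]; exact le_self_add
  · exact (single_le_sum (f := M1) (fun _ _ => zero_le) (Finset.mem_univ i)).trans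
      (le_add_self.trans le_self_add)
  · simp

section Magnitudes

variable {ι : Type*} [Fintype ι]

/-- The `ℓ¹` length of the first derivatives. -/
def gradMag (D1 : Fin 4 → ι → R4 → ℝ) (x : R4) : ℝ≥0∞ := ∑ i, ∑ a, ‖D1 i a x‖ₑ

/-- The `ℓ¹` length of the second derivatives. -/
def hessMag (D2 : Fin 4 → Fin 4 → ι → R4 → ℝ) (x : R4) : ℝ≥0∞ := ∑ i, ∑ j, ∑ a, ‖D2 i j a x‖ₑ

/-- The `ℓ¹` length of the Laplacian. -/
def lapMag (D2 : Fin 4 → Fin 4 → ι → R4 → ℝ) (x : R4) : ℝ≥0∞ := ∑ a, ‖lapC D2 a x‖ₑ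

/-- The `ℓ¹` length of a vector field. -/
def srcMag (f : ι → R4 → ℝ) (x : R4) : ℝ≥0∞ := ∑ a, ‖f a x‖ₑ

variable {D1 : Fin 4 → ι → R4 → ℝ} {D2 : Fin 4 → Fin 4 → ι → R4 → ℝ} {f : ι → R4 → ℝ}

theorem enorm_le_gradMag (i : Fin 4) (a : ι) (x : R4) : ‖D1 i a x‖ₑ ≤ gradMag D1 x :=
  (single_le_sum (f := fun a => ‖D1 i a x‖ₑ) (fun _ _ => zero_le) (Finset.mem_univ a)).trans
    (single_le_sum (f := fun i => ∑ a, ‖D1 i a x‖ₑ) (fun _ _ => zero_le)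
      (Finset.mem_univ i))

theorem enorm_le_hessMag (i j : Fin 4) (a : ι) (x : R4) : ‖D2 i j a x‖ₑ ≤ hessMag D2 x :=
  (enorm_le_gradMag (D1 := D2 i) j a x).trans
    (single_le_sum (f := fun i => ∑ j, ∑ a, ‖D2 i j a x‖ₑ) (fun _ _ => zero_le)
      (Finset.mem_univ i))

theorem enorm_le_lapMag (a : ι) (x : R4) : ‖lapC D2 a x‖ₑ ≤ lapMag D2 x :=
  single_le_sum (f := fun a => ‖lapC D2 a x‖ₑ) (fun _ _ => zero_le) (Finset.mem_univ a)

theorem enorm_le_srcMag (a : ι) (x : R4) : ‖f a x‖ₑ ≤ srcMag f x :=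
  single_le_sum (f := fun a => ‖f a x‖ₑ) (fun _ _ => zero_le) (Finset.mem_univ a)

theorem lapMag_le_hessMag (x : R4) : lapMag D2 x ≤ hessMag D2 x := by
  calc lapMag D2 x ≤ ∑ a, ∑ i, ‖D2 i i a x‖ₑ := sum_le_sum fun a _ => enorm_sum_le _ _
    _ = ∑ i, ∑ a, ‖D2 i i a x‖ₑ := sum_comm
    _ ≤ hessMag D2 x := sum_le_sum fun i _ =>
        single_le_sum (f := fun j => ∑ a, ‖D2 i j a x‖ₑ) (fun _ _ => zero_le)
          (Finset.mem_univ i)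

theorem enorm_gradSq_le (x : R4) : ‖gradSq D1 x‖ₑ ≤ gradMag D1 x * gradMag D1 x := by
  rw [gradSq]
  refine (enorm_sum_le _ _).trans ?_
  nth_rewrite 2 [gradMag]
  rw [mul_sum]
  refine sum_le_sum fun i _ => (enorm_sum_le _ _).trans ?_
  rw [mul_sum]
  refine sum_le_sum fun a _ => ?_
  rw [enorm_pow, sq]; gcongr
  exact enorm_le_gradMag i a x

/-- A vector is controlled by its wedge and its scalar product with a unit vector. -/
theorem enorm_sphere_le {u v : ι → ℝ} (hu : ∑ a, u a ^ 2 = 1) (hb : ∀ a, |u a| ≤ 1) (a : ι) :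
    ‖v a‖ₑ ≤ (∑ b, ‖v a * u b - u a * v b‖ₑ) + ‖∑ b, u b * v b‖ₑ := by
  have hb' : ∀ a, ‖u a‖ₑ ≤ 1 := fun a => by solve_by_elim
  have key : v a = (∑ b, (v a * u b - u a * v b) * u b) + (∑ b, u b * v b) * u a := by
    have e1 : ∑ b, (v a * u b - u a * v b) * u b
        = v a * (∑ b, u b ^ 2) - u a * ∑ b, u b * v b := by
      rw [mul_sum, mul_sum, ← Finset.sum_sub_distrib]
      grind
    grind
  nth_rewrite 1 [key]
  refine (enorm_add_le _ _).trans (add_le_add ((enorm_sum_le _ _).trans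
    (sum_le_sum fun b _ => ?_)) ?_)
  · rw [enorm_mul]; exact mul_le_of_le_one_right zero_le (hb' b)
  · rw [enorm_mul]; exact mul_le_of_le_one_right zero_le (hb' a)

end Magnitudes

namespace SphereMap

variable {ι : Type*} [Fintype ι] {Ω : Set R4} {u f : ι → R4 → ℝ} {D1 D3 : Fin 4 → ι → R4 → ℝ}
  {D2 : Fin 4 → Fin 4 → ι → R4 → ℝ}

theorem measurable_u (h : SphereMap Ω u D1 D2 D3 f) (a : ι) : Measurable (u a) :=
  (h.weak₁ 0 a).measurable

theorem measurable_D1 (h : SphereMap Ω u D1 D2 D3 f) (i : Fin 4) (a : ι) : Measurable (D1 i a) :=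
  (h.weak₁ i a).measurable_deriv

theorem measurable_D2 (h : SphereMap Ω u D1 D2 D3 f) (i j : Fin 4) (a : ι) :
    Measurable (D2 i j a) :=
  (h.weak₂ i j a).measurable_deriv

theorem measurable_D3 (h : SphereMap Ω u D1 D2 D3 f) (i : Fin 4) (a : ι) : Measurable (D3 i a) :=
  (h.weak₃ i a).measurable_deriv

theorem measurable_lapC (h : SphereMap Ω u D1 D2 D3 f) (a : ι) : Measurable (lapC D2 a) :=
  (h.weak₃ 0 a).measurable

theorem measurable_gradMag (h : SphereMap Ω u D1 D2 D3 f) : Measurable (gradMag D1) :=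
  measurable_sum _ fun i _ => measurable_sum _ fun a _ => (h.measurable_D1 i a).enorm

theorem measurable_hessMag (h : SphereMap Ω u D1 D2 D3 f) : Measurable (hessMag D2) :=
  measurable_sum _ fun i _ => measurable_sum _ fun j _ =>
    measurable_sum _ fun a _ => (h.measurable_D2 i j a).enorm

theorem measurable_lapMag (h : SphereMap Ω u D1 D2 D3 f) : Measurable (lapMag D2) :=
  measurable_sum _ fun a _ => (h.measurable_lapC a).enorm

theorem measurable_thirdMag (h : SphereMap Ω u D1 D2 D3 f) : Measurable (gradMag D3) :=
  measurable_sum _ fun i _ => measurable_sum _ fun a _ => (h.measurable_D3 i a).enorm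

theorem measurable_srcMag (h : SphereMap Ω u D1 D2 D3 f) : Measurable (srcMag f) :=
  measurable_sum _ fun a _ => (h.measurable_f a).enorm

theorem enorm_u_le (h : SphereMap Ω u D1 D2 D3 f) (a : ι) (x : R4) : ‖u a x‖ₑ ≤ 1 := by
  rw [Real.enorm_eq_ofReal_abs]
  exact ofReal_le_one.2 (h.abs_le a x)

theorem integrable_mul_u (h : SphereMap Ω u D1 D2 D3 f) {v : R4 → ℝ} (hv : Integrable v) (a : ι) :
    Integrable fun x => v x * u a x :=
  hv.mul_bdd (c := 1) (h.measurable_u a).aestronglyMeasurable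
    (.of_forall fun x => h.abs_le a x)

theorem integrable_wedgeLap (h : SphereMap Ω u D1 D2 D3 f) (a b : ι) :
    Integrable (wedgeLap u D2 a b) := by
  have := (h.integrable_mul_u (h.weak₃ 0 a).integrable b).sub
    (h.integrable_mul_u (h.weak₃ 0 b).integrable a)
  refine this.congr (.of_forall fun x => ?_)
  simp only [wedgeLap, Pi.sub_apply]; ring

theorem measurable_wedgeLap (h : SphereMap Ω u D1 D2 D3 f) (a b : ι) :
    Measurable (wedgeLap u D2 a b) :=
  ((h.measurable_u b).mul (h.measurable_lapC a)).sub ((h.measurable_u a).mul (h.measurable_lapC b))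

theorem integrable_wedgeFlux (h : SphereMap Ω u D1 D2 D3 f) (a b : ι) (i : Fin 4) :
    Integrable (wedgeFlux D1 D2 a b i) :=
  ((h.memLp_D1_two i b).integrable_mul (h.memLp_lapC a)).sub
    ((h.memLp_D1_two i a).integrable_mul (h.memLp_lapC b))

theorem measurable_wedgeFlux (h : SphereMap Ω u D1 D2 D3 f) (a b : ι) (i : Fin 4) :
    Measurable (wedgeFlux D1 D2 a b i) :=
  ((h.measurable_D1 i b).mul (h.measurable_lapC a)).sub
    ((h.measurable_D1 i a).mul (h.measurable_lapC b))

/-- The wedge form of the equation, cut off. -/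
theorem isWeakPoisson_wedgeLap (h : SphereMap Ω u D1 D2 D3 f) {ζ : R4 → ℝ} (hζ : IsTest Ω ζ)
    (a b : ι) :
    IsWeakPoisson (fun x => ζ x * wedgeLap u D2 a b x)
      (fun i x => ζ x * (-2 * wedgeFlux D1 D2 a b i x) - 2 * (pd i ζ x * wedgeLap u D2 a b x))
      (fun x => ζ x * (f a x * u b x - f b x * u a x)
        + (∑ i, pd i ζ x * (-2 * wedgeFlux D1 D2 a b i x)) - lapl ζ x * wedgeLap u D2 a b x) := by
  have hg : Integrable fun x => f a x * u b x - f b x * u a x :=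
    (h.integrable_mul_u (h.integrable_f a) b).sub (h.integrable_mul_u (h.integrable_f b) a)
  have hG : ∀ i, Integrable fun x => -2 * wedgeFlux D1 D2 a b i x := fun i =>
    (h.integrable_wedgeFlux a b i).const_mul _
  refine isWeakPoisson_cutoff (h.measurable_wedgeLap a b) (h.integrable_wedgeLap a b)
    (fun i => (h.measurable_wedgeFlux a b i).const_mul _) hG
    (((h.measurable_f a).mul (h.measurable_u b)).sub ((h.measurable_f b).mul (h.measurable_u a)))
    hg (fun φ hφ => ?_) hζ
  have key := h.integral_wedgeLap a b hφ
  have I1 : Integrable fun x => wedgeLap u D2 a b x * lapl φ x :=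
    integrable_mul_test (h.integrable_wedgeLap a b) (isTest_lapl hφ)
  have I2 : ∀ i, Integrable fun x => -2 * wedgeFlux D1 D2 a b i x * pd i φ x := fun i =>
    integrable_mul_test (hG i) (hφ.pd i)
  have I3 : Integrable fun x => (f a x * u b x - f b x * u a x) * φ x := integrable_mul_test hg hφ
  have I4 : Integrable fun x => ∑ i, -2 * wedgeFlux D1 D2 a b i x * pd i φ x :=
    integrable_finsetSum _ fun i _ => I2 i
  have I5 : Integrable fun x => wedgeLap u D2 a b x * lapl φ x
      - ∑ i, -2 * wedgeFlux D1 D2 a b i x * pd i φ x := I1.sub I4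
  have e1 : (∫ x, wedgeLap u D2 a b x * lapl φ x)
      - (∑ i, ∫ x, -2 * wedgeFlux D1 D2 a b i x * pd i φ x)
      - ∫ x, (f a x * u b x - f b x * u a x) * φ x = 0 := by
    rw [← integral_finsetSum _ fun i _ => I2 i, ← integral_sub I1 I4, ← integral_sub I5 I3, ← key]
    refine integral_congr_ae (.of_forall fun x => ?_)
    simp only [Fin.sum_univ_four]; ring
  linarith

theorem integral_D1_mul_lapl (h : SphereMap Ω u D1 D2 D3 f) (j : Fin 4) (a : ι) {φ : R4 → ℝ}
    (hφ : IsTest Ω φ) :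
    ∫ x, D1 j a x * lapl φ x = -∫ x, lapC D2 a x * pd j φ x := by
  have e1 : ∀ i, ∫ x, D1 j a x * pd i (pd i φ) x = -∫ x, D2 i i a x * pd j φ x := by
    intro i
    have h1 := (h.weak₁ j a).eq _ ((hφ.pd i).pd i)
    have h2 := (h.weak₁ i a).eq _ ((hφ.pd j).pd i)
    have h3 := (h.weak₂ i i a).eq _ (hφ.pd j)
    have c : pd j (pd i (pd i φ)) = pd i (pd i (pd j φ)) := by
      rw [pd_comm (hφ.pd i).contDiff j i, pd_comm hφ.contDiff j i]
    simp_all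
  have I1 : ∀ i, Integrable fun x => D1 j a x * pd i (pd i φ) x := fun i =>
    integrable_mul_test (h.weak₁ j a).integrable_deriv ((hφ.pd i).pd i)
  have I2 : ∀ i, Integrable fun x => D2 i i a x * pd j φ x := fun i =>
    integrable_mul_test (h.weak₂ i i a).integrable_deriv (hφ.pd j)
  simp only [lapl, lapC, mul_sum, sum_mul]
  rw [integral_finsetSum _ fun i _ => I1 i, integral_finsetSum _ fun i _ => I2 i,
    ← sum_neg_distrib]
  simp [*]

/-- The equation `Δ ∂ⱼu = ∂ⱼ Δu`, cut off. -/
theorem isWeakPoisson_D1 (h : SphereMap Ω u D1 D2 D3 f) {ζ : R4 → ℝ} (hζ : IsTest Ω ζ)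
    (j : Fin 4) (a : ι) :
    IsWeakPoisson (fun x => ζ x * D1 j a x)
      (fun i x => ζ x * (if i = j then -lapC D2 a x else 0) - 2 * (pd i ζ x * D1 j a x))
      (fun x => ζ x * 0 + (∑ i, pd i ζ x * (if i = j then -lapC D2 a x else 0))
        - lapl ζ x * D1 j a x) := by
  have hG : ∀ i : Fin 4, Measurable (fun x => if i = j then -lapC D2 a x else 0)
      ∧ Integrable (fun x => if i = j then -lapC D2 a x else 0) := by
    intro i
    by_cases hij : i = j
    · simpa only [hij, if_true] using ⟨(h.measurable_lapC a).neg, (h.weak₃ 0 a).integrable.neg⟩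
    · simp [*]
  refine isWeakPoisson_cutoff (h.measurable_D1 j a) (h.weak₁ j a).integrable_deriv
    (fun i => (hG i).1) (fun i => (hG i).2) measurable_const (integrable_zero _ _ _)
    (fun φ hφ => ?_) hζ
  rw [h.integral_D1_mul_lapl j a hφ, Finset.sum_eq_single j]
  · simp [integral_neg]
  · aesop
  · simp

theorem isWeakPoisson_D1' (h : SphereMap Ω u D1 D2 D3 f) {ζ : R4 → ℝ} (hζ : IsTest Ω ζ)
    (j : Fin 4) (a : ι) :
    IsWeakPoisson (fun x => ζ x * D1 j a x) (fun _ _ => 0)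
      (fun x => ζ x * D3 j a x + 2 * (∑ i, pd i ζ x * D2 i j a x) + lapl ζ x * D1 j a x) :=
  isWeakPoisson_cutoff_of_weakPd (fun i => h.weak₂ i j a) (h.measurable_D3 j a)
    (h.weak₃ j a).integrable_deriv (fun φ hφ => by
      rw [h.integral_D1_mul_lapl j a hφ, (h.weak₃ j a).eq φ hφ, neg_neg]) hζ

/-- The weak derivative of `u^b Δu^a - u^a Δu^b`. -/
def wedgeLapDeriv (u : ι → R4 → ℝ) (D1 : Fin 4 → ι → R4 → ℝ) (D2 : Fin 4 → Fin 4 → ι → R4 → ℝ)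
    (D3 : Fin 4 → ι → R4 → ℝ) (j : Fin 4) (a b : ι) (x : R4) : ℝ :=
  (D1 j b x * lapC D2 a x + u b x * D3 j a x) + -(D1 j a x * lapC D2 b x + u a x * D3 j b x)

theorem weakPd_wedgeLap (h : SphereMap Ω u D1 D2 D3 f) (j : Fin 4) (a b : ι) :
    WeakPd Ω j (wedgeLap u D2 a b) (wedgeLapDeriv u D1 D2 D3 j a b) := by
  have hm := fun a b => (h.weak₁ j b).mul (h.weak₃ j a) h.isOpen (h.memLp_two b)
    (h.memLp_D1_two j b) (h.memLp_lapC a) (Or.inl ⟨1, h.abs_le b⟩)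
  exact ((hm a b).add (hm b a).neg).congr (h.measurable_wedgeLap a b)
    ((hm a b).add (hm b a).neg).measurable_deriv
    (.of_forall fun x => by simp only [wedgeLap]; ring) (ae_eq_refl _)

end SphereMap

/-! ### Pointwise estimates by potentials -/

theorem pot_le_const_mul (k : ℕ) {g h : R4 → ℝ≥0∞} (hh : Measurable h) (c : ℝ≥0∞)
    (hgh : ∀ y, g y ≤ c * h y) (x : R4) : pot k g x ≤ c * pot k h x := by
  rw [← pot_const_mul k hh]
  exact pot_mono k (.of_forall hgh) x

theorem enorm_two_real : ‖(2 : ℝ)‖ₑ = 2 := by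
  rw [Real.enorm_eq_ofReal (by norm_num)]; simp

/-- The constant of the representation formula. -/
def repConst : ℝ≥0 := 8 * kerMass⁻¹.toNNReal

theorem IsWeakPoisson.ae_enorm_le_of_le {W g : R4 → ℝ} {G : Fin 4 → R4 → ℝ}
    (hW : IsWeakPoisson W G g) {P Q : R4 → ℝ≥0∞} (hP : Measurable P) (hQ : Measurable Q) {c : ℝ≥0}
    (hG : ∀ i x, ‖G i x‖ₑ ≤ c * P x) (hg : ∀ x, ‖g x‖ₑ ≤ c * Q x) :
    ∀ᵐ x, ‖W x‖ₑ ≤ (repConst * c : ℝ≥0) * (pot 3 P x + pot 2 Q x) := by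
  filter_upwards [hW.ae_enorm_le_pot] with x hx
  refine hx.trans ?_
  calc _ ≤ ofReal kerMass⁻¹ * (2 * ∑ _i : Fin 4, c * pot 3 P x + 8 * (c * pot 2 Q x)) := by
        refine mul_le_mul_right (add_le_add (mul_le_mul_right (sum_le_sum fun i _ =>
          pot_le_const_mul 3 hP c (hG i) x) 2) ((pot_le_const_mul 2 hQ c hg x).trans ?_)) _
        exact le_mul_of_one_le_left zero_le (by norm_num)
    _ = _ := by
        rw [ofReal, repConst]
        simp only [sum_const, card_univ, card_fin, nsmul_eq_mul]
        push_cast; ring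

namespace SphereMap

variable {ι : Type*} [Fintype ι] {Ω : Set R4} {u f : ι → R4 → ℝ} {D1 D3 : Fin 4 → ι → R4 → ℝ}
  {D2 : Fin 4 → Fin 4 → ι → R4 → ℝ}

theorem enorm_wedgeLap_le (h : SphereMap Ω u D1 D2 D3 f) (a b : ι) (x : R4) :
    ‖wedgeLap u D2 a b x‖ₑ ≤ 2 * lapMag D2 x := by
  rw [wedgeLap, two_mul]
  refine enorm_sub_le.trans (add_le_add ?_ ?_) <;> rw [enorm_mul, ← one_mul (lapMag D2 x)]
  exacts [mul_le_mul' (h.enorm_u_le b x) (enorm_le_lapMag a x),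
    mul_le_mul' (h.enorm_u_le a x) (enorm_le_lapMag b x)]

theorem enorm_wedgeFlux_le (a b : ι) (i : Fin 4) (x : R4) :
    ‖wedgeFlux D1 D2 a b i x‖ₑ ≤ 2 * (gradMag D1 x * lapMag D2 x) := by
  rw [wedgeFlux, two_mul]
  refine enorm_sub_le.trans (add_le_add ?_ ?_) <;> rw [enorm_mul]
  exacts [mul_le_mul' (enorm_le_gradMag i b x) (enorm_le_lapMag a x),
    mul_le_mul' (enorm_le_gradMag i a x) (enorm_le_lapMag b x)]

/-- The flux in the equation of the cut off function `ζ (u^b Δu^a - u^a Δu^b)`. -/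
theorem enorm_cutoffFlux_le (h : SphereMap Ω u D1 D2 D3 f) {ζ : R4 → ℝ} {M : ℝ≥0}
    (hM1 : ∀ i x, ‖pd i ζ x‖ₑ ≤ M) (a b : ι) (i : Fin 4) (x : R4) :
    ‖ζ x * (-2 * wedgeFlux D1 D2 a b i x) - 2 * (pd i ζ x * wedgeLap u D2 a b x)‖ₑ
      ≤ (4 + 16 * M : ℝ≥0) * (gradMag D1 x * (‖ζ x‖ₑ * lapMag D2 x) + lapMag D2 x) := by
  refine enorm_sub_le.trans ?_
  simp only [enorm_mul, enorm_neg, enorm_two_real]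
  calc _ ≤ ‖ζ x‖ₑ * (2 * (2 * (gradMag D1 x * lapMag D2 x))) + 2 * (M * (2 * lapMag D2 x)) := by
        gcongr
        · exact enorm_wedgeFlux_le a b i x
        · exact hM1 i x
        · exact h.enorm_wedgeLap_le a b x
    _ = 4 * (gradMag D1 x * (‖ζ x‖ₑ * lapMag D2 x)) + (4 * M) * lapMag D2 x := by ring
    _ ≤ (4 + 16 * M) * (gradMag D1 x * (‖ζ x‖ₑ * lapMag D2 x)) + (4 + 16 * M) * lapMag D2 x := by
        gcongr
        · exact le_self_add
        · exact le_trans (mul_le_mul' (by norm_num) le_rfl) le_add_self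
    _ = _ := by push_cast; ring

/-- The source in the equation of the cut off function `ζ (u^b Δu^a - u^a Δu^b)`. -/
theorem enorm_cutoffSource_le (h : SphereMap Ω u D1 D2 D3 f) {ζ : R4 → ℝ} {M : ℝ≥0}
    (hM0 : ∀ x, ‖ζ x‖ₑ ≤ M) (hM1 : ∀ i x, ‖pd i ζ x‖ₑ ≤ M) (hM2 : ∀ x, ‖lapl ζ x‖ₑ ≤ M)
    (a b : ι) (x : R4) :
    ‖ζ x * (f a x * u b x - f b x * u a x)
        + (∑ i, pd i ζ x * (-2 * wedgeFlux D1 D2 a b i x)) - lapl ζ x * wedgeLap u D2 a b x‖ₑ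
      ≤ (4 + 16 * M : ℝ≥0) * (srcMag f x + gradMag D1 x * lapMag D2 x + lapMag D2 x) := by
  have hs : ‖f a x * u b x - f b x * u a x‖ₑ ≤ 2 * srcMag f x := by
    rw [two_mul]
    refine enorm_sub_le.trans (add_le_add ?_ ?_) <;> rw [enorm_mul, ← mul_one (srcMag f x)]
    exacts [mul_le_mul' (enorm_le_srcMag a x) (h.enorm_u_le b x),
      mul_le_mul' (enorm_le_srcMag b x) (h.enorm_u_le a x)]
  calc _ ≤ M * (2 * srcMag f x) + (∑ _i : Fin 4, M * (2 * (2 * (gradMag D1 x * lapMag D2 x))))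
        + M * (2 * lapMag D2 x) := by
        refine enorm_sub_le.trans (add_le_add ((enorm_add_le _ _).trans (add_le_add ?_ ?_)) ?_)
        · rw [enorm_mul]; bound
        · refine (enorm_sum_le _ _).trans (sum_le_sum fun i _ => ?_)
          rw [enorm_mul, enorm_mul, enorm_neg, enorm_two_real]
          exact mul_le_mul' (hM1 i x) (mul_le_mul_right (enorm_wedgeFlux_le a b i x) 2)
        · rw [enorm_mul]
          exact mul_le_mul' (hM2 x) (h.enorm_wedgeLap_le a b x)
    _ = (2 * M) * srcMag f x + (16 * M) * (gradMag D1 x * lapMag D2 x) + (2 * M) * lapMag D2 x := by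
        simp only [sum_const, card_univ, card_fin, nsmul_eq_mul]
        push_cast; ring
    _ ≤ (4 + 16 * M) * srcMag f x + (4 + 16 * M) * (gradMag D1 x * lapMag D2 x)
        + (4 + 16 * M) * lapMag D2 x := by
        have : 2 * (M : ℝ≥0∞) ≤ 4 + 16 * M :=
          le_trans (mul_le_mul' (by norm_num) le_rfl) le_add_self
        bound
    _ = _ := by push_cast; ring

/-- The last term is the normal component `⟨u, Δu⟩ = -|Du|²`. -/
theorem exists_lapMag_le {ζ : R4 → ℝ} (hζ : IsTest Ω ζ) (ι : Type*) [Fintype ι] :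
    ∃ C : ℝ≥0, ∀ {u : ι → R4 → ℝ} {D1 D2 D3 f}, SphereMap Ω u D1 D2 D3 f →
      ∀ᵐ x, ‖ζ x‖ₑ * lapMag D2 x
        ≤ C * (pot 3 (fun y => gradMag D1 y * (‖ζ y‖ₑ * lapMag D2 y) + lapMag D2 y) x
          + pot 2 (fun y => srcMag f y + gradMag D1 y * lapMag D2 y + lapMag D2 y) x)
          + C * (gradMag D1 x * (‖ζ x‖ₑ * gradMag D1 x)) := by
  obtain ⟨M, hM0, hM1, hM2⟩ := hζ.exists_enorm_le
  set c : ℝ≥0 := repConst * (4 + 16 * M) with hc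
  refine ⟨Fintype.card ι * Fintype.card ι * c + Fintype.card ι,
    fun {u D1 D2 D3 f} h => ?_⟩
  have mζ : Measurable fun x => ‖ζ x‖ₑ := hζ.continuous.measurable.enorm
  have ma := h.measurable_gradMag
  have mb := h.measurable_lapMag
  have mf := h.measurable_srcMag
  have hω : ∀ a b, ∀ᵐ x, ‖ζ x * wedgeLap u D2 a b x‖ₑ ≤ c *
      (pot 3 (fun y => gradMag D1 y * (‖ζ y‖ₑ * lapMag D2 y) + lapMag D2 y) x
          + pot 2 (fun y => srcMag f y + gradMag D1 y * lapMag D2 y + lapMag D2 y) x) := fun a b =>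
    (h.isWeakPoisson_wedgeLap hζ a b).ae_enorm_le_of_le (by fun_prop) (by fun_prop)
      (fun i x => h.enorm_cutoffFlux_le hM1 a b i x)
      (fun x => h.enorm_cutoffSource_le hM0 hM1 hM2 a b x)
  filter_upwards [ae_all_iff.2 fun a => ae_all_iff.2 (hω a), h.sphere, h.ae_dotLap]
    with x hx hs hd
  set X := pot 3 (fun y => gradMag D1 y * (‖ζ y‖ₑ * lapMag D2 y) + lapMag D2 y) x
          + pot 2 (fun y => srcMag f y + gradMag D1 y * lapMag D2 y + lapMag D2 y) x
  by_cases hxΩ : x ∈ Ω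
  · have h1 : ∀ a, ‖lapC D2 a x‖ₑ
        ≤ (∑ b, ‖wedgeLap u D2 a b x‖ₑ) + gradMag D1 x * gradMag D1 x := by
      intro a
      refine (enorm_sphere_le (u := fun a => u a x) (v := fun a => lapC D2 a x) (hs hxΩ)
        (fun a => h.abs_le a x) a).trans (add_le_add (sum_le_sum fun b _ => le_of_eq ?_) ?_)
      · rw [wedgeLap]; ring_nf
      · have := hd hxΩ
        rw [dotLap] at this
        rw [this, enorm_neg]
        exact enorm_gradSq_le x
    calc ‖ζ x‖ₑ * lapMag D2 x
        ≤ ‖ζ x‖ₑ * ∑ a, ((∑ b, ‖wedgeLap u D2 a b x‖ₑ) + gradMag D1 x * gradMag D1 x) :=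
          mul_le_mul_right (sum_le_sum fun a _ => h1 a) _
      _ = (∑ a, ∑ b, ‖ζ x * wedgeLap u D2 a b x‖ₑ)
          + Fintype.card ι * (gradMag D1 x * (‖ζ x‖ₑ * gradMag D1 x)) := by
          simp only [sum_add_distrib, mul_add, enorm_mul, mul_sum, sum_const,
            card_univ, nsmul_eq_mul]
          ring
      _ ≤ (∑ _a : ι, ∑ _b : ι, c * X)
          + Fintype.card ι * (gradMag D1 x * (‖ζ x‖ₑ * gradMag D1 x)) := by bound
      _ = (Fintype.card ι * Fintype.card ι * c : ℝ≥0∞) * X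
          + Fintype.card ι * (gradMag D1 x * (‖ζ x‖ₑ * gradMag D1 x)) := by
          simp only [sum_const, card_univ, nsmul_eq_mul]; ring
      _ ≤ _ := by
          push_cast
          gcongr
          · simp
          · simp
  · rw [hζ.eq_zero hxΩ]; simp

theorem exists_gradMag_le {ζ : R4 → ℝ} (hζ : IsTest Ω ζ) (ι : Type*) [Fintype ι] :
    ∃ C : ℝ≥0, ∀ {u : ι → R4 → ℝ} {D1 D2 D3 f}, SphereMap Ω u D1 D2 D3 f →
      ∀ᵐ x, ‖ζ x‖ₑ * gradMag D1 x
        ≤ C * (pot 3 (fun y => ‖ζ y‖ₑ * lapMag D2 y + gradMag D1 y) x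
          + pot 2 (fun y => lapMag D2 y + gradMag D1 y) x) := by
  obtain ⟨M, hM0, hM1, hM2⟩ := hζ.exists_enorm_le
  set c : ℝ≥0 := repConst * (1 + 4 * M) with hc
  refine ⟨4 * Fintype.card ι * c, fun {u D1 D2 D3 f} h => ?_⟩
  have mζ : Measurable fun x => ‖ζ x‖ₑ := hζ.continuous.measurable.enorm
  have ma := h.measurable_gradMag
  have mb := h.measurable_lapMag
  have hif : ∀ (i j : Fin 4) a x, ‖(if i = j then -lapC D2 a x else 0 : ℝ)‖ₑ ≤ lapMag D2 x := by
    intro i j a x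
    by_cases hij : i = j
    · simpa [hij] using enorm_le_lapMag a x
    · simp [hij]
  have hω : ∀ j a, ∀ᵐ x, ‖ζ x * D1 j a x‖ₑ ≤ c *
      (pot 3 (fun y => ‖ζ y‖ₑ * lapMag D2 y + gradMag D1 y) x
          + pot 2 (fun y => lapMag D2 y + gradMag D1 y) x) := by
    intro j a
    refine (h.isWeakPoisson_D1 hζ j a).ae_enorm_le_of_le (by fun_prop) (by fun_prop)
      (fun i x => ?_) (fun x => ?_)
    · refine enorm_sub_le.trans ?_
      simp only [enorm_mul, enorm_two_real]
      calc _ ≤ ‖ζ x‖ₑ * lapMag D2 x + 2 * (M * gradMag D1 x) := by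
            gcongr
            · simp [*]
            · bound
            · exact enorm_le_gradMag j a x
        _ ≤ ‖ζ x‖ₑ * lapMag D2 x + 4 * (M * gradMag D1 x) := by bound
        _ ≤ (‖ζ x‖ₑ * lapMag D2 x + 4 * (M * gradMag D1 x))
            + (4 * M * (‖ζ x‖ₑ * lapMag D2 x) + gradMag D1 x) := le_self_add
        _ = _ := by push_cast; ring
    · calc _ ≤ (∑ _i : Fin 4, M * lapMag D2 x) + M * gradMag D1 x := by
            refine enorm_sub_le.trans (add_le_add ?_ ?_)
            · rw [mul_zero, zero_add]
              refine (enorm_sum_le _ _).trans (sum_le_sum fun i _ => ?_)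
              rw [enorm_mul]
              exact mul_le_mul' (hM1 i x) (hif i j a x)
            · rw [enorm_mul]
              exact mul_le_mul' (hM2 x) (enorm_le_gradMag j a x)
        _ ≤ (∑ _i : Fin 4, M * lapMag D2 x) + M * gradMag D1 x
            + (lapMag D2 x + gradMag D1 x + 3 * M * gradMag D1 x) := le_self_add
        _ = _ := by
            simp only [sum_const, card_univ, card_fin, nsmul_eq_mul]
            push_cast; ring
  filter_upwards [ae_all_iff.2 fun j => ae_all_iff.2 (hω j)] with x hx
  calc ‖ζ x‖ₑ * gradMag D1 x = ∑ j, ∑ a, ‖ζ x * D1 j a x‖ₑ := by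
        simp only [gradMag, mul_sum, enorm_mul]
    _ ≤ ∑ _j : Fin 4, ∑ _a : ι, _ := sum_le_sum fun j _ => sum_le_sum fun a _ => hx j a
    _ = _ := by
        simp only [sum_const, card_univ, card_fin, nsmul_eq_mul]
        push_cast; ring

/-- `ζ₂ |DΔu|` in terms of the derivatives of the functions `ζ (u^b Δu^a - u^a Δu^b)`. -/
theorem exists_thirdMag_le {ζ ζ₂ : R4 → ℝ} (hζ₂ : IsTest Ω ζ₂) (hb : ∀ x, ‖ζ₂ x‖ₑ ≤ 1) {U : Set R4}
    (hU : IsOpen U) (h1 : ∀ x ∈ U, ζ x = 1) (hsub : tsupport ζ₂ ⊆ U) (ι : Type*) [Fintype ι] :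
    ∃ C : ℝ≥0, ∀ {u : ι → R4 → ℝ} {D1 D2 D3 f}, SphereMap Ω u D1 D2 D3 f →
      ∀ᵐ x, ‖ζ₂ x‖ₑ * gradMag D3 x
        ≤ (∑ j, ∑ a, ∑ b, ‖ζ x * wedgeLapDeriv u D1 D2 D3 j a b x
            + pd j ζ x * wedgeLap u D2 a b x‖ₑ)
          + C * (gradMag D1 x * (‖ζ₂ x‖ₑ * hessMag D2 x)) := by
  set c : ℝ≥0 := (Fintype.card ι : ℝ≥0) with hc
  refine ⟨4 * c * (2 * c + (c + 2 * (4 * c))), fun {u D1 D2 D3 f} h => ?_⟩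
  filter_upwards [h.sphere, ae_all_iff.2 h.ae_dot_gradLap] with x hs hd
  by_cases hxU : x ∈ tsupport ζ₂
  swap
  · rw [image_eq_zero_of_notMem_tsupport hxU]; simp
  have hxΩ := hζ₂.tsupport_subset hxU
  have hz : ζ x = 1 := h1 x (hsub hxU)
  have hz' : ∀ i, pd i ζ x = 0 := fun i => pd_eq_zero_of_eq_one hU h1 i x (hsub hxU)
  simp only [hz, hz', one_mul, zero_mul, add_zero]
  set X := gradMag D1 x * hessMag D2 x with hX
  have q : ∀ i j k a b, ‖D1 i a x * D2 j k b x‖ₑ ≤ X := fun i j k a b => by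
    rw [enorm_mul]
    exact mul_le_mul' (enorm_le_gradMag i a x) (enorm_le_hessMag j k b x)
  have q' : ∀ i a b, ‖D1 i a x * lapC D2 b x‖ₑ ≤ X := fun i a b => by
    rw [enorm_mul]
    exact mul_le_mul' (enorm_le_gradMag i a x) ((enorm_le_lapMag b x).trans (lapMag_le_hessMag x))
  have g1 : ∀ j, ‖gradLap D1 D2 j x‖ₑ ≤ c * X := by
    intro j
    refine (enorm_sum_le _ _).trans ((sum_le_sum fun a _ => q' j a a).trans_eq ?_)
    simp [hc]
  have g2 : ∀ j, ‖∑ i, ∑ a, D2 j i a x * D1 i a x‖ₑ ≤ 4 * c * X := by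
    intro j
    calc _ ≤ ∑ _i : Fin 4, ∑ _a : ι, X := by
          refine (enorm_sum_le _ _).trans (sum_le_sum fun i _ => (enorm_sum_le _ _).trans
            (sum_le_sum fun a _ => ?_))
          rw [mul_comm]; bound
      _ = _ := by simp [hc]; ring
  have key : ∀ j a, ‖D3 j a x‖ₑ ≤ (∑ b, ‖wedgeLapDeriv u D1 D2 D3 j a b x‖ₑ)
      + ((2 * c + (c + 2 * (4 * c)) : ℝ≥0) : ℝ≥0∞) * X := by
    intro j a
    have s1 := enorm_sphere_le (u := fun a => u a x) (v := fun a => D3 j a x) (hs hxΩ)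
      (fun a => h.abs_le a x) a
    have s2 : ‖∑ b, u b x * D3 j b x‖ₑ ≤ (c + 2 * (4 * c)) * X := by
      rw [hd j hxΩ]
      refine enorm_sub_le.trans ?_
      rw [enorm_neg, enorm_mul, enorm_two_real, add_mul]
      refine add_le_add (g1 j) ?_
      rw [mul_assoc (2 : ℝ≥0∞)]; bound
    have s3 : ∀ b, ‖D3 j a x * u b x - u a x * D3 j b x‖ₑ
        ≤ ‖wedgeLapDeriv u D1 D2 D3 j a b x‖ₑ + (X + X) := by
      intro b
      have e1 : D3 j a x * u b x - u a x * D3 j b x = wedgeLapDeriv u D1 D2 D3 j a b x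
          - (D1 j b x * lapC D2 a x - D1 j a x * lapC D2 b x) := by
        rw [wedgeLapDeriv]; ring
      rw [e1]
      exact enorm_sub_le.trans (add_le_add le_rfl
        (enorm_sub_le.trans (add_le_add (q' j b a) (q' j a b))))
    calc ‖D3 j a x‖ₑ ≤ _ := s1
      _ ≤ (∑ b, (‖wedgeLapDeriv u D1 D2 D3 j a b x‖ₑ + (X + X))) + (c + 2 * (4 * c)) * X :=
          add_le_add (sum_le_sum fun b _ => s3 b) s2
      _ = _ := by
          simp only [sum_add_distrib, sum_const, card_univ, nsmul_eq_mul, hc]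
          push_cast; ring
  calc ‖ζ₂ x‖ₑ * gradMag D3 x
      ≤ ‖ζ₂ x‖ₑ * ∑ j, ∑ a, ((∑ b, ‖wedgeLapDeriv u D1 D2 D3 j a b x‖ₑ)
      + ((2 * c + (c + 2 * (4 * c)) : ℝ≥0) : ℝ≥0∞) * X) := by
        refine mul_le_mul_right (sum_le_sum fun j _ => sum_le_sum fun a _ => key j a) _
    _ = ‖ζ₂ x‖ₑ * (∑ j, ∑ a, ∑ b, ‖wedgeLapDeriv u D1 D2 D3 j a b x‖ₑ)
        + ‖ζ₂ x‖ₑ * ((4 * c * (2 * c + (c + 2 * (4 * c))) : ℝ≥0) * X) := by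
        simp only [sum_add_distrib, sum_const, card_univ, nsmul_eq_mul, hc,
          card_fin, mul_add]
        push_cast; ring
    _ ≤ 1 * (∑ j, ∑ a, ∑ b, ‖wedgeLapDeriv u D1 D2 D3 j a b x‖ₑ)
        + ‖ζ₂ x‖ₑ * ((4 * c * (2 * c + (c + 2 * (4 * c))) : ℝ≥0) * X) := by bound
    _ = _ := by rw [hX]; ring

end SphereMap

/-! ### Potentials and products of set bounds -/

namespace SetBound

theorem congr_exponent {θ₁ θ₂ θ₂' : ℝ} {K : ℝ≥0∞} {Z : R4 → ℝ≥0∞} (h : SetBound θ₁ θ₂ K 0 Z) :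
    SetBound θ₁ θ₂' K 0 Z := fun E hE hf => by simpa using h E hE hf

theorem swap {θ₁ θ₂ : ℝ} {K₁ K₂ : ℝ≥0∞} {Z : R4 → ℝ≥0∞} (h : SetBound θ₁ θ₂ K₁ K₂ Z) :
    SetBound θ₂ θ₁ K₂ K₁ Z := fun E hE hf => by simpa only [add_comm] using h E hE hf

theorem pot_of_lintegral {k : ℕ} (hk : 0 < k) (hk4 : k < 4) {Z : R4 → ℝ≥0∞} (hZ : Measurable Z)
    {m : ℝ≥0∞} (hm : ∫⁻ x, Z x ≤ m) (θ₁ : ℝ) :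
    SetBound θ₁ (1 - (k : ℝ) / 4) 0 (potConst k * m) (BiharmonicSphere.pot k Z) := fun E hE hf => by
  rw [zero_mul, zero_add]
  refine (setLIntegral_pot_le hk hk4 hZ hE hf).trans ?_
  gcongr

/-- Functions in `L^p` supported in `S`; the bound has content if `S` has finite measure. -/
theorem of_lintegral_rpow {S : Set R4} (hS : MeasurableSet S) {p θ₁ θ₂ : ℝ}
    (hp : 1 < p) (hθ : 0 ≤ θ₁) (hθp : θ₁ ≤ 1 - 1 / p) {Z : R4 → ℝ≥0∞} (hZ : Measurable Z)
    (h0 : ∀ x, x ∉ S → Z x = 0) {κ : ℝ≥0∞} (hκ : ∫⁻ x, Z x ^ p ≤ κ ^ p) :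
    SetBound θ₁ θ₂ ((1 + volume S) * κ) 0 Z := fun E hE hf => by
  have hpq : p.HolderConjugate (p / (p - 1)) := HolderConjugate.conjExponent hp
  have hq : 1 / (p / (p - 1)) = 1 - 1 / p := by grind
  have hp0 : 0 < p := by linarith
  have h1 : ∫⁻ x in E, Z x = ∫⁻ x, Z x * (E ∩ S).indicator 1 x := by
    rw [← lintegral_indicator hE]
    congr with x
    by_cases hx : x ∈ E <;> by_cases hx' : x ∈ S <;> simp [hx, hx', h0]
  have hi : ∀ x, ((E ∩ S).indicator 1 x : ℝ≥0∞) ^ (p / (p - 1)) = (E ∩ S).indicator 1 x := by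
    intro x; by_cases hx : x ∈ E ∩ S <;> simp [*]
  rw [zero_mul, add_zero, h1]
  have h2 := ENNReal.lintegral_mul_le_Lp_mul_Lq volume hpq hZ.aemeasurable
    ((measurable_one.indicator (hE.inter hS)).aemeasurable (μ := volume) :
      AEMeasurable ((E ∩ S).indicator (1 : R4 → ℝ≥0∞)) volume)
  refine h2.trans ?_
  simp only [hi, lintegral_indicator_one (hE.inter hS), hq]
  have h3 : (∫⁻ x, Z x ^ p) ^ (1 / p) ≤ κ := by
    refine (rpow_le_rpow hκ (by positivity)).trans_eq ?_
    rw [← rpow_mul, mul_one_div_cancel hp0.ne', rpow_one]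
  have h4 : volume (E ∩ S) ^ (1 - 1 / p) ≤ (1 + volume S) * volume E ^ θ₁ := by
    have : 1 - 1 / p = (1 - 1 / p - θ₁) + θ₁ := by ring
    rw [this, rpow_add_of_nonneg _ _ (by linarith) hθ]; gcongr
    · refine (rpow_le_rpow (measure_mono inter_subset_right) (by linarith)).trans ?_
      have h5 : 1 - 1 / p - θ₁ ≤ 1 := by
        have : 0 < 1 / p := by positivity
        linarith
      rcases le_total (volume S) 1 with h | h
      · exact (ENNReal.rpow_le_one h (by linarith)).trans le_self_add
      · calc volume S ^ (1 - 1 / p - θ₁) ≤ volume S ^ (1 : ℝ) :=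
              ENNReal.rpow_le_rpow_of_exponent_le h h5
          _ ≤ 1 + volume S := by simp
    · simp
  calc _ ≤ κ * ((1 + volume S) * volume E ^ θ₁) := mul_le_mul' h3 h4
    _ = _ := by ring

end SetBound

theorem IsWeakPoisson.ae_enorm_deriv_le {W Y g : R4 → ℝ}
    (hW : IsWeakPoisson W (fun _ _ => 0) g) {j : Fin 4} (hY : WeakPd univ j W Y) :
    ∀ᵐ x, ‖Y x‖ₑ ≤ ofReal kerMass⁻¹ * (2 * pot 3 (fun y => ‖g y‖ₑ) x) := by
  have hm := measurable_pot 3 hW.measurable_source.enorm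
  refine ae_le_of_forall_setLIntegral_le_of_sigmaFinite₀ hY.measurable_deriv.enorm.aemeasurable
    fun E hE hf => ?_
  have := hW.setLIntegral_deriv_le hY.measurable_deriv hY.integrable_deriv
    (fun ψ h1 h2 => hY.eq ψ ⟨h1, h2, subset_univ _⟩) one_pos one_pos (C₁ := 0) (C₂ := 0)
    (by simp) (by simp) (fun h _ _ E _ _ => by simp [regCZ, cv])
    (fun K hK => setLIntegral_pot_ne_top (by norm_num) (by norm_num) hW.measurable_source.enorm
      hW.integrable_source.2.ne hK) hE
  rw [lintegral_const_mul _ (by fun_prop), lintegral_const_mul _ hm]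
  simp_all

/-- Calderón–Zygmund estimate for the first derivatives of a weak solution of `ΔW = div G + g`. -/
theorem IsWeakPoisson.exists_setBound_deriv :
    ∃ C : ℝ≥0, ∀ {W Y g : R4 → ℝ} {G : Fin 4 → R4 → ℝ} {j : Fin 4} {K₁ K₂ L₁ L₂ : ℝ≥0∞},
      IsWeakPoisson W G g → WeakPd univ j W Y → K₁ ≠ ⊤ → K₂ ≠ ⊤ →
      (∀ i, SetBound (5 / 12) (1 / 4) K₁ K₂ fun x => ‖G i x‖ₑ) →
      SetBound (5 / 12) (1 / 4) L₁ L₂ (pot 3 fun y => ‖g y‖ₑ) →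
      SetBound (5 / 12) (1 / 4) (C * (K₁ + L₁)) (C * (K₂ + L₂)) fun x => ‖Y x‖ₑ := by
  obtain ⟨C, hC⟩ := SetBound.regCZ (θ₁ := 5 / 12) (θ₂ := 1 / 4) (by norm_num) (by norm_num)
    (by norm_num) (by norm_num)
  refine ⟨kerMass⁻¹.toNNReal * (C + 2), fun {W Y g G j K₁ K₂ L₁ L₂} hW hY h1 h2 hG hg E hE hf => ?_⟩
  have := hW.setLIntegral_deriv_le hY.measurable_deriv hY.integrable_deriv
    (fun ψ h1 h2 => hY.eq ψ ⟨h1, h2, subset_univ _⟩) (θ₁ := 5 / 12) (θ₂ := 1 / 4) (by norm_num)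
    (by norm_num) (C₁ := C * K₁) (C₂ := C * K₂) (mul_ne_top (by simp) h1)
    (mul_ne_top (by simp) h2) (fun h hh hh1 => hC j hh hh1 hW.measurable_flux
      hW.integrable_flux h1 h2 hG)
    (fun K hK => setLIntegral_pot_ne_top (by norm_num) (by norm_num) hW.measurable_source.enorm
      hW.integrable_source.2.ne hK) hE
  refine this.trans ?_
  calc _ ≤ ofReal kerMass⁻¹ * (C * K₁ * volume E ^ (5 / 12 : ℝ)
        + C * K₂ * volume E ^ (1 / 4 : ℝ) + 2 * (L₁ * volume E ^ (5 / 12 : ℝ)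
        + L₂ * volume E ^ (1 / 4 : ℝ))) := by bound
    _ ≤ ofReal kerMass⁻¹ * (C * K₁ * volume E ^ (5 / 12 : ℝ)
        + C * K₂ * volume E ^ (1 / 4 : ℝ) + 2 * (L₁ * volume E ^ (5 / 12 : ℝ)
        + L₂ * volume E ^ (1 / 4 : ℝ))) + ofReal kerMass⁻¹ *
        ((2 * K₁ + C * L₁) * volume E ^ (5 / 12 : ℝ) + (2 * K₂ + C * L₂) * volume E ^ (1 / 4 : ℝ)) :=
        le_self_add
    _ = _ := by
        rw [ofReal]
        push_cast; ring

/-- The bounds on potentials and products that are used in the estimates on an annulus, with a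
common constant. -/
structure SetBoundCalculus (C : ℝ≥0) : Prop where
  pot3_low : ∀ {K₁ K₂ : ℝ≥0∞} {Z : R4 → ℝ≥0∞}, Measurable Z →
    SetBound (5 / 12) (1 / 4) K₁ K₂ Z → SetBound (2 / 3) (1 / 2) (C * K₁) (C * K₂) (pot 3 Z)
  pot3_high : ∀ {K₁ K₂ : ℝ≥0∞} {Z : R4 → ℝ≥0∞}, Measurable Z →
    SetBound (2 / 3) (1 / 2) K₁ K₂ Z → SetBound (11 / 12) (3 / 4) (C * K₁) (C * K₂) (pot 3 Z)
  pot3_src : ∀ {K : ℝ≥0∞} {Z : R4 → ℝ≥0∞}, Measurable Z →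
    SetBound (1 / 6) (1 / 6) K 0 Z → SetBound (5 / 12) (1 / 4) (C * K) 0 (pot 3 Z)
  pot3_one : ∀ {m : ℝ≥0∞} {Z : R4 → ℝ≥0∞}, Measurable Z → ∫⁻ x, Z x ≤ m →
    SetBound (5 / 12) (1 / 4) 0 (C * m) (pot 3 Z)
  pot2_high : ∀ {K₁ K₂ : ℝ≥0∞} {Z : R4 → ℝ≥0∞}, Measurable Z →
    SetBound (5 / 12) (1 / 4) K₁ K₂ Z → SetBound (11 / 12) (3 / 4) (C * K₁) (C * K₂) (pot 2 Z)
  pot2_src : ∀ {K : ℝ≥0∞} {Z : R4 → ℝ≥0∞}, Measurable Z →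
    SetBound (1 / 6) (1 / 6) K 0 Z → SetBound (2 / 3) (1 / 2) (C * K) 0 (pot 2 Z)
  pot2_one : ∀ {m : ℝ≥0∞} {Z : R4 → ℝ≥0∞}, Measurable Z → ∫⁻ x, Z x ≤ m →
    SetBound (2 / 3) (1 / 2) 0 (C * m) (pot 2 Z)
  mul_high : ∀ {K₁ K₂ A : ℝ≥0∞} {Z a : R4 → ℝ≥0∞}, Measurable Z → Measurable a →
    ∫⁻ x, a x ^ 4 ≤ A ^ 4 → SetBound (11 / 12) (3 / 4) K₁ K₂ Z →
    SetBound (2 / 3) (1 / 2) (C * A * K₁) (C * A * K₂) (fun x => a x * Z x)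
  mul_low : ∀ {K₁ K₂ A : ℝ≥0∞} {Z a : R4 → ℝ≥0∞}, Measurable Z → Measurable a →
    ∫⁻ x, a x ^ 4 ≤ A ^ 4 → SetBound (2 / 3) (1 / 2) K₁ K₂ Z →
    SetBound (5 / 12) (1 / 4) (C * A * K₁) (C * A * K₂) (fun x => a x * Z x)
  mul_src : ∀ {K A : ℝ≥0∞} {Z a : R4 → ℝ≥0∞}, Measurable Z → Measurable a →
    ∫⁻ x, a x ^ 4 ≤ A ^ 4 → SetBound (5 / 12) (1 / 4) K 0 Z →
    SetBound (1 / 6) (1 / 6) (C * A * K) 0 (fun x => a x * Z x)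
  deriv : ∀ {W Y g : R4 → ℝ} {G : Fin 4 → R4 → ℝ} {j : Fin 4} {K₁ K₂ L₁ L₂ : ℝ≥0∞},
    IsWeakPoisson W G g → WeakPd univ j W Y → K₁ ≠ ⊤ → K₂ ≠ ⊤ →
    (∀ i, SetBound (5 / 12) (1 / 4) K₁ K₂ fun x => ‖G i x‖ₑ) →
    SetBound (5 / 12) (1 / 4) L₁ L₂ (pot 3 fun y => ‖g y‖ₑ) →
    SetBound (5 / 12) (1 / 4) (C * (K₁ + L₁)) (C * (K₂ + L₂)) fun x => ‖Y x‖ₑ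

theorem exists_setBoundCalculus : ∃ C : ℝ≥0, SetBoundCalculus C := by
  obtain ⟨c1, h1⟩ := SetBound.pot (k := 3) (θ₁ := 5 / 12) (θ₂ := 1 / 4) (by norm_num)
    (by norm_num) (by norm_num) (by norm_num) (by norm_num) (by norm_num)
  obtain ⟨c2, h2⟩ := SetBound.pot (k := 3) (θ₁ := 2 / 3) (θ₂ := 1 / 2) (by norm_num)
    (by norm_num) (by norm_num) (by norm_num) (by norm_num) (by norm_num)
  obtain ⟨c3, h3⟩ := SetBound.pot (k := 3) (θ₁ := 1 / 6) (θ₂ := 1 / 6) (by norm_num)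
    (by norm_num) (by norm_num) (by norm_num) (by norm_num) (by norm_num)
  obtain ⟨c4, h4⟩ := SetBound.pot (k := 2) (θ₁ := 5 / 12) (θ₂ := 1 / 4) (by norm_num)
    (by norm_num) (by norm_num) (by norm_num) (by norm_num) (by norm_num)
  obtain ⟨c5, h5⟩ := SetBound.pot (k := 2) (θ₁ := 1 / 6) (θ₂ := 1 / 6) (by norm_num)
    (by norm_num) (by norm_num) (by norm_num) (by norm_num) (by norm_num)
  obtain ⟨c6, h6⟩ := SetBound.mul_of_pow_four (θ₁ := 11 / 12) (θ₂ := 3 / 4) (by norm_num)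
    (by norm_num)
  obtain ⟨c7, h7⟩ := SetBound.mul_of_pow_four (θ₁ := 2 / 3) (θ₂ := 1 / 2) (by norm_num)
    (by norm_num)
  obtain ⟨c8, h8⟩ := SetBound.mul_of_pow_four (θ₁ := 5 / 12) (θ₂ := 5 / 12) (by norm_num)
    (by norm_num)
  obtain ⟨c9, h9⟩ := IsWeakPoisson.exists_setBound_deriv
  set C : ℝ≥0 := potConst 3 + potConst 2 + c1 + c2 + c3 + c4 + c5 + c6 + c7 + c8 + c9 with hC
  have hle : ∀ c ∈ [potConst 3, potConst 2, c1, c2, c3, c4, c5, c6, c7, c8, c9],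
      (c : ℝ≥0∞) ≤ C := by
    simp only [List.mem_cons, List.not_mem_nil, or_false, forall_eq_or_imp, forall_eq,
      coe_le_coe, hC]
    refine ⟨?_, ?_, ?_, ?_, ?_, ?_, ?_, ?_, ?_, ?_, ?_⟩ <;> rw [← NNReal.coe_le_coe] <;> push_cast <;>
      linarith [(potConst 3).2, (potConst 2).2, c1.2, c2.2, c3.2, c4.2, c5.2, c6.2, c7.2, c8.2, c9.2]
  simp only [List.mem_cons, List.not_mem_nil, or_false, forall_eq_or_imp, forall_eq] at hle
  obtain ⟨lp3, lp2, l1, l2, l3, l4, l5, l6, l7, l8, l9⟩ := hle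
  refine ⟨C, ⟨?_, ?_, ?_, ?_, ?_, ?_, ?_, ?_, ?_, ?_, ?_⟩⟩
  · intro K₁ K₂ Z hZ h
    have := h1 hZ h
    norm_num at this
    exact this.mono (by gcongr) (by gcongr)
  · intro K₁ K₂ Z hZ h
    have := h2 hZ h
    norm_num at this
    exact this.mono (by gcongr) (by gcongr)
  · intro K Z hZ h
    have := h3 hZ h
    norm_num at this
    exact (this.mono (by gcongr) le_rfl).congr_exponent
  · intro m Z hZ h
    have := SetBound.pot_of_lintegral (k := 3) (by norm_num) (by norm_num) hZ h (5 / 12)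
    norm_num at this
    exact this.mono le_rfl (by gcongr)
  · intro K₁ K₂ Z hZ h
    have := h4 hZ h
    norm_num at this
    exact this.mono (by gcongr) (by gcongr)
  · intro K Z hZ h
    have := h5 hZ h
    norm_num at this
    exact (this.mono (by gcongr) le_rfl).congr_exponent
  · intro m Z hZ h
    have := SetBound.pot_of_lintegral (k := 2) (by norm_num) (by norm_num) hZ h (2 / 3)
    norm_num at this
    exact this.mono le_rfl (by gcongr)
  · intro K₁ K₂ A Z a hZ ha hA h
    have := h6 hZ ha hA h
    norm_num at this
    exact this.mono (by gcongr) (by gcongr)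
  · intro K₁ K₂ A Z a hZ ha hA h
    have := h7 hZ ha hA h
    norm_num at this
    exact this.mono (by gcongr) (by gcongr)
  · intro K A Z a hZ ha hA h
    have := h8 hZ ha hA h.congr_exponent
    norm_num at this
    exact this.mono (by gcongr) le_rfl
  · intro W Y g G j K₁ K₂ L₁ L₂ a1 a2 a3 a4 a5 a6
    exact (h9 a1 a2 a3 a4 a5 a6).mono (by gcongr) (by gcongr)

theorem SphereMap.exists_hessMag_le {Ω : Set R4} {ζ : R4 → ℝ} (hζ : IsTest Ω ζ) (ι : Type*)
    [Fintype ι] :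
    ∃ C : ℝ≥0, ∀ {u : ι → R4 → ℝ} {D1 D2 D3 f}, SphereMap Ω u D1 D2 D3 f →
      ∀ᵐ x, ‖ζ x‖ₑ * hessMag D2 x
        ≤ C * pot 3 (fun y => ‖ζ y‖ₑ * gradMag D3 y + hessMag D2 y + gradMag D1 y) x
          + C * gradMag D1 x := by
  obtain ⟨M, hM0, hM1, hM2⟩ := hζ.exists_enorm_le
  set c : ℝ≥0 := 2 * kerMass⁻¹.toNNReal * (1 + 8 * M) with hc
  refine ⟨16 * Fintype.card ι * (c + M), fun {u D1 D2 D3 f} h => ?_⟩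
  have mζ : Measurable fun x => ‖ζ x‖ₑ := hζ.continuous.measurable.enorm
  have ma := h.measurable_gradMag
  have mb := h.measurable_hessMag
  have mc := h.measurable_thirdMag
  set X := pot 3 (fun y => ‖ζ y‖ₑ * gradMag D3 y + hessMag D2 y + gradMag D1 y) with hX
  have hω : ∀ i j a, ∀ᵐ x, ‖ζ x * D2 i j a x‖ₑ ≤ c * X x + M * gradMag D1 x := by
    intro i j a
    filter_upwards [(h.isWeakPoisson_D1' hζ j a).ae_enorm_deriv_le ((h.weak₂ i j a).mul_test hζ)]
      with x hx
    have h1 : pot 3 (fun x => ‖ζ x * D3 j a x + 2 * (∑ i, pd i ζ x * D2 i j a x)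
        + lapl ζ x * D1 j a x‖ₑ) x ≤ (1 + 8 * M : ℝ≥0) * X x := by
      refine pot_le_const_mul 3 (by fun_prop) _ (fun x => ?_) x
      calc _ ≤ ‖ζ x‖ₑ * gradMag D3 x + 2 * (∑ _i : Fin 4, M * hessMag D2 x) + M * gradMag D1 x := by
            refine (enorm_add_le _ _).trans (add_le_add ((enorm_add_le _ _).trans
              (add_le_add ?_ ?_)) ?_)
            · rw [enorm_mul]
              exact mul_le_mul_right (enorm_le_gradMag j a x) _
            · rw [enorm_mul, enorm_two_real]
              refine mul_le_mul_right ((enorm_sum_le _ _).trans (sum_le_sum fun i _ => ?_)) _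
              rw [enorm_mul]
              exact mul_le_mul' (hM1 i x) (enorm_le_hessMag i j a x)
            · rw [enorm_mul]
              exact mul_le_mul' (hM2 x) (enorm_le_gradMag j a x)
        _ ≤ _ + (8 * M * (‖ζ x‖ₑ * gradMag D3 x) + hessMag D2 x + gradMag D1 x
              + 7 * M * gradMag D1 x) := le_self_add
        _ = _ := by
            simp only [sum_const, card_univ, card_fin, nsmul_eq_mul]
            push_cast; ring
    have e1 : ζ x * D2 i j a x = (ζ x * D2 i j a x + pd i ζ x * D1 j a x) - pd i ζ x * D1 j a x := by
      ring
    rw [e1]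
    refine enorm_sub_le.trans (add_le_add (hx.trans ?_) ?_)
    · calc _ ≤ ofReal kerMass⁻¹ * (2 * ((1 + 8 * M : ℝ≥0) * X x)) := by gcongr
        _ = _ := by rw [ofReal, hc]; push_cast; ring
    · rw [enorm_mul]
      exact mul_le_mul' (hM1 i x) (enorm_le_gradMag j a x)
  filter_upwards [ae_all_iff.2 fun i => ae_all_iff.2 fun j => ae_all_iff.2 (hω i j)] with x hx
  calc ‖ζ x‖ₑ * hessMag D2 x = ∑ i, ∑ j, ∑ a, ‖ζ x * D2 i j a x‖ₑ := by
        simp only [hessMag, mul_sum, enorm_mul]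
    _ ≤ ∑ _i : Fin 4, ∑ _j : Fin 4, ∑ _a : ι, _ := sum_le_sum fun i _ =>
        sum_le_sum fun j _ => sum_le_sum fun a _ => hx i j a
    _ = (16 * Fintype.card ι * c) * X x + (16 * Fintype.card ι * M) * gradMag D1 x := by
        simp only [sum_const, card_univ, card_fin, nsmul_eq_mul]; ring
    _ ≤ (16 * Fintype.card ι * (c + M)) * X x + (16 * Fintype.card ι * (c + M)) * gradMag D1 x := by
        bound
    _ = _ := by push_cast; ring

/-! ### Absorption for small energy -/

section LocalData

variable {ι : Type*} [Fintype ι]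

/-- The quantities that control a map on an annulus: the derivatives vanish outside of `S`, the
energies are bounded by powers of `κ`, and the mass of the right-hand side is at most `m`. -/
structure LocalData (S : Set R4) (κ m : ℝ≥0∞) (D1 : Fin 4 → ι → R4 → ℝ)
    (D2 : Fin 4 → Fin 4 → ι → R4 → ℝ) (f : ι → R4 → ℝ) : Prop where
  grad_eq_zero : ∀ x, x ∉ S → gradMag D1 x = 0
  hess_eq_zero : ∀ x, x ∉ S → hessMag D2 x = 0
  lintegral_grad : ∫⁻ x, gradMag D1 x ^ 4 ≤ κ ^ 4
  lintegral_hess : ∫⁻ x, hessMag D2 x ^ 2 ≤ κ ^ 2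
  lintegral_src : ∫⁻ x, srcMag f x ≤ m
  energy_ne_top : κ ≠ ⊤
  mass_ne_top : m ≠ ⊤

variable {S : Set R4} {κ m : ℝ≥0∞} {D1 : Fin 4 → ι → R4 → ℝ}
  {D2 : Fin 4 → Fin 4 → ι → R4 → ℝ} {f : ι → R4 → ℝ}

theorem LocalData.setBound_grad (hd : LocalData S κ m D1 D2 f) (hS : MeasurableSet S)
    (hm : Measurable (gradMag D1)) {θ₁ : ℝ} (θ₂ : ℝ) (h0 : 0 ≤ θ₁)
    (h1 : θ₁ ≤ 3 / 4) : SetBound θ₁ θ₂ ((1 + volume S) * κ) 0 (gradMag D1) :=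
  SetBound.of_lintegral_rpow hS (p := 4) (by norm_num) h0 (by linarith) hm hd.grad_eq_zero
    (by simpa only [← rpow_natCast, Nat.cast_ofNat] using hd.lintegral_grad)

theorem LocalData.setBound_hess (hd : LocalData S κ m D1 D2 f) (hS : MeasurableSet S)
    (hm : Measurable (hessMag D2)) {θ₁ : ℝ} (θ₂ : ℝ) (h0 : 0 ≤ θ₁)
    (h1 : θ₁ ≤ 1 / 2) : SetBound θ₁ θ₂ ((1 + volume S) * κ) 0 (hessMag D2) :=
  SetBound.of_lintegral_rpow hS (p := 2) (by norm_num) h0 (by linarith) hm hd.hess_eq_zero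
    (by simpa only [← rpow_natCast, Nat.cast_ofNat] using hd.lintegral_hess)

theorem LocalData.setBound_lap (hd : LocalData S κ m D1 D2 f) (hS : MeasurableSet S)
    (hm : Measurable (hessMag D2)) {θ₁ : ℝ} (θ₂ : ℝ) (h0 : 0 ≤ θ₁)
    (h1 : θ₁ ≤ 1 / 2) : SetBound θ₁ θ₂ ((1 + volume S) * κ) 0 (lapMag D2) :=
  (hd.setBound_hess hS hm θ₂ h0 h1).mono_fun (.of_forall lapMag_le_hessMag)

end LocalData

/-- If the energy is small, then the linear terms can be absorbed in the estimates of `Δu` and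
`Du`. -/
theorem SphereMap.exists_setBound_lap_grad {Ω : Set R4} {ζ : R4 → ℝ} (hζ : IsTest Ω ζ)
    (hζ1 : ∀ x, ‖ζ x‖ₑ ≤ 1) {S : Set R4} (hS : MeasurableSet S) (hSf : volume S ≠ ⊤) (ι : Type*)
    [Fintype ι] :
    ∃ κ₀ C : ℝ≥0, 0 < κ₀ ∧ κ₀ ≤ 1 ∧ ∀ {u : ι → R4 → ℝ} {D1 D2 D3 f}
      {κ m : ℝ≥0∞}, SphereMap Ω u D1 D2 D3 f → LocalData S κ m D1 D2 f → κ ≤ κ₀ →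
      SetBound (2 / 3) (1 / 2) (C * κ) (C * m) (fun x => ‖ζ x‖ₑ * lapMag D2 x) ∧
      SetBound (11 / 12) (3 / 4) (C * κ) (C * m) (fun x => ‖ζ x‖ₑ * gradMag D1 x) := by
  obtain ⟨C, hC⟩ := exists_setBoundCalculus
  obtain ⟨c1, h1⟩ := exists_lapMag_le hζ ι
  obtain ⟨c2, h2⟩ := exists_gradMag_le hζ ι
  obtain ⟨v, hv⟩ : ∃ v : ℝ≥0, (v : ℝ≥0∞) = 1 + volume S :=
    ⟨(1 + volume S).toNNReal, coe_toNNReal (by simp [hSf])⟩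
  set q : ℝ≥0 := c1 * C ^ 2 + c1 * c2 * C ^ 2 with hq
  set B : ℝ≥0 := 2 * (c1 * (C * v + C * (C * v + v)) + c1 * c2 * (C * (3 * C * v)) + c1 * C) with hB
  refine ⟨(2 * q + 1)⁻¹, B + c2 * (C * B + 3 * C * v), by positivity,
    inv_le_one_of_one_le₀ (by simp), fun {u D1 D2 D3 f κ m} h hd hκ => ?_⟩
  have hκ1 : κ ≤ 1 := hκ.trans (by exact_mod_cast inv_le_one_of_one_le₀ (by simp))
  have mζ : Measurable fun x => ‖ζ x‖ₑ := hζ.continuous.measurable.enorm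
  have ma := h.measurable_gradMag
  have mb := h.measurable_lapMag
  have mh := h.measurable_hessMag
  have mf := h.measurable_srcMag
  set a := gradMag D1 with ha
  set β := lapMag D2 with hβ
  set w := fun x => ‖ζ x‖ₑ * β x with hw
  have mw : Measurable w := mζ.mul mb
  have maw : Measurable fun y => a y * w y := ma.mul mw
  have maβ : Measurable fun y => a y * β y := ma.mul mb
  have mp3 : ∀ {g : R4 → ℝ≥0∞}, Measurable g → Measurable (pot 3 g) := fun hg => measurable_pot 3 hg
  have mp2 : ∀ {g : R4 → ℝ≥0∞}, Measurable g → Measurable (pot 2 g) := fun hg => measurable_pot 2 hg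
  have sa : ∀ {θ₁ : ℝ} (θ₂ : ℝ), 0 ≤ θ₁ → θ₁ ≤ 3 / 4 → SetBound θ₁ θ₂ (v * κ) 0 a := by
    intro θ₁ θ₂ q1 q2; rw [hv]; exact hd.setBound_grad hS ma θ₂ q1 q2
  have sβ : ∀ {θ₁ : ℝ} (θ₂ : ℝ), 0 ≤ θ₁ → θ₁ ≤ 1 / 2 → SetBound θ₁ θ₂ (v * κ) 0 β := by
    intro θ₁ θ₂ q1 q2; rw [hv]; exact hd.setBound_lap hS mh θ₂ q1 q2
  have p1 := hC.pot3_low mb (sβ (1 / 4) (by norm_num) (by norm_num))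
  have p2 := hC.pot2_one mf hd.lintegral_src
  have p3 := hC.pot2_src (maβ.add mb) (((hC.mul_src mb ma hd.lintegral_grad
    (sβ (1 / 4) (by norm_num) (by norm_num))).add (sβ (1 / 6) (by norm_num) (by norm_num)) maβ).mono
    le_rfl (add_zero (0 : ℝ≥0∞)).le)
  have p4 := hC.pot3_high ma (sa (1 / 2) (by norm_num) (by norm_num))
  have p5 := hC.pot2_high (mb.add ma) ((sβ (1 / 4) (by norm_num) (by norm_num)).add
    (sa (1 / 4) (by norm_num) (by norm_num)) mb)
  have p6 := hC.mul_high ((mp3 ma).add (mp2 (mb.add ma))) ma hd.lintegral_grad (p4.add p5 (mp3 ma))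
  have pZ := ((p1.add (p2.add p3 (mp2 mf)) (mp3 mb)).const_mul
      ((mp3 mb).add ((mp2 mf).add (mp2 (maβ.add mb)))) (c1 : ℝ≥0∞)).add
    (p6.const_mul (ma.mul ((mp3 ma).add (mp2 (mb.add ma)))) (c1 * c2 : ℝ≥0∞))
    (((mp3 mb).add ((mp2 mf).add (mp2 (maβ.add mb)))).const_mul _)
  have key := SetBound.of_iterate (b := w) (M := v * κ)
    (T := fun w x => c1 * pot 3 (fun y => a y * w y) x + c1 * c2 * (a x * pot 3 w x))
    (mul_ne_top (by simp) hd.energy_ne_top)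
    ((((mp3 mb).add ((mp2 mf).add (mp2 (maβ.add mb)))).const_mul _).add
      ((ma.mul ((mp3 ma).add (mp2 (mb.add ma)))).const_mul _)) pZ
    (((sβ (2 / 3) (by norm_num) le_rfl).swap).mono_fun (.of_forall fun x =>
      mul_le_of_le_one_left zero_le (hζ1 x))) ?_ ?_ (by norm_num)
  · have hK1 : SetBound (2 / 3) (1 / 2) (B * κ) (B * m) w := by
      refine key.mono ?_ ?_
      · have hκκ : κ * κ ≤ κ := mul_le_of_le_one_left zero_le hκ1
        calc _ = 2 * ((c1 * (C * v + C * v)) * κ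
              + (c1 * (C * (C * v)) + c1 * c2 * (C * (3 * C * v))) * (κ * κ)) := by ring
          _ ≤ 2 * ((c1 * (C * v + C * v)) * κ
              + (c1 * (C * (C * v)) + c1 * c2 * (C * (3 * C * v))) * κ) := by gcongr
          _ ≤ 2 * ((c1 * (C * v + C * v)) * κ
              + (c1 * (C * (C * v)) + c1 * c2 * (C * (3 * C * v))) * κ) + 2 * c1 * C * κ :=
              le_self_add
          _ = B * κ := by rw [hB]; push_cast; ring
      · simp only [zero_add, add_zero, mul_zero]
        rw [hB]
        calc 2 * ((c1 : ℝ≥0∞) * (C * m)) = (2 * (c1 * C)) * m := by ring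
          _ ≤ _ := by
              gcongr
              push_cast
              rw [mul_add]; simp
    refine ⟨hK1.mono (by gcongr; exact_mod_cast le_self_add) (by gcongr; exact_mod_cast le_self_add),
      ?_⟩
    have r1 := ((hC.pot3_high mw hK1).add (p4.add p5 (mp3 ma)) (mp3 mw)).const_mul
      ((mp3 mw).add ((mp3 ma).add (mp2 (mb.add ma)))) (c2 : ℝ≥0∞)
    refine (r1.mono_fun ?_).mono ?_ ?_
    · filter_upwards [h2 h] with x hx
      refine hx.trans_eq ?_
      rw [pot_add 3 mw]
      ring_nf
      rfl
    · calc _ = (c2 * (C * B + 3 * C * v)) * κ := by ring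
        _ ≤ _ := by bound
    · calc _ = (c2 * (C * B)) * m := by ring
        _ ≤ (c2 * (C * B)) * m + (B + c2 * (3 * C * v)) * m := le_self_add
        _ = _ := by push_cast; ring
  · filter_upwards [h1 h, h2 h] with x hx1 hx2
    refine hx1.trans ?_
    have e1 : pot 3 (fun y => a y * (‖ζ y‖ₑ * β y) + β y) x
        = pot 3 (fun y => a y * w y) x + pot 3 β x := pot_add 3 maw β x
    have e2 : pot 2 (fun y => srcMag f y + a y * β y + β y) x
        = pot 2 (srcMag f) x + pot 2 (fun y => a y * β y + β y) x := by
      rw [← pot_add 2 mf]; ring_nf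
    have e3 : pot 3 (fun y => ‖ζ y‖ₑ * β y + a y) x = pot 3 w x + pot 3 a x := pot_add 3 mw a x
    rw [e1, e2]
    rw [e3] at hx2
    calc _ ≤ c1 * (pot 3 (fun y => a y * w y) x + pot 3 β x
          + (pot 2 (srcMag f) x + pot 2 (fun y => a y * β y + β y) x))
          + c1 * (a x * (c2 * (pot 3 w x + pot 3 a x + pot 2 (fun y => β y + a y) x))) := by gcongr
      _ = _ := by
          show _ = (c1 * (pot 3 β x + (pot 2 (srcMag f) x + pot 2 (fun y => a y * β y + β y) x))
            + c1 * c2 * (a x * (pot 3 a x + pot 2 (fun y => β y + a y) x)))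
            + (c1 * pot 3 (fun y => a y * w y) x + c1 * c2 * (a x * pot 3 w x))
          ring
  · intro L₁ L₂ hL
    have t1 := hC.pot3_low maw (hC.mul_low mw ma hd.lintegral_grad hL)
    have t2 := hC.mul_high (mp3 mw) ma hd.lintegral_grad (hC.pot3_high mw hL)
    have hqκ : (q : ℝ≥0∞) * κ ≤ 2⁻¹ := by
      calc (q : ℝ≥0∞) * κ ≤ q * ((2 * q + 1)⁻¹ : ℝ≥0) := by gcongr
        _ ≤ ((2⁻¹ : ℝ≥0) : ℝ≥0∞) := by
            rw [← coe_mul, coe_le_coe, ← div_eq_mul_inv, ← NNReal.coe_le_coe]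
            push_cast
            rw [div_le_iff₀ (by positivity)]; linarith
        _ = 2⁻¹ := by simp
    refine ((t1.const_mul (mp3 maw) (c1 : ℝ≥0∞)).add (t2.const_mul (ma.mul (mp3 mw)) (c1 * c2 : ℝ≥0∞))
      ((mp3 maw).const_mul _)).mono ?_ ?_
    · calc _ = (q * κ) * L₁ := by rw [hq]; push_cast; ring
        _ ≤ _ := by gcongr
    · calc _ = (q * κ) * L₂ := by rw [hq]; push_cast; ring
        _ ≤ _ := by gcongr

/-! ### Interior estimates -/

namespace SphereMap

/-- The derivative of the cut off function `ζ (u^b Δu^a - u^a Δu^b)`. -/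
def cutoffDeriv {ι : Type*} (ζ : R4 → ℝ) (u : ι → R4 → ℝ) (D1 : Fin 4 → ι → R4 → ℝ)
    (D2 : Fin 4 → Fin 4 → ι → R4 → ℝ) (D3 : Fin 4 → ι → R4 → ℝ) (j : Fin 4) (a b : ι) (x : R4) : ℝ :=
  ζ x * wedgeLapDeriv u D1 D2 D3 j a b x + pd j ζ x * wedgeLap u D2 a b x

/-- The Calderón–Zygmund estimate for the derivative of `u^b Δu^a - u^a Δu^b`. -/
theorem exists_setBound_cutoffDeriv {Ω : Set R4} {ζ : R4 → ℝ} (hζ : IsTest Ω ζ)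
    {S : Set R4} (hS : MeasurableSet S) (hSf : volume S ≠ ⊤) (ι : Type*) [Fintype ι] :
    ∃ C : ℝ≥0, ∀ {u : ι → R4 → ℝ} {D1 D2 D3 f}
      {κ m L₁ L₂ : ℝ≥0∞}, SphereMap Ω u D1 D2 D3 f → LocalData S κ m D1 D2 f → L₁ ≠ ⊤ → L₂ ≠ ⊤ →
      SetBound (5 / 12) (1 / 4) L₁ L₂ (fun x => gradMag D1 x * (‖ζ x‖ₑ * lapMag D2 x)) →
      SetBound (5 / 12) (1 / 4) (C * (κ + κ * κ + L₁)) (C * (m + L₂))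
        (fun x => ∑ j, ∑ a, ∑ b, ‖cutoffDeriv ζ u D1 D2 D3 j a b x‖ₑ) := by
  obtain ⟨C, hC⟩ := exists_setBoundCalculus
  obtain ⟨M, hM0, hM1, hM2⟩ := hζ.exists_enorm_le
  obtain ⟨v, hv⟩ : ∃ v : ℝ≥0, (v : ℝ≥0∞) = 1 + volume S :=
    ⟨(1 + volume S).toNNReal, coe_toNNReal (by simp [hSf])⟩
  set c : ℝ≥0 := 4 + 16 * M with hc
  set q : ℝ≥0 := C * (c * (1 + v + C * (1 + C * v + v))) with hq
  refine ⟨4 * Fintype.card ι * Fintype.card ι * q,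
    fun {u D1 D2 D3 f κ m L₁ L₂} h hd hL₁ hL₂ hL => ?_⟩
  have mζ : Measurable fun x => ‖ζ x‖ₑ := hζ.continuous.measurable.enorm
  have ma := h.measurable_gradMag
  have mb := h.measurable_lapMag
  have mh := h.measurable_hessMag
  have mf := h.measurable_srcMag
  set a := gradMag D1 with ha
  set β := lapMag D2 with hβ
  have maw : Measurable fun y => a y * (‖ζ y‖ₑ * β y) := ma.mul (mζ.mul mb)
  have maβ : Measurable fun y => a y * β y := ma.mul mb
  have sβ : ∀ {θ₁ : ℝ} (θ₂ : ℝ), 0 ≤ θ₁ → θ₁ ≤ 1 / 2 → SetBound θ₁ θ₂ (v * κ) 0 β := by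
    intro θ₁ θ₂ q1 q2; rw [hv]; exact hd.setBound_lap hS mh θ₂ q1 q2
  have p1 := ((hL.add (sβ (1 / 4) (by norm_num) (by norm_num)) maw).const_mul (maw.add mb)
    (c : ℝ≥0∞))
  have p2 := hC.pot3_src (maβ.add mb) (((hC.mul_src mb ma hd.lintegral_grad
    (sβ (1 / 4) (by norm_num) (by norm_num))).add (sβ (1 / 6) (by norm_num) (by norm_num)) maβ).mono
    le_rfl (add_zero (0 : ℝ≥0∞)).le)
  have p3 := ((hC.pot3_one mf hd.lintegral_src).add p2 (measurable_pot 3 mf)).const_mul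
    ((measurable_pot 3 mf).add (measurable_pot 3 (maβ.add mb))) (c : ℝ≥0∞)
  have hY : ∀ j a b, SetBound (5 / 12) (1 / 4) (q * (κ + κ * κ + L₁)) (q * (m + L₂))
      (fun x => ‖cutoffDeriv ζ u D1 D2 D3 j a b x‖ₑ) := by
    intro j i b
    have := hC.deriv (h.isWeakPoisson_wedgeLap hζ i b) ((h.weakPd_wedgeLap j i b).mul_test hζ)
      (K₁ := c * (L₁ + v * κ)) (K₂ := c * (L₂ + 0))
      (mul_ne_top (by simp) (add_ne_top.2 ⟨hL₁, mul_ne_top (by simp)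
        hd.energy_ne_top⟩)) (mul_ne_top (by simp) (by simpa using hL₂))
      (fun k => p1.mono_fun (.of_forall fun x => h.enorm_cutoffFlux_le hM1 i b k x))
      (p3.mono_fun (.of_forall fun x => by
        refine (pot_le_const_mul 3 (h := fun x => srcMag f x + (a x * β x + β x)) (by fun_prop) c
          (fun x => (h.enorm_cutoffSource_le hM0 hM1 hM2 i b x).trans_eq (by rw [add_assoc])) x).trans_eq ?_
        rw [pot_add 3 mf]
        rfl))
    refine this.mono ?_ ?_
    · calc _ = C * (c * ((v + C * v) * κ + C * C * v * (κ * κ) + 1 * L₁)) := by ring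
        _ ≤ C * (c * ((1 + v + C * (1 + C * v + v)) * κ + (1 + v + C * (1 + C * v + v)) * (κ * κ)
            + (1 + v + C * (1 + C * v + v)) * L₁)) := by
            have e1 : (v : ℝ≥0∞) + C * v ≤ 1 + v + C * (1 + C * v + v) := by bound
            have e2 : (C : ℝ≥0∞) * C * v ≤ 1 + v + C * (1 + C * v + v) := by
              rw [mul_assoc]
              refine le_trans ?_ le_add_self
              gcongr
              exact le_trans le_add_self le_self_add
            have e3 : (1 : ℝ≥0∞) ≤ 1 + v + C * (1 + C * v + v) := by
              rw [add_assoc]; exact le_self_add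
            gcongr
        _ = _ := by rw [hq]; push_cast; ring
    · calc _ = C * (c * (C * m + L₂)) := by ring
        _ ≤ C * (c * (C * m + L₂)) + C * (c * ((1 + v + C * (C * v + v)) * m
            + (v + C * (1 + C * v + v)) * L₂)) := le_self_add
        _ = _ := by rw [hq]; push_cast; ring
  have mY : ∀ j a b, Measurable fun x => ‖cutoffDeriv ζ u D1 D2 D3 j a b x‖ₑ := fun j a b =>
    ((h.weakPd_wedgeLap j a b).mul_test hζ).measurable_deriv.enorm
  have := SetBound.sum Finset.univ (fun j _ => SetBound.sum Finset.univ (fun a _ =>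
    SetBound.sum Finset.univ (fun b _ => hY j a b) (mY j a))
    (fun a => measurable_sum _ fun b _ => mY j a b)) (fun j => measurable_sum _
      fun a _ => measurable_sum _ fun b _ => mY j a b)
  refine this.mono (le_of_eq ?_) (le_of_eq ?_) <;>
  · simp only [sum_const, card_univ, card_fin, nsmul_eq_mul]
    push_cast; ring

/-- The interior estimates on a compact subset of the domain. The bound for the third derivatives
holds without a smallness assumption. -/
theorem exists_local_setBound {Ω K S : Set R4} (hΩ : IsOpen Ω) (hK : IsCompact K) (hKΩ : K ⊆ Ω)
    (hS : MeasurableSet S) (hSf : volume S ≠ ⊤) (ι : Type*) [Fintype ι] :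
    ∃ κ₀ C : ℝ≥0, 0 < κ₀ ∧ κ₀ ≤ 1 ∧ ∀ {u : ι → R4 → ℝ} {D1 D2 D3 f}
      {κ m : ℝ≥0∞}, SphereMap Ω u D1 D2 D3 f → LocalData S κ m D1 D2 f →
      SetBound (5 / 12) (1 / 4) (C * (κ + κ * κ)) (C * (κ * κ + m)) (K.indicator (gradMag D3)) ∧
      (κ ≤ κ₀ → SetBound (11 / 12) (3 / 4) (C * κ) (C * m) (K.indicator (gradMag D1)) ∧
        SetBound (2 / 3) (1 / 2) (C * κ) (C * m) (K.indicator (hessMag D2)) ∧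
        SetBound (5 / 12) (1 / 4) (C * κ) (C * m) (K.indicator (gradMag D3))) := by
  obtain ⟨ζ, hζ, hζ0, hζ1, U, hU, hKU, hζU⟩ := exists_cutoff hK hΩ hKΩ
  obtain ⟨ζ₂, hζ₂', hζ₂0, hζ₂1, U₂, hU₂, hKU₂, hζ₂U⟩ :=
    exists_cutoff hK (hU.inter hΩ) (subset_inter hKU hKΩ)
  have hζ₂ : IsTest Ω ζ₂ := hζ₂'.mono inter_subset_right
  have hne : ∀ {χ : R4 → ℝ}, (∀ x, 0 ≤ χ x) → (∀ x, χ x ≤ 1) → ∀ x, ‖χ x‖ₑ ≤ 1 := by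
    intro χ h0 h1 x
    rw [Real.enorm_eq_ofReal (h0 x)]
    simp [*]
  have hind : ∀ {χ : R4 → ℝ} {V : Set R4} (g : R4 → ℝ≥0∞), K ⊆ V → (∀ x ∈ V, χ x = 1) →
      ∀ᵐ x, K.indicator g x ≤ ‖χ x‖ₑ * g x := by
    intro χ V g hV h1
    refine Eventually.of_forall fun x => ?_
    by_cases hx : x ∈ K
    · rw [indicator_of_mem hx, h1 x (hV hx)]; simp
    · simp [*]
  obtain ⟨κ₁, c₁, hκ₁, hκ₁1, hgood⟩ := exists_setBound_lap_grad hζ (hne hζ0 hζ1) hS hSf ι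
  obtain ⟨c₂, hderiv⟩ := exists_setBound_cutoffDeriv hζ hS hSf ι
  obtain ⟨c₃, hthird⟩ := exists_thirdMag_le hζ₂ (hne hζ₂0 hζ₂1) hU hζU
    (hζ₂'.tsupport_subset.trans inter_subset_left) ι
  obtain ⟨c₄, hhess⟩ := exists_hessMag_le hζ₂ ι
  obtain ⟨C, hC⟩ := exists_setBoundCalculus
  obtain ⟨v, hv⟩ : ∃ v : ℝ≥0, (v : ℝ≥0∞) = 1 + volume S :=
    ⟨(1 + volume S).toNNReal, coe_toNNReal (by simp [hSf])⟩
  -- the constants for the third derivatives, without and with smallness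
  set A₁ : ℝ≥0 := c₂ * (1 + C * v) + c₃ * (C * v) with hA₁
  set A₂ : ℝ≥0 := c₂ * (2 + C * c₁) with hA₂
  set A₃ : ℝ≥0 := 2 * (c₄ * (C * (A₂ + 2 * v) + v)) with hA₃
  set A₄ : ℝ≥0 := A₂ + c₃ * (C * A₃) with hA₄
  set q : ℝ≥0 := c₄ * c₃ * C ^ 2 with hq
  refine ⟨min κ₁ (2 * q + 1)⁻¹, A₁ + c₁ + A₃ + A₄, lt_min hκ₁ (by positivity),
    (min_le_left _ _).trans hκ₁1, fun {u D1 D2 D3 f κ m} h hd => ?_⟩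
  have mζ : Measurable fun x => ‖ζ x‖ₑ := hζ.continuous.measurable.enorm
  have mζ₂ : Measurable fun x => ‖ζ₂ x‖ₑ := hζ₂.continuous.measurable.enorm
  have ma := h.measurable_gradMag
  have mβ := h.measurable_lapMag
  have mb := h.measurable_hessMag
  have mc := h.measurable_thirdMag
  have mY : Measurable fun x => ∑ j, ∑ a, ∑ b, ‖cutoffDeriv ζ u D1 D2 D3 j a b x‖ₑ :=
    measurable_sum _ fun j _ => measurable_sum _ fun a _ =>
      measurable_sum _ fun b _ => ((h.weakPd_wedgeLap j a b).mul_test hζ).measurable_deriv.enorm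
  set Y := fun x => ∑ j, ∑ a, ∑ b, ‖cutoffDeriv ζ u D1 D2 D3 j a b x‖ₑ with hYdef
  set a := gradMag D1 with ha
  set b := hessMag D2 with hb
  set β := lapMag D2 with hβ
  set w := fun x => ‖ζ₂ x‖ₑ * b x with hw
  have mw : Measurable w := mζ₂.mul mb
  have maw : Measurable fun y => a y * w y := ma.mul mw
  have hwb : ∀ x, w x ≤ b x := fun x => mul_le_of_le_one_left zero_le (hne hζ₂0 hζ₂1 x)
  have hzb : ∀ x, ‖ζ x‖ₑ * β x ≤ b x := fun x =>
    (mul_le_of_le_one_left zero_le (hne hζ0 hζ1 x)).trans (lapMag_le_hessMag x)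
  have sa : ∀ {θ₁ : ℝ} (θ₂ : ℝ), 0 ≤ θ₁ → θ₁ ≤ 3 / 4 → SetBound θ₁ θ₂ (v * κ) 0 a := by
    intro θ₁ θ₂ q1 q2; rw [hv]; exact hd.setBound_grad hS ma θ₂ q1 q2
  have sb : ∀ {θ₁ : ℝ} (θ₂ : ℝ), 0 ≤ θ₁ → θ₁ ≤ 1 / 2 → SetBound θ₁ θ₂ (v * κ) 0 b := by
    intro θ₁ θ₂ q1 q2; rw [hv]; exact hd.setBound_hess hS mb θ₂ q1 q2
  have hthird' : ∀ᵐ x, ‖ζ₂ x‖ₑ * gradMag D3 x ≤ Y x + c₃ * (a x * w x) := hthird h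
  have hfinκ : ∀ {X : ℝ≥0∞} (c c' : ℝ≥0), X ≠ ⊤ → (C : ℝ≥0∞) * κ * (c * X) ≠ ⊤ := fun c c' hX =>
    mul_ne_top (mul_ne_top (by simp) hd.energy_ne_top) (mul_ne_top (by simp) hX)
  constructor
  · have s0 := hC.mul_low mb ma hd.lintegral_grad (sb (2 / 3) (by norm_num) le_rfl).swap
    have s1 := s0.mono_fun (Y := fun x => a x * (‖ζ x‖ₑ * β x))
      (.of_forall fun x => mul_le_mul_right (hzb x) _)
    have s2 := s0.mono_fun (Y := fun x => a x * w x)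
      (.of_forall fun x => mul_le_mul_right (hwb x) _)
    have s3 := hderiv h hd (by simp) (hfinκ v 0 hd.energy_ne_top) s1
    have s4 := (s3.add (s2.const_mul maw (c₃ : ℝ≥0∞)) mY).mono_fun hthird'
    refine (s4.mono_fun (hind _ hKU₂ hζ₂U)).mono ?_ ?_
    · calc _ = c₂ * (κ + κ * κ) := by ring
        _ ≤ c₂ * (κ + κ * κ) + (c₂ * (C * v) + c₃ * (C * v) + c₁ + A₃ + A₄) * (κ + κ * κ) :=
            le_self_add
        _ = _ := by rw [hA₁]; push_cast; ring
    · calc _ = c₂ * m + (c₂ * (C * v) + c₃ * (C * v)) * (κ * κ) := by ring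
        _ ≤ c₂ * m + (c₂ * (C * v) + c₃ * (C * v)) * (κ * κ) + ((c₂ * (C * v) + c₃ * (C * v)) * m
              + c₂ * (κ * κ) + (c₁ + A₃ + A₄) * (κ * κ + m)) := le_self_add
        _ = _ := by rw [hA₁]; push_cast; ring
  intro hκ
  have hκ1 : κ ≤ 1 := hκ.trans (by exact_mod_cast (min_le_left _ _).trans hκ₁1)
  have hκκ : κ * κ ≤ κ := mul_le_of_le_one_left zero_le hκ1
  obtain ⟨gβ, ga⟩ := hgood h hd (hκ.trans (by exact_mod_cast min_le_left _ _))
  have s1 := hderiv h hd (hfinκ c₁ 0 hd.energy_ne_top) (hfinκ c₁ 0 hd.mass_ne_top)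
    (hC.mul_low (mζ.mul mβ) ma hd.lintegral_grad gβ)
  have s2 : SetBound (5 / 12) (1 / 4) (A₂ * κ) (A₂ * m) Y := by
    refine s1.mono ?_ ?_
    · calc _ = c₂ * (κ + (1 + C * c₁) * (κ * κ)) := by ring
        _ ≤ c₂ * (κ + (1 + C * c₁) * κ) := by gcongr
        _ = _ := by rw [hA₂]; push_cast; ring
    · calc _ = c₂ * (m + C * c₁ * (κ * m)) := by ring
        _ ≤ c₂ * (m + C * c₁ * (1 * m)) := by gcongr
        _ ≤ c₂ * (m + C * c₁ * (1 * m)) + c₂ * m := le_self_add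
        _ = _ := by rw [hA₂]; push_cast; ring
  have p1 := hC.pot3_low (mY.add (mb.add ma)) (s2.add ((sb (1 / 4) (by norm_num) (by norm_num)).add
    (sa (1 / 4) (by norm_num) (by norm_num)) mb) mY)
  have mP := measurable_pot 3 (mY.add (mb.add ma))
  have pZ := (p1.const_mul mP (c₄ : ℝ≥0∞)).add ((sa (θ₁ := 2 / 3) (1 / 2) (by norm_num)
    (by norm_num)).const_mul ma (c₄ : ℝ≥0∞)) (mP.const_mul _)
  have key := SetBound.of_iterate (b := w) (M := v * κ)
    (T := fun w x => c₄ * c₃ * pot 3 (fun y => a y * w y) x)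
    (mul_ne_top (by simp) hd.energy_ne_top) ((mP.const_mul _).add (ma.const_mul _)) pZ
    (((sb (2 / 3) (by norm_num) le_rfl).swap).mono_fun (.of_forall hwb)) ?_ ?_ (by norm_num)
  · have hw' : SetBound (2 / 3) (1 / 2) (A₃ * κ) (A₃ * m) w := by
      refine key.mono (le_of_eq ?_) ?_
      · rw [hA₃]; push_cast; ring
      · simp only [add_zero, mul_zero]
        calc 2 * ((c₄ : ℝ≥0∞) * (C * (A₂ * m)))
            ≤ 2 * ((c₄ : ℝ≥0∞) * (C * (A₂ * m))) + 2 * (c₄ * (C * (2 * v) + v)) * m := le_self_add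
          _ = _ := by rw [hA₃]; push_cast; ring
    have s4 := (s2.add ((hC.mul_low mw ma hd.lintegral_grad hw').const_mul maw (c₃ : ℝ≥0∞))
      mY).mono_fun hthird'
    refine ⟨(ga.mono_fun (hind _ hKU hζU)).mono ?_ ?_, (hw'.mono_fun (hind _ hKU₂ hζ₂U)).mono ?_ ?_,
      (s4.mono_fun (hind _ hKU₂ hζ₂U)).mono ?_ ?_⟩
    · gcongr; exact (le_add_self.trans le_self_add).trans le_self_add
    · gcongr; exact (le_add_self.trans le_self_add).trans le_self_add
    · gcongr; exact le_add_self.trans le_self_add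
    · gcongr; exact le_add_self.trans le_self_add
    · calc _ = A₂ * κ + c₃ * (C * A₃) * (κ * κ) := by ring
        _ ≤ A₂ * κ + c₃ * (C * A₃) * κ := by gcongr
        _ = A₄ * κ := by rw [hA₄]; push_cast; ring
        _ ≤ _ := by gcongr; exact le_add_self
    · calc _ = A₂ * m + c₃ * (C * A₃) * (κ * m) := by ring
        _ ≤ A₂ * m + c₃ * (C * A₃) * (1 * m) := by gcongr
        _ = A₄ * m := by rw [hA₄]; push_cast; ring
        _ ≤ _ := by gcongr; exact le_add_self
  · filter_upwards [hhess h] with x hx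
    refine hx.trans ?_
    have e1 : pot 3 (fun y => ‖ζ₂ y‖ₑ * gradMag D3 y + b y + a y) x
        ≤ pot 3 (Y + (b + a)) x + c₃ * pot 3 (fun y => a y * w y) x := by
      rw [← pot_const_mul 3 maw, ← pot_add 3 (mY.add (mb.add ma))]
      refine pot_mono 3 ?_ x
      filter_upwards [hthird'] with y hy
      calc _ ≤ Y y + c₃ * (a y * w y) + b y + a y := by gcongr
        _ = _ := by simp only [Pi.add_apply]; ring
    calc _ ≤ c₄ * (pot 3 (Y + (b + a)) x + c₃ * pot 3 (fun y => a y * w y) x) + c₄ * a x := by gcongr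
      _ = (c₄ * pot 3 (Y + (b + a)) x + c₄ * a x) + c₄ * c₃ * pot 3 (fun y => a y * w y) x := by ring
  · intro L₁ L₂ hL
    have t1 := (hC.pot3_low maw (hC.mul_low mw ma hd.lintegral_grad hL)).const_mul
      (measurable_pot 3 maw) (c₄ * c₃ : ℝ≥0∞)
    have hqκ : (q : ℝ≥0∞) * κ ≤ 2⁻¹ := by
      calc (q : ℝ≥0∞) * κ ≤ q * ((2 * q + 1)⁻¹ : ℝ≥0) := by
            gcongr
            exact hκ.trans (by exact_mod_cast min_le_right _ _)
        _ ≤ ((2⁻¹ : ℝ≥0) : ℝ≥0∞) := by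
            rw [← coe_mul, coe_le_coe, ← div_eq_mul_inv, ← NNReal.coe_le_coe]
            push_cast
            rw [div_le_iff₀ (by positivity)]; linarith
        _ = 2⁻¹ := by simp
    refine t1.mono ?_ ?_
    · calc _ = (q * κ) * L₁ := by rw [hq]; push_cast; ring
        _ ≤ _ := by gcongr
    · calc _ = (q * κ) * L₂ := by rw [hq]; push_cast; ring
        _ ≤ _ := by gcongr

end SphereMap

/-! ### Scaling -/

section Scaling

variable {ρ : ℝ}

theorem measurable_smul_R4 (ρ : ℝ) : Measurable fun x : R4 => ρ • x :=
  (continuous_const_smul ρ).measurable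

theorem map_smul_volume (hρ : 0 < ρ) :
    Measure.map (fun x : R4 => ρ • x) volume = ofReal ((ρ ^ 4)⁻¹) • volume := by
  rw [Measure.map_addHaar_smul volume hρ.ne', finrank_euclideanSpace_fin, abs_of_pos (by positivity)]

theorem lintegral_comp_smul (hρ : 0 < ρ) {g : R4 → ℝ≥0∞} (hg : Measurable g) :
    ∫⁻ x, g (ρ • x) = ofReal ((ρ ^ 4)⁻¹) * ∫⁻ x, g x := by
  rw [← lintegral_map hg (measurable_smul_R4 ρ), map_smul_volume hρ, lintegral_smul_measure,
    smul_eq_mul]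

theorem integral_comp_smul_R4 (hρ : 0 < ρ) (g : R4 → ℝ) :
    ∫ x, g (ρ • x) = (ρ ^ 4)⁻¹ * ∫ x, g x := by
  rw [Measure.integral_comp_smul, finrank_euclideanSpace_fin, abs_of_pos (by positivity), smul_eq_mul]

theorem ae_comp_smul (hρ : 0 < ρ) {p : R4 → Prop} (h : ∀ᵐ x, p x) : ∀ᵐ x : R4, p (ρ • x) := by
  have : ∀ᵐ y ∂(Measure.map (fun x : R4 => ρ • x) volume), p y := by
    rw [map_smul_volume hρ]
    simp [*]
  exact ae_of_ae_map (measurable_smul_R4 ρ).aemeasurable this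

theorem memLp_comp_smul (hρ : 0 < ρ) {g : R4 → ℝ} {p : ℝ≥0∞} (hg : MemLp g p) :
    MemLp (fun x => g (ρ • x)) p := by
  have : MemLp g p (Measure.map (fun x : R4 => ρ • x) volume) := by
    rw [map_smul_volume hρ]
    exact hg.smul_measure ofReal_ne_top
  exact this.comp_of_map (measurable_smul_R4 ρ).aemeasurable

theorem pd_comp_smul (ρ : ℝ) (i : Fin 4) (ψ : R4 → ℝ) (x : R4) :
    pd i (fun x => ψ (ρ • x)) x = ρ * pd i ψ (ρ • x) := by
  simp [pd, fderiv_comp_smul]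

theorem pd_const_mul (c : ℝ) (i : Fin 4) {ψ : R4 → ℝ} (hψ : ContDiff ℝ ∞ ψ) (x : R4) :
    pd i (fun x => c * ψ x) x = c * pd i ψ x := by
  rw [pd, fderiv_const_mul (hψ.differentiable (by simp) x)]
  simp [pd]

theorem lapl_comp_smul (ρ : ℝ) {ψ : R4 → ℝ} (hψ : ContDiff ℝ ∞ ψ) (x : R4) :
    lapl (fun x => ψ (ρ • x)) x = ρ ^ 2 * lapl ψ (ρ • x) := by
  rw [lapl, lapl, mul_sum]
  refine sum_congr rfl fun i _ => ?_
  have h1 : pd i (fun x => ψ (ρ • x)) = fun x => ρ * pd i ψ (ρ • x) := funext fun x =>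
    pd_comp_smul ρ i ψ x
  rw [h1, pd_const_mul ρ i (ψ := fun x => pd i ψ (ρ • x))
    ((contDiff_pd hψ i).comp (contDiff_const_smul ρ)), pd_comp_smul]
  ring

theorem IsTest.comp_smul_inv {Ω : Set R4} (hρ : 0 < ρ) {φ : R4 → ℝ}
    (hφ : IsTest ((fun x => ρ • x) ⁻¹' Ω) φ) : IsTest Ω fun x => φ (ρ⁻¹ • x) := by
  have hc : tsupport (fun x => φ (ρ⁻¹ • x)) ⊆ (fun x : R4 => ρ⁻¹ • x) ⁻¹' tsupport φ :=
    tsupport_comp_subset_preimage φ (continuous_const_smul ρ⁻¹)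
  refine ⟨hφ.contDiff.comp (contDiff_const_smul ρ⁻¹), ?_, fun x hx => ?_⟩
  · exact hφ.hasCompactSupport.comp_homeomorph (Homeomorph.smulOfNeZero ρ⁻¹ (inv_ne_zero hρ.ne'))
  · have := hφ.tsupport_subset (hc hx)
    simpa [smul_smul, hρ.ne'] using this

theorem WeakPd.comp_smul {Ω : Set R4} {i : Fin 4} {v w : R4 → ℝ} (h : WeakPd Ω i v w)
    (hρ : 0 < ρ) (c : ℝ) :
    WeakPd ((fun x => ρ • x) ⁻¹' Ω) i (fun x => c * v (ρ • x)) (fun x => c * ρ * w (ρ • x)) := by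
  refine ⟨(h.measurable.comp (measurable_smul_R4 ρ)).const_mul _,
    (h.measurable_deriv.comp (measurable_smul_R4 ρ)).const_mul _,
    (h.integrable.comp_smul hρ.ne').const_mul _, (h.integrable_deriv.comp_smul hρ.ne').const_mul _,
    fun φ hφ => ?_⟩
  have hψ := hφ.comp_smul_inv hρ
  set ψ : R4 → ℝ := fun x => φ (ρ⁻¹ • x) with hψdef
  have hφψ : φ = fun x => ψ (ρ • x) := by
    funext x
    simp [hψdef, smul_smul, hρ.ne']
  have e1 := integral_comp_smul_R4 hρ fun y => c * ρ * (v y * pd i ψ y)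
  have e2 := integral_comp_smul_R4 hρ fun y => c * ρ * (w y * ψ y)
  rw [integral_const_mul] at e1 e2
  have e3 : ∫ x, c * v (ρ • x) * pd i φ x = ∫ x, c * ρ * (v (ρ • x) * pd i ψ (ρ • x)) := by
    refine integral_congr_ae (.of_forall fun x => ?_)
    simp only
    rw [hφψ, pd_comp_smul]; ring
  have e4 : ∫ x, c * ρ * w (ρ • x) * φ x = ∫ x, c * ρ * (w (ρ • x) * ψ (ρ • x)) := by
    refine integral_congr_ae (.of_forall fun x => ?_)
    simp only
    rw [hφψ]; ring
  rw [e3, e4]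
  rw [integral_const_mul] at e1 e2 ⊢
  rw [integral_const_mul, integral_comp_smul_R4 hρ fun y => v y * pd i ψ y,
    integral_comp_smul_R4 hρ fun y => w y * ψ y, h.eq ψ hψ]
  ring

theorem SphereMap.comp_smul {ι : Type*} [Fintype ι] {Ω : Set R4} {u f : ι → R4 → ℝ} {D1 D3 : Fin 4 → ι → R4 → ℝ}
  {D2 : Fin 4 → Fin 4 → ι → R4 → ℝ} (h : SphereMap Ω u D1 D2 D3 f) (hρ : 0 < ρ) :
    SphereMap ((fun x => ρ • x) ⁻¹' Ω) (fun a x => u a (ρ • x)) (fun i a x => ρ * D1 i a (ρ • x))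
      (fun i j a x => ρ ^ 2 * D2 i j a (ρ • x)) (fun i a x => ρ ^ 3 * D3 i a (ρ • x))
      (fun a x => ρ ^ 4 * f a (ρ • x)) := by
  have hl : ∀ a, lapC (fun i j a x => ρ ^ 2 * D2 i j a (ρ • x)) a
      = fun x => ρ ^ 2 * lapC D2 a (ρ • x) := fun a => by
    funext x
    simp only [lapC, mul_sum]
  refine ⟨h.isOpen.preimage (continuous_const_smul ρ), fun i a => ?_, fun i j a => ?_, fun i a => ?_,
    fun a x => h.abs_le a _, ae_comp_smul hρ h.sphere, fun a => memLp_comp_smul hρ (h.memLp_two a),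
    fun a => memLp_comp_smul hρ (h.memLp_four a),
    fun i a => (memLp_comp_smul hρ (h.memLp_D1_two i a)).const_mul _,
    fun i a => (memLp_comp_smul hρ (h.memLp_D1_four i a)).const_mul _,
    fun i j a => (memLp_comp_smul hρ (h.memLp_D2_two i j a)).const_mul _,
    fun a => ((h.measurable_f a).comp (measurable_smul_R4 ρ)).const_mul _,
    fun a => ((h.integrable_f a).comp_smul hρ.ne').const_mul _, fun a φ hφ => ?_⟩
  · simpa using (h.weak₁ i a).comp_smul hρ 1
  · simpa only [sq] using (h.weak₂ i j a).comp_smul hρ ρ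
  · rw [hl, show ρ ^ 3 = ρ ^ 2 * ρ by ring]
    exact (h.weak₃ i a).comp_smul hρ (ρ ^ 2)
  · have hψ := hφ.comp_smul_inv hρ
    set ψ : R4 → ℝ := fun x => φ (ρ⁻¹ • x) with hψdef
    have hφψ : φ = fun x => ψ (ρ • x) := by
      funext x
      simp [hψdef, smul_smul, hρ.ne']
    have e1 := integral_comp_smul_R4 hρ fun y => coeffLap u D1 D2 a y * lapl ψ y
      + (∑ i, coeffGrad u D1 D2 i a y * pd i ψ y) + coeffZero u D1 D2 a y * ψ y
    rw [h.eq a ψ hψ, ← integral_comp_smul_R4 hρ] at e1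
    have e2 : ∫ x, ρ ^ 4 * f a (ρ • x) * φ x = ρ ^ 4 * ∫ x, f a (ρ • x) * ψ (ρ • x) := by
      rw [← integral_const_mul]
      refine integral_congr_ae (.of_forall fun x => ?_)
      simp only
      rw [hφψ]; ring
    rw [e2, ← e1, ← integral_const_mul]
    refine integral_congr_ae (.of_forall fun x => ?_)
    simp only
    rw [hφψ, lapl_comp_smul ρ hψ.contDiff]
    have g1 : gradSq (fun i a x => ρ * D1 i a (ρ • x)) x = ρ ^ 2 * gradSq D1 (ρ • x) := by
      simp only [gradSq, mul_pow, mul_sum]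
    have g2 : dotLap (fun a x => u a (ρ • x)) (fun i j a x => ρ ^ 2 * D2 i j a (ρ • x)) x
        = ρ ^ 2 * dotLap u D2 (ρ • x) := by
      simp only [dotLap, hl, mul_sum]
      grind
    have g3 : ∀ i, gradLap (fun i a x => ρ * D1 i a (ρ • x))
        (fun i j a x => ρ ^ 2 * D2 i j a (ρ • x)) i x = ρ ^ 3 * gradLap D1 D2 i (ρ • x) := fun i => by
      simp only [gradLap, hl, mul_sum]; ring_nf
    have g4 : ∑ c, (ρ ^ 2 * lapC D2 c (ρ • x)) ^ 2 = ρ ^ 4 * ∑ c, lapC D2 c (ρ • x) ^ 2 := by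
      rw [mul_sum]; ring_nf
    simp only [pd_comp_smul, coeffLap, coeffGrad, coeffZero, g1, g2, g3, hl, g4, Fin.sum_univ_four]
    ring

end Scaling

/-! ### Passage to components -/

section Components

variable {n : ℕ} {Ω Ω' : Set R4}

/-- `v'` consists of measurable representatives on `Ω` of the components of `v`. -/
structure IsCompRep (Ω : Set R4) (v : R4 → Amb n) (v' : Fin (n + 1) → R4 → ℝ) : Prop where
  measurable : ∀ a, Measurable (v' a)
  ae_eq : ∀ᵐ x, x ∈ Ω → ∀ a, v' a x = v x a

theorem exists_isCompRep (hΩ : MeasurableSet Ω) {v : R4 → Amb n}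
    (hv : AEStronglyMeasurable v (volume.restrict Ω)) : ∃ v', IsCompRep Ω v v' := by
  refine ⟨fun a x => hv.mk v x a, fun a => ?_, ?_⟩
  · fun_prop
  · filter_upwards [(ae_restrict_iff' hΩ).1 hv.ae_eq_mk] with x hx hxΩ a
    rw [hx hxΩ]

theorem IsCompRep.mono {v : R4 → Amb n} {v' : Fin (n + 1) → R4 → ℝ} (h : IsCompRep Ω' v v')
    (hΩ : Ω ⊆ Ω') : IsCompRep Ω v v' :=
  ⟨h.measurable, h.ae_eq.mono fun _ hx hxΩ => hx (hΩ hxΩ)⟩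

theorem exists_isCompRep_of_norm_eq_one (hΩ : MeasurableSet Ω) {v : R4 → Amb n}
    (hv : AEStronglyMeasurable v (volume.restrict Ω)) (h1 : ∀ᵐ x, x ∈ Ω → ‖v x‖ = 1) :
    ∃ v', IsCompRep Ω v v' ∧ ∀ a x, |v' a x| ≤ 1 := by
  obtain ⟨v', hv'⟩ := exists_isCompRep hΩ hv
  refine ⟨fun a x => max (-1) (min 1 (v' a x)), ⟨fun a => ?_, ?_⟩, fun a x => ?_⟩
  · exact measurable_const.max (measurable_const.min (hv'.measurable a))
  · filter_upwards [hv'.ae_eq, h1] with x hx hx1 hxΩ a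
    have : |v x a| ≤ 1 := by
      rw [← hx1 hxΩ, ← norm_eq_abs]
      exact PiLp.norm_apply_le (v x) a
    grind
  · grind

theorem integral_indicator_mul {φ : R4 → ℝ} (h0 : ∀ x, x ∉ Ω → φ x = 0) (g : R4 → ℝ) :
    ∫ x, Ω.indicator g x * φ x = ∫ x, g x * φ x := by
  refine integral_congr_ae (.of_forall fun x => ?_)
  by_cases hx : x ∈ Ω
  · simp [*]
  · simp [h0 x hx]

theorem setIntegral_smul_apply {v : R4 → Amb n} {v' : Fin (n + 1) → R4 → ℝ}
    (hv' : IsCompRep Ω v v') (hΩΩ' : Ω ⊆ Ω') (hv : LocallyIntegrableOn v Ω')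
    {φ : R4 → ℝ} (hφ : IsTest Ω φ) (a : Fin (n + 1)) :
    (∫ x in Ω', φ x • v x) a = ∫ x, Ω.indicator (v' a) x * φ x := by
  have hK : IsCompact (tsupport φ) := hφ.hasCompactSupport
  have hz : ∀ x, x ∉ tsupport φ → φ x = 0 := fun x => image_eq_zero_of_notMem_tsupport
  have hI : IntegrableOn (fun x => φ x • v x) (tsupport φ) :=
    (hv.integrableOn_compact_subset (hφ.tsupport_subset.trans hΩΩ') hK).continuousOn_smul
      hφ.continuous.continuousOn hK
  have e1 : ∫ x in Ω', φ x • v x = ∫ x in tsupport φ, φ x • v x := by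
    rw [setIntegral_eq_integral_of_forall_compl_eq_zero fun x hx => by
        rw [hz x fun h => hx (hΩΩ' (hφ.tsupport_subset h)), zero_smul],
      setIntegral_eq_integral_of_forall_compl_eq_zero fun x hx => by rw [hz x hx, zero_smul]]
  have e2 := (EuclideanSpace.proj a : Amb n →L[ℝ] ℝ).integral_comp_comm hI
  rw [e1, integral_indicator_mul (fun x hx => hφ.eq_zero hx)]
  refine e2.symm.trans ?_
  have e3 : ∫ x in tsupport φ, v' a x * φ x = ∫ x, v' a x * φ x :=
    setIntegral_eq_integral_of_forall_compl_eq_zero fun x hx => by rw [hz x hx, mul_zero]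
  rw [← e3]
  refine integral_congr_ae ?_
  filter_upwards [ae_restrict_of_ae hv'.ae_eq, ae_restrict_mem hK.measurableSet] with x hx hxK
  rw [hx (hφ.tsupport_subset hxK) a]
  simp [mul_comm]

theorem HasWeakPartial.weakPd {i : Fin 4} {v w : R4 → Amb n} {v' w' : Fin (n + 1) → R4 → ℝ}
    (h : HasWeakPartial Ω' i v w) (hΩ : MeasurableSet Ω) (hΩΩ' : Ω ⊆ Ω') (hv : IsCompRep Ω v v')
    (hw : IsCompRep Ω w w') (a : Fin (n + 1)) (hvi : Integrable (Ω.indicator (v' a)))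
    (hwi : Integrable (Ω.indicator (w' a))) :
    WeakPd Ω i (Ω.indicator (v' a)) (Ω.indicator (w' a)) := by
  refine ⟨(hv.measurable a).indicator hΩ, (hw.measurable a).indicator hΩ, hvi, hwi, fun φ hφ => ?_⟩
  have := congrArg (fun z : Amb n => z a) (h.integral_eq φ hφ.contDiff hφ.hasCompactSupport
    (hφ.tsupport_subset.trans hΩΩ'))
  have e1 := setIntegral_smul_apply hv hΩΩ' h.locallyIntegrable (hφ.pd i) a
  have e2 := setIntegral_smul_apply hw hΩΩ' h.locallyIntegrable_partial hφ a
  rw [← e1, ← e2]; bound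

theorem laplacian_smul_const {φ : R4 → ℝ} (hφ : ContDiff ℝ ∞ φ) (w : Amb n) (x : R4) :
    Laplacian.laplacian (fun x => φ x • w) x = lapl φ x • w := by
  have h2 : ContDiffAt ℝ 2 φ x := hφ.contDiffAt.of_le (WithTop.coe_le_coe.2 (le_top : (2 : ℕ∞) ≤ ⊤))
  have e1 := h2.laplacian_CLM_comp_left (l := (ContinuousLinearMap.id ℝ ℝ).smulRight w)
  have e2 : Laplacian.laplacian φ x = lapl φ x := by
    rw [InnerProductSpace.laplacian_eq_iteratedFDeriv_orthonormalBasis φ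
      (EuclideanSpace.basisFun (Fin 4) ℝ)]
    refine sum_congr rfl fun i _ => ?_
    rw [iteratedFDeriv_two_apply]
    have hd : DifferentiableAt ℝ (fderiv ℝ φ) x :=
      (hφ.fderiv_right (m := ∞) (by simp)).contDiffAt.differentiableAt (by simp)
    have : HasFDerivAt (fun y => fderiv ℝ φ y (e i))
        ((ContinuousLinearMap.apply ℝ ℝ (e i)).comp (fderiv ℝ (fderiv ℝ φ) x)) x :=
      (ContinuousLinearMap.apply ℝ ℝ (e i)).hasFDerivAt.comp x hd.hasFDerivAt
    have e3 : pd i (pd i φ) x = fderiv ℝ (fderiv ℝ φ) x (e i) (e i) := by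
      show fderiv ℝ (fun y => fderiv ℝ φ y (e i)) x (e i) = _
      rw [this.fderiv]; rfl
    simp [*]
  aesop

/-- An approximate biharmonic map in components, restricted to an open subset of the ball. -/
theorem IsApproxBiharmonic.sphereMap {u f : R4 → Amb n} {Du : Fin 4 → R4 → Amb n}
    {D2u : Fin 4 → Fin 4 → R4 → Amb n} {DLapu : Fin 4 → R4 → Amb n}
    (h : IsApproxBiharmonic (B 1) u Du D2u f) (hΩ : IsOpen Ω) (hΩ1 : Ω ⊆ B 1) (hΩΩ' : Ω ⊆ Ω')
    (hw : ∀ i, HasWeakPartial Ω' i (lap D2u) (DLapu i)) {u' f' : Fin (n + 1) → R4 → ℝ}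
    {D1 : Fin 4 → Fin (n + 1) → R4 → ℝ} {D2 : Fin 4 → Fin 4 → Fin (n + 1) → R4 → ℝ}
    {D3 : Fin 4 → Fin (n + 1) → R4 → ℝ} (hu : IsCompRep Ω u u') (hu1 : ∀ a x, |u' a x| ≤ 1)
    (hD1 : ∀ i, IsCompRep Ω (Du i) (D1 i)) (hD2 : ∀ i j, IsCompRep Ω (D2u i j) (D2 i j))
    (hD3 : ∀ i, IsCompRep Ω (DLapu i) (D3 i)) (hf : IsCompRep Ω f f')
    (h4 : ∀ i a, MemLp (Ω.indicator (D1 i a)) 4) (h3 : ∀ i a, Integrable (Ω.indicator (D3 i a)))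
    (hfi : ∀ a, Integrable (Ω.indicator (f' a))) :
    SphereMap Ω (fun a => Ω.indicator (u' a)) (fun i a => Ω.indicator (D1 i a))
      (fun i j a => Ω.indicator (D2 i j a)) (fun i a => Ω.indicator (D3 i a))
      (fun a => Ω.indicator (f' a)) := by
  have hΩm := hΩ.measurableSet
  have hvol : volume Ω ≠ ⊤ := ((measure_mono hΩ1).trans_lt measure_ball_lt_top).ne
  have hcomp : ∀ {v : R4 → Amb n} {v' : Fin (n + 1) → R4 → ℝ} (a : Fin (n + 1)), IsCompRep Ω v v' →
      MemLp v 2 (volume.restrict (B 1)) → MemLp (Ω.indicator (v' a)) 2 := by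
    intro v v' a hv' hv
    rw [memLp_indicator_iff_restrict hΩm]
    refine (hv.mono_measure (Measure.restrict_mono hΩ1 le_rfl)).of_le
      (hv'.measurable a).aestronglyMeasurable ?_
    filter_upwards [ae_restrict_of_ae hv'.ae_eq, ae_restrict_mem hΩm] with x hx hxΩ
    rw [hx hxΩ a]
    exact PiLp.norm_apply_le (v x) a
  have hint : ∀ {g : R4 → ℝ}, MemLp (Ω.indicator g) 2 → Integrable (Ω.indicator g) := by
    intro g hg
    rw [memLp_indicator_iff_restrict hΩm] at hg
    have : IsFiniteMeasure (volume.restrict Ω) := ⟨by simpa using hvol.lt_top⟩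
    rw [integrable_indicator_iff hΩm]
    exact hg.integrable (by norm_num)
  have mu : ∀ a x, |Ω.indicator (u' a) x| ≤ 1 := fun a x => by
    by_cases hx : x ∈ Ω
    · simp [*]
    · simp [*]
  have hu4 : ∀ a p, MemLp (Ω.indicator (u' a)) p := fun a p => by
    rw [memLp_indicator_iff_restrict hΩm]
    have : IsFiniteMeasure (volume.restrict Ω) := ⟨by simpa using hvol.lt_top⟩
    exact MemLp.of_bound (hu.measurable a).aestronglyMeasurable 1 (.of_forall (hu1 a))
  have m1 := fun i a => hcomp a (hD1 i) (h.isW22.memLp_D i)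
  have m2 := fun i j a => hcomp a (hD2 i j) (h.isW22.memLp_D2 i j)
  have hl : ∀ a, lapC (fun i j a => Ω.indicator (D2 i j a)) a = Ω.indicator (lapC D2 a) := fun a => by
    funext x
    by_cases hx : x ∈ Ω <;> simp [lapC, hx]
  have hlr : IsCompRep Ω (lap D2u) (lapC D2) := by
    refine ⟨fun a => measurable_sum _ fun i _ => (hD2 i i).measurable a, ?_⟩
    filter_upwards [ae_all_iff.2 fun i => (hD2 i i).ae_eq] with x hx hxΩ a
    simp only [lapC, lap, hx _ hxΩ a]; simp
  refine ⟨hΩ, fun i a => ?_, fun i j a => ?_, fun i a => ?_, mu, ?_, fun a => hu4 a 2,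
    fun a => hu4 a 4, m1, h4, m2, fun a => (hf.measurable a).indicator hΩm, hfi, fun a φ hφ => ?_⟩
  · exact (h.isW22.weak_D i).weakPd hΩm hΩ1 hu (hD1 i) a (hint (hu4 a 2)) (hint (m1 i a))
  · exact (h.isW22.weak_D2 i j).weakPd hΩm hΩ1 (hD1 j) (hD2 i j) a (hint (m1 j a)) (hint (m2 i j a))
  · rw [hl]
    refine (hw i).weakPd hΩm hΩΩ' hlr (hD3 i) a ?_ (h3 i a)
    have : MemLp (lapC (fun i j a => Ω.indicator (D2 i j a)) a) 2 :=
      memLp_finsetSum _ fun i _ => m2 i i a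
    simp_all
  · filter_upwards [hu.ae_eq, (ae_restrict_iff' measurableSet_ball).1 h.norm_eq_one] with x hx hx1 hxΩ
    have := hx1 (hΩ1 hxΩ)
    simp only [indicator_of_mem hxΩ, hx hxΩ]
    rw [EuclideanSpace.norm_eq, Real.sqrt_eq_one] at this
    simp_all
  · set w : Amb n := EuclideanSpace.single a 1 with hwdef
    have hiw : ∀ (v : Amb n) (c : ℝ), inner ℝ v (c • w) = v a * c := fun v c => by
      rw [inner_smul_right, hwdef, EuclideanSpace.inner_single_right]
      simp [mul_comm]
    have hη : ContDiff ℝ ∞ fun x => φ x • w := hφ.contDiff.smul contDiff_const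
    have hsub : tsupport (fun x => φ x • w) ⊆ tsupport φ := tsupport_smul_subset_left φ _
    have key := h.equation _ hη (hφ.hasCompactSupport.smul_right)
      (hsub.trans (hφ.tsupport_subset.trans hΩ1))
    have hfd : ∀ x i, fderiv ℝ (fun x => φ x • w) x (e i) = pd i φ x • w := fun x i => by
      rw [fderiv_smul_const (hφ.contDiff.differentiable (by simp) x)]; rfl
    simp only [laplacian_smul_const hφ.contDiff, hfd, hiw] at key
    have z0 : ∀ x, x ∉ Ω → φ x = 0 := fun x => hφ.eq_zero
    have z1 : ∀ i x, x ∉ Ω → pd i φ x = 0 := fun i x => (hφ.pd i).eq_zero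
    have z2 : ∀ x, x ∉ Ω → lapl φ x = 0 := fun x => (isTest_lapl hφ).eq_zero
    rw [setIntegral_eq_integral_of_forall_compl_eq_zero fun x hx => by
        simp [z0 x fun h => hx (hΩ1 h), z1 _ x fun h => hx (hΩ1 h), z2 x fun h => hx (hΩ1 h)],
      setIntegral_eq_integral_of_forall_compl_eq_zero fun x hx => by
        rw [z0 x fun h => hx (hΩ1 h), mul_zero]] at key
    have e1 : ∫ x, Ω.indicator (f' a) x * φ x = ∫ x, f x a * φ x := by
      rw [integral_indicator_mul z0]
      refine integral_congr_ae ?_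
      filter_upwards [hf.ae_eq] with x hx
      by_cases hxΩ : x ∈ Ω
      · rw [hx hxΩ]
      · simp [z0 x hxΩ]
    rw [e1, ← key]
    refine integral_congr_ae ?_
    filter_upwards [hu.ae_eq, ae_all_iff.2 fun i => (hD1 i).ae_eq, hlr.ae_eq] with x hxu hx1 hx2
    by_cases hxΩ : x ∈ Ω
    · have r0 : ∀ a, Ω.indicator (u' a) x = u x a := fun a => by
        rw [indicator_of_mem hxΩ, hxu hxΩ]
      have r1 : ∀ i a, Ω.indicator (D1 i a) x = Du i x a := fun i a => by simp [*]
      have r2 : ∀ a, lapC (fun i j a => Ω.indicator (D2 i j a)) a x = lap D2u x a := fun a => by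
        simp [*]
      have i1 : ∀ v v' : Amb n, inner ℝ v v' = ∑ c, v c * v' c := fun v v' => by
        rw [PiLp.inner_apply]
        exact sum_congr rfl fun c _ => by simp [mul_comm]
      simp only [coeffLap, coeffGrad, coeffZero, gradSq, gradLap, dotLap, r0, r1, r2,
        secondFFTrace, secondFF, partialProj, lapProj, dTanProj, i1]
      simp only [Fin.sum_univ_four, sq, PiLp.add_apply, PiLp.neg_apply, PiLp.smul_apply, smul_eq_mul]
      ring
    · simp [z0 x hxΩ, z1 _ x hxΩ, z2 x hxΩ]

end Components

/-! ### Rearrangements -/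

section Rearrangements

/-- The weak Lorentz norm is controlled by the integrals over sets of given measure. -/
theorem weakLorentzNorm_le {F : Type*} [NormedAddCommGroup F] {p : ℝ} (hp : 1 < p) {N : Set R4}
    (hN : MeasurableSet N) (hNf : volume N ≠ ⊤) {g : R4 → F} {G : R4 → ℝ≥0∞} (hG : Measurable G)
    (hgG : ∀ᵐ x, x ∈ N → ‖g x‖ₑ ≤ G x) {K : ℝ≥0∞} (hK0 : K ≠ 0) (hK : K ≠ ⊤)
    (h : ∀ E, MeasurableSet E → volume E ≠ ⊤ →
      ∫⁻ x in E, N.indicator G x ≤ K * volume E ^ (1 - 1 / p)) :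
    weakLorentzNorm p (volume.restrict N) g ≤ ofReal (1 / (1 - 1 / p)) * K := by
  have hp0 : 0 < p := by linarith
  have hp1 : 1 / p < 1 := by bound
  have hpp : 0 < 1 / p := by positivity
  have hlev : ∀ s : ℝ≥0∞, s ≠ 0 → s ≠ ⊤ → volume.restrict N {x | s < ‖g x‖ₑ} ≤ (K / s) ^ p := by
    intro s hs hst
    have hm : MeasurableSet {x | s < N.indicator G x} :=
      measurableSet_lt measurable_const (hG.indicator hN)
    have hsub : {x | s < N.indicator G x} ⊆ N := fun x hx => by
      by_contra hxN
      simp_all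
    have hf : volume {x | s < N.indicator G x} ≠ ⊤ := measure_ne_top_of_subset hsub hNf
    calc volume.restrict N {x | s < ‖g x‖ₑ} ≤ volume.restrict N {x | s < N.indicator G x} := by
          refine measure_mono_ae ?_
          filter_upwards [ae_restrict_of_ae hgG, ae_restrict_mem hN] with x hx hxN hs
          have hs' : s < ‖g x‖ₑ := hs
          show s < N.indicator G x
          rw [indicator_of_mem hxN]
          grind
      _ ≤ volume {x | s < N.indicator G x} := Measure.restrict_apply_le _ _
      _ ≤ (K / s) ^ (1 / (1 - (1 - 1 / p))) := by
          refine le_div_rpow_of_mul_le (by linarith) hf hs hst ?_ (by linarith)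
          refine le_trans ?_ (h _ hm hf)
          rw [← setLIntegral_const]
          exact setLIntegral_mono (hG.indicator hN) fun x hx => le_of_lt hx
      _ = (K / s) ^ p := by simp
  have hre : ∀ t : ℝ, 0 < t → rearr (volume.restrict N) g t ≤ K * (1 / ofReal t) ^ (1 / p) := by
    intro t ht
    have ht0 : ofReal t ≠ 0 := by simpa using ht
    have hX0 : (1 / ofReal t) ^ (1 / p) ≠ 0 :=
      (ENNReal.rpow_pos (by simp) (div_ne_top (by simp) ht0)).ne'
    have hXt : (1 / ofReal t) ^ (1 / p) ≠ ⊤ :=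
      rpow_ne_top_of_nonneg hpp.le (div_ne_top (by simp) ht0)
    refine sInf_le ?_
    refine (hlev _ (mul_ne_zero hK0 hX0) (mul_ne_top hK hXt)).trans_eq ?_
    rw [ENNReal.div_eq_inv_mul, ENNReal.mul_inv (Or.inl hK0) (Or.inl hK), mul_right_comm,
      ENNReal.inv_mul_cancel hK0 hK, one_mul, ← ENNReal.inv_rpow, ← rpow_mul,
      one_div_mul_cancel hp0.ne', rpow_one, one_div, inv_inv]
  refine iSup₂_le fun t ht => ?_
  have ht0 : ofReal t ≠ 0 := by simpa using ht
  have hI : ∫⁻ s in Ioc 0 t, rearr (volume.restrict N) g s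
      ≤ K * (ofReal (1 / (1 - 1 / p)) * ofReal t ^ (1 - 1 / p)) := by
    calc _ ≤ ∫⁻ s in Ioc 0 t, K * (1 / ofReal s) ^ (1 / p) :=
          setLIntegral_mono' measurableSet_Ioc fun s hs => hre s hs.1
      _ = K * ∫⁻ s in Ioo 0 t, (1 / ofReal s) ^ (1 / p) := by
          rw [lintegral_const_mul _ (by fun_prop), setLIntegral_congr Ioo_ae_eq_Ioc]
      _ ≤ K * ∫⁻ s in {s : ℝ | 0 < s ∧ ofReal s < ofReal t},
            (1 / ofReal s) ^ (1 / p) := by aesop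
      _ ≤ _ := by
          gcongr
          simpa using lintegral_Ioc_div_rpow_le hpp hp1 1 (ofReal t)
  calc ofReal (t ^ (1 / p)) * rearrAvg (volume.restrict N) g t
      ≤ ofReal t ^ (1 / p) * ((ofReal t)⁻¹ *
        (K * (ofReal (1 / (1 - 1 / p)) * ofReal t ^ (1 - 1 / p)))) := by
        rw [ofReal_rpow_of_pos ht, rearrAvg]; gcongr
    _ = (ofReal t ^ (1 / p) * ofReal t ^ (1 - 1 / p)) * (ofReal t)⁻¹
        * (ofReal (1 / (1 - 1 / p)) * K) := by ring
    _ = _ := by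
        rw [← rpow_add _ _ ht0 ofReal_ne_top, add_sub_cancel, rpow_one,
          ENNReal.mul_inv_cancel ht0 ofReal_ne_top, one_mul]

theorem volume_ofReal_le (w : ℝ≥0∞) : volume {s : ℝ | 0 < s ∧ ofReal s ≤ w} ≤ w := by
  rcases eq_or_ne w ⊤ with rfl | hw
  · simp
  · calc _ ≤ volume (Ioc 0 w.toReal) := measure_mono fun s hs =>
          ⟨hs.1, (ENNReal.ofReal_le_iff_le_toReal hw).1 hs.2⟩
      _ = w := by simp [*]

/-- The Hardy–Littlewood inequality for the integral over a set. -/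
theorem setLIntegral_le_lintegral_rearr {α F : Type*} [MeasurableSpace α] [NormedAddCommGroup F]
    (μ : Measure α) [SFinite μ] {g : α → F} (hg : AEStronglyMeasurable g μ) {E : Set α}
    {τ : ℝ} (hτ : μ E ≤ ofReal τ) :
    ∫⁻ x in E, ‖g x‖ₑ ∂μ ≤ ∫⁻ r in Ioc 0 τ, rearr μ g r := by
  set d : ℝ → ℝ≥0∞ := fun s => μ {x | ofReal s < ‖g x‖ₑ} with hd
  have hdm : Measurable d := Antitone.measurable fun s s' hs =>
    measure_mono fun x hx => (ofReal_le_ofReal hs).trans_lt hx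
  have hgm : Measurable fun x => ‖hg.mk g x‖ₑ := hg.stronglyMeasurable_mk.enorm
  have h1 : ∫⁻ x in E, ‖g x‖ₑ ∂μ
      = ∫⁻ s in Ioi (0 : ℝ), μ.restrict E {x | ofReal s < ‖hg.mk g x‖ₑ} := by
    have := lintegral_mul_eq_layer (μ.restrict E) (Z := fun _ => 1) measurable_const hgm
    simp only [one_mul, setLIntegral_one] at this
    rw [← this]
    refine lintegral_congr_ae ?_
    filter_upwards [ae_restrict_of_ae hg.ae_eq_mk] with x hx
    rw [hx]
  have h2 : ∀ s, μ.restrict E {x | ofReal s < ‖hg.mk g x‖ₑ}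
      ≤ ∫⁻ r in Ioc 0 τ, {r : ℝ | ofReal r < d s}.indicator 1 r := by
    intro s
    have hm : MeasurableSet {r : ℝ | ofReal r < d s} :=
      measurableSet_lt measurable_ofReal measurable_const
    rw [lintegral_indicator_one hm, Measure.restrict_apply hm]
    have hE : μ.restrict E {x | ofReal s < ‖hg.mk g x‖ₑ} ≤ min (d s) (ofReal τ) := by
      refine le_min ?_ ((measure_mono (subset_univ _)).trans (by simpa using hτ))
      refine (Measure.restrict_apply_le _ _).trans (measure_mono_ae ?_)
      filter_upwards [hg.ae_eq_mk] with x hx hs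
      have hs' : ofReal s < ‖hg.mk g x‖ₑ := hs
      show ofReal s < ‖g x‖ₑ
      rwa [hx]
    refine hE.trans ?_
    set m := min (d s) (ofReal τ) with hmdef
    have hmt : m ≠ ⊤ := ((min_le_right _ _).trans_lt ofReal_lt_top).ne
    calc m = volume (Ioo 0 m.toReal) := by simp [*]
      _ ≤ _ := by
          refine measure_mono fun r hr => ?_
          have hr' : ofReal r < m := (ENNReal.ofReal_lt_iff_lt_toReal hr.1.le hmt).2 hr.2
          refine ⟨hr'.trans_le (min_le_left _ _), hr.1, ?_⟩
          by_contra hlt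
          exact absurd (hr'.trans_le (min_le_right _ _))
            (not_lt.2 (ofReal_le_ofReal (not_le.1 hlt).le))
  rw [h1]
  calc _ ≤ ∫⁻ s in Ioi (0 : ℝ), ∫⁻ r in Ioc 0 τ, {r : ℝ | ofReal r < d s}.indicator 1 r :=
        lintegral_mono h2
    _ = ∫⁻ r in Ioc 0 τ, ∫⁻ s in Ioi (0 : ℝ), {r : ℝ | ofReal r < d s}.indicator 1 r := by
        refine lintegral_lintegral_swap ?_
        have hm : MeasurableSet {z : ℝ × ℝ | ofReal z.2 < d z.1} :=
          measurableSet_lt (measurable_ofReal.comp measurable_snd) (hdm.comp measurable_fst)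
        exact (measurable_one.indicator hm).aemeasurable (f := {z : ℝ × ℝ |
          ofReal z.2 < d z.1}.indicator (1 : ℝ × ℝ → ℝ≥0∞))
    _ ≤ _ := by
        refine lintegral_mono fun r => ?_
        calc ∫⁻ s in Ioi (0 : ℝ), {r : ℝ | ofReal r < d s}.indicator (1 : ℝ → ℝ≥0∞) r
            = ∫⁻ s in Ioi (0 : ℝ), {s : ℝ | ofReal r < d s}.indicator 1 s := rfl
          _ = volume ({s : ℝ | ofReal r < d s} ∩ Ioi 0) := by
              have hm : MeasurableSet {s : ℝ | ofReal r < d s} :=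
                measurableSet_lt measurable_const hdm
              simp_all
          _ ≤ volume {s : ℝ | 0 < s ∧ ofReal s ≤ rearr μ g r} := by
              refine measure_mono fun s hs => ⟨hs.2, le_sInf fun s' hs' => ?_⟩
              by_contra hlt
              refine absurd hs.1 (not_lt.2 (le_trans (measure_mono fun x hx => ?_) hs'))
              grind
          _ ≤ _ := volume_ofReal_le _

/-- The mass of `f ∈ L log L` in small balls decays logarithmically. -/
theorem exists_setLIntegral_le_LLogLNorm : ∃ C : ℝ≥0, ∀ {n : ℕ} {f : R4 → Amb n} {δ : ℝ},
    AEStronglyMeasurable f (volume.restrict (B 1)) → 0 < δ → δ ≤ 1 / 2 →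
    ∫⁻ x in B (2 * δ), ‖f x‖ₑ
      ≤ C * LLogLNorm (volume.restrict (B 1)) f * ofReal (Real.log (1 / δ))⁻¹ := by
  set K : ℝ := 16 * ballVol with hK
  have hK0 : 0 < K := by have := ballVol_pos; positivity
  obtain ⟨q, hq⟩ := pow_unbounded_of_one_lt (K + 1) (one_lt_two : (1 : ℝ) < 2)
  refine ⟨q + 1, fun {n f δ} hf hδ hδ2 => ?_⟩
  have hsub : B (2 * δ) ⊆ B 1 := ball_subset_ball (by linarith)
  set τ : ℝ := K * δ ^ 4 with hτ
  have hτ0 : 0 < τ := by positivity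
  have hvol : (volume.restrict (B 1)) (B (2 * δ)) ≤ ofReal τ := by
    refine (Measure.restrict_apply_le _ _).trans_eq ?_
    rw [volume_ball_R4 _ (by linarith), ← ofReal_pow (by linarith), hτ, hK,
      ← ofReal_coe_nnreal, ← ofReal_mul (by positivity)]
    ring_nf
  have h1 := setLIntegral_le_lintegral_rearr (volume.restrict (B 1)) hf hvol
  rw [Measure.restrict_restrict measurableSet_ball, inter_eq_left.2 hsub] at h1
  set ℓ := Real.log (1 / δ) with hℓ
  have hδ1 : 2 ≤ 1 / δ := by rw [le_div_iff₀ hδ]; linarith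
  have hℓ0 : 0 < ℓ := Real.log_pos (by linarith)
  -- the elementary inequality `log (1/δ) ≤ C log (2 + 1/|B_{2δ}|)`
  have hlog : ℓ ≤ (q + 1) * Real.log (2 + 1 / τ) := by
    have hτi : 0 < 1 / τ := by positivity
    have h2 : 1 / δ ≤ (2 + 1 / τ) ^ (q + 1) := by
      rcases le_total (1 / δ) (K + 1) with h | h
      · calc 1 / δ ≤ 2 ^ q := h.trans hq.le
          _ ≤ (2 + 1 / τ) ^ q := by gcongr; linarith
          _ ≤ _ := pow_le_pow_right₀ (by linarith) (Nat.le_succ _)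
      · have h3 : 1 / δ ≤ 1 / τ := by
          have : K * δ ≤ 1 := by
            rw [le_div_iff₀ hδ] at h
            nlinarith
          rw [hτ]
          refine one_div_le_one_div_of_le (by positivity) ?_
          calc K * δ ^ 4 = (K * δ) * δ ^ 2 * δ := by ring
            _ ≤ 1 * 1 * δ := by bound
            _ = δ := by ring
        calc 1 / δ ≤ (2 + 1 / τ) ^ 1 := by linarith
          _ ≤ _ := pow_le_pow_right₀ (by linarith) (by omega)
    calc ℓ ≤ Real.log ((2 + 1 / τ) ^ (q + 1)) := Real.log_le_log (by positivity) h2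
      _ = _ := by simp
  refine h1.trans ?_
  calc ∫⁻ r in Ioc 0 τ, rearr (volume.restrict (B 1)) f r
      ≤ ∫⁻ r in Ioc 0 τ, ((q + 1 : ℝ≥0) * ofReal ℓ⁻¹)
          * (rearr (volume.restrict (B 1)) f r * ofReal (Real.log (2 + 1 / r))) := by
        refine setLIntegral_mono' measurableSet_Ioc fun r hr => ?_
        have h3 : (1 : ℝ≥0∞) ≤ (q + 1 : ℝ≥0) * ofReal ℓ⁻¹
            * ofReal (Real.log (2 + 1 / r)) := by
          rw [← ofReal_coe_nnreal, ← ofReal_mul (by positivity),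
            ← ofReal_mul (by positivity), ENNReal.one_le_ofReal]
          have h4 : Real.log (2 + 1 / τ) ≤ Real.log (2 + 1 / r) := by
            refine Real.log_le_log (by positivity) ?_
            have := one_div_le_one_div_of_le hr.1 hr.2
            linarith
          have h5 : ℓ ≤ (q + 1) * Real.log (2 + 1 / r) := hlog.trans (by gcongr)
          calc (1 : ℝ) = ℓ * ℓ⁻¹ := (mul_inv_cancel₀ hℓ0.ne').symm
            _ ≤ (q + 1) * Real.log (2 + 1 / r) * ℓ⁻¹ := by gcongr
            _ = _ := by push_cast; ring
        calc _ = rearr (volume.restrict (B 1)) f r * 1 := (mul_one _).symm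
          _ ≤ rearr (volume.restrict (B 1)) f r * _ := mul_le_mul_right h3 _
          _ = _ := by ring
    _ ≤ ((q + 1 : ℝ≥0) * ofReal ℓ⁻¹) * ∫⁻ r in Ioc 0 τ,
          (rearr (volume.restrict (B 1)) f r * ofReal (Real.log (2 + 1 / r))) := by
        rw [lintegral_const_mul' _ _ (mul_ne_top (by simp) (by simp))]
    _ ≤ ((q + 1 : ℝ≥0) * ofReal ℓ⁻¹) * LLogLNorm (volume.restrict (B 1)) f := by
        gcongr
        exact lintegral_mono_set Ioc_subset_Ioi_self
    _ = _ := by ring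

end Rearrangements

/-! ### Estimates on annuli of any size -/

section Annuli

/-- The open annulus `{ρ/2 < |x| < 2ρ}`. -/
def annulus (ρ : ℝ) : Set R4 := B (2 * ρ) \ closedBall 0 (ρ / 2)

/-- The closed shell `{ρ ≤ |x| ≤ 3ρ/2}`. -/
def shell (ρ : ℝ) : Set R4 := closedBall 0 (3 / 2 * ρ) \ B ρ

theorem mem_annulus {ρ : ℝ} {x : R4} : x ∈ annulus ρ ↔ ρ / 2 < ‖x‖ ∧ ‖x‖ < 2 * ρ := by
  simp [annulus, and_comm]

theorem mem_shell {ρ : ℝ} {x : R4} : x ∈ shell ρ ↔ ρ ≤ ‖x‖ ∧ ‖x‖ ≤ 3 / 2 * ρ := by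
  simp [shell, and_comm]

theorem isOpen_annulus (ρ : ℝ) : IsOpen (annulus ρ) := Metric.isOpen_ball.sdiff Metric.isClosed_closedBall

theorem measurableSet_shell (ρ : ℝ) : MeasurableSet (shell ρ) :=
  measurableSet_closedBall.diff measurableSet_ball

theorem smul_mem_annulus {ρ : ℝ} (hρ : 0 < ρ) (x : R4) : ρ • x ∈ annulus ρ ↔ x ∈ annulus 1 := by
  rw [mem_annulus, mem_annulus, norm_smul, norm_of_nonneg hρ.le]
  field_simp

theorem smul_mem_shell {ρ : ℝ} (hρ : 0 < ρ) (x : R4) : ρ • x ∈ shell ρ ↔ x ∈ shell 1 := by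
  rw [mem_shell, mem_shell, norm_smul, norm_of_nonneg hρ.le]
  field_simp

theorem volume_shell_le {ρ : ℝ} (hρ : 0 < ρ) :
    volume (shell ρ) ≤ ofReal (16 * ballVol * ρ ^ 4) := by
  calc volume (shell ρ) ≤ volume (Metric.ball (0 : R4) (2 * ρ)) := measure_mono fun x hx => by
        rw [mem_shell] at hx
        rw [mem_ball_zero_iff]; linarith
    _ = _ := by
        rw [volume_ball_R4 _ (by linarith), ← ofReal_pow (by linarith),
          ← ofReal_coe_nnreal, ← ofReal_mul (by positivity)]
        ring_nf

/-- The exponent `θ` is invariant under the scaling of `k`-th derivatives; an exponent larger by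
`1/6` costs the factor `ρ ^ (-2/3)`. -/
theorem SetBound.of_comp_smul {k : ℕ} {θ : ℝ} (hθ : θ = 1 - k / 4) (hθ0 : 0 < θ) {ρ : ℝ} (hρ : 0 < ρ)
    {K₁ K₂ : ℝ≥0∞} {Z : R4 → ℝ≥0∞} (hZ : Measurable Z)
    (h : SetBound (θ + 1 / 6) θ K₁ K₂ fun x => ofReal (ρ ^ k) * Z (ρ • x)) :
    SetBound (θ + 1 / 6) θ (ofReal (ρ ^ (-(2 / 3) : ℝ)) * K₁) K₂ Z := fun E hE hf => by
  set X := ofReal ρ with hX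
  have hX0 : X ≠ 0 := by positivity
  have hXt : X ≠ ⊤ := ofReal_ne_top
  have hinv : ofReal ((ρ ^ 4)⁻¹) = X ^ (-4 : ℝ) := by
    rw [ofReal_inv_of_pos (by positivity), ofReal_pow hρ.le, ENNReal.rpow_neg]
    norm_cast
  have hpre : volume ((fun x : R4 => ρ • x) ⁻¹' E) = X ^ (-4 : ℝ) * volume E := by
    rw [← Measure.map_apply (measurable_smul_R4 ρ) hE, map_smul_volume hρ, Measure.smul_apply,
      smul_eq_mul, hinv]
  have hm' : MeasurableSet ((fun x : R4 => ρ • x) ⁻¹' E) := measurable_smul_R4 ρ hE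
  have key := h _ hm' (by
    rw [hpre]; exact mul_ne_top (ENNReal.rpow_ne_top_of_ne_zero hX0 hXt) hf)
  have e1 : ∫⁻ x in (fun x : R4 => ρ • x) ⁻¹' E, ofReal (ρ ^ k) * Z (ρ • x)
      = X ^ (k : ℝ) * (X ^ (-4 : ℝ) * ∫⁻ x in E, Z x) := by
    rw [lintegral_const_mul _ (show Measurable fun x => Z (ρ • x) from
        hZ.comp (measurable_smul_R4 ρ)), ← lintegral_indicator hm',
      ← lintegral_indicator hE, ← hinv, ← lintegral_comp_smul hρ (hZ.indicator hE),
      ofReal_pow hρ.le, rpow_natCast]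
    rfl
  have mul_r : ∀ p q : ℝ, X ^ p * X ^ q = X ^ (p + q) := fun p q =>
    (rpow_add p q hX0 hXt).symm
  rw [e1, hpre, mul_rpow_of_nonneg _ _ (by linarith), mul_rpow_of_nonneg _ _ hθ0.le,
    ← rpow_mul, ← rpow_mul] at key
  rw [← ofReal_rpow_of_pos hρ, ← hX]
  calc ∫⁻ x in E, Z x = X ^ (4 - k : ℝ) * (X ^ (k : ℝ) * (X ^ (-4 : ℝ) * ∫⁻ x in E, Z x)) := by
        rw [← mul_assoc, ← mul_assoc, mul_r, mul_r]; simp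
    _ ≤ X ^ (4 - k : ℝ) * (K₁ * (X ^ (-4 * (θ + 1 / 6)) * volume E ^ (θ + 1 / 6))
          + K₂ * (X ^ (-4 * θ) * volume E ^ θ)) := mul_le_mul_right key _
    _ = (X ^ (4 - k : ℝ) * X ^ (-4 * (θ + 1 / 6))) * K₁ * volume E ^ (θ + 1 / 6)
          + (X ^ (4 - k : ℝ) * X ^ (-4 * θ)) * K₂ * volume E ^ θ := by ring
    _ = _ := by
        rw [mul_r, mul_r, show (4 - k : ℝ) + -4 * (θ + 1 / 6) = -(2 / 3) by rw [hθ]; ring,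
          show (4 - k : ℝ) + -4 * θ = 0 by rw [hθ]; ring]
        simp

/-- The estimates of `SphereMap.exists_local_setBound` on an annulus of radius `ρ`. -/
theorem exists_shell_setBound (ι : Type*) [Fintype ι] :
    ∃ κ₀ C : ℝ≥0, 0 < κ₀ ∧ κ₀ ≤ 1 ∧ ∀ {ρ : ℝ} {u : ι → R4 → ℝ} {D1 D2 D3 f}
      {κ m : ℝ≥0∞}, 0 < ρ → SphereMap (annulus ρ) u D1 D2 D3 f →
      LocalData (annulus ρ) κ m D1 D2 f →
      SetBound (1 / 4 + 1 / 6) (1 / 4) (ofReal (ρ ^ (-(2 / 3) : ℝ)) * (C * (κ + κ * κ)))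
        (C * (κ * κ + m)) ((shell ρ).indicator (gradMag D3)) ∧
      (κ ≤ κ₀ → SetBound (3 / 4 + 1 / 6) (3 / 4) (ofReal (ρ ^ (-(2 / 3) : ℝ)) * (C * κ))
          (C * m) ((shell ρ).indicator (gradMag D1)) ∧
        SetBound (1 / 2 + 1 / 6) (1 / 2) (ofReal (ρ ^ (-(2 / 3) : ℝ)) * (C * κ)) (C * m)
          ((shell ρ).indicator (hessMag D2)) ∧
        SetBound (1 / 4 + 1 / 6) (1 / 4) (ofReal (ρ ^ (-(2 / 3) : ℝ)) * (C * κ)) (C * m)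
          ((shell ρ).indicator (gradMag D3))) := by
  have hS : volume (annulus 1) ≠ ⊤ := measure_ne_top_of_subset sdiff_subset measure_ball_lt_top.ne
  obtain ⟨κ₀, C, h0, h1, key⟩ := SphereMap.exists_local_setBound (isOpen_annulus 1)
    (K := shell 1) ((isCompact_closedBall _ _).diff Metric.isOpen_ball)
    (fun x hx => by rw [mem_shell] at hx; rw [mem_annulus]; constructor <;> linarith)
    (isOpen_annulus 1).measurableSet hS ι
  refine ⟨κ₀, C, h0, h1, fun {ρ u D1 D2 D3 f κ m} hρ h hd => ?_⟩
  have hΩ : (fun x : R4 => ρ • x) ⁻¹' annulus ρ = annulus 1 := by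
    ext x; exact smul_mem_annulus hρ x
  have hs := h.comp_smul hρ
  rw [hΩ] at hs
  have hen : ∀ k : ℕ, ‖ρ ^ k‖ₑ = ofReal ρ ^ k := fun k => by
    rw [enorm_pow, Real.enorm_eq_ofReal hρ.le]
  have hg : ∀ (k : ℕ) (D : Fin 4 → ι → R4 → ℝ) x, gradMag (fun i a x => ρ ^ k * D i a (ρ • x)) x
      = ofReal ρ ^ k * gradMag D (ρ • x) := fun k D x => by
    simp only [gradMag, enorm_mul, hen, mul_sum]
  have hg1 : ∀ x, gradMag (fun i a x => ρ * D1 i a (ρ • x)) x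
      = ofReal ρ * gradMag D1 (ρ • x) := fun x => by simpa using hg 1 D1 x
  have hh : ∀ x, hessMag (fun i j a x => ρ ^ 2 * D2 i j a (ρ • x)) x
      = ofReal ρ ^ 2 * hessMag D2 (ρ • x) := fun x => by
    simp only [hessMag, enorm_mul, hen, mul_sum]
  have hf : ∀ x, srcMag (fun a x => ρ ^ 4 * f a (ρ • x)) x
      = ofReal ρ ^ 4 * srcMag f (ρ • x) := fun x => by
    simp only [srcMag, enorm_mul, hen, mul_sum]
  -- the energies and the mass of the right-hand side are scaling invariant
  have hinv : ∀ {G : R4 → ℝ≥0∞}, Measurable G →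
      ∫⁻ x, ofReal ρ ^ 4 * G (ρ • x) = ∫⁻ x, G x := fun {G} hG => by
    rw [lintegral_const_mul _ (show Measurable fun x => G (ρ • x) from
        hG.comp (measurable_smul_R4 ρ)), lintegral_comp_smul hρ hG, ← mul_assoc,
      ← ofReal_pow hρ.le, ← ofReal_mul (by positivity),
      mul_inv_cancel₀ (by positivity), ENNReal.ofReal_one, one_mul]
  have hd' : LocalData (annulus 1) κ m (fun i a x => ρ * D1 i a (ρ • x))
      (fun i j a x => ρ ^ 2 * D2 i j a (ρ • x)) (fun a x => ρ ^ 4 * f a (ρ • x)) := by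
    refine ⟨fun x hx => ?_, fun x hx => ?_, ?_, ?_, ?_, hd.energy_ne_top, hd.mass_ne_top⟩
    · rw [hg1, hd.grad_eq_zero _ (mt (smul_mem_annulus hρ x).1 hx), mul_zero]
    · rw [hh, hd.hess_eq_zero _ (mt (smul_mem_annulus hρ x).1 hx), mul_zero]
    · simp only [hg1, mul_pow]
      rw [hinv (h.measurable_gradMag.pow_const 4)]
      exact hd.lintegral_grad
    · simp only [hh, mul_pow, ← pow_mul]
      rw [hinv (h.measurable_hessMag.pow_const 2)]
      exact hd.lintegral_hess
    · simp only [hf]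
      rw [hinv h.measurable_srcMag]
      exact hd.lintegral_src
  have hback : ∀ {k : ℕ} {θ : ℝ} {K₁ K₂ : ℝ≥0∞} {G G' : R4 → ℝ≥0∞}, θ = 1 - k / 4 → 0 < θ →
      Measurable G → (∀ x, G' x = ofReal ρ ^ k * G (ρ • x)) →
      SetBound (θ + 1 / 6) θ K₁ K₂ ((shell 1).indicator G') →
      SetBound (θ + 1 / 6) θ (ofReal (ρ ^ (-(2 / 3) : ℝ)) * K₁) K₂ ((shell ρ).indicator G) := by
    intro k θ K₁ K₂ G G' hk hθ hG hGG' hb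
    refine SetBound.of_comp_smul hk hθ hρ (hG.indicator (measurableSet_shell ρ)) ?_
    convert hb using 1
    funext x
    by_cases hx : x ∈ shell 1
    · rw [indicator_of_mem hx, indicator_of_mem ((smul_mem_shell hρ x).2 hx), hGG',
        ofReal_pow hρ.le]
    · rw [indicator_of_notMem hx, indicator_of_notMem (mt (smul_mem_shell hρ x).1 hx), mul_zero]
  obtain ⟨b1, b2⟩ := key hs hd'
  have e1 : (5 / 12 : ℝ) = 1 / 4 + 1 / 6 := by norm_num
  have e2 : (11 / 12 : ℝ) = 3 / 4 + 1 / 6 := by norm_num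
  have e3 : (2 / 3 : ℝ) = 1 / 2 + 1 / 6 := by norm_num
  rw [e1] at b1 b2
  rw [e2] at b2
  refine ⟨hback (k := 3) (by norm_num) (by norm_num) h.measurable_thirdMag (hg 3 D3) b1,
    fun hκ => ?_⟩
  obtain ⟨c1, c2, c3⟩ := b2 hκ
  rw [e3] at c2
  exact ⟨hback (k := 1) (by norm_num) (by norm_num) h.measurable_gradMag
      (fun x => by rw [hg1, pow_one]) c1,
    hback (k := 2) (by norm_num) (by norm_num) h.measurable_hessMag hh c2,
    hback (k := 3) (by norm_num) (by norm_num) h.measurable_thirdMag (hg 3 D3) c3⟩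

/-- A geometric sum over the scales below and above the one of a set of volume `V`. -/
theorem exists_sum_scales_le {θ c : ℝ} (hθ : 1 / 6 ≤ θ) (hc : 0 < c) :
    ∃ C : ℝ≥0, ∀ {t : ℝ} (N : ℕ) {V : ℝ≥0∞}, 0 < t → V ≠ ⊤ →
      ∑ k ∈ Finset.range N, ofReal ((t * (3 / 2) ^ k) ^ (-(2 / 3) : ℝ))
        * (min V (ofReal (c * (t * (3 / 2) ^ k) ^ 4))) ^ (θ + 1 / 6) ≤ C * V ^ θ := by
  set q : ℝ := (3 / 2) ^ (2 / 3 : ℝ) with hq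
  have hq1 : 1 < q := Real.one_lt_rpow (by norm_num) (by norm_num)
  have hterm : ∀ {ρ v : ℝ}, 0 < ρ → 0 < v → ρ ^ (-(2 / 3) : ℝ) * (min v (c * ρ ^ 4)) ^ (θ + 1 / 6)
      ≤ (1 + c) ^ (θ + 1 / 6) * v ^ θ
        * min (ρ ^ (2 / 3 : ℝ) * v ^ (-(1 / 6) : ℝ)) (ρ ^ (2 / 3 : ℝ) * v ^ (-(1 / 6) : ℝ))⁻¹ := by
    intro ρ v hρ hv
    set p := ρ ^ (2 / 3 : ℝ) * v ^ (-(1 / 6) : ℝ) with hp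
    have hp0 : 0 < p := by positivity
    have h1c : 1 ≤ (1 + c) ^ (θ + 1 / 6) := Real.one_le_rpow (by linarith) (by linarith)
    rcases le_total 1 p with h | h
    · rw [min_eq_right ((inv_le_one_of_one_le₀ h).trans h)]
      calc _ ≤ ρ ^ (-(2 / 3) : ℝ) * v ^ (θ + 1 / 6) := by bound
        _ = 1 * v ^ θ * p⁻¹ := by
            rw [hp, mul_inv, ← Real.rpow_neg hρ.le, ← Real.rpow_neg hv.le, Real.rpow_add hv]
            ring_nf
        _ ≤ _ := by gcongr
    · rw [min_eq_left (h.trans (one_le_inv_iff₀.2 ⟨hp0, h⟩))]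
      calc _ ≤ ρ ^ (-(2 / 3) : ℝ) * (c * ρ ^ 4) ^ (θ + 1 / 6) := by bound
        _ = c ^ (θ + 1 / 6) * v ^ θ * p ^ (6 * θ) := by
            rw [hp, Real.mul_rpow hc.le (by positivity), Real.mul_rpow (by positivity) (by positivity),
              ← Real.rpow_mul hρ.le, ← Real.rpow_mul hv.le, ← Real.rpow_natCast ρ 4,
              ← Real.rpow_mul hρ.le]
            have e1 : v ^ θ * v ^ (-(1 / 6) * (6 * θ)) = 1 := by
              rw [← Real.rpow_add hv]; ring_nf; simp
            have e2 : ρ ^ (-(2 / 3) : ℝ) * ρ ^ (((4 : ℕ) : ℝ) * (θ + 1 / 6))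
                = ρ ^ (2 / 3 * (6 * θ)) := by
              rw [← Real.rpow_add hρ]; congr 1; push_cast; ring
            grind
        _ ≤ (1 + c) ^ (θ + 1 / 6) * v ^ θ * p := by
            have hcc : c ^ (θ + 1 / 6) ≤ (1 + c) ^ (θ + 1 / 6) :=
              Real.rpow_le_rpow hc.le (by linarith) (by linarith)
            refine mul_le_mul (mul_le_mul_of_nonneg_right hcc (by positivity)) ?_ (by positivity)
              (by positivity)
            · calc p ^ (6 * θ) ≤ p ^ (1 : ℝ) :=
                  Real.rpow_le_rpow_of_exponent_ge hp0 h (by linarith)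
                _ = p := Real.rpow_one p
  -- the sum telescopes after comparison with the increments of `p ↦ p / (1 + p)`
  have htel : ∀ {p : ℝ} (N : ℕ), 0 < p → ∑ k ∈ Finset.range N, min (p * q ^ k) (p * q ^ k)⁻¹
      ≤ 2 * (1 + q) / (q - 1) := by
    intro p N hp
    have h1 : ∀ y : ℝ, 0 < y → min y y⁻¹
        ≤ 2 * (1 + q) / (q - 1) * (q * y / (1 + q * y) - y / (1 + y)) := by
      intro y hy
      have e1 : q * y / (1 + q * y) - y / (1 + y) = (q - 1) * y / ((1 + y) * (1 + q * y)) := by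
        field_simp; ring
      rw [e1]
      have e2 : 2 * (1 + q) / (q - 1) * ((q - 1) * y / ((1 + y) * (1 + q * y)))
          = 2 * (1 + q) * y / ((1 + y) * (1 + q * y)) := by grind
      rw [e2, le_div_iff₀ (by positivity)]
      rcases le_total y 1 with h | h
      · refine (mul_le_mul_of_nonneg_right (min_le_left _ _) (by positivity)).trans ?_
        have : (1 + y) * (1 + q * y) ≤ 2 * (1 + q) := by bound
        nlinarith
      · refine (mul_le_mul_of_nonneg_right (min_le_right _ _) (by positivity)).trans ?_
        rw [inv_mul_le_iff₀ hy]
        have : (1 + y) * (1 + q * y) ≤ (2 * y) * ((1 + q) * y) := by bound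
        nlinarith
    calc _ ≤ ∑ k ∈ Finset.range N, 2 * (1 + q) / (q - 1) *
          (p * q ^ (k + 1) / (1 + p * q ^ (k + 1)) - p * q ^ k / (1 + p * q ^ k)) := by
          refine sum_le_sum fun k _ => (h1 _ (by positivity)).trans_eq ?_
          ring
      _ = 2 * (1 + q) / (q - 1) * (p * q ^ N / (1 + p * q ^ N) - p * q ^ 0 / (1 + p * q ^ 0)) := by
          rw [← mul_sum, Finset.sum_range_sub fun k => p * q ^ k / (1 + p * q ^ k)]
      _ ≤ 2 * (1 + q) / (q - 1) * 1 := by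
          have h0 : 0 < q - 1 := by linarith
          gcongr
          have a1 : p * q ^ N / (1 + p * q ^ N) ≤ 1 := by bound
          have a2 : 0 ≤ p * q ^ 0 / (1 + p * q ^ 0) := by positivity
          linarith
      _ = _ := mul_one _
  refine ⟨((1 + c) ^ (θ + 1 / 6) * (2 * (1 + q) / (q - 1))).toNNReal, fun {t} N {V} ht hV => ?_⟩
  rcases eq_or_ne V 0 with rfl | hV0
  · refine (sum_eq_zero fun k _ => ?_).trans_le zero_le
    rw [zero_min, zero_rpow_of_pos (by linarith), mul_zero]
  set v := V.toReal with hv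
  have hv0 : 0 < v := toReal_pos hV0 hV
  have hVv : V = ofReal v := (ofReal_toReal hV).symm
  have hsum : ∑ k ∈ Finset.range N, (t * (3 / 2) ^ k) ^ (-(2 / 3) : ℝ)
      * (min v (c * (t * (3 / 2) ^ k) ^ 4)) ^ (θ + 1 / 6)
      ≤ (1 + c) ^ (θ + 1 / 6) * v ^ θ * (2 * (1 + q) / (q - 1)) := by
    calc _ ≤ ∑ k ∈ Finset.range N, (1 + c) ^ (θ + 1 / 6) * v ^ θ
          * min (t ^ (2 / 3 : ℝ) * v ^ (-(1 / 6) : ℝ) * q ^ k)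
            (t ^ (2 / 3 : ℝ) * v ^ (-(1 / 6) : ℝ) * q ^ k)⁻¹ := by
          refine sum_le_sum fun k _ => (hterm (by positivity) hv0).trans_eq ?_
          have : (t * (3 / 2) ^ k) ^ (2 / 3 : ℝ) * v ^ (-(1 / 6) : ℝ)
              = t ^ (2 / 3 : ℝ) * v ^ (-(1 / 6) : ℝ) * q ^ k := by
            rw [Real.mul_rpow ht.le (by positivity), ← Real.rpow_natCast, ← Real.rpow_mul (by norm_num),
              hq, ← Real.rpow_natCast, ← Real.rpow_mul (by norm_num), mul_comm (k : ℝ)]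
            ring
          rw [this]
      _ ≤ _ := by
          rw [← mul_sum]; bound
  calc _ = ofReal (∑ k ∈ Finset.range N, (t * (3 / 2) ^ k) ^ (-(2 / 3) : ℝ)
      * (min v (c * (t * (3 / 2) ^ k) ^ 4)) ^ (θ + 1 / 6)) := by
        rw [ENNReal.ofReal_sum_of_nonneg fun k _ => by positivity]
        refine sum_congr rfl fun k _ => ?_
        rw [hVv, ← ENNReal.ofReal_min,
          ENNReal.ofReal_rpow_of_nonneg (by positivity) (by linarith),
          ← ofReal_mul (by positivity)]
    _ ≤ ofReal _ := ofReal_le_ofReal hsum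
    _ = _ := by
        rw [hVv, ofReal_rpow_of_pos hv0, ENNReal.ofNNReal_toNNReal,
          ← ofReal_mul (by
            have : 0 < q - 1 := by linarith
            positivity)]
        ring_nf

end Annuli

/-! ### Summation over dyadic shells -/

section Summation

/-- Bounds on shells of geometrically growing radii add up, because the terms of exponent
`θ + 1/6` decay geometrically away from the scale of the set of integration. -/
theorem exists_setBound_of_shells {θ : ℝ} (hθ : 1 / 6 ≤ θ) : ∃ C : ℝ≥0, ∀ {t δ : ℝ} {n : ℕ}
    {Z : R4 → ℝ≥0∞} {K₁ : ℝ≥0∞} {K₂ : ℕ → ℝ≥0∞}, Measurable Z → 0 < t → δ ≤ t * (3 / 2) ^ n →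
    (∀ k < n, SetBound (θ + 1 / 6) θ (ofReal ((t * (3 / 2) ^ k) ^ (-(2 / 3) : ℝ)) * K₁)
      (K₂ k) ((shell (t * (3 / 2) ^ k)).indicator Z)) →
    SetBound θ θ (C * K₁) (∑ k ∈ Finset.range n, K₂ k) ((B δ \ B t).indicator Z) := by
  have hb : 0 < 16 * (ballVol : ℝ) := by have := ballVol_pos; positivity
  obtain ⟨C, hC⟩ := exists_sum_scales_le hθ hb
  refine ⟨C, fun {t δ n Z K₁ K₂} hZ ht hδ h E hE hf => ?_⟩
  have hcov : ∀ x, (B δ \ B t).indicator Z x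
      ≤ ∑ k ∈ Finset.range n, (shell (t * (3 / 2) ^ k)).indicator Z x := by
    intro x
    by_cases hx : x ∈ B δ \ B t
    · rw [indicator_of_mem hx]
      rw [Set.mem_sdiff, mem_ball_zero_iff, mem_ball_zero_iff, not_lt] at hx
      obtain ⟨k, h1, h2⟩ := exists_nat_pow_near ((one_le_div ht).2 hx.2)
        (show (1 : ℝ) < 3 / 2 by norm_num)
      rw [le_div_iff₀ ht] at h1
      rw [div_lt_iff₀ ht, pow_succ] at h2
      have hk : k < n := (pow_lt_pow_iff_right₀ (show (1 : ℝ) < 3 / 2 by norm_num)).1 <|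
        lt_of_mul_lt_mul_left (by nlinarith) ht.le
      have hxs : x ∈ shell (t * (3 / 2) ^ k) := mem_shell.2 ⟨by linarith, by linarith⟩
      exact (indicator_of_mem hxs Z).ge.trans (single_le_sum
        (f := fun k => (shell (t * (3 / 2) ^ k)).indicator Z x) (fun _ _ => zero_le)
        (Finset.mem_range.2 hk))
    · simp [*]
  have hpiece : ∀ k ∈ Finset.range n, ∫⁻ x in E, (shell (t * (3 / 2) ^ k)).indicator Z x
      ≤ K₁ * (ofReal ((t * (3 / 2) ^ k) ^ (-(2 / 3) : ℝ)) * (min (volume E)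
        (ofReal (16 * ballVol * (t * (3 / 2) ^ k) ^ 4))) ^ (θ + 1 / 6))
        + K₂ k * volume E ^ θ := by
    intro k hk
    have hSm := measurableSet_shell (t * (3 / 2) ^ k)
    have hv : volume (E ∩ shell (t * (3 / 2) ^ k)) ≤ volume E := measure_mono inter_subset_left
    have := h k (Finset.mem_range.1 hk) _ (hE.inter hSm) (ne_top_of_le_ne_top hf hv)
    rw [setLIntegral_indicator hSm, ← inter_assoc, inter_comm _ E, inter_assoc, inter_self,
      inter_comm E] at this
    rw [setLIntegral_indicator hSm]
    refine this.trans ?_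
    rw [inter_comm, mul_comm _ K₁, mul_assoc]; gcongr
    exact le_min hv ((measure_mono inter_subset_right).trans (volume_shell_le (by positivity)))
  calc ∫⁻ x in E, (B δ \ B t).indicator Z x
      ≤ ∫⁻ x in E, ∑ k ∈ Finset.range n, (shell (t * (3 / 2) ^ k)).indicator Z x :=
        lintegral_mono hcov
    _ = ∑ k ∈ Finset.range n, ∫⁻ x in E, (shell (t * (3 / 2) ^ k)).indicator Z x :=
        lintegral_finsetSum _ fun k _ => hZ.indicator (measurableSet_shell _)
    _ ≤ _ := sum_le_sum hpiece
    _ ≤ _ := by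
        rw [sum_add_distrib, ← mul_sum, ← sum_mul, mul_comm (C : ℝ≥0∞),
          mul_assoc K₁]
        bound

/-- A point lies in at most four of the annuli. -/
theorem sum_setLIntegral_annulus_le {g : R4 → ℝ≥0∞} (hg : Measurable g) {t : ℝ} (ht : 0 < t)
    (n : ℕ) : ∑ k ∈ Finset.range n, ∫⁻ x in annulus (t * (3 / 2) ^ k), g x ≤ 4 * ∫⁻ x, g x := by
  classical
  rw [← lintegral_const_mul _ hg]
  simp_rw [← lintegral_indicator (isOpen_annulus _).measurableSet]
  rw [← lintegral_finsetSum _ fun k _ => hg.indicator (isOpen_annulus _).measurableSet]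
  refine lintegral_mono fun x => ?_
  simp only [indicator_apply]
  rw [← Finset.sum_filter, sum_const, nsmul_eq_mul]
  refine mul_le_mul_left ?_ _
  set s := (Finset.range n).filter fun k => x ∈ annulus (t * (3 / 2) ^ k)
  rcases s.eq_empty_or_nonempty with hs | hs
  · simp [hs]
  obtain ⟨m, hm, hmin⟩ := s.exists_min_image id hs
  have hsub : s ⊆ Finset.Ico m (m + 4) := fun k hk => by
    rw [Finset.mem_Ico]
    refine ⟨hmin k hk, ?_⟩
    by_contra! h
    have h1 := (mem_annulus.1 (Finset.mem_filter.1 hk).2).1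
    have h2 := (mem_annulus.1 (Finset.mem_filter.1 hm).2).2
    have h3 : (3 / 2 : ℝ) ^ (m + 4) ≤ (3 / 2) ^ k := pow_le_pow_right₀ (by norm_num) h
    rw [pow_add] at h3
    have h4 := mul_le_mul_of_nonneg_left h3 ht.le
    have h5 : 0 < t * (3 / 2) ^ m := by positivity
    nlinarith
  have := Finset.card_le_card hsub
  simp_all

end Summation

/-! ### Estimates on the whole neck -/

section Neck

variable {ι : Type*} [Fintype ι]

theorem gradMag_indicator (S : Set R4) (D : Fin 4 → ι → R4 → ℝ) :
    gradMag (fun i a => S.indicator (D i a)) = S.indicator (gradMag D) := by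
  funext x
  by_cases hx : x ∈ S <;> simp [gradMag, hx]

theorem hessMag_indicator (S : Set R4) (D : Fin 4 → Fin 4 → ι → R4 → ℝ) :
    hessMag (fun i j a => S.indicator (D i j a)) = S.indicator (hessMag D) := by
  funext x
  by_cases hx : x ∈ S <;> simp [hessMag, hx]

theorem srcMag_indicator (S : Set R4) (f : ι → R4 → ℝ) :
    srcMag (fun a => S.indicator (f a)) = S.indicator (srcMag f) := by
  funext x
  by_cases hx : x ∈ S <;> simp [srcMag, hx]

theorem LocalData.of_indicator {S : Set R4} (hS : MeasurableSet S) {D1 : Fin 4 → ι → R4 → ℝ}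
    {D2 : Fin 4 → Fin 4 → ι → R4 → ℝ} {f : ι → R4 → ℝ} {κ : ℝ≥0∞}
    (h4 : ∫⁻ x in S, gradMag D1 x ^ 4 + hessMag D2 x ^ 2 ≤ κ ^ 4)
    (h2 : ∫⁻ x in S, gradMag D1 x ^ 4 + hessMag D2 x ^ 2 ≤ κ ^ 2) (hκ : κ ≠ ⊤)
    (hf : ∫⁻ x in S, srcMag f x ≠ ⊤) :
    LocalData S κ (∫⁻ x in S, srcMag f x) (fun i a => S.indicator (D1 i a))
      (fun i j a => S.indicator (D2 i j a)) (fun a => S.indicator (f a)) := by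
  have hpow : ∀ (Z : R4 → ℝ≥0∞) {m : ℕ}, m ≠ 0 →
      ∫⁻ x, S.indicator Z x ^ m = ∫⁻ x in S, Z x ^ m := fun Z m hm => by
    rw [← lintegral_indicator hS]
    congr 1
    funext x
    by_cases hx : x ∈ S <;> simp [hx, hm]
  refine ⟨fun x hx => ?_, fun x hx => ?_, ?_, ?_, ?_, hκ, hf⟩
  · rw [gradMag_indicator, indicator_of_notMem hx]
  · rw [hessMag_indicator, indicator_of_notMem hx]
  · rw [gradMag_indicator, hpow _ four_ne_zero]
    exact (lintegral_mono fun x => le_self_add).trans h4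
  · rw [hessMag_indicator, hpow _ two_ne_zero]
    exact (lintegral_mono fun x => le_add_self).trans h2
  · rw [srcMag_indicator, lintegral_indicator hS]

/-- Estimates on the neck `B_δ \ B_t`. The bound on the third derivatives holds whatever the energy:
where the energy of an annulus exceeds the threshold `e₀`, the quadratic error of the estimate is at
most a multiple of that energy, and the energies of the annuli have a bounded sum. -/
theorem exists_neck_setBound (ι : Type*) [Fintype ι] : ∃ e₀ C : ℝ≥0, 0 < e₀ ∧
    ∀ {t δ : ℝ} {n : ℕ} {u : ι → R4 → ℝ} {D1 D2 D3 f} {E M : ℝ≥0∞},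
      0 < t → δ ≤ t * (3 / 2) ^ n →
      (∀ ρ, (∃ k < n, ρ = t * (3 / 2) ^ k) → SphereMap (annulus ρ)
        (fun a => (annulus ρ).indicator (u a)) (fun i a => (annulus ρ).indicator (D1 i a))
        (fun i j a => (annulus ρ).indicator (D2 i j a)) (fun i a => (annulus ρ).indicator (D3 i a))
        fun a => (annulus ρ).indicator (f a)) →
      Measurable (gradMag D1) → Measurable (hessMag D2) → Measurable (gradMag D3) →
      Measurable (srcMag f) → E ≠ ⊤ → M ≠ ⊤ →
      ∫⁻ x, gradMag D1 x ^ 4 + hessMag D2 x ^ 2 ≤ E → ∫⁻ x, srcMag f x ≤ M →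
      SetBound (1 / 4) (1 / 4) (C * (1 + E) ^ 2) (C * ((1 + E) ^ 2 * E + M))
        ((B δ \ B t).indicator (gradMag D3)) ∧
      ∀ η ≤ (e₀ : ℝ≥0∞), (∀ k < n, ∫⁻ x in annulus (t * (3 / 2) ^ k),
          gradMag D1 x ^ 4 + hessMag D2 x ^ 2 ≤ η) →
        SetBound (3 / 4) (3 / 4) (C * η ^ (1 / 4 : ℝ)) (C * M)
          ((B δ \ B t).indicator (gradMag D1)) ∧
        SetBound (1 / 2) (1 / 2) (C * η ^ (1 / 4 : ℝ)) (C * M)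
          ((B δ \ B t).indicator (hessMag D2)) ∧
        SetBound (1 / 4) (1 / 4) (C * η ^ (1 / 4 : ℝ)) (C * M)
          ((B δ \ B t).indicator (gradMag D3)) := by
  obtain ⟨κ₀, c, h0, h1, key⟩ := exists_shell_setBound ι
  obtain ⟨A₁, hA₁⟩ := exists_setBound_of_shells (θ := 3 / 4) (by norm_num)
  obtain ⟨A₂, hA₂⟩ := exists_setBound_of_shells (θ := 1 / 2) (by norm_num)
  obtain ⟨A₃, hA₃⟩ := exists_setBound_of_shells (θ := 1 / 4) (by norm_num)
  set A := A₁ + A₂ + A₃ with hA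
  have l1 : (A₁ : ℝ≥0∞) ≤ A := by exact_mod_cast (le_self_add.trans le_self_add : A₁ ≤ A)
  have l2 : (A₂ : ℝ≥0∞) ≤ A := by exact_mod_cast (le_add_self.trans le_self_add : A₂ ≤ A)
  have l3 : (A₃ : ℝ≥0∞) ≤ A := by simp [*]
  set e₀ : ℝ≥0 := κ₀ ^ 4 with he₀
  have he₀0 : 0 < e₀ := by positivity
  refine ⟨e₀, 2 * A * c + 4 * c + 4 * c * e₀⁻¹, he₀0,
    fun {t δ n u D1 D2 D3 f E M} ht hδ hs m1 m2 m3 m4 hE hM hen hsrc => ?_⟩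
  have hg : Measurable fun x => gradMag D1 x ^ 4 + hessMag D2 x ^ 2 :=
    (m1.pow_const 4).add (m2.pow_const 2)
  have hmass : ∀ k, ∫⁻ x in annulus (t * (3 / 2) ^ k), srcMag f x ≠ ⊤ := fun k =>
    ne_top_of_le_ne_top hM ((setLIntegral_le_lintegral _ _).trans hsrc)
  have hsumM : ∑ k ∈ Finset.range n, ∫⁻ x in annulus (t * (3 / 2) ^ k), srcMag f x ≤ 4 * M :=
    (sum_setLIntegral_annulus_le m4 ht n).trans (mul_le_mul_right hsrc 4)
  have hres : ∀ {ρ : ℝ} {Z : R4 → ℝ≥0∞}, 0 < ρ →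
      (shell ρ).indicator ((annulus ρ).indicator Z) = (shell ρ).indicator Z := by
    intro ρ Z hρ
    rw [indicator_indicator, inter_eq_self_of_subset_left]
    intro x hx
    rw [mem_shell] at hx
    exact mem_annulus.2 ⟨by linarith, by linarith⟩
  -- the energy enters through a bound for the norms of the derivatives
  have hsmall : ∀ {η : ℝ≥0∞}, η ≤ e₀ → η ^ (1 / 4 : ℝ) ≤ κ₀ ∧ (η ^ (1 / 4 : ℝ)) ^ 4 = η ∧
      η ≤ (η ^ (1 / 4 : ℝ)) ^ 2 := by
    intro η hη
    have hη1 : η ≤ 1 := hη.trans (by rw [he₀]; exact_mod_cast pow_le_one₀ κ₀.2 h1)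
    refine ⟨?_, ?_, ?_⟩
    · calc η ^ (1 / 4 : ℝ) ≤ ((κ₀ : ℝ≥0∞) ^ 4) ^ (1 / 4 : ℝ) := by
            gcongr; rw [he₀] at hη; exact_mod_cast hη
        _ = κ₀ := by rw [← rpow_natCast, ← rpow_mul]; norm_num
    · rw [← rpow_natCast, ← rpow_mul]; norm_num
    · rw [← rpow_natCast, ← rpow_mul]
      conv_lhs => rw [← rpow_one η]
      exact ENNReal.rpow_le_rpow_of_exponent_ge hη1 (by norm_num)
  have hC : ∀ {a : ℝ≥0∞}, (2 * A * c : ℝ≥0∞) * a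
      ≤ (2 * A * c + 4 * c + 4 * c * e₀⁻¹ : ℝ≥0) * a := fun {a} => by
    gcongr
    push_cast
    rw [add_assoc]; simp
  have hC' : ∀ {b : ℝ≥0∞}, b ≤ 4 * M → c * b
      ≤ (2 * A * c + 4 * c + 4 * c * e₀⁻¹ : ℝ≥0) * M := fun {b} hb => by
    calc (c : ℝ≥0∞) * b ≤ c * (4 * M) := by gcongr
      _ = ((4 * c : ℝ≥0) : ℝ≥0∞) * M := by push_cast; ring
      _ ≤ _ := by
          gcongr
          rw [add_right_comm]; simp
  refine ⟨?_, fun η hη hη' => ?_⟩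
  · have hE1 : (1 : ℝ≥0∞) ≤ 1 + E := le_self_add
    have hloc : ∀ k < n, SetBound (1 / 4 + 1 / 6) (1 / 4)
        (ofReal ((t * (3 / 2) ^ k) ^ (-(2 / 3) : ℝ)) * (2 * c * (1 + E) ^ 2))
        (c * (∫⁻ x in annulus (t * (3 / 2) ^ k), srcMag f x) + c * (1 + E) ^ 2 * (e₀ : ℝ≥0∞)⁻¹
          * ∫⁻ x in annulus (t * (3 / 2) ^ k), gradMag D1 x ^ 4 + hessMag D2 x ^ 2)
        ((shell (t * (3 / 2) ^ k)).indicator (gradMag D3)) := by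
      intro k hk
      have hρ : 0 < t * (3 / 2) ^ k := by positivity
      rcases le_or_gt (∫⁻ x in annulus (t * (3 / 2) ^ k), gradMag D1 x ^ 4 + hessMag D2 x ^ 2) e₀
        with hle | hlt
      · obtain ⟨a1, a2, a3⟩ := hsmall (le_refl (e₀ : ℝ≥0∞))
        have hd := LocalData.of_indicator (isOpen_annulus _).measurableSet (hle.trans_eq a2.symm)
          (hle.trans a3) (ne_top_of_le_ne_top coe_ne_top a1) (hmass k)
        have b := ((key hρ (hs _ ⟨k, hk, rfl⟩) hd).2 a1).2.2
        rw [gradMag_indicator, hres hρ] at b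
        refine b.mono (mul_le_mul_right ?_ _) le_self_add
        calc (c : ℝ≥0∞) * (e₀ : ℝ≥0∞) ^ (1 / 4 : ℝ) ≤ c * 1 := by
              gcongr; exact a1.trans (by exact_mod_cast h1)
          _ ≤ 2 * c * (1 + E) ^ 2 := by
              refine mul_le_mul' ?_ (one_le_pow₀ hE1)
              rw [two_mul]; exact le_self_add
      · have hk4 : ∫⁻ x in annulus (t * (3 / 2) ^ k), gradMag D1 x ^ 4 + hessMag D2 x ^ 2 ≤ 1 + E :=
          ((setLIntegral_le_lintegral _ _).trans hen).trans le_add_self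
        have hd := LocalData.of_indicator (isOpen_annulus _).measurableSet
          (hk4.trans (le_self_pow₀ hE1 four_ne_zero)) (hk4.trans (le_self_pow₀ hE1 two_ne_zero))
          (by simpa using hE) (hmass k)
        have b := (key hρ (hs _ ⟨k, hk, rfl⟩) hd).1
        rw [gradMag_indicator, hres hρ] at b
        refine b.mono (mul_le_mul_right ?_ _) ?_
        · calc (c : ℝ≥0∞) * (1 + E + (1 + E) * (1 + E))
              ≤ c * ((1 + E) ^ 2 + (1 + E) * (1 + E)) := by bound
            _ = _ := by ring
        · have hq : 1 ≤ (e₀ : ℝ≥0∞)⁻¹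
              * ∫⁻ x in annulus (t * (3 / 2) ^ k), gradMag D1 x ^ 4 + hessMag D2 x ^ 2 := by
            rw [mul_comm, ← div_eq_mul_inv,
              ENNReal.le_div_iff_mul_le (by simp [he₀0.ne']) (by simp), one_mul]
            bound
          rw [mul_add, add_comm, ← sq, mul_assoc _ (e₀ : ℝ≥0∞)⁻¹]; bound
    refine (hA₃ m3 ht hδ hloc).mono ?_ ?_
    · calc (A₃ : ℝ≥0∞) * (2 * c * (1 + E) ^ 2) ≤ A * (2 * c * (1 + E) ^ 2) := by gcongr
        _ = 2 * A * c * (1 + E) ^ 2 := by ring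
        _ ≤ _ := hC
    · rw [sum_add_distrib, ← mul_sum, ← mul_sum, add_comm, mul_add]
      refine add_le_add ?_ (hC' hsumM)
      calc _ ≤ c * (1 + E) ^ 2 * (e₀ : ℝ≥0∞)⁻¹ * (4 * E) := by
            gcongr
            exact (sum_setLIntegral_annulus_le hg ht n).trans (mul_le_mul_right hen 4)
        _ = ((4 * c * e₀⁻¹ : ℝ≥0) : ℝ≥0∞) * ((1 + E) ^ 2 * E) := by
            push_cast [ENNReal.coe_inv he₀0.ne']; ring
        _ ≤ _ := by bound
  · obtain ⟨a1, a2, a3⟩ := hsmall hη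
    have b := fun k (hk : k < n) => (key (show 0 < t * (3 / 2) ^ k by positivity)
      (hs _ ⟨k, hk, rfl⟩) (LocalData.of_indicator (isOpen_annulus _).measurableSet
        ((hη' k hk).trans_eq a2.symm) ((hη' k hk).trans a3)
        (ne_top_of_le_ne_top coe_ne_top a1) (hmass k))).2 a1
    have hfin : ∀ {A' : ℝ≥0}, (A' : ℝ≥0∞) ≤ A → (A' : ℝ≥0∞) * (c * η ^ (1 / 4 : ℝ))
        ≤ (2 * A * c + 4 * c + 4 * c * e₀⁻¹ : ℝ≥0) * η ^ (1 / 4 : ℝ) := fun {A'} hA' => by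
      calc (A' : ℝ≥0∞) * (c * η ^ (1 / 4 : ℝ)) ≤ (2 * A) * (c * η ^ (1 / 4 : ℝ)) := by
            gcongr
            rw [two_mul]
            exact hA'.trans le_self_add
        _ = 2 * A * c * η ^ (1 / 4 : ℝ) := by ring
        _ ≤ _ := hC
    have hsum := hC' hsumM
    rw [mul_sum] at hsum
    refine ⟨(hA₁ m1 ht hδ fun k hk => ?_).mono (hfin l1) hsum,
      (hA₂ m2 ht hδ fun k hk => ?_).mono (hfin l2) hsum,
      (hA₃ m3 ht hδ fun k hk => ?_).mono (hfin l3) hsum⟩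
    · have := (b k hk).1
      rwa [gradMag_indicator, hres (by positivity)] at this
    · have := (b k hk).2.1
      rwa [hessMag_indicator, hres (by positivity)] at this
    · have := (b k hk).2.2
      rwa [gradMag_indicator, hres (by positivity)] at this

end Neck

section Neck

/-- The two regimes of `exists_neck_setBound` combined: above the threshold for the energy of the
annuli, a constant is a multiple of `η ^ (1/8)`. -/
theorem exists_neck_setBound_of_energy_le (ι : Type*) [Fintype ι] (E : ℝ≥0) : ∃ C : ℝ≥0,
    ∀ {t δ : ℝ} {n : ℕ} {u : ι → R4 → ℝ} {D1 D2 D3 f} {η M : ℝ≥0∞},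
      0 < t → δ ≤ 1 → δ ≤ t * (3 / 2) ^ n →
      (∀ ρ, (∃ k < n, ρ = t * (3 / 2) ^ k) → SphereMap (annulus ρ)
        (fun a => (annulus ρ).indicator (u a)) (fun i a => (annulus ρ).indicator (D1 i a))
        (fun i j a => (annulus ρ).indicator (D2 i j a)) (fun i a => (annulus ρ).indicator (D3 i a))
        fun a => (annulus ρ).indicator (f a)) →
      Measurable (gradMag D1) → Measurable (hessMag D2) → Measurable (gradMag D3) →
      Measurable (srcMag f) → M ≠ ⊤ →
      ∫⁻ x, gradMag D1 x ^ 4 + hessMag D2 x ^ 2 ≤ E → ∫⁻ x, srcMag f x ≤ M →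
      (∀ k < n, ∫⁻ x in annulus (t * (3 / 2) ^ k), gradMag D1 x ^ 4 + hessMag D2 x ^ 2 ≤ η) →
        SetBound (3 / 4) (3 / 4) (C * η ^ (1 / 8 : ℝ)) (C * M)
          ((B δ \ B t).indicator (gradMag D1)) ∧
        SetBound (1 / 2) (1 / 2) (C * η ^ (1 / 8 : ℝ)) (C * M)
          ((B δ \ B t).indicator (hessMag D2)) ∧
        SetBound (1 / 4) (1 / 4) (C * η ^ (1 / 8 : ℝ)) (C * M)
          ((B δ \ B t).indicator (gradMag D3)) := by
  obtain ⟨e₀, c, he₀, key⟩ := exists_neck_setBound ι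
  set β : ℝ≥0 := e₀ ^ (1 / 8 : ℝ) with hβ
  have hβ0 : 0 < β := NNReal.rpow_pos he₀
  set V : ℝ≥0 := (volume (B 1)).toNNReal with hV
  have hVv : volume (B 1) = V := (coe_toNNReal measure_ball_lt_top.ne).symm
  refine ⟨c * β + c + (c * (1 + E) ^ 2 + c * ((1 + E) ^ 2 * E) + (1 + V) * (1 + E)) * β⁻¹,
    fun {t δ n u D1 D2 D3 f η M} ht hδ1 hδ hs m1 m2 m3 m4 hM hen hsrc hη => ?_⟩
  set Q : ℝ≥0 := c * (1 + E) ^ 2 + c * ((1 + E) ^ 2 * E) + (1 + V) * (1 + E) with hQ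
  obtain ⟨k1, k2⟩ := key ht hδ hs m1 m2 m3 m4 coe_ne_top hM hen hsrc
  have hCM : (c : ℝ≥0∞) * M ≤ (c * β + c + Q * β⁻¹ : ℝ≥0) * M := by
    gcongr
    rw [add_right_comm]; simp
  rcases le_or_gt η e₀ with hle | hlt
  · have h1 : (c : ℝ≥0∞) * η ^ (1 / 4 : ℝ) ≤ (c * β + c + Q * β⁻¹ : ℝ≥0) * η ^ (1 / 8 : ℝ) := by
      calc (c : ℝ≥0∞) * η ^ (1 / 4 : ℝ) = c * (η ^ (1 / 8 : ℝ) * η ^ (1 / 8 : ℝ)) := by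
            rw [← rpow_add_of_nonneg _ _ (by norm_num) (by norm_num)]; norm_num
        _ ≤ c * ((e₀ : ℝ≥0∞) ^ (1 / 8 : ℝ) * η ^ (1 / 8 : ℝ)) := by gcongr
        _ = ((c * β : ℝ≥0) : ℝ≥0∞) * η ^ (1 / 8 : ℝ) := by
            rw [hβ, coe_mul, coe_rpow_of_nonneg _ (by norm_num), mul_assoc]
        _ ≤ _ := by
            gcongr
            rw [add_assoc]; simp
    obtain ⟨a1, a2, a3⟩ := k2 η hle hη
    exact ⟨a1.mono h1 hCM, a2.mono h1 hCM, a3.mono h1 hCM⟩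
  · have hQη : (Q : ℝ≥0∞) ≤ (c * β + c + Q * β⁻¹ : ℝ≥0) * η ^ (1 / 8 : ℝ) := by
      calc (Q : ℝ≥0∞) = ((Q * β⁻¹ * β : ℝ≥0) : ℝ≥0∞) := by field_simp
        _ = ((Q * β⁻¹ : ℝ≥0) : ℝ≥0∞) * (e₀ : ℝ≥0∞) ^ (1 / 8 : ℝ) := by
            rw [hβ, coe_mul _ (e₀ ^ (1 / 8 : ℝ)), coe_rpow_of_nonneg _ (by norm_num)]
        _ ≤ _ := by
            gcongr
            simp
    have hN : MeasurableSet (B δ \ B t) := measurableSet_ball.diff measurableSet_ball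
    have hNv : volume (B δ \ B t) ≤ V := hVv ▸ measure_mono
      (sdiff_subset.trans (ball_subset_ball hδ1))
    have hE1 : (1 : ℝ≥0∞) ≤ 1 + E := le_self_add
    have hglob : ∀ {p : ℕ} {Z : R4 → ℝ≥0∞}, 1 < p → Measurable Z → ∫⁻ x, Z x ^ p ≤ E →
        SetBound (1 - 1 / (p : ℝ)) (1 - 1 / (p : ℝ)) ((c * β + c + Q * β⁻¹ : ℝ≥0) * η ^ (1 / 8 : ℝ))
          ((c * β + c + Q * β⁻¹ : ℝ≥0) * M) ((B δ \ B t).indicator Z) := by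
      intro p Z hp hZ hZE
      have hp1 : (1 : ℝ) < p := by exact_mod_cast hp
      refine (SetBound.of_lintegral_rpow hN hp1 ?_ le_rfl (hZ.indicator hN)
        (fun x hx => indicator_of_notMem hx Z) (κ := 1 + E) ?_).mono ?_ zero_le
      · rw [sub_nonneg, div_le_one (by linarith)]; exact hp1.le
      · simp_rw [rpow_natCast]
        calc _ ≤ ∫⁻ x, Z x ^ p := lintegral_mono fun x => by
              gcongr; exact indicator_le_self _ _ x
          _ ≤ _ := hZE.trans (le_add_self.trans (le_self_pow₀ hE1 (by omega)))
      · calc (1 + volume (B δ \ B t)) * (1 + E) ≤ ((1 + V : ℝ≥0) : ℝ≥0∞) * ((1 + E : ℝ≥0) : ℝ≥0∞) := by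
              push_cast; gcongr
          _ ≤ Q := by rw [hQ]; exact_mod_cast le_add_self
          _ ≤ _ := hQη
    have g1 := hglob (p := 4) (by norm_num) m1 ((lintegral_mono fun x => le_self_add).trans hen)
    have g2 := hglob (p := 2) (by norm_num) m2 ((lintegral_mono fun x => le_add_self).trans hen)
    have e1 : (1 - 1 / ((4 : ℕ) : ℝ)) = 3 / 4 := by norm_num
    have e2 : (1 - 1 / ((2 : ℕ) : ℝ)) = 1 / 2 := by norm_num
    rw [e1] at g1
    rw [e2] at g2
    refine ⟨g1, g2, fun F hF hf => (k1 F hF hf).trans ?_⟩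
    rw [← add_mul, ← add_mul, mul_add (c : ℝ≥0∞), ← add_assoc]; gcongr
    calc (c : ℝ≥0∞) * (1 + E) ^ 2 + c * ((1 + E) ^ 2 * E)
        = ((c * (1 + E) ^ 2 + c * ((1 + E) ^ 2 * E) : ℝ≥0) : ℝ≥0∞) := by push_cast; rfl
      _ ≤ Q := by rw [hQ]; exact_mod_cast le_self_add
      _ ≤ _ := hQη

end Neck

/-! ### Euclidean lengths and sums of components -/

section Lengths

variable {n : ℕ} {κ : Type*} [Fintype κ]

theorem sqrt_sum_norm_sq_le (y : κ → Amb n) :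
    ‖Real.sqrt (∑ i, ‖y i‖ ^ 2)‖ₑ ≤ ∑ i, ∑ a, ‖y i a‖ₑ := by
  have h1 : ∀ i, ‖y i‖ₑ ≤ ∑ a, ‖y i a‖ₑ := fun i => by
    conv_lhs => rw [← (EuclideanSpace.basisFun (Fin (n + 1)) ℝ).sum_repr (y i)]
    refine (enorm_sum_le _ _).trans (sum_le_sum fun a _ => ?_)
    rw [enorm_smul, ← ofReal_norm (EuclideanSpace.basisFun (Fin (n + 1)) ℝ a),
      OrthonormalBasis.norm_eq_one]
    simp
  calc ‖Real.sqrt (∑ i, ‖y i‖ ^ 2)‖ₑ ≤ ofReal (∑ i, ‖y i‖) := by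
        rw [enorm_of_nonneg (sqrt_nonneg _)]
        refine ofReal_le_ofReal (Real.sqrt_le_iff.2 ⟨by positivity, ?_⟩)
        exact Finset.sum_sq_le_sq_sum_of_nonneg fun i _ => norm_nonneg _
    _ = ∑ i, ‖y i‖ₑ := by
        rw [ENNReal.ofReal_sum_of_nonneg fun i _ => norm_nonneg _]; simp
    _ ≤ _ := sum_le_sum fun i _ => h1 i

theorem enorm_apply_le_sqrt_sum (y : κ → Amb n) (i : κ) (a : Fin (n + 1)) :
    ‖y i a‖ₑ ≤ ‖Real.sqrt (∑ i, ‖y i‖ ^ 2)‖ₑ := by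
  rw [enorm_of_nonneg (sqrt_nonneg _), Real.enorm_eq_ofReal_abs]
  refine ofReal_le_ofReal ((PiLp.norm_apply_le (y i) a).trans (Real.le_sqrt_of_sq_le ?_))
  exact single_le_sum (f := fun i => ‖y i‖ ^ 2) (fun i _ => by positivity) (Finset.mem_univ i)

theorem sum_enorm_le_sqrt_sum (y : κ → Amb n) : ∑ i, ∑ a, ‖y i a‖ₑ
    ≤ (Fintype.card κ * (n + 1) : ℕ) * ‖Real.sqrt (∑ i, ‖y i‖ ^ 2)‖ₑ := by
  refine (sum_le_sum fun i _ => sum_le_sum fun a _ =>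
    enorm_apply_le_sqrt_sum y i a).trans_eq ?_
  simp [mul_assoc]

variable {Du : Fin 4 → R4 → Amb n} {D1 : Fin 4 → Fin (n + 1) → R4 → ℝ}
  {D2u : Fin 4 → Fin 4 → R4 → Amb n} {D2 : Fin 4 → Fin 4 → Fin (n + 1) → R4 → ℝ} {x : R4}

theorem gradMag_comparison (h : ∀ i a, D1 i a x = Du i x a) :
    ‖gradNorm Du x‖ₑ ≤ gradMag D1 x ∧
      gradMag D1 x ≤ (16 * (n + 1) : ℕ) * ‖gradNorm Du x‖ₑ := by
  simp only [gradNorm, gradMag, h]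
  refine ⟨sqrt_sum_norm_sq_le _, (sum_enorm_le_sqrt_sum _).trans ?_⟩
  gcongr
  simp

theorem hessMag_comparison (h : ∀ i j a, D2 i j a x = D2u i j x a) :
    ‖hessNorm D2u x‖ₑ ≤ hessMag D2 x ∧
      hessMag D2 x ≤ (16 * (n + 1) : ℕ) * ‖hessNorm D2u x‖ₑ := by
  have h1 := sqrt_sum_norm_sq_le fun p : Fin 4 × Fin 4 => D2u p.1 p.2 x
  have h2 := sum_enorm_le_sqrt_sum fun p : Fin 4 × Fin 4 => D2u p.1 p.2 x
  simp only [Fintype.sum_prod_type] at h1 h2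
  simp only [hessNorm, hessMag, h]; bound

end Lengths

/-! ### Energies in terms of Euclidean lengths -/

section Energies

theorem IsCompRep.indicator {n : ℕ} {Ω : Set R4} {v : R4 → Amb n} {v' : Fin (n + 1) → R4 → ℝ}
    (h : IsCompRep Ω v v') (hΩ : MeasurableSet Ω) : IsCompRep Ω v fun a => Ω.indicator (v' a) :=
  ⟨fun a => (h.measurable a).indicator hΩ, h.ae_eq.mono fun x hx hxΩ a => by simp [*]⟩

theorem exists_pow_scales {t δ : ℝ} (ht : 0 < t) :
    ∃ n : ℕ, δ ≤ t * (3 / 2) ^ n ∧ ∀ k < n, t * (3 / 2) ^ k ≤ δ := by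
  have h : ∃ n : ℕ, δ ≤ t * (3 / 2) ^ n := by
    obtain ⟨n, hn⟩ := pow_unbounded_of_one_lt (δ / t) (show (1 : ℝ) < 3 / 2 by norm_num)
    exact ⟨n, ((div_lt_iff₀' ht).1 hn).le⟩
  classical
  exact ⟨Nat.find h, Nat.find_spec h, fun k hk => (not_le.1 (Nat.find_min h hk)).le⟩

theorem annulus_subset {t δ ρ : ℝ} (htρ : t ≤ ρ) (hρδ : ρ ≤ δ) :
    annulus ρ ⊆ B (2 * δ) \ closedBall 0 (t / 2) := fun x hx => by
  rw [mem_annulus] at hx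
  simp only [Set.mem_sdiff, mem_ball_zero_iff, mem_closedBall_zero_iff, not_le]; bound

/-- An annulus is covered by two dyadic shells. -/
theorem setLIntegral_annulus_le {F : R4 → ℝ≥0∞} {t δ ρ : ℝ} {b : ℝ≥0∞}
    (h : ∀ ρ : ℝ, 0 < ρ → B (2 * ρ) \ B ρ ⊆ B (2 * δ) \ B (t / 2) →
      ∫⁻ x in B (2 * ρ) \ B ρ, F x < b) (ht : 0 < t) (htρ : t ≤ ρ) (hρδ : ρ ≤ δ) :
    ∫⁻ x in annulus ρ, F x ≤ 2 * b := by
  have hsub : ∀ r : ℝ, t / 2 ≤ r → r ≤ δ → B (2 * r) \ B r ⊆ B (2 * δ) \ B (t / 2) :=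
    fun r h1 h2 => sdiff_subset_sdiff (ball_subset_ball (by linarith))
      (ball_subset_ball h1)
  calc ∫⁻ x in annulus ρ, F x
      ≤ ∫⁻ x in (B (2 * ρ) \ B ρ) ∪ (B (2 * (ρ / 2)) \ B (ρ / 2)), F x := by
        refine lintegral_mono_set fun x hx => ?_
        rw [mem_annulus] at hx
        simp only [mem_union, Set.mem_sdiff, mem_ball_zero_iff, not_lt]
        grind
    _ ≤ _ := lintegral_union_le _ _ _
    _ ≤ b + b := add_le_add (h ρ (by linarith) (hsub ρ (by linarith) hρδ)).le
        (h (ρ / 2) (by linarith) (hsub _ (by linarith) (by linarith))).le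
    _ = 2 * b := (two_mul b).symm

theorem lintegral_pow_le_eLpNorm {Ω : Set R4} (hΩ : MeasurableSet Ω) (hΩ1 : Ω ⊆ B 1)
    {Z : R4 → ℝ≥0∞} {g : R4 → ℝ} {L : ℕ} {p : ℕ} (hp : p ≠ 0) (h0 : ∀ x, x ∉ Ω → Z x = 0)
    (h : ∀ᵐ x, x ∈ Ω → Z x ≤ L * ‖g x‖ₑ) :
    ∫⁻ x, Z x ^ p ≤ L ^ p * eLpNorm g p (volume.restrict (B 1)) ^ p := by
  have e : eLpNorm g p (volume.restrict (B 1)) ^ p = ∫⁻ x in B 1, ‖g x‖ₑ ^ p := by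
    have := eLpNorm_nnreal_pow_eq_lintegral (f := g) (μ := volume.restrict (B 1)) (p := (p : ℝ≥0))
      (by exact_mod_cast hp)
    simp_all
  calc ∫⁻ x, Z x ^ p = ∫⁻ x in Ω, Z x ^ p := by
        rw [← lintegral_indicator hΩ]
        refine lintegral_congr fun x => ?_
        by_cases hx : x ∈ Ω <;> simp [hx, h0, hp]
    _ ≤ ∫⁻ x in Ω, L ^ p * ‖g x‖ₑ ^ p := by
        refine lintegral_mono_ae ((ae_restrict_iff' hΩ).2 (h.mono fun x hx hxΩ => ?_))
        rw [← mul_pow]; bound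
    _ ≤ ∫⁻ x in B 1, L ^ p * ‖g x‖ₑ ^ p := lintegral_mono_set hΩ1
    _ = _ := by rw [lintegral_const_mul' _ _ (pow_ne_top (ENNReal.natCast_ne_top L)), e]

end Energies

end BiharmonicSphere

theorem lemma2p3 (n : ℕ) (Λ : ℝ) :
    ∃ C : ℝ, 0 < C ∧
      ∀ (u f : R4 → Amb n) (Du : Fin 4 → R4 → Amb n) (D2u : Fin 4 → Fin 4 → R4 → Amb n)
        (DLapu : Fin 4 → R4 → Amb n) (ε δ t : ℝ),
        IsApproxBiharmonic (B 1) u Du D2u f →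
        eLpNorm (hessNorm D2u) 2 (volume.restrict (B 1))
            + eLpNorm (gradNorm Du) 4 (volume.restrict (B 1))
            + LLogLNorm (volume.restrict (B 1)) f ≤ ENNReal.ofReal Λ →
        0 < ε → 0 < t → t < δ → δ ≤ 1 / 2 →
        -- `DLapu` is the weak derivative `DΔu` on the open annulus
        (∀ i, HasWeakPartial (B (2 * δ) \ Metric.closedBall 0 (t / 2)) i (lap D2u) (DLapu i)) →
        (∀ ρ : ℝ, 0 < ρ → B (2 * ρ) \ B ρ ⊆ B (2 * δ) \ B (t / 2) →
          ∫⁻ x in B (2 * ρ) \ B ρ, ENNReal.ofReal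
              (gradNorm Du x ^ 4 + hessNorm D2u x ^ 2 + gradNorm DLapu x ^ (4 / 3 : ℝ))
            < ENNReal.ofReal ε) →
        weakLorentzNorm 4 (volume.restrict (B δ \ B t)) (gradNorm Du)
            + weakLorentzNorm 2 (volume.restrict (B δ \ B t)) (hessNorm D2u)
            + weakLorentzNorm (4 / 3) (volume.restrict (B δ \ B t)) (gradNorm DLapu)
          ≤ ENNReal.ofReal (C * (ε ^ (1 / 8 : ℝ) + (Real.log (1 / δ))⁻¹)) := by
  set L : ℕ := 16 * (n + 1) with hL
  set l : ℝ≥0 := Λ.toNNReal with hl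
  obtain ⟨C, hC⟩ := exists_neck_setBound_of_energy_le (Fin (n + 1))
    ((L : ℝ≥0) ^ 4 * l ^ 4 + (L : ℝ≥0) ^ 2 * l ^ 2)
  obtain ⟨A, hA⟩ := exists_setLIntegral_le_LLogLNorm
  set a₁ : ℝ≥0 := C * (L ^ 4 * 2) ^ (1 / 8 : ℝ) with ha₁
  set a₂ : ℝ≥0 := C * ((n + 1) * (A * l)) with ha₂
  set C₁ : ℝ≥0 := a₁ + a₂ + 1 with hC₁
  refine ⟨12 * C₁, by positivity, fun u f Du D2u DLapu ε δ t h hΛ hε ht htδ hδ hw hen => ?_⟩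
  have hL1 : 1 ≤ L := by omega
  have hlog : 0 < (Real.log (1 / δ))⁻¹ :=
    inv_pos.2 (Real.log_pos (by rw [lt_div_iff₀ (by linarith)]; linarith))
  set σ : ℝ := ε ^ (1 / 8 : ℝ) + (Real.log (1 / δ))⁻¹ with hσ
  have hσ0 : 0 < σ := by positivity
  set Ω : Set R4 := B (2 * δ) \ closedBall 0 (t / 2) with hΩ
  have hΩo : IsOpen Ω := Metric.isOpen_ball.sdiff Metric.isClosed_closedBall
  have hΩm := hΩo.measurableSet
  have hΩδ : Ω ⊆ B (2 * δ) := sdiff_subset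
  have hΩ1 : Ω ⊆ B 1 := hΩδ.trans (ball_subset_ball (by linarith))
  have hμ : volume.restrict Ω ≤ volume.restrict (B 1) := Measure.restrict_mono hΩ1 le_rfl
  -- measurable components, vanishing off the open annulus
  obtain ⟨u', hu, hu1⟩ := exists_isCompRep_of_norm_eq_one hΩm
    (h.isW22.memLp.aestronglyMeasurable.mono_measure hμ)
    (((ae_restrict_iff' measurableSet_ball).1 h.norm_eq_one).mono fun x hx hxΩ => hx (hΩ1 hxΩ))
  have hrep : ∀ {v : R4 → Amb n}, AEStronglyMeasurable v (volume.restrict Ω) →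
      ∃ v', IsCompRep Ω v v' ∧ ∀ a x, x ∉ Ω → v' a x = 0 := fun hv => by
    obtain ⟨v', hv'⟩ := exists_isCompRep hΩm hv
    exact ⟨_, hv'.indicator hΩm, fun a x hx => indicator_of_notMem hx _⟩
  choose D1 hD1 hD1z using fun i =>
    hrep ((h.isW22.memLp_D i).aestronglyMeasurable.mono_measure hμ)
  choose D2 hD2 hD2z using fun i j =>
    hrep ((h.isW22.memLp_D2 i j).aestronglyMeasurable.mono_measure hμ)
  choose D3 hD3 hD3z using fun i => hrep (hw i).locallyIntegrable_partial.aestronglyMeasurable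
  obtain ⟨f', hf, hfz⟩ := hrep (h.memLLogL.aestronglyMeasurable.mono_measure hμ)
  have m1 : Measurable (gradMag D1) := measurable_sum _ fun i _ =>
    measurable_sum _ fun a _ => ((hD1 i).measurable a).enorm
  have m2 : Measurable (hessMag D2) := measurable_sum _ fun i _ =>
    measurable_sum _ fun j _ => measurable_sum _ fun a _ =>
      ((hD2 i j).measurable a).enorm
  have m3 : Measurable (gradMag D3) := measurable_sum _ fun i _ =>
    measurable_sum _ fun a _ => ((hD3 i).measurable a).enorm
  have m4 : Measurable (srcMag f') := measurable_sum _ fun a _ => (hf.measurable a).enorm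
  have c1 : ∀ᵐ x, x ∈ Ω → ‖gradNorm Du x‖ₑ ≤ gradMag D1 x ∧
      gradMag D1 x ≤ L * ‖gradNorm Du x‖ₑ := by
    filter_upwards [ae_all_iff.2 fun i => (hD1 i).ae_eq] with x hx hxΩ
    exact gradMag_comparison fun i a => hx i hxΩ a
  have c2 : ∀ᵐ x, x ∈ Ω → ‖hessNorm D2u x‖ₑ ≤ hessMag D2 x ∧
      hessMag D2 x ≤ L * ‖hessNorm D2u x‖ₑ := by
    filter_upwards [ae_all_iff.2 fun i => ae_all_iff.2 fun j => (hD2 i j).ae_eq] with x hx hxΩ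
    exact hessMag_comparison fun i j a => hx i j hxΩ a
  have c3 : ∀ᵐ x, x ∈ Ω → ‖gradNorm DLapu x‖ₑ ≤ gradMag D3 x ∧
      gradMag D3 x ≤ L * ‖gradNorm DLapu x‖ₑ := by
    filter_upwards [ae_all_iff.2 fun i => (hD3 i).ae_eq] with x hx hxΩ
    exact gradMag_comparison fun i a => hx i hxΩ a
  have z1 : ∀ x, x ∉ Ω → gradMag D1 x = 0 := fun x hx => by simp [gradMag, hD1z _ _ x hx]
  have z2 : ∀ x, x ∉ Ω → hessMag D2 x = 0 := fun x hx => by simp [hessMag, hD2z _ _ _ x hx]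
  -- the energy on `B 1` and the mass of `f`
  have hΛ2 : eLpNorm (hessNorm D2u) 2 (volume.restrict (B 1)) ≤ l :=
    (le_self_add.trans le_self_add).trans hΛ
  have hΛ4 : eLpNorm (gradNorm Du) 4 (volume.restrict (B 1)) ≤ l :=
    (le_add_self.trans le_self_add).trans hΛ
  have E1 : ∫⁻ x, gradMag D1 x ^ 4 ≤ L ^ 4 * l ^ 4 :=
    (lintegral_pow_le_eLpNorm hΩm hΩ1 four_ne_zero z1 (c1.mono fun x hx hxΩ => (hx hxΩ).2)).trans
      (by gcongr; exact hΛ4)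
  have E2 : ∫⁻ x, hessMag D2 x ^ 2 ≤ L ^ 2 * l ^ 2 :=
    (lintegral_pow_le_eLpNorm hΩm hΩ1 two_ne_zero z2 (c2.mono fun x hx hxΩ => (hx hxΩ).2)).trans
      (by gcongr; exact hΛ2)
  have E12 : ∫⁻ x, gradMag D1 x ^ 4 + hessMag D2 x ^ 2
      ≤ (((L : ℝ≥0) ^ 4 * l ^ 4 + (L : ℝ≥0) ^ 2 * l ^ 2 : ℝ≥0) : ℝ≥0∞) := by
    rw [lintegral_add_left (m1.pow_const 4)]
    push_cast
    exact add_le_add E1 E2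
  set M : ℝ≥0∞ := (n + 1) * (A * l * ofReal (Real.log (1 / δ))⁻¹) with hM
  have hMt : M ≠ ⊤ := mul_ne_top (by simp) (mul_ne_top
    (mul_ne_top coe_ne_top coe_ne_top) ofReal_ne_top)
  have E4 : ∫⁻ x, srcMag f' x ≤ M := by
    calc ∫⁻ x, srcMag f' x ≤ ∫⁻ x, Ω.indicator (fun x => (n + 1 : ℝ≥0∞) * ‖f x‖ₑ) x := by
          refine lintegral_mono_ae (hf.ae_eq.mono fun x hx => ?_)
          by_cases hxΩ : x ∈ Ω
          · rw [indicator_of_mem hxΩ]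
            refine (sum_le_sum fun a _ => ?_).trans_eq
              (by rw [sum_const, Finset.card_fin, nsmul_eq_mul, Nat.cast_succ])
            rw [hx hxΩ, ← ofReal_norm, ← ofReal_norm]
            exact ofReal_le_ofReal (PiLp.norm_apply_le (f x) a)
          · simp [srcMag, hfz _ x hxΩ]
      _ = (n + 1) * ∫⁻ x in Ω, ‖f x‖ₑ := by
          rw [lintegral_indicator hΩm, lintegral_const_mul' _ _ (by simp)]
      _ ≤ (n + 1) * ∫⁻ x in B (2 * δ), ‖f x‖ₑ := by gcongr
      _ ≤ M := by
          refine mul_le_mul_right ((hA h.memLLogL.aestronglyMeasurable (by linarith) hδ).trans ?_) _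
          gcongr
          exact le_add_self.trans hΛ
  -- the maps on the annuli at dyadic scales
  obtain ⟨N, hN, hNk⟩ := exists_pow_scales (δ := δ) ht
  have hscale : ∀ {ρ : ℝ}, (∃ k < N, ρ = t * (3 / 2) ^ k) → t ≤ ρ ∧ ρ ≤ δ := by
    rintro _ ⟨k, hk, rfl⟩
    exact ⟨le_mul_of_one_le_right ht.le (one_le_pow₀ (by norm_num)), hNk k hk⟩
  have hann : ∀ {ρ : ℝ}, (∃ k < N, ρ = t * (3 / 2) ^ k) → ∫⁻ x in annulus ρ, ofReal
      (gradNorm Du x ^ 4 + hessNorm D2u x ^ 2 + gradNorm DLapu x ^ (4 / 3 : ℝ))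
        ≤ 2 * ofReal ε := fun hρ =>
    setLIntegral_annulus_le hen ht (hscale hρ).1 (hscale hρ).2
  have hmem : ∀ {p : ℕ} {v : R4 → ℝ} {Z : R4 → ℝ≥0∞} {b : ℝ≥0∞}, p ≠ 0 → Measurable v → b ≠ ⊤ →
      (∀ x, ‖v x‖ₑ ≤ Z x) → ∫⁻ x, Z x ^ p ≤ b → MemLp v p := by
    intro p v Z b hp hv hb hvZ hZ
    refine ⟨hv.aestronglyMeasurable, ?_⟩
    rw [eLpNorm_lt_top_iff_lintegral_rpow_enorm_lt_top (by simpa using hp) (by simp)]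
    simp only [ENNReal.toReal_natCast, rpow_natCast]
    exact ((lintegral_mono fun x => pow_le_pow_left' (hvZ x) p).trans hZ).trans_lt hb.lt_top
  have hs : ∀ ρ, (∃ k < N, ρ = t * (3 / 2) ^ k) → SphereMap (annulus ρ)
      (fun a => (annulus ρ).indicator (u' a)) (fun i a => (annulus ρ).indicator (D1 i a))
      (fun i j a => (annulus ρ).indicator (D2 i j a)) (fun i a => (annulus ρ).indicator (D3 i a))
      fun a => (annulus ρ).indicator (f' a) := by
    intro ρ hρ
    have hsub : annulus ρ ⊆ Ω := annulus_subset (hscale hρ).1 (hscale hρ).2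
    have hm := (isOpen_annulus ρ).measurableSet
    refine h.sphereMap (isOpen_annulus ρ) (hsub.trans hΩ1) hsub hw (hu.mono hsub) hu1
      (fun i => (hD1 i).mono hsub) (fun i j => (hD2 i j).mono hsub) (fun i => (hD3 i).mono hsub)
      (hf.mono hsub) (fun i a => ?_) (fun i a => ?_) (fun a => ?_)
    · refine MemLp.indicator hm ?_
      exact hmem four_ne_zero ((hD1 i).measurable a) (by finiteness)
        (fun x => enorm_le_gradMag i a x) E1
    · rw [integrable_indicator_iff hm]
      refine ⟨((hD3 i).measurable a).aestronglyMeasurable, ?_⟩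
      calc ∫⁻ x in annulus ρ, ‖D3 i a x‖ₑ
          ≤ ∫⁻ x in annulus ρ, (L : ℝ≥0∞) * (1 + ofReal
            (gradNorm Du x ^ 4 + hessNorm D2u x ^ 2 + gradNorm DLapu x ^ (4 / 3 : ℝ))) := by
            refine lintegral_mono_ae ((ae_restrict_iff' hm).2 (c3.mono fun x hx hxρ => ?_))
            refine (enorm_le_gradMag i a x).trans ((hx (hsub hxρ)).2.trans (mul_le_mul_right ?_ _))
            have g0 : 0 ≤ gradNorm DLapu x := sqrt_nonneg _
            rw [enorm_of_nonneg g0, ← ENNReal.ofReal_one,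
              ← ofReal_add zero_le_one (by positivity)]
            refine ofReal_le_ofReal ?_
            have g1 : gradNorm DLapu x ≤ 1 + gradNorm DLapu x ^ (4 / 3 : ℝ) := by
              rcases le_total (gradNorm DLapu x) 1 with hc | hc
              · exact hc.trans (le_add_of_nonneg_right (by positivity))
              · exact (Real.self_le_rpow_of_one_le hc (by norm_num)).trans
                  (le_add_of_nonneg_left zero_le_one)
            have : 0 ≤ gradNorm Du x ^ 4 + hessNorm D2u x ^ 2 := by positivity
            linarith
        _ = L * (volume (annulus ρ) + ∫⁻ x in annulus ρ, ofReal
            (gradNorm Du x ^ 4 + hessNorm D2u x ^ 2 + gradNorm DLapu x ^ (4 / 3 : ℝ))) := by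
            rw [lintegral_const_mul' _ _ (by simp), lintegral_add_left measurable_const]
            simp
        _ ≤ L * (volume (B 1) + 2 * ofReal ε) := by
            gcongr
            · exact hsub.trans hΩ1
            · exact hann hρ
        _ < ⊤ := by
            have := (measure_ball_lt_top (μ := volume) (x := (0 : R4)) (r := 1)).ne
            finiteness
    · refine Integrable.indicator ?_ hm
      refine memLp_one_iff_integrable.1 ?_
      exact_mod_cast hmem one_ne_zero (hf.measurable a) hMt (fun x => enorm_le_srcMag a x)
        (by simpa only [pow_one] using E4)
  have hη : ∀ k < N, ∫⁻ x in annulus (t * (3 / 2) ^ k), gradMag D1 x ^ 4 + hessMag D2 x ^ 2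
      ≤ L ^ 4 * (2 * ofReal ε) := by
    intro k hk
    have hρ : ∃ j < N, t * (3 / 2 : ℝ) ^ k = t * (3 / 2) ^ j := ⟨k, hk, rfl⟩
    have hsub := annulus_subset (hscale hρ).1 (hscale hρ).2
    refine le_trans ?_ (mul_le_mul_right (hann hρ) _)
    rw [← lintegral_const_mul' _ _ (by finiteness)]
    refine lintegral_mono_ae ((ae_restrict_iff' (isOpen_annulus _).measurableSet).2 ?_)
    filter_upwards [c1, c2] with x h1 h2 hx
    have g1 : 0 ≤ gradNorm Du x := sqrt_nonneg _
    have g2 : 0 ≤ hessNorm D2u x := sqrt_nonneg _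
    have g3 : 0 ≤ gradNorm DLapu x := sqrt_nonneg _
    calc gradMag D1 x ^ 4 + hessMag D2 x ^ 2
        ≤ (L * ‖gradNorm Du x‖ₑ) ^ 4 + (L * ‖hessNorm D2u x‖ₑ) ^ 2 := by
          gcongr
          · exact (h1 (hsub hx)).2
          · exact (h2 (hsub hx)).2
      _ ≤ L ^ 4 * ‖gradNorm Du x‖ₑ ^ 4 + L ^ 4 * ‖hessNorm D2u x‖ₑ ^ 2 := by
          rw [mul_pow, mul_pow]
          gcongr
          · exact_mod_cast hL1
          · norm_num
      _ = L ^ 4 * ofReal (gradNorm Du x ^ 4 + hessNorm D2u x ^ 2) := by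
          rw [enorm_of_nonneg g1, enorm_of_nonneg g2, ← ofReal_pow g1,
            ← ofReal_pow g2, ofReal_add (by positivity) (by positivity), mul_add]
      _ ≤ _ := mul_le_mul_right
          (ofReal_le_ofReal (le_add_of_nonneg_right (by positivity))) _
  obtain ⟨b1, b2, b3⟩ := hC ht (by linarith) hN hs m1 m2 m3 m4 hMt E12 E4 hη
  -- collecting the constants
  have hK : C * ((L : ℝ≥0∞) ^ 4 * (2 * ofReal ε)) ^ (1 / 8 : ℝ) + C * M
      ≤ C₁ * ofReal σ := by
    have k1 : C * ((L : ℝ≥0∞) ^ 4 * (2 * ofReal ε)) ^ (1 / 8 : ℝ)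
        = a₁ * ofReal (ε ^ (1 / 8 : ℝ)) := by
      rw [← mul_assoc ((L : ℝ≥0∞) ^ 4), mul_rpow_of_nonneg _ _ (by norm_num), ha₁,
        ofReal_rpow_of_pos hε, coe_mul, coe_rpow_of_nonneg _ (by norm_num),
        mul_assoc]
      push_cast
      rfl
    have k2 : C * M = a₂ * ofReal (Real.log (1 / δ))⁻¹ := by
      rw [hM, ha₂]
      push_cast
      ring
    calc _ = a₁ * ofReal (ε ^ (1 / 8 : ℝ)) + a₂ * ofReal (Real.log (1 / δ))⁻¹ := by
          rw [k1, k2]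
      _ ≤ C₁ * ofReal (ε ^ (1 / 8 : ℝ)) + C₁ * ofReal (Real.log (1 / δ))⁻¹ := by
          gcongr
          · rw [hC₁, add_assoc]; exact le_self_add
          · rw [hC₁]; exact le_add_self.trans le_self_add
      _ = _ := by rw [hσ, ofReal_add (by positivity) hlog.le, mul_add]
  have hC₁0 : (C₁ : ℝ≥0∞) ≠ 0 := by simp [hC₁]
  have hKt : (C₁ : ℝ≥0∞) * ofReal σ ≠ ⊤ := by finiteness
  have hK0 : (C₁ : ℝ≥0∞) * ofReal σ ≠ 0 := mul_ne_zero hC₁0 (by simpa using hσ0)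
  have hNΩ : B δ \ B t ⊆ Ω := fun x hx => by
    simp only [Set.mem_sdiff, mem_ball_zero_iff, not_lt] at hx
    simp only [hΩ, Set.mem_sdiff, mem_ball_zero_iff, mem_closedBall_zero_iff, not_le]
    constructor <;> linarith
  have hfin : ∀ {p θ : ℝ} {g : R4 → ℝ} {G : R4 → ℝ≥0∞}, 1 < p → 1 / 4 ≤ θ → 1 - 1 / p = θ →
      Measurable G → (∀ᵐ x, x ∈ Ω → ‖g x‖ₑ ≤ G x) →
      SetBound θ θ (C * ((L : ℝ≥0∞) ^ 4 * (2 * ofReal ε)) ^ (1 / 8 : ℝ)) (C * M)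
        ((B δ \ B t).indicator G) →
      weakLorentzNorm p (volume.restrict (B δ \ B t)) g
        ≤ ofReal 4 * (C₁ * ofReal σ) := by
    intro p θ g G hp hθ hpθ hG hgG hb
    refine (weakLorentzNorm_le hp (measurableSet_ball.diff measurableSet_ball)
      (ne_top_of_le_ne_top measure_ball_lt_top.ne (measure_mono sdiff_subset)) hG
      (hgG.mono fun x hx hxN => hx (hNΩ hxN)) hK0 hKt fun F hF hf => ?_).trans ?_
    · rw [hpθ]
      refine (hb F hF hf).trans ?_
      rw [← add_mul]
      gcongr
    · rw [hpθ]
      gcongr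
      rw [div_le_iff₀ (by linarith)]
      linarith
  have w1 := hfin (p := 4) (θ := 3 / 4) (by norm_num) (by norm_num) (by norm_num) m1
    (c1.mono fun x hx hxΩ => (hx hxΩ).1) b1
  have w2 := hfin (p := 2) (θ := 1 / 2) (by norm_num) (by norm_num) (by norm_num) m2
    (c2.mono fun x hx hxΩ => (hx hxΩ).1) b2
  have w3 := hfin (p := 4 / 3) (θ := 1 / 4) (by norm_num) (by norm_num) (by norm_num) m3
    (c3.mono fun x hx hxΩ => (hx hxΩ).1) b3
  refine (add_le_add (add_le_add w1 w2) w3).trans_eq ?_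
  rw [← ofReal_coe_nnreal, ← ofReal_mul (NNReal.coe_nonneg _),
    ← ofReal_mul (by norm_num), ← ofReal_add (by positivity) (by positivity),
    ← ofReal_add (by positivity) (by positivity)]
  congr 1
  ring

end
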